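/- \textbf{Setting.} Let $N\in\mathbb N$, let $\mathbf x_1,\dots,\mathbf x_N\in\mathbb R^2$ be distinct, and let $\alpha_1,\dots,\alpha_N\in(0,1)$. With $(a,b)^\perp=(-b,a)$ put $$\mathbf A_n(\mathbf x)=\alpha_n\frac{(\mathbf x-\mathbf x_n)^\perp}{|\mathbf x-\mathbf x_n|^2},\qquad \mathbf S_n=\sum_{m\ne n}\mathbf A_m,\qquad \check{\mathbf S}_n(\mathbf x)=\mathbf S_n(\mathbf x)-\mathbf S_n(\mathbf x_n).$$ Scalar products $\langle\cdot|\cdot\rangle$ are those of $L^2(\mathbb R^2)$, antilinear in the first entry. \textbf{Friedrichs form.} $Q_N^{(\mathrm F)}[\phi]=\|(-i\nabla+\sum_n\mathbf A_n)\phi\|_2^2$ on the domain $\mathscr D[Q_N^{(\mathrm F)}]$, the closure of $C_c^\infty(\mathbb R^2\setminus\{\mathbf x_1,\dots,\mathbf x_N\})$ in the norm $(\|\phi\|_2^2+Q_N^{(\mathrm F)}[\phi])^{1/2}$. \textbf{Cut-offs.} $\xi_1,\dots,\xi_N:\mathbb R^2\to[0,1]$ are $C^2$ functions such that, for some $r_*>0$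 with $r_*<\frac12\min_{m\neq n}|\mathbf x_m-\mathbf x_n|$, $\mathrm{supp}\,\xi_n\subset B_{r_*}(\mathbf x_n)$ and $\xi_n=1$ on $B_{r_*/2}(\mathbf x_n)$, and such that $\xi_0^2+\sum_{n\ge1}\xi_n^2=1$ for some $C^2$ function $\xi_0:\mathbb R^2\to[0,1]$. \textbf{Defect functions.} For $\lambda>0$, $\ell\in\{0,-1\}$ and polar coordinates $(r_n,\theta_n)$ centred at $\mathbf x_n$, $$G^{(\ell)}_{\lambda,n}=\lambda^{|\ell+\alpha_n|}K_{|\ell+\alpha_n|}(\lambda r_n)\frac{e^{i\ell\theta_n}}{\sqrt{2\pi}},$$ where $K_\nu$ is the modified Bessel function of the second kind. \textbf{The forms.} Let $u_n(\mathbf x)=e^{-i\mathbf S_n(\mathbf x_n)\cdot(\mathbf x-\mathbf x_n)}$ and let $B=(B_{mn}^{(\ell\ell')})$ be a Hermitian $2N\times2N$ matrix. Let $\mathscr D[Q_N^{(B)}]$ be the set of $\psi\in L^2(\mathbb R^2)$ of the form $$\psi=\phi_\lambda+\sum_{n=1}^N u_n\,\xi_n\sum_{\ell\in\{0,-1\}}q_n^{(\ell)}G^{(\ell)}_{\lambda,n},\qquad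 \phi_\lambda\in\mathscr D[Q_N^{(\mathrm F)}],\quad q_n^{(\ell)}\in\mathbb C,\tag{1}$$ and for such $\psi$ put $$\begin{aligned}Q_N^{(B)}[\psi]={}&Q_N^{(\mathrm F)}[\phi_\lambda]-\lambda^2\|\psi\|_2^2+\lambda^2\|\phi_\lambda\|_2^2\\&+2\sum_{n,\ell}\mathrm{Re}\Big[q_n^{(\ell)}\Big(2\langle(-i\nabla+\mathbf A_n)\phi_\lambda|\zeta_{1,n}G^{(\ell)}_{\lambda,n}\rangle+\langle\phi_\lambda|\zeta_{2,n}G^{(\ell)}_{\lambda,n}\rangle\Big)\Big]\\&+\sum_{m,n,\ell,\ell'}\overline{q_m^{(\ell)}}\,q_n^{(\ell')}\Big[B_{mn}^{(\ell\ell')}+\delta_{mn}\Big(\frac{\pi\lambda^{2|\ell+\alpha_n|}}{2\sin(\pi\alpha_n)}\delta_{\ell\ell'}+\Xi_n^{(\ell\ell')}(\lambda)\Big)\Big],\end{aligned}$$ where $$\zeta_{1,n}=u_n(\check{\mathbf S}_n\xi_n-i\nabla\xi_n),\qquad \zeta_{2,n}=u_n\big[\check{\mathbf S}_n^2\xi_n+2\,\mathbf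 S_n(\mathbf x_n)\cdot(\check{\mathbf S}_n\xi_n-i\nabla\xi_n)+\Delta\xi_n\big],$$ $$\Xi_n^{(\ell\ell')}(\lambda)=\big\langle G^{(\ell)}_{\lambda,n}\big|\big[(\check{\mathbf S}_n^2+2\check{\mathbf S}_n\cdot\mathbf A_n)\xi_n^2+(\nabla\xi_n)^2\big]G^{(\ell')}_{\lambda,n}\big\rangle+2\big\langle\xi_nG^{(\ell)}_{\lambda,n}\big|\check{\mathbf S}_n\cdot(-i\nabla)(\xi_nG^{(\ell')}_{\lambda,n})\big\rangle.$$ \textbf{Theorem.} For every Hermitian matrix $B$: (i) $Q_N^{(B)}$ is well defined on $\mathscr D[Q_N^{(B)}]$. That is, for all $\lambda>0$ and all cut-offs, the second summand in (1) is in $L^2(\mathbb R^2)$, all scalar products above are absolutely convergent integrals, the decomposition (1) of $\psi$ is unique, and $Q_N^{(B)}$ is the real-valued quadratic form of a Hermitian sesquilinear form on the linear subspace $\mathscr D[Q_N^{(B)}]$. Moreover, both $\mathscr D[Q_N^{(B)}]$ and $Q_N^{(B)}$ are independent of $\lambda>0$ and of the cut-offs $(\xi_n)$. (ii) $Q_N^{(B)}$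 is closed and bounded from below on $\mathscr D[Q_N^{(B)}]$. It is coercive in the following sense: for given cut-offs there is $\lambda_0>0$ such that for every $\lambda\ge\lambda_0$ there is $c_\lambda>0$ with $$Q_N^{(B)}[\psi]+\lambda^2\|\psi\|_2^2\ \ge\ c_\lambda\Big(Q_N^{(\mathrm F)}[\phi_\lambda]+\|\phi_\lambda\|_2^2+\sum_{n,\ell}|q_n^{(\ell)}|^2\Big)$$ for all $\psi\in\mathscr D[Q_N^{(B)}]$ decomposed as in (1). -/

import Mathlib

open MeasureTheory Filter Topology Set
open scoped ContDiff ComplexConjugate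

namespace AharonovBohm

noncomputable section

/-- The plane `ℝ²` with its Euclidean structure. -/
abbrev Plane : Type := EuclideanSpace ℝ (Fin 2)

/-- `ℂ²` with its Hermitian structure; the inner product is antilinear in the first slot. -/
abbrev CVec : Type := EuclideanSpace ℂ (Fin 2)

/-- The Hilbert space `L²(ℝ²; ℂ)`. -/
abbrev L2 : Type := Lp ℂ 2 (volume : Measure Plane)

/-- Rotation by a right angle, `(a, b) ↦ (-b, a)`. -/
def perp (v : Plane) : Plane := !₂[-(v 1), v 0]

/-- A real vector regarded as a complex one. -/
def toCVec (v : Plane) : CVec := WithLp.toLp 2 (fun j => ((v j : ℝ) : ℂ))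

/-- The classical gradient of a complex-valued function. -/
def cGrad (f : Plane → ℂ) (y : Plane) : CVec :=
  WithLp.toLp 2 (fun j => fderiv ℝ f y (EuclideanSpace.single j (1 : ℝ)))

variable {N : ℕ}

/-! ### Potentials -/

/-- The potential `A_n` of one flux. -/
def potA (x : Fin N → Plane) (α : Fin N → ℝ) (n : Fin N) (y : Plane) : Plane :=
  (α n / ‖y - x n‖ ^ 2) • perp (y - x n)

/-- The total potential `∑ₙ A_n`. -/
def potTotal (x : Fin N → Plane) (α : Fin N → ℝ) (y : Plane) : Plane :=
  ∑ n, potA x α n y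

/-- The regular part `S_n = ∑_{m ≠ n} A_m` of the potential near the `n`-th flux. -/
def potS (x : Fin N → Plane) (α : Fin N → ℝ) (n : Fin N) (y : Plane) : Plane :=
  ∑ m ∈ Finset.univ.erase n, potA x α m y

/-- `Š_n(y) = S_n(y) - S_n(x_n)`. -/
def potSCheck (x : Fin N → Plane) (α : Fin N → ℝ) (n : Fin N) (y : Plane) : Plane :=
  potS x α n y - potS x α n (x n)

/-! ### The Friedrichs form -/

/-- `f ∈ C_c^∞(ℝ² \ {x_1, …, x_N})`. -/
def IsTest (x : Fin N → Plane) (f : Plane → ℂ) : Prop :=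
  ContDiff ℝ ∞ f ∧ HasCompactSupport f ∧ tsupport f ⊆ (range x)ᶜ

/-- `g` is the gradient of `φ` in the sense of distributions on `ℝ² \ {x_1, …, x_N}`. -/
def IsWeakGrad (x : Fin N → Plane) (φ : Plane → ℂ) (g : Plane → CVec) : Prop :=
  LocallyIntegrableOn g (range x)ᶜ volume ∧
    ∀ f : Plane → ℂ, IsTest x f → ∀ j : Fin 2,
      ∫ y, g y j * f y = - ∫ y, φ y * cGrad f y j

open Classical in
/-- The distributional gradient on `ℝ² \ {x_1, …, x_N}` (unique almost everywhere);
zero by convention if there is none among the locally integrable fields. -/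
def weakGrad (x : Fin N → Plane) (φ : Plane → ℂ) : Plane → CVec :=
  if h : ∃ g, IsWeakGrad x φ g then h.choose else 0

/-- `-i g + a φ`, which is `(-i∇ + a) φ` when `g` is the gradient of `φ`. -/
def magField (a : Plane → Plane) (φ : Plane → ℂ) (g : Plane → CVec) (y : Plane) : CVec :=
  -(Complex.I • g y) + φ y • toCVec (a y)

/-- The domain of the Friedrichs form: the closure of `C_c^∞(ℝ² \ {x_1, …, x_N})` in the norm
`‖φ‖_N² = ‖φ‖² + ‖(-i∇ + ∑ₙ A_n) φ‖²`. -/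
def friedrichsDomain (x : Fin N → Plane) (α : Fin N → ℝ) : Set L2 :=
  {φ | ∃ g : Plane → CVec, IsWeakGrad x φ g ∧
    ∃ f : ℕ → Plane → ℂ, (∀ k, IsTest x (f k)) ∧
      Tendsto (fun k => eLpNorm (fun y => φ y - f k y) 2 volume) atTop (𝓝 0) ∧
      Tendsto (fun k => eLpNorm (fun y => magField (potTotal x α) φ g y
        - magField (potTotal x α) (f k) (cGrad (f k)) y) 2 volume) atTop (𝓝 0)}

/-- `(-i∇ + a) φ`, with the distributional gradient. -/
def magGrad (x : Fin N → Plane) (a : Plane → Plane) (φ : L2) : Plane → CVec :=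
  magField a φ (weakGrad x φ)

/-- The Friedrichs form `‖(-i∇ + ∑ₙ A_n) φ‖²`. -/
def friedrichsForm (x : Fin N → Plane) (α : Fin N → ℝ) (φ : L2) : ℝ :=
  ∫ y, ‖magGrad x (potTotal x α) φ y‖ ^ 2

/-! ### Cut-off functions and defect functions -/

/-- `(ξ_n)_{n = 1, …, N}` are the localized members of a quadratic `C²` partition of unity
`ξ_0² + ξ_1² + … + ξ_N² = 1` adapted to the points `x_n`. -/
def IsCutoff (x : Fin N → Plane) (ξ : Fin N → Plane → ℝ) : Prop :=
  (∀ n, ContDiff ℝ 2 (ξ n) ∧ ∀ y, ξ n y ∈ Icc (0 : ℝ) 1) ∧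
  (∃ r : ℝ, 0 < r ∧ (∀ m n, m ≠ n → r < dist (x m) (x n) / 2) ∧
    ∀ n, tsupport (ξ n) ⊆ Metric.ball (x n) r ∧
      ∀ y ∈ Metric.ball (x n) (r / 2), ξ n y = 1) ∧
  ∃ ξ₀ : Plane → ℝ, ContDiff ℝ 2 ξ₀ ∧ (∀ y, ξ₀ y ∈ Icc (0 : ℝ) 1) ∧
    ∀ y, ξ₀ y ^ 2 + ∑ n, ξ n y ^ 2 = 1

/-- The angular momenta: `ell 0 = 0` (s-wave) and `ell 1 = -1` (p-wave). -/
def ell : Fin 2 → ℤ := ![0, -1]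

/-- `|ℓ + α_n|`. -/
def nu (α : Fin N → ℝ) (n : Fin N) (l : Fin 2) : ℝ := |(ell l : ℝ) + α n|

/-- The Macdonald function (modified Bessel function of the second kind), for `z > 0`:
`K_ν(z) = ½ (z/2)^ν ∫₀^∞ exp(-t - z²/(4t)) t^(-ν-1) dt`. -/
def macdonaldK (ν z : ℝ) : ℝ :=
  (1 / 2) * (z / 2) ^ ν *
    ∫ t in Ioi (0 : ℝ), Real.exp (-t - z ^ 2 / (4 * t)) * t ^ (-ν - 1)

/-- The polar angle of a vector. -/
def polarAngle (v : Plane) : ℝ := Complex.arg ⟨v 0, v 1⟩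

/-- The defect function
`G^{(ℓ)}_{λ,n} = λ^|ℓ+α_n| K_|ℓ+α_n|(λ r_n) e^{iℓθ_n} / √(2π)`,
where `(r_n, θ_n)` are the polar coordinates centred at `x_n`. -/
def defectG (x : Fin N → Plane) (α : Fin N → ℝ) (lam : ℝ) (n : Fin N) (l : Fin 2)
    (y : Plane) : ℂ :=
  ((lam ^ nu α n l * macdonaldK (nu α n l) (lam * ‖y - x n‖) : ℝ) : ℂ) *
    (Complex.exp (Complex.I * (ell l : ℂ) * (polarAngle (y - x n) : ℂ)) /
      (Real.sqrt (2 * Real.pi) : ℂ))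

/-- The phase `exp(-i S_n(x_n) · (y - x_n))`. -/
def phase (x : Fin N → Plane) (α : Fin N → ℝ) (n : Fin N) (y : Plane) : ℂ :=
  Complex.exp (-Complex.I * ((inner ℝ (potS x α n (x n)) (y - x n) : ℝ) : ℂ))

/-- The singular part `∑ₙ exp(-i S_n(x_n) · (y - x_n)) ξ_n ∑_ℓ q_n^{(ℓ)} G^{(ℓ)}_{λ,n}`. -/
def singularPart (x : Fin N → Plane) (α : Fin N → ℝ) (ξ : Fin N → Plane → ℝ) (lam : ℝ)
    (q : Fin N × Fin 2 → ℂ) (y : Plane) : ℂ :=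
  ∑ n, phase x α n y * (ξ n y : ℂ) * ∑ l, q (n, l) * defectG x α lam n l y

/-! ### The perturbed forms -/

/-- `ψ = φ + ∑ₙ exp(-i S_n(x_n) · (y - x_n)) ξ_n ∑_ℓ q_n^{(ℓ)} G^{(ℓ)}_{λ,n}` with `φ` in the
Friedrichs form domain. -/
def IsDecomp (x : Fin N → Plane) (α : Fin N → ℝ) (ξ : Fin N → Plane → ℝ) (lam : ℝ)
    (ψ φ : L2) (q : Fin N × Fin 2 → ℂ) : Prop :=
  φ ∈ friedrichsDomain x α ∧
    ∀ᵐ y ∂(volume : Measure Plane), ψ y = φ y + singularPart x α ξ lam q y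

/-- The domain of the perturbed forms. -/
def formDomain (x : Fin N → Plane) (α : Fin N → ℝ) (ξ : Fin N → Plane → ℝ) (lam : ℝ) : Set L2 :=
  {ψ | ∃ (φ : L2) (q : Fin N × Fin 2 → ℂ), IsDecomp x α ξ lam ψ φ q}

/-- `Š_n ξ_n - i ∇ξ_n`. -/
def fieldW (x : Fin N → Plane) (α : Fin N → ℝ) (ξ : Fin N → Plane → ℝ) (n : Fin N)
    (y : Plane) : CVec :=
  (ξ n y : ℂ) • toCVec (potSCheck x α n y) - Complex.I • toCVec (gradient (ξ n) y)

/-- `ζ_{1,n} = exp(-i S_n(x_n) · (y - x_n)) (Š_n ξ_n - i ∇ξ_n)`. -/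
def zeta1 (x : Fin N → Plane) (α : Fin N → ℝ) (ξ : Fin N → Plane → ℝ) (n : Fin N)
    (y : Plane) : CVec :=
  phase x α n y • fieldW x α ξ n y

/-- `ζ_{2,n} = exp(-i S_n(x_n) · (y - x_n))
  [Š_n² ξ_n + 2 S_n(x_n) · (Š_n ξ_n - i ∇ξ_n) + Δξ_n]`. -/
def zeta2 (x : Fin N → Plane) (α : Fin N → ℝ) (ξ : Fin N → Plane → ℝ) (n : Fin N)
    (y : Plane) : ℂ :=
  phase x α n y *
    (((‖potSCheck x α n y‖ ^ 2 * ξ n y : ℝ) : ℂ)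
      + 2 * ∑ j, ((potS x α n (x n) j : ℝ) : ℂ) * fieldW x α ξ n y j
      + ((Laplacian.laplacian (ξ n) y : ℝ) : ℂ))

/-- The integrand of `⟨(-i∇ + A_n) φ | ζ_{1,n} G^{(ℓ)}_{λ,n}⟩`. -/
def cross1 (x : Fin N → Plane) (α : Fin N → ℝ) (ξ : Fin N → Plane → ℝ) (lam : ℝ)
    (φ : L2) (n : Fin N) (l : Fin 2) (y : Plane) : ℂ :=
  inner ℂ (magGrad x (potA x α n) φ y) (defectG x α lam n l y • zeta1 x α ξ n y)

/-- The integrand of `⟨φ | ζ_{2,n} G^{(ℓ)}_{λ,n}⟩`. -/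
def cross2 (x : Fin N → Plane) (α : Fin N → ℝ) (ξ : Fin N → Plane → ℝ) (lam : ℝ)
    (φ : L2) (n : Fin N) (l : Fin 2) (y : Plane) : ℂ :=
  conj (φ y) * (zeta2 x α ξ n y * defectG x α lam n l y)

/-- The integrand of
`⟨G^{(ℓ)}_{λ,n} | [(Š_n² + 2 Š_n · A_n) ξ_n² + (∇ξ_n)²] G^{(ℓ')}_{λ,n}⟩`. -/
def xi1 (x : Fin N → Plane) (α : Fin N → ℝ) (ξ : Fin N → Plane → ℝ) (lam : ℝ)
    (n : Fin N) (l l' : Fin 2) (y : Plane) : ℂ :=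
  conj (defectG x α lam n l y) *
    ((((‖potSCheck x α n y‖ ^ 2 + 2 * inner ℝ (potSCheck x α n y) (potA x α n y)) * ξ n y ^ 2
      + ‖gradient (ξ n) y‖ ^ 2 : ℝ) : ℂ) * defectG x α lam n l' y)

/-- The integrand of `⟨ξ_n G^{(ℓ)}_{λ,n} | Š_n · (-i∇)(ξ_n G^{(ℓ')}_{λ,n})⟩`. -/
def xi2 (x : Fin N → Plane) (α : Fin N → ℝ) (ξ : Fin N → Plane → ℝ) (lam : ℝ)
    (n : Fin N) (l l' : Fin 2) (y : Plane) : ℂ :=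
  conj ((ξ n y : ℂ) * defectG x α lam n l y) *
    ∑ j, ((potSCheck x α n y j : ℝ) : ℂ) *
      (-Complex.I * cGrad (fun w => (ξ n w : ℂ) * defectG x α lam n l' w) y j)

/-- `Ξ_n^{(ℓ ℓ')}(λ)`. -/
def Xi (x : Fin N → Plane) (α : Fin N → ℝ) (ξ : Fin N → Plane → ℝ) (lam : ℝ)
    (n : Fin N) (l l' : Fin 2) : ℂ :=
  (∫ y, xi1 x α ξ lam n l l' y) + 2 * ∫ y, xi2 x α ξ lam n l l' y

/-- The expression defining `Q_N^{(B)}[ψ]` in terms of a decomposition of `ψ` with regular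
part `φ` and charges `q`. -/
def formExpr (x : Fin N → Plane) (α : Fin N → ℝ) (ξ : Fin N → Plane → ℝ) (lam : ℝ)
    (B : Matrix (Fin N × Fin 2) (Fin N × Fin 2) ℂ) (ψ φ : L2) (q : Fin N × Fin 2 → ℂ) : ℂ :=
  ((friedrichsForm x α φ - lam ^ 2 * ‖ψ‖ ^ 2 + lam ^ 2 * ‖φ‖ ^ 2 : ℝ) : ℂ)
  + 2 * ∑ n, ∑ l, (((q (n, l) * (2 * (∫ y, cross1 x α ξ lam φ n l y)
      + ∫ y, cross2 x α ξ lam φ n l y)).re : ℝ) : ℂ)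
  + ∑ m, ∑ n, ∑ l, ∑ l', conj (q (m, l)) * q (n, l') *
      (B (m, l) (n, l')
        + if m = n then
            (if l = l' then
              ((Real.pi * lam ^ (2 * nu α n l) / (2 * Real.sin (Real.pi * α n)) : ℝ) : ℂ)
            else 0) + Xi x α ξ lam n l l'
          else 0)

open Classical in
/-- The form `Q_N^{(B)}` computed with parameter `lam` and cut-offs `ξ`, from some decomposition
of `ψ` (zero by convention outside the domain). -/
def form (x : Fin N → Plane) (α : Fin N → ℝ) (ξ : Fin N → Plane → ℝ) (lam : ℝ)
    (B : Matrix (Fin N × Fin 2) (Fin N × Fin 2) ℂ) (ψ : L2) : ℝ :=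
  if h : ∃ p : L2 × (Fin N × Fin 2 → ℂ), IsDecomp x α ξ lam ψ p.1 p.2 then
    (formExpr x α ξ lam B ψ h.choose.1 h.choose.2).re
  else 0

/-- `Q` is a Hermitian quadratic form on the linear subspace `D`. -/
def IsHermitianForm (D : Set L2) (Q : L2 → ℝ) : Prop :=
  ∃ (V : Submodule ℂ L2) (s : V →ₗ⋆[ℂ] V →ₗ[ℂ] ℂ), (V : Set L2) = D ∧
    (∀ u v : V, s u v = conj (s v u)) ∧ ∀ u : V, s u u = (Q u : ℂ)

/-- `Q` is bounded from below on `D`. -/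
def IsBoundedBelow (D : Set L2) (Q : L2 → ℝ) : Prop :=
  ∃ m : ℝ, ∀ ψ ∈ D, m * ‖ψ‖ ^ 2 ≤ Q ψ

/-- `Q` is closed on `D`: if `ψ_k ∈ D`, `ψ_k → ψ` in `L²` and `Q[ψ_k - ψ_l] → 0`, then `ψ ∈ D`
and `Q[ψ_k - ψ] → 0`. -/
def IsClosedOn (D : Set L2) (Q : L2 → ℝ) : Prop :=
  ∀ (u : ℕ → L2) (ψ : L2), (∀ k, u k ∈ D) → Tendsto u atTop (𝓝 ψ) →
    Tendsto (fun p : ℕ × ℕ => Q (u p.1 - u p.2)) atTop (𝓝 0) →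
      ψ ∈ D ∧ Tendsto (fun k => Q (u k - ψ)) atTop (𝓝 0)

end

end AharonovBohm

open AharonovBohm

open MeasureTheory Filter Topology Set
open scoped ContDiff ComplexConjugate

namespace AharonovBohm

noncomputable section

variable {N : ℕ}

/-! ### The Laplace-type integral behind the Macdonald function -/

/-! Write D for -i∇ plus the total potential, and χ = u ξ G for the singular function of one point
and one angular momentum with exponent ν = |ℓ + α|. The proof rests on the local behaviour of G, one
divergence identity, and a limit of fluxes at the points.

Local behaviour. The Macdonald function is a power times P_ν(w) = ∫ exp(-s - w/s) s^(ν-1) ds, so G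
is a constant times r^(-ν-|ℓ|) P_ν(λ²r²/4) times the harmonic polynomial r^|ℓ| e^{iℓθ}. Since P_κ ≤
Γ(κ), G = O(r^(-ν)) and ∇G = O(r^(-ν-1)) with constants independent of λ. Replacing λ by λ' changes
G only by O(r^(ν/2)), because P_ν is Hölder continuous at 0. As Š_n and ∇ξ_n vanish at x_n, all
cross terms and Ξ-integrands converge, with λ-uniform bounds (`exists_coefficient_bound`). The
difference η of two singular functions with different parameters or cut-offs lies in the Friedrichs
domain (`eta_mem`).

Friedrichs domain. It is the projection of the closed graph `formGraph` of D in L² × L²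
(`mem_friedrichsDomain_iff`); weak gradients are unique, so this graph is the graph of an operator.
Identities continuous in (φ, Dφ) need only be checked on test functions.

Green identities. G satisfies (-i∇ + A_n)² G = -λ² G. Hence conj(Df)·Dχ + λ² conj(f) χ minus the
density of the cross terms is a divergence (`energy_sub_crossDens`). For a test function f it
integrates to zero (`test_pairing`). For a second singular function the flux through small circles
survives: between different ℓ it vanishes by oddness, and for equal ℓ the reflection formula
Γ(ν)Γ(1-ν) = π / sin πν produces exactly the differences of the coefficients πλ^(2ν)/(2 sin πα)
(`tendsto_radialCurrent`, `green_sing`). A second divergence identity shows that the cross term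
evaluated at a singular function with the same parameters is Ξ (`integral_crossDens_self`); Ξ is
therefore Hermitian (`Xi_conj`).

Uniqueness. If a singular part with charges q lay in the Friedrichs domain, so would the one with λ
+ 1, because η lies there. Computing the inner product of their magnetic gradients in two ways gives
∑ |q_p|² (d_p(λ+1) - d_p(λ)) = 0, where d_p(λ) is the diagonal coefficient. As d_p is strictly
increasing, q = 0 (`eq_zero_of_chiS_mem`).

Independence. Changing λ and ξ keeps the charges and replaces φ by φ + η(q). Expanding the form, the
pairing formula for Dη and Green's identity cancel every new term (`sesqVal_change`).

Coercivity and closedness. Adding λ²‖ψ‖² leaves ‖Dφ‖² + λ²‖φ‖², cross terms, and a quadratic form in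
q whose diagonal tends to infinity with λ while all other coefficients stay bounded; completing
squares suffices for large λ (`exists_coercive`). Sequences that are Cauchy for the form then have
Cauchy decompositions in the complete space L² × L² × ℂ^(2N), and the graph is closed
(`isClosedOn_of_coercive`). Independence carries closedness and semiboundedness to every λ. -/

/-- The integrand of `besselP`. -/
def besselKer (κ w s : ℝ) : ℝ := Real.exp (-s - w / s) * s ^ (κ - 1)

/-- `P_κ(w) = ∫₀^∞ exp(-s - w/s) s^(κ-1) ds`. -/
def besselP (κ w : ℝ) : ℝ := ∫ s in Ioi (0 : ℝ), besselKer κ w s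

lemma continuousOn_besselKer (κ w : ℝ) : ContinuousOn (besselKer κ w) (Ioi 0) := by
  intro s hs
  have hs' : s ≠ 0 := (mem_Ioi.1 hs).ne'
  unfold besselKer
  refine ContinuousAt.continuousWithinAt ?_
  refine ContinuousAt.mul (by fun_prop (disch := assumption)) ?_
  exact Real.continuousAt_rpow_const _ _ (Or.inl hs')

lemma aestronglyMeasurable_besselKer (κ w : ℝ) :
    AEStronglyMeasurable (besselKer κ w) (volume.restrict (Ioi 0)) :=
  (continuousOn_besselKer κ w).aestronglyMeasurable measurableSet_Ioi

lemma besselKer_nonneg (κ w : ℝ) {s : ℝ} (hs : 0 < s) : 0 ≤ besselKer κ w s := by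
  unfold besselKer; positivity

lemma besselKer_le_gamma (κ : ℝ) {w s : ℝ} (hw : 0 ≤ w) (hs : 0 < s) :
    besselKer κ w s ≤ Real.exp (-s) * s ^ (κ - 1) := by
  unfold besselKer
  have : 0 ≤ w / s := by positivity
  gcongr
  linarith

/-- For w > 0 the factor exp(-w/s) supplies as many powers of s at the origin as desired, by x^m /
m! ≤ exp x. This makes P_κ(w) meaningful for κ ≤ 0 as well. -/
lemma exp_neg_div_le (m : ℕ) {w s : ℝ} (hw : 0 < w) (hs : 0 < s) :
    Real.exp (-(w / s)) ≤ m.factorial * w ^ (-(m : ℝ)) * s ^ (m : ℝ) := by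
  have h := Real.pow_div_factorial_le_exp (x := w / s) (by positivity) m
  rw [Real.exp_neg, Real.rpow_neg hw.le, Real.rpow_natCast, Real.rpow_natCast]
  rw [inv_le_comm₀ (Real.exp_pos _) (by positivity)]
  refine le_trans (le_of_eq ?_) h
  rw [div_pow]; field_simp

lemma besselKer_le (κ : ℝ) (m : ℕ) {w s : ℝ} (hw : 0 < w) (hs : 0 < s) :
    besselKer κ w s ≤ m.factorial * w ^ (-(m : ℝ)) * (Real.exp (-s) * s ^ (κ + m - 1)) := by
  unfold besselKer
  have h := exp_neg_div_le m hw hs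
  have e1 : Real.exp (-s - w / s) = Real.exp (-s) * Real.exp (-(w / s)) := by
    rw [← Real.exp_add]; ring_nf
  have e2 : s ^ (κ + m - 1) = s ^ (m : ℝ) * s ^ (κ - 1) := by
    rw [← Real.rpow_add hs]; ring_nf
  rw [e1, e2]
  calc Real.exp (-s) * Real.exp (-(w / s)) * s ^ (κ - 1)
      ≤ Real.exp (-s) * (m.factorial * w ^ (-(m : ℝ)) * s ^ (m : ℝ)) * s ^ (κ - 1) := by gcongr
    _ = _ := by ring

lemma integrableOn_besselKer_of_pos (κ : ℝ) {w : ℝ} (hw : 0 < w) :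
    IntegrableOn (besselKer κ w) (Ioi 0) := by
  obtain ⟨m, hm⟩ := exists_nat_gt (-κ)
  have hG := (Real.GammaIntegral_convergent (s := κ + m) (by linarith)).const_mul
    (m.factorial * w ^ (-(m : ℝ)))
  refine Integrable.mono' hG (aestronglyMeasurable_besselKer κ w) ?_
  filter_upwards [ae_restrict_mem measurableSet_Ioi] with s hs
  rw [Real.norm_of_nonneg (besselKer_nonneg κ w hs)]
  exact besselKer_le κ m hw hs

lemma integrableOn_besselKer {κ w : ℝ} (hκ : 0 < κ) (hw : 0 ≤ w) :
    IntegrableOn (besselKer κ w) (Ioi 0) := by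
  refine Integrable.mono' (Real.GammaIntegral_convergent hκ)
    (aestronglyMeasurable_besselKer κ w) ?_
  filter_upwards [ae_restrict_mem measurableSet_Ioi] with s hs
  rw [Real.norm_of_nonneg (besselKer_nonneg κ w hs)]
  exact besselKer_le_gamma κ hw hs

lemma besselP_nonneg (κ w : ℝ) : 0 ≤ besselP κ w :=
  setIntegral_nonneg measurableSet_Ioi fun _ hs => besselKer_nonneg κ w hs

lemma besselP_le_gamma {κ w : ℝ} (hκ : 0 < κ) (hw : 0 ≤ w) : besselP κ w ≤ Real.Gamma κ := by
  rw [Real.Gamma_eq_integral hκ]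
  exact setIntegral_mono_on (integrableOn_besselKer hκ hw) (Real.GammaIntegral_convergent hκ)
    measurableSet_Ioi fun s hs => besselKer_le_gamma κ hw hs

/-- The left side is at most min(1, x), and min(1, x) ≤ x^t for 0 ≤ t ≤ 1. -/
lemma one_sub_exp_neg_le_rpow {x t : ℝ} (hx : 0 < x) (ht0 : 0 ≤ t) (ht : t ≤ 1) :
    1 - Real.exp (-x) ≤ x ^ t := by
  rcases le_total x 1 with h | h
  · calc 1 - Real.exp (-x) ≤ x := by linarith [Real.add_one_le_exp (-x)]
      _ = x ^ (1 : ℝ) := (Real.rpow_one x).symm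
      _ ≤ x ^ t := Real.rpow_le_rpow_of_exponent_ge hx h ht
  · calc 1 - Real.exp (-x) ≤ 1 := by linarith [Real.exp_pos (-x)]
      _ ≤ x ^ t := Real.one_le_rpow h ht0

/-- Γ(κ) is the value at w = 0. Estimating 1 - exp(-w/s) by (w/s)^t costs t powers of s, which the
Gamma integral can afford while t < κ. This rate is the source of the gain of regularity in
differences of defect functions. -/
lemma gamma_sub_besselP_le {κ w t : ℝ} (hw : 0 < w) (ht0 : 0 ≤ t) (ht : t ≤ 1) (htκ : t < κ) :
    |Real.Gamma κ - besselP κ w| ≤ w ^ t * Real.Gamma (κ - t) := by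
  have hκ : 0 < κ := by linarith
  rw [abs_of_nonneg (sub_nonneg.2 (besselP_le_gamma hκ hw.le)), Real.Gamma_eq_integral hκ,
    Real.Gamma_eq_integral (sub_pos.2 htκ), besselP,
    ← integral_sub (Real.GammaIntegral_convergent hκ) (integrableOn_besselKer hκ hw.le),
    ← integral_const_mul]
  refine setIntegral_mono_on
    ((Real.GammaIntegral_convergent hκ).sub (integrableOn_besselKer hκ hw.le))
    ((Real.GammaIntegral_convergent (sub_pos.2 htκ)).const_mul _) measurableSet_Ioi ?_
  intro s hs
  have hs : 0 < s := hs
  have h := one_sub_exp_neg_le_rpow (x := w / s) (by positivity) ht0 ht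
  unfold besselKer
  have e1 : Real.exp (-s - w / s) = Real.exp (-s) * Real.exp (-(w / s)) := by
    rw [← Real.exp_add]; ring_nf
  have e2 : s ^ (κ - t - 1) = s ^ (-t) * s ^ (κ - 1) := by
    rw [← Real.rpow_add hs]; ring_nf
  rw [Real.div_rpow hw.le hs.le] at h
  rw [e1, e2, Real.rpow_neg hs.le]
  calc Real.exp (-s) * s ^ (κ - 1) - Real.exp (-s) * Real.exp (-(w / s)) * s ^ (κ - 1)
      = Real.exp (-s) * s ^ (κ - 1) * (1 - Real.exp (-(w / s))) := by ring
    _ ≤ Real.exp (-s) * s ^ (κ - 1) * (w ^ t / s ^ t) := by gcongr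
    _ = _ := by ring

lemma tendsto_besselP_zero {κ : ℝ} (hκ : 0 < κ) :
    Tendsto (besselP κ) (𝓝[>] 0) (𝓝 (Real.Gamma κ)) := by
  have ht0 : 0 < min 1 (κ / 2) := by positivity
  have h0 : Tendsto (fun w : ℝ => w ^ (min 1 (κ / 2)) * Real.Gamma (κ - min 1 (κ / 2)))
      (𝓝[>] 0) (𝓝 0) := by
    have : Tendsto (fun w : ℝ => w ^ (min 1 (κ / 2))) (𝓝[>] 0) (𝓝 0) := by
      have := (Real.continuousAt_rpow_const 0 (min 1 (κ / 2)) (Or.inr ht0.le)).tendsto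
      rw [Real.zero_rpow ht0.ne'] at this
      exact this.mono_left nhdsWithin_le_nhds
    simpa using this.mul_const (Real.Gamma (κ - min 1 (κ / 2)))
  refine tendsto_iff_norm_sub_tendsto_zero.2 (squeeze_zero' (.of_forall fun _ => norm_nonneg _)
    ?_ h0)
  filter_upwards [self_mem_nhdsWithin] with w hw
  rw [Real.norm_eq_abs, abs_sub_comm]
  exact gamma_sub_besselP_le hw ht0.le (min_le_left _ _)
    (lt_of_le_of_lt (min_le_right _ _) (by linarith))

/-- Differentiating in w brings down -1/s, which lowers κ by one. The kernel decreases in w, so its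
value at w/2 dominates on a neighbourhood of w. -/
lemma hasDerivAt_besselP (κ : ℝ) {w : ℝ} (hw : 0 < w) :
    HasDerivAt (besselP κ) (-besselP (κ - 1) w) w := by
  have key := hasDerivAt_integral_of_dominated_loc_of_deriv_le
    (μ := volume.restrict (Ioi (0 : ℝ))) (F := fun w s => besselKer κ w s)
    (F' := fun w s => -besselKer (κ - 1) w s) (x₀ := w) (s := Ioi (w / 2))
    (bound := besselKer (κ - 1) (w / 2))
    (Ioi_mem_nhds (by linarith)) (.of_forall fun _ => aestronglyMeasurable_besselKer _ _)
    (integrableOn_besselKer_of_pos κ hw) (aestronglyMeasurable_besselKer _ _).neg ?_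
    (integrableOn_besselKer_of_pos _ (by positivity)) ?_
  · have := key.2
    rwa [integral_neg] at this
  · filter_upwards [ae_restrict_mem measurableSet_Ioi] with s hs x hx
    have hs : 0 < s := hs
    have hx : w / 2 < x := hx
    rw [norm_neg, Real.norm_of_nonneg (besselKer_nonneg _ _ hs)]
    unfold besselKer
    gcongr
  · filter_upwards [ae_restrict_mem measurableSet_Ioi] with s hs x hx
    have hs : 0 < s := hs
    unfold besselKer
    have h1 : HasDerivAt (fun x : ℝ => -s - x / s) (-(1 / s)) x := by
      simpa using ((hasDerivAt_id x).div_const s).const_sub (-s)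
    have h2 := (h1.exp).mul_const (s ^ (κ - 1))
    refine h2.congr_deriv ?_
    have : s ^ (κ - 1 - 1) = s ^ (κ - 1) / s := by
      rw [Real.rpow_sub_one hs.ne']
    rw [this]; ring

/-- The substitution s ↦ w/s exchanges the two terms of the exponent; it is carried out as a
dilation by w followed by an inversion. In terms of Macdonald functions this is K_{-κ} = K_κ. -/
lemma besselP_neg (κ : ℝ) {w : ℝ} (hw : 0 < w) :
    besselP (-κ) w = w ^ (-κ) * besselP κ w := by
  have h1 : ∫ s in Ioi (0 : ℝ), besselKer (-κ) w s
      = w * ∫ s in Ioi (0 : ℝ), besselKer (-κ) w (w * s) := by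
    have := integral_comp_mul_left_Ioi' (besselKer (-κ) w) 0 hw
    simpa using this.symm
  have h2 := integral_comp_rpow_Ioi (fun s => besselKer (-κ) w (w * s)) (p := -1) (by norm_num)
  rw [besselP, h1, ← h2, besselP, ← integral_const_mul, ← integral_const_mul]
  refine setIntegral_congr_fun measurableSet_Ioi fun s hs => ?_
  have hs : 0 < s := hs
  simp only [abs_neg, abs_one, one_mul, smul_eq_mul, besselKer]
  rw [Real.rpow_neg_one, Real.mul_rpow hw.le (by positivity), Real.inv_rpow hs.le,
    ← Real.rpow_neg hs.le]
  have e1 : -(w * s⁻¹) - w / (w * s⁻¹) = -s - w / s := by field_simp; ring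
  have e2 : s ^ (κ - 1) = s ^ (-1 - 1 : ℝ) * s ^ (-(-κ - 1)) := by
    rw [← Real.rpow_add hs]; ring_nf
  have e3 : w ^ (-κ) = w * w ^ (-κ - 1) := by
    rw [Real.rpow_sub_one hw.ne']; field_simp
  rw [e1, e2, e3]; ring

lemma tendsto_besselKer_zero (κ : ℝ) {w : ℝ} (hw : 0 < w) :
    Tendsto (besselKer κ w) (𝓝[>] 0) (𝓝 0) := by
  obtain ⟨m, hm⟩ := exists_nat_gt (1 - κ)
  have h0 : Tendsto (fun s : ℝ => m.factorial * w ^ (-(m : ℝ)) * (Real.exp (-s) * s ^ (κ + m - 1)))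
      (𝓝[>] 0) (𝓝 0) := by
    have h1 := (Real.continuousAt_rpow_const 0 (κ + m - 1) (Or.inr (by linarith))).tendsto
    rw [Real.zero_rpow (by linarith)] at h1
    have h2 : Tendsto (fun s : ℝ => Real.exp (-s)) (𝓝 0) (𝓝 (Real.exp (-0))) :=
      (by fun_prop : Continuous fun s : ℝ => Real.exp (-s)).tendsto 0
    have := ((h2.mul h1).const_mul (m.factorial * w ^ (-(m : ℝ)))).mono_left
      (nhdsWithin_le_nhds (s := Ioi 0))
    simpa using this
  refine squeeze_zero' ?_ ?_ h0
  · filter_upwards [self_mem_nhdsWithin] with s hs using besselKer_nonneg κ w hs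
  · filter_upwards [self_mem_nhdsWithin] with s hs using besselKer_le κ m hw hs

lemma tendsto_besselKer_atTop (κ : ℝ) {w : ℝ} (hw : 0 < w) :
    Tendsto (besselKer κ w) atTop (𝓝 0) := by
  have h0 := tendsto_rpow_mul_exp_neg_mul_atTop_nhds_zero (κ - 1) 1 one_pos
  refine squeeze_zero' ?_ ?_ h0
  · filter_upwards [eventually_gt_atTop 0] with s hs using besselKer_nonneg κ w hs
  · filter_upwards [eventually_gt_atTop 0] with s hs
    refine (besselKer_le_gamma κ hw.le hs).trans (le_of_eq ?_)
    rw [mul_comm]; ring_nf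

/-- Integrate the derivative of exp(-s - w/s) s^κ over the half-line; both boundary terms vanish
because w > 0. -/
lemma besselP_succ (κ : ℝ) {w : ℝ} (hw : 0 < w) :
    besselP (κ + 1) w = κ * besselP κ w + w * besselP (κ - 1) w := by
  have i1 := integrableOn_besselKer_of_pos (κ + 1) hw
  have i2 := (integrableOn_besselKer_of_pos κ hw).const_mul κ
  have i3 := (integrableOn_besselKer_of_pos (κ - 1) hw).const_mul w
  have hd : ∀ s ∈ Ioi (0 : ℝ), HasDerivAt (besselKer (κ + 1) w)
      ((κ * besselKer κ w s + w * besselKer (κ - 1) w s) - besselKer (κ + 1) w s) s := by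
    intro s hs
    have hs : 0 < s := hs
    unfold besselKer
    have h1 : HasDerivAt (fun s : ℝ => -s - w / s) (-1 + w / s ^ 2) s := by
      have h2 := ((hasDerivAt_inv hs.ne').const_mul w)
      have h3 := (hasDerivAt_id s).neg.sub h2
      refine h3.congr_deriv ?_
      field_simp; ring
    have h2 := h1.exp.mul (Real.hasDerivAt_rpow_const (p := κ + 1 - 1) (Or.inl hs.ne'))
    refine h2.congr_deriv ?_
    have e1 : s ^ (κ + 1 - 1) = s ^ (κ - 1) * s := by
      rw [← Real.rpow_add_one hs.ne']; ring_nf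
    have e2 : s ^ (κ - 1 - 1) = s ^ (κ - 1) / s := by
      rw [Real.rpow_sub_one hs.ne']
    have e3 : s ^ (κ + 1 - 1 - 1) = s ^ (κ - 1) := by ring_nf
    rw [e1, e2, e3]; field_simp; ring
  -- The kernel is redefined as 0 for s ≤ 0, its limit from the right: the formula itself may take
  -- another value at s = 0 (it gives 1 when κ = 0), which would break continuity at the endpoint.
  have hI := integral_Ioi_of_hasDerivAt_of_tendsto (a := 0) (m := 0)
    (f := fun s => if s ≤ 0 then 0 else besselKer (κ + 1) w s)
    (f' := fun s => (κ * besselKer κ w s + w * besselKer (κ - 1) w s) - besselKer (κ + 1) w s)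
    ?_ ?_ ((i2.add i3).sub i1) ?_
  · have e1 := integral_sub (i2.add i3) i1
    have e2 := integral_add i2 i3
    simp only [Pi.add_apply] at e1
    rw [e1, e2, integral_const_mul, integral_const_mul] at hI
    simp only [le_refl, if_true, sub_zero] at hI
    unfold besselP
    linarith
  · refine continuousWithinAt_Ioi_iff_Ici.1 ?_
    have := tendsto_besselKer_zero (κ + 1) hw
    refine (this.congr' ?_).trans (by simp)
    filter_upwards [self_mem_nhdsWithin] with s hs
    rw [if_neg (not_le.2 hs)]
  · intro s hs
    refine (hd s hs).congr_of_eventuallyEq ?_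
    filter_upwards [Ioi_mem_nhds hs] with t ht
    rw [if_neg (not_le.2 ht)]
  · refine (tendsto_besselKer_atTop (κ + 1) hw).congr' ?_
    filter_upwards [eventually_gt_atTop 0] with s hs
    rw [if_neg (not_le.2 hs)]

lemma contDiffAt_besselP (κ : ℝ) {w : ℝ} (hw : 0 < w) : ContDiffAt ℝ 2 (besselP κ) w := by
  have hC : ∀ n : ℕ, ∀ κ : ℝ, ContDiffOn ℝ n (besselP κ) (Ioi 0) := by
    intro n
    induction n with
    | zero =>
      intro κ
      refine contDiffOn_zero.2 fun w hw => ?_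
      exact (hasDerivAt_besselP κ hw).continuousAt.continuousWithinAt
    | succ n ih =>
      intro κ
      rw [Nat.cast_succ]
      refine (contDiffOn_succ_iff_deriv_of_isOpen isOpen_Ioi).2 ⟨?_, ?_, ?_⟩
      · exact fun w hw => (hasDerivAt_besselP κ hw).differentiableAt.differentiableWithinAt
      · intro h; exact absurd h (by exact_mod_cast (WithTop.coe_ne_top (a := (n : ℕ∞))))
      · exact (ih (κ - 1)).neg.congr fun w hw => (hasDerivAt_besselP κ hw).deriv
  exact (hC 2 κ).contDiffAt (x := w) ((isOpen_Ioi (a := (0:ℝ))).mem_nhds (mem_Ioi.2 hw))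

/-- The Macdonald function in terms of `besselP`. -/
lemma macdonaldK_eq (ν : ℝ) {z : ℝ} (hz : 0 < z) :
    macdonaldK ν z = (1 / 2) * (z / 2) ^ (-ν) * besselP ν (z ^ 2 / 4) := by
  have h1 : (∫ t in Ioi (0 : ℝ), Real.exp (-t - z ^ 2 / (4 * t)) * t ^ (-ν - 1))
      = besselP (-ν) (z ^ 2 / 4) := by
    unfold besselP besselKer
    simp only [div_div]
  have h2 : z ^ 2 / 4 = (z / 2) ^ (2 : ℝ) := by norm_cast; ring
  rw [macdonaldK, h1, besselP_neg ν (by positivity)]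
  have h3 : (z ^ 2 / 4) ^ (-ν) = (z / 2) ^ (-ν) * (z / 2) ^ (-ν) := by
    rw [h2, ← Real.rpow_mul (by positivity), ← Real.rpow_add (by positivity)]; ring_nf
  have h4 : (z / 2) ^ ν * (z / 2) ^ (-ν) = 1 := by
    rw [← Real.rpow_add (by positivity)]; simp
  rw [h3]
  linear_combination (1 / 2 : ℝ) * (z / 2) ^ (-ν) * besselP ν (z ^ 2 / 4) * h4

/-! ### Partial derivatives -/

/-- The `j`-th partial derivative. -/
def pd (j : Fin 2) (f : Plane → ℂ) (y : Plane) : ℂ :=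
  fderiv ℝ f y (EuclideanSpace.single j (1 : ℝ))

lemma cGrad_apply (f : Plane → ℂ) (y : Plane) (j : Fin 2) : cGrad f y j = pd j f y := rfl

/-- `f` is differentiable at `y` with partial derivatives `d`. -/
def HasPd (f : Plane → ℂ) (d : Fin 2 → ℂ) (y : Plane) : Prop :=
  DifferentiableAt ℝ f y ∧ ∀ j, pd j f y = d j

lemma hasPd_pd {f : Plane → ℂ} {y : Plane} (h : DifferentiableAt ℝ f y) :
    HasPd f (fun j => pd j f y) y := ⟨h, fun _ => rfl⟩

lemma HasFDerivAt.hasPd {f : Plane → ℂ} {y : Plane} {f' : Plane →L[ℝ] ℂ}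
    (h : HasFDerivAt f f' y) : HasPd f (fun j => f' (EuclideanSpace.single j 1)) y :=
  ⟨h.differentiableAt, fun j => by rw [pd, h.fderiv]⟩

lemma HasPd.congr {f : Plane → ℂ} {d e : Fin 2 → ℂ} {y : Plane} (h : HasPd f d y)
    (hde : ∀ j, d j = e j) : HasPd f e y := ⟨h.1, fun j => (h.2 j).trans (hde j)⟩

lemma HasPd.congr_of_eventuallyEq {f g : Plane → ℂ} {d : Fin 2 → ℂ} {y : Plane} (h : HasPd f d y)
    (hfg : g =ᶠ[𝓝 y] f) : HasPd g d y :=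
  ⟨h.1.congr_of_eventuallyEq hfg, fun j => by rw [pd, hfg.fderiv_eq]; exact h.2 j⟩

lemma hasPd_const (c : ℂ) (y : Plane) : HasPd (fun _ => c) (fun _ => 0) y :=
  ⟨differentiableAt_const c, fun j => by simp [pd]⟩

lemma HasPd.add {f g : Plane → ℂ} {d e : Fin 2 → ℂ} {y : Plane} (hf : HasPd f d y)
    (hg : HasPd g e y) : HasPd (fun z => f z + g z) (fun j => d j + e j) y :=
  ⟨hf.1.add hg.1, fun j => by
    simp only [pd, fderiv_fun_add hf.1 hg.1, ← hf.2 j, ← hg.2 j]; rfl⟩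

lemma HasPd.sub {f g : Plane → ℂ} {d e : Fin 2 → ℂ} {y : Plane} (hf : HasPd f d y)
    (hg : HasPd g e y) : HasPd (fun z => f z - g z) (fun j => d j - e j) y :=
  ⟨hf.1.sub hg.1, fun j => by
    simp only [pd, fderiv_fun_sub hf.1 hg.1, ← hf.2 j, ← hg.2 j]; rfl⟩

lemma HasPd.mul {f g : Plane → ℂ} {d e : Fin 2 → ℂ} {y : Plane} (hf : HasPd f d y)
    (hg : HasPd g e y) :
    HasPd (fun z => f z * g z) (fun j => d j * g y + f y * e j) y :=
  ⟨hf.1.mul hg.1, fun j => by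
    simp only [pd, fderiv_fun_mul hf.1 hg.1, ← hf.2 j, ← hg.2 j]
    simp [mul_comm, add_comm]⟩

lemma HasPd.const_mul {f : Plane → ℂ} {d : Fin 2 → ℂ} {y : Plane} (c : ℂ) (hf : HasPd f d y) :
    HasPd (fun z => c * f z) (fun j => c * d j) y :=
  ((hasPd_const c y).mul hf).congr fun j => by simp

lemma HasPd.conj {f : Plane → ℂ} {d : Fin 2 → ℂ} {y : Plane} (hf : HasPd f d y) :
    HasPd (fun z => conj (f z)) (fun j => conj (d j)) y := by
  have h := (Complex.conjCLE : ℂ ≃L[ℝ] ℂ).hasFDerivAt.comp y hf.1.hasFDerivAt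
  refine (HasFDerivAt.hasPd (f := fun z => conj (f z)) h).congr fun j => ?_
  rw [← hf.2 j]; rfl

lemma HasPd.sum {ι : Type*} {s : Finset ι} {f : ι → Plane → ℂ} {d : ι → Fin 2 → ℂ} {y : Plane}
    (h : ∀ i ∈ s, HasPd (f i) (d i) y) :
    HasPd (fun z => ∑ i ∈ s, f i z) (fun j => ∑ i ∈ s, d i j) y := by
  refine ⟨DifferentiableAt.fun_sum fun i hi => (h i hi).1, fun j => ?_⟩
  rw [pd, fderiv_fun_sum fun i hi => (h i hi).1, sum_apply]
  exact Finset.sum_congr rfl fun i hi => (h i hi).2 j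

lemma hasPd_ofReal {f : Plane → ℝ} {y : Plane} {f' : Plane →L[ℝ] ℝ} (h : HasFDerivAt f f' y) :
    HasPd (fun z => (f z : ℂ)) (fun j => ((f' (EuclideanSpace.single j 1) : ℝ) : ℂ)) y := by
  have := Complex.ofRealCLM.hasFDerivAt.comp y h
  exact HasFDerivAt.hasPd (f := fun z => (f z : ℂ)) this

lemma hasPd_coord (i : Fin 2) (y : Plane) :
    HasPd (fun z => ((z i : ℝ) : ℂ)) (fun j => if i = j then 1 else 0) y := by
  have h : HasFDerivAt (fun z : Plane => z i) (EuclideanSpace.proj i : Plane →L[ℝ] ℝ) y :=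
    (EuclideanSpace.proj i : Plane →L[ℝ] ℝ).hasFDerivAt
  refine (hasPd_ofReal h).congr fun j => ?_
  by_cases hij : i = j <;> simp [hij]

lemma norm_sq_plane (v : Plane) : ‖v‖ ^ 2 = v 0 ^ 2 + v 1 ^ 2 := by
  rw [EuclideanSpace.norm_sq_eq, Fin.sum_univ_two]; simp

lemma abs_coord_le (v : Plane) (j : Fin 2) : |v j| ≤ ‖v‖ := by
  simpa using PiLp.norm_apply_le v j

lemma norm_cvec_le (v : CVec) {C : ℝ} (h : ∀ j, ‖v j‖ ≤ C) : ‖v‖ ≤ 2 * C := by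
  have hC : 0 ≤ C := (norm_nonneg _).trans (h 0)
  refine abs_le_of_sq_le_sq' ?_ (by positivity) |>.2
  rw [EuclideanSpace.norm_sq_eq, Fin.sum_univ_two]
  nlinarith [h 0, h 1, norm_nonneg (v 0), norm_nonneg (v 1)]

lemma contDiffAt_pd {f : Plane → ℂ} {y : Plane} {m n : WithTop ℕ∞} (h : ContDiffAt ℝ n f y)
    (hmn : m + 1 ≤ n) (j : Fin 2) : ContDiffAt ℝ m (pd j f) y :=
  (h.fderiv_right hmn).clm_apply contDiffAt_const

lemma pd_eq_zero_of_notMem {f : Plane → ℂ} {y : Plane} (h : y ∉ tsupport f) (j : Fin 2) :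
    pd j f y = 0 := by
  rw [pd, fderiv_of_notMem_tsupport ℝ h]; rfl

lemma hasCompactSupport_pd {f : Plane → ℂ} (hc : HasCompactSupport f) (j : Fin 2) :
    HasCompactSupport (pd j f) :=
  HasCompactSupport.intro hc fun _ hy => pd_eq_zero_of_notMem hy j

lemma integrable_pd {f : Plane → ℂ} (hf : ContDiff ℝ 1 f) (hc : HasCompactSupport f) (j : Fin 2) :
    Integrable (pd j f) volume := by
  refine Continuous.integrable_of_hasCompactSupport ?_ (hasCompactSupport_pd hc j)
  exact continuous_iff_continuousAt.2 fun y =>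
    (contDiffAt_pd (m := 0) hf.contDiffAt (by norm_num) j).continuousAt

/-- Integration by parts against the constant function 1. -/
lemma integral_pd_eq_zero {f : Plane → ℂ} (hf : ContDiff ℝ 1 f) (hc : HasCompactSupport f)
    (j : Fin 2) : ∫ y, pd j f y = 0 := by
  have h := integral_mul_fderiv_eq_neg_fderiv_mul_of_integrable (μ := (volume : Measure Plane))
    (f := fun _ : Plane => (1 : ℂ)) (g := f) (v := EuclideanSpace.single j (1 : ℝ))
    (by simp) (by simpa [pd] using! integrable_pd hf hc j)
    (by simpa using hf.continuous.integrable_of_hasCompactSupport hc)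
    (fun _ _ => differentiableAt_const _) (fun y _ => hf.differentiable (by norm_num) y)
  simpa [pd] using h

/-! ### Radial cut-offs and the flux through a small circle -/

/-- A smooth radial function vanishing for `‖y - c‖ ≤ ε` and equal to `1` for
`‖y - c‖ ^ 2 ≥ 2 ε ^ 2`. -/
def cutAway (c : Plane) (ε : ℝ) (y : Plane) : ℝ :=
  Real.smoothTransition (‖y - c‖ ^ 2 / ε ^ 2 - 1)

/-- The radial density with `∇ cutAway = cutDens • (y - c)`. -/
def cutDens (c : Plane) (ε : ℝ) (y : Plane) : ℝ :=
  2 / ε ^ 2 * deriv Real.smoothTransition (‖y - c‖ ^ 2 / ε ^ 2 - 1)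

lemma contDiff_cutAway (c : Plane) (ε : ℝ) : ContDiff ℝ ∞ (cutAway c ε) := by
  have h : ContDiff ℝ ∞ (fun y : Plane => ‖y - c‖ ^ 2 / ε ^ 2 - 1) :=
    (((contDiff_id.sub contDiff_const).norm_sq ℝ).div_const _).sub contDiff_const
  exact (Real.smoothTransition.contDiff (n := ⊤)).comp h

lemma cutAway_mem (c : Plane) (ε : ℝ) (y : Plane) : cutAway c ε y ∈ Icc (0 : ℝ) 1 :=
  ⟨Real.smoothTransition.nonneg _, Real.smoothTransition.le_one _⟩

lemma hasPd_cutAway (c : Plane) (ε : ℝ) (y : Plane) :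
    HasPd (fun z => (cutAway c ε z : ℂ))
      (fun j => ((cutDens c ε y * (y - c) j : ℝ) : ℂ)) y := by
  have h1 : HasFDerivAt (fun z : Plane => ‖z - c‖ ^ 2 / ε ^ 2 - 1)
      ((1 / ε ^ 2) • (2 • (innerSL ℝ (y - c)).comp (ContinuousLinearMap.id ℝ Plane))) y := by
    have := ((((hasFDerivAt_id y).sub_const c).norm_sq).const_mul (1 / ε ^ 2)).sub_const 1
    simpa [div_eq_inv_mul] using this
  have h2 : HasDerivAt Real.smoothTransition
      (deriv Real.smoothTransition (‖y - c‖ ^ 2 / ε ^ 2 - 1)) (‖y - c‖ ^ 2 / ε ^ 2 - 1) :=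
    ((Real.smoothTransition.contDiff (n := 1)).differentiable (by norm_num) _).hasDerivAt
  have h3 := h2.comp_hasFDerivAt y h1
  refine (hasPd_ofReal (f := cutAway c ε) h3).congr fun j => ?_
  norm_cast
  have h4 : inner ℝ (y - c) (EuclideanSpace.single j (1 : ℝ)) = (y - c) j := by
    rw [EuclideanSpace.inner_single_right]; simp
  simp only [smul_apply, ContinuousLinearMap.comp_id, innerSL_apply_apply, h4, cutDens,
    smul_eq_mul, nsmul_eq_mul]
  push_cast; ring

lemma cutDens_nonneg (c : Plane) (ε : ℝ) (y : Plane) : 0 ≤ cutDens c ε y :=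
  mul_nonneg (by positivity) (Real.smoothTransition.monotone.deriv_nonneg)

lemma deriv_smoothTransition_eq_zero {s : ℝ} (h : s < 0 ∨ 1 < s) :
    deriv Real.smoothTransition s = 0 := by
  rcases h with h | h
  · have : Real.smoothTransition =ᶠ[𝓝 s] fun _ => 0 := by
      filter_upwards [Iio_mem_nhds h] with t ht
      exact Real.smoothTransition.zero_of_nonpos (le_of_lt ht)
    rw [this.deriv_eq]; simp
  · have : Real.smoothTransition =ᶠ[𝓝 s] fun _ => 1 := by
      filter_upwards [Ioi_mem_nhds h] with t ht
      exact Real.smoothTransition.one_of_one_le (le_of_lt ht)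
    rw [this.deriv_eq]; simp

lemma cutDens_eq_zero_of_lt {c : Plane} {ε : ℝ} (hε : 0 < ε) {y : Plane} (h : ‖y - c‖ < ε) :
    cutDens c ε y = 0 := by
  rw [cutDens, deriv_smoothTransition_eq_zero, mul_zero]
  left
  rw [sub_neg, div_lt_one (by positivity)]
  exact pow_lt_pow_left₀ h (norm_nonneg _) two_ne_zero

lemma cutDens_eq_zero_of_gt {c : Plane} {ε : ℝ} (hε : 0 < ε) {y : Plane} (h : 2 * ε ≤ ‖y - c‖) :
    cutDens c ε y = 0 := by
  rw [cutDens, deriv_smoothTransition_eq_zero, mul_zero]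
  right
  rw [lt_sub_iff_add_lt, lt_div_iff₀ (by positivity)]
  nlinarith

lemma cutAway_eq_zero {c : Plane} {ε : ℝ} (hε : 0 < ε) {y : Plane} (h : ‖y - c‖ ≤ ε) :
    cutAway c ε y = 0 := by
  refine Real.smoothTransition.zero_of_nonpos ?_
  rw [sub_nonpos, div_le_one (by positivity)]
  exact pow_le_pow_left₀ (norm_nonneg _) h _

lemma cutAway_eq_one {c : Plane} {ε : ℝ} (hε : 0 < ε) {y : Plane} (h : 2 * ε ≤ ‖y - c‖) :
    cutAway c ε y = 1 := by
  refine Real.smoothTransition.one_of_one_le ?_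
  rw [le_sub_iff_add_le, le_div_iff₀ (by positivity)]
  nlinarith

lemma exists_deriv_smoothTransition_le : ∃ K, 0 < K ∧ ∀ s, deriv Real.smoothTransition s ≤ K := by
  have hc : Continuous (deriv Real.smoothTransition) :=
    (Real.smoothTransition.contDiff (n := 1)).continuous_deriv le_rfl
  obtain ⟨K, hK⟩ := (isCompact_Icc (a := (0 : ℝ)) (b := 1)).bddAbove_image hc.continuousOn
  refine ⟨max K 1, by positivity, fun s => ?_⟩
  by_cases hs : s ∈ Icc (0 : ℝ) 1
  · exact (hK (mem_image_of_mem _ hs)).trans (le_max_left _ _)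
  · rw [deriv_smoothTransition_eq_zero]
    · positivity
    · by_contra! h; exact hs ⟨h.1, h.2⟩

/-- The density is of size ε⁻² and lives where ε ≤ ‖y - c‖ ≤ 2ε, so ε⁻² can be traded for ‖y - c‖⁻².
The bound no longer contains ε and can serve as a dominating function. -/
lemma exists_cutDens_le : ∃ K, 0 < K ∧ ∀ (c : Plane) (ε : ℝ) (y : Plane), 0 < ε → y ≠ c →
    cutDens c ε y ≤ K / ‖y - c‖ ^ 2 := by
  obtain ⟨K, hK0, hK⟩ := exists_deriv_smoothTransition_le
  refine ⟨8 * K, by positivity, fun c ε y hε hy => ?_⟩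
  have hn : 0 < ‖y - c‖ := norm_pos_iff.2 (sub_ne_zero.2 hy)
  by_cases h : 2 * ε ≤ ‖y - c‖
  · rw [cutDens_eq_zero_of_gt hε h]; positivity
  · push Not at h
    calc cutDens c ε y ≤ 2 / ε ^ 2 * K := by
          unfold cutDens; gcongr; exact hK _
      _ ≤ 8 * K / ‖y - c‖ ^ 2 := by
          rw [div_mul_eq_mul_div, div_le_div_iff₀ (by positivity) (by positivity)]
          have : ‖y - c‖ ^ 2 ≤ 4 * ε ^ 2 := by nlinarith
          nlinarith

lemma continuous_cutDens (c : Plane) (ε : ℝ) : Continuous (cutDens c ε) := by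
  have hc : Continuous (deriv Real.smoothTransition) :=
    (Real.smoothTransition.contDiff (n := 1)).continuous_deriv le_rfl
  unfold cutDens
  fun_prop

lemma hasCompactSupport_cutDens (c : Plane) {ε : ℝ} (hε : 0 < ε) :
    HasCompactSupport (cutDens c ε) := by
  refine HasCompactSupport.intro (isCompact_closedBall c (2 * ε)) fun y hy => ?_
  rw [Metric.mem_closedBall, dist_eq_norm, not_le] at hy
  exact cutDens_eq_zero_of_gt hε hy.le

/-- In polar coordinates r times the density is the radial derivative of the transition function, so
the radial integral is its total increase 1 and the angle contributes 2π. -/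
lemma integral_cutDens (c : Plane) {ε : ℝ} (hε : 0 < ε) :
    ∫ y, cutDens c ε y = 2 * Real.pi := by
  have h1 : ∫ y, cutDens c ε y = ∫ v : Plane, cutDens 0 ε v := by
    rw [← integral_sub_right_eq_self (cutDens 0 ε) c]
    simp [cutDens]
  rw [h1]
  have h2 := integral_fun_norm_addHaar (volume : Measure Plane)
    (fun r : ℝ => 2 / ε ^ 2 * deriv Real.smoothTransition (r ^ 2 / ε ^ 2 - 1))
  have h3 : ∫ r in Ioi (0 : ℝ), r * (2 / ε ^ 2 * deriv Real.smoothTransition (r ^ 2 / ε ^ 2 - 1))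
      = 1 - Real.smoothTransition ((0 : ℝ) ^ 2 / ε ^ 2 - 1) := by
    refine integral_Ioi_of_hasDerivAt_of_nonneg' (a := 0)
      (g := fun r => Real.smoothTransition (r ^ 2 / ε ^ 2 - 1))
      (g' := fun r => r * (2 / ε ^ 2 * deriv Real.smoothTransition (r ^ 2 / ε ^ 2 - 1))) (fun r _ => ?_) (fun r hr => ?_) ?_
    · have h4 : HasDerivAt (fun r : ℝ => r ^ 2 / ε ^ 2 - 1) (2 * r / ε ^ 2) r := by
        simpa using ((hasDerivAt_pow 2 r).div_const (ε ^ 2)).sub_const 1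
      have h5 : HasDerivAt Real.smoothTransition
          (deriv Real.smoothTransition (r ^ 2 / ε ^ 2 - 1)) (r ^ 2 / ε ^ 2 - 1) :=
        ((Real.smoothTransition.contDiff (n := 1)).differentiable (by norm_num) _).hasDerivAt
      have h6 : HasDerivAt (fun r : ℝ => Real.smoothTransition (r ^ 2 / ε ^ 2 - 1))
          (deriv Real.smoothTransition (r ^ 2 / ε ^ 2 - 1) * (2 * r / ε ^ 2)) r :=
        HasDerivAt.comp (h₂ := Real.smoothTransition) r h5 h4
      convert! h6 using 1
      ring
    · have : 0 ≤ deriv Real.smoothTransition (r ^ 2 / ε ^ 2 - 1) :=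
        Real.smoothTransition.monotone.deriv_nonneg
      have : (0 : ℝ) < r := hr
      positivity
    · refine tendsto_const_nhds.congr' ?_
      filter_upwards [eventually_ge_atTop (2 * ε)] with r hr
      refine (Real.smoothTransition.one_of_one_le ?_).symm
      rw [le_sub_iff_add_le, le_div_iff₀ (by positivity)]
      nlinarith
  simp only [cutDens, sub_zero]
  rw [h2]
  simp only [finrank_euclideanSpace, Fintype.card_fin, smul_eq_mul, pow_one, Nat.add_one_sub_one]
  have h0 : Real.smoothTransition ((0 : ℝ) ^ 2 / ε ^ 2 - 1) = 0 :=
    Real.smoothTransition.zero_of_nonpos (by norm_num)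
  rw [h3, h0, Measure.real, EuclideanSpace.volume_ball_fin_two]
  simp [Real.pi_nonneg]

lemma tendsto_integral_cutAway_mul (c : Plane) {f : Plane → ℂ} (hf : Integrable f volume) :
    Tendsto (fun ε => ∫ y, (cutAway c ε y : ℂ) * f y) (𝓝[>] 0) (𝓝 (∫ y, f y)) := by
  refine tendsto_integral_filter_of_dominated_convergence (fun y => ‖f y‖) ?_ ?_ hf.norm ?_
  · filter_upwards with ε
    exact (Complex.continuous_ofReal.comp (contDiff_cutAway c ε).continuous).aestronglyMeasurable.mul
      hf.aestronglyMeasurable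
  · filter_upwards with ε
    filter_upwards with y
    rw [norm_mul, Complex.norm_real, Real.norm_of_nonneg (cutAway_mem c ε y).1]
    exact mul_le_of_le_one_left (norm_nonneg _) (cutAway_mem c ε y).2
  · filter_upwards [compl_mem_ae_iff.2 (measure_singleton c)] with y hy
    have hn : 0 < ‖y - c‖ := norm_pos_iff.2 (sub_ne_zero.2 hy)
    refine tendsto_const_nhds.congr' ?_
    filter_upwards [Ioo_mem_nhdsGT (half_pos hn)] with ε hε
    rw [cutAway_eq_one hε.1 (by linarith [hε.2])]; simp

lemma contDiff_cutAway_mul {c : Plane} {ε : ℝ} (hε : 0 < ε) {f : Plane → ℂ}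
    (hf : ∀ y, y ≠ c → ContDiffAt ℝ 1 f y) : ContDiff ℝ 1 (fun y => (cutAway c ε y : ℂ) * f y) := by
  refine contDiff_iff_contDiffAt.2 fun y => ?_
  by_cases hy : y = c
  · subst hy
    refine (contDiffAt_const (c := (0 : ℂ))).congr_of_eventuallyEq ?_
    filter_upwards [Metric.ball_mem_nhds y hε] with z hz
    rw [Metric.mem_ball, dist_eq_norm] at hz
    rw [cutAway_eq_zero hε hz.le]; simp
  · refine ContDiffAt.mul ?_ (hf y hy)
    exact (Complex.ofRealCLM.contDiff.comp
      ((contDiff_cutAway c ε).of_le (by exact_mod_cast le_top))).contDiffAt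

/-- The field cut off near c is C¹ with compact support, so its divergence has integral zero. By the
product rule this divergence is the averaged flux plus the cut-off times div V, and the second part
converges to ∫ div V. -/
lemma tendsto_flux (c : Plane) (V : Fin 2 → Plane → ℂ)
    (hV : ∀ j y, y ≠ c → ContDiffAt ℝ 1 (V j) y) (hc : ∀ j, HasCompactSupport (V j))
    (hint : Integrable (fun y => ∑ j, pd j (V j) y) volume) :
    Tendsto (fun ε => ∫ y, (cutDens c ε y : ℂ) * ∑ j, (((y - c) j : ℝ) : ℂ) * V j y) (𝓝[>] 0)
      (𝓝 (-∫ y, ∑ j, pd j (V j) y)) := by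
  refine (tendsto_integral_cutAway_mul c hint).neg.congr' ?_
  filter_upwards [self_mem_nhdsWithin] with ε hε
  have hε : 0 < ε := hε
  have hW : ∀ j, ContDiff ℝ 1 (fun y => (cutAway c ε y : ℂ) * V j y) :=
    fun j => contDiff_cutAway_mul hε (hV j)
  have hWc : ∀ j, HasCompactSupport (fun y => (cutAway c ε y : ℂ) * V j y) :=
    fun j => (hc j).mul_left
  have h0 : ∫ y, ∑ j, pd j (fun y => (cutAway c ε y : ℂ) * V j y) y = 0 := by
    rw [integral_finsetSum _ fun j _ => integrable_pd (hW j) (hWc j) j]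
    exact Finset.sum_eq_zero fun j _ => integral_pd_eq_zero (hW j) (hWc j) j
  have i0 : Integrable (fun y => ∑ j, pd j (fun y => (cutAway c ε y : ℂ) * V j y) y) volume :=
    integrable_finsetSum _ fun j _ => integrable_pd (hW j) (hWc j) j
  have i1 : Integrable (fun y => (cutAway c ε y : ℂ) * ∑ j, pd j (V j) y) volume := by
    refine hint.bdd_mul (c := 1) (Complex.continuous_ofReal.comp
      (contDiff_cutAway c ε).continuous).aestronglyMeasurable (.of_forall fun y => ?_)
    rw [Complex.norm_real, Real.norm_of_nonneg (cutAway_mem c ε y).1]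
    exact (cutAway_mem c ε y).2
  have hae : ∀ᵐ y ∂(volume : Measure Plane),
      (cutDens c ε y : ℂ) * ∑ j, (((y - c) j : ℝ) : ℂ) * V j y
      = ∑ j, pd j (fun y => (cutAway c ε y : ℂ) * V j y) y
        - (cutAway c ε y : ℂ) * ∑ j, pd j (V j) y := by
    filter_upwards [compl_mem_ae_iff.2 (measure_singleton c)] with y hy
    have := fun j => ((hasPd_cutAway c ε y).mul
      (hasPd_pd ((hV j y hy).differentiableAt (by norm_num)))).2 j
    simp only [this, Fin.sum_univ_two]
    push_cast; ring
  rw [integral_congr_ae hae, integral_sub i0 i1, h0]; simp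

/-- The reflection through c preserves the density and reverses the sign of f. No bound on f near c
is needed. -/
lemma integral_cutDens_mul_odd (c : Plane) (ε : ℝ) {f : Plane → ℂ}
    (hf : ∀ v, f (c + v) = -f (c - v)) : ∫ y, (cutDens c ε y : ℂ) * f y = 0 := by
  have h1 : ∫ y, (cutDens c ε y : ℂ) * f y
      = ∫ v : Plane, (cutDens c ε (c + v) : ℂ) * f (c + v) :=
    (integral_add_left_eq_self (fun y => (cutDens c ε y : ℂ) * f y) c).symm
  have h2 : ∫ y, (cutDens c ε y : ℂ) * f y
      = ∫ v : Plane, (cutDens c ε (c - v) : ℂ) * f (c - v) :=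
    (integral_sub_left_eq_self (fun y => (cutDens c ε y : ℂ) * f y) volume c).symm
  have h3 : ∫ v : Plane, (cutDens c ε (c + v) : ℂ) * f (c + v)
      = -∫ v : Plane, (cutDens c ε (c - v) : ℂ) * f (c - v) := by
    rw [← integral_neg]
    refine integral_congr_ae (.of_forall fun v => ?_)
    have : cutDens c ε (c + v) = cutDens c ε (c - v) := by simp [cutDens]
    simp only [hf v, this]; ring
  rw [← h1, ← h2] at h3
  exact self_eq_neg.1 h3

lemma aestronglyMeasurable_cutDens_mul {c : Plane} {ε R : ℝ} (hε : 0 < ε) (hεR : 2 * ε < R)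
    {f : Plane → ℂ} (hf : ∀ y, y ≠ c → ‖y - c‖ < R → ContinuousAt f y) :
    AEStronglyMeasurable (fun y => (cutDens c ε y : ℂ) * f y) volume := by
  refine Continuous.aestronglyMeasurable (continuous_iff_continuousAt.2 fun y => ?_)
  by_cases h1 : ‖y - c‖ < ε
  · refine (continuousAt_const (y := (0 : ℂ))).congr ?_
    filter_upwards [(isOpen_lt (continuous_id.sub continuous_const).norm
      continuous_const).mem_nhds h1] with z (hz : ‖z - c‖ < ε)
    rw [cutDens_eq_zero_of_lt hε hz]; simp
  by_cases h2 : ‖y - c‖ < R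
  · refine ContinuousAt.mul ?_ (hf y ?_ h2)
    · exact (Complex.continuous_ofReal.comp (continuous_cutDens c ε)).continuousAt
    · rintro rfl; simp [hε] at h1
  · refine (continuousAt_const (y := (0 : ℂ))).congr ?_
    have h3 : 2 * ε < ‖y - c‖ := hεR.trans_le (not_lt.1 h2)
    filter_upwards [(isOpen_lt continuous_const
      (continuous_id.sub continuous_const).norm).mem_nhds h3] with z (hz : 2 * ε < ‖z - c‖)
    rw [cutDens_eq_zero_of_gt hε (le_of_lt hz)]; simp

lemma integrable_cutDens_mul {c : Plane} {ε R C : ℝ} (hε : 0 < ε) (hεR : 2 * ε < R)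
    {f : Plane → ℂ} (hf : ∀ y, y ≠ c → ‖y - c‖ < R → ContinuousAt f y)
    (hC : ∀ y, ε ≤ ‖y - c‖ → ‖y - c‖ < 2 * ε → ‖f y‖ ≤ C) :
    Integrable (fun y => (cutDens c ε y : ℂ) * f y) volume := by
  refine Integrable.mono' (((continuous_cutDens c ε).integrable_of_hasCompactSupport
    (hasCompactSupport_cutDens c hε)).mul_const C) (aestronglyMeasurable_cutDens_mul hε hεR hf)
    (.of_forall fun y => ?_)
  rw [norm_mul, Complex.norm_real, Real.norm_of_nonneg (cutDens_nonneg c ε y)]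
  by_cases h1 : ‖y - c‖ < ε
  · simp [cutDens_eq_zero_of_lt hε h1]
  by_cases h2 : ‖y - c‖ < 2 * ε
  · exact mul_le_mul_of_nonneg_left (hC y (not_lt.1 h1) h2) (cutDens_nonneg c ε y)
  · simp [cutDens_eq_zero_of_gt hε (not_lt.1 h2)]

lemma integrable_cutDens_mul_of_continuousAt {c : Plane} {ε R : ℝ} (hε : 0 < ε) (hεR : 2 * ε < R)
    {f : Plane → ℂ} (hf : ∀ y, y ≠ c → ‖y - c‖ < R → ContinuousAt f y) :
    Integrable (fun y => (cutDens c ε y : ℂ) * f y) volume := by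
  have hK : IsCompact {y : Plane | ε ≤ ‖y - c‖ ∧ ‖y - c‖ ≤ 2 * ε} := by
    refine (isCompact_closedBall c (2 * ε)).of_isClosed_subset ?_ fun y hy => ?_
    · have h : Continuous fun y : Plane => ‖y - c‖ := by fun_prop
      exact (isClosed_le continuous_const h).inter (isClosed_le h continuous_const)
    · rw [Metric.mem_closedBall, dist_eq_norm]; exact hy.2
  obtain ⟨C, hC⟩ := hK.exists_bound_of_continuousOn (f := f) fun y hy =>
    (hf y (by rintro rfl; simp at hy; linarith [hy.1]) (hy.2.trans_lt hεR)).continuousWithinAt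
  exact integrable_cutDens_mul hε hεR hf fun y h1 h2 => hC y ⟨h1, h2.le⟩

/-- The densities are an approximate identity at c of total mass 2π. -/
lemma tendsto_integral_cutDens_mul {c : Plane} {R : ℝ} (hR : 0 < R) {f : Plane → ℂ}
    (hf : ∀ y, y ≠ c → ‖y - c‖ < R → ContinuousAt f y) {κ : ℂ}
    (hκ : Tendsto f (𝓝[≠] c) (𝓝 κ)) :
    Tendsto (fun ε => ∫ y, (cutDens c ε y : ℂ) * f y) (𝓝[>] 0) (𝓝 (2 * Real.pi * κ)) := by
  rw [Metric.tendsto_nhds]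
  intro δ hδ
  -- With total mass 2π this tolerance produces an error of at most δ/2.
  have hδ' : 0 < δ / (4 * Real.pi) := by positivity
  obtain ⟨r, hr, hr'⟩ := Metric.mem_nhdsWithin_iff.1 (Metric.tendsto_nhds.1 hκ _ hδ')
  have hrR : 0 < min r R / 2 := by positivity
  filter_upwards [Ioo_mem_nhdsGT hrR] with ε hε
  have hεR : 2 * ε < R := by linarith [hε.2, min_le_right r R]
  have i0 : Integrable (cutDens c ε) volume :=
    (continuous_cutDens c ε).integrable_of_hasCompactSupport (hasCompactSupport_cutDens c hε.1)
  have i1 := integrable_cutDens_mul_of_continuousAt hε.1 hεR hf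
  have e1 : (2 * Real.pi * κ : ℂ) = ∫ y, (cutDens c ε y : ℂ) * κ := by
    rw [integral_mul_const, integral_complex_ofReal, integral_cutDens c hε.1]; push_cast; ring
  have i2 : Integrable (fun y => (cutDens c ε y : ℂ) * κ) volume := i0.ofReal.mul_const κ
  rw [dist_eq_norm, e1, ← integral_sub i1 i2]
  have hle : ‖∫ y, ((cutDens c ε y : ℂ) * f y - (cutDens c ε y : ℂ) * κ)‖
      ≤ ∫ y, cutDens c ε y * (δ / (4 * Real.pi)) := by
    refine norm_integral_le_of_norm_le (i0.mul_const _) (.of_forall fun y => ?_)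
    rw [← mul_sub, norm_mul, Complex.norm_real, Real.norm_of_nonneg (cutDens_nonneg c ε y)]
    by_cases h1 : ‖y - c‖ < ε
    · simp [cutDens_eq_zero_of_lt hε.1 h1]
    by_cases h2 : ‖y - c‖ < 2 * ε
    · refine mul_le_mul_of_nonneg_left ?_ (cutDens_nonneg c ε y)
      have : y ∈ Metric.ball c r ∩ {c}ᶜ := by
        refine ⟨?_, ?_⟩
        · rw [Metric.mem_ball, dist_eq_norm]; linarith [hε.2, min_le_left r R]
        · rintro rfl; simp [hε.1] at h1
      have := hr' this
      rw [mem_ofPred_eq, dist_eq_norm] at this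
      exact this.le
    · simp [cutDens_eq_zero_of_gt hε.1 (not_lt.1 h2)]
  refine hle.trans_lt ?_
  rw [integral_mul_const, integral_cutDens c hε.1]
  have := Real.pi_pos
  field_simp
  norm_num

/-- The divergence theorem on the plane punctured at `c`, when the radial component of the field
is the sum of an odd function and a function with a limit at `c`. -/
lemma integral_div_eq_flux {c : Plane} {V : Fin 2 → Plane → ℂ}
    (hV : ∀ j y, y ≠ c → ContDiffAt ℝ 1 (V j) y) (hc : ∀ j, HasCompactSupport (V j))
    (hint : Integrable (fun y => ∑ j, pd j (V j) y) volume) {f g : Plane → ℂ} {R : ℝ} (hR : 0 < R)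
    (hfg : ∀ y, y ≠ c → ‖y - c‖ < R → ∑ j, (((y - c) j : ℝ) : ℂ) * V j y = f y + g y)
    (hf : ∀ y, y ≠ c → ‖y - c‖ < R → ContinuousAt f y)
    (hg : ∀ y, y ≠ c → ‖y - c‖ < R → ContinuousAt g y)
    (hodd : ∀ v, f (c + v) = -f (c - v)) {κ : ℂ} (hκ : Tendsto g (𝓝[≠] c) (𝓝 κ)) :
    ∫ y, ∑ j, pd j (V j) y = -(2 * Real.pi * κ) := by
  have h1 := tendsto_flux c V hV hc hint
  have h2 := tendsto_integral_cutDens_mul hR hg hκ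
  have h3 : Tendsto (fun ε => ∫ y, (cutDens c ε y : ℂ) * ∑ j, (((y - c) j : ℝ) : ℂ) * V j y)
      (𝓝[>] 0) (𝓝 (2 * Real.pi * κ)) := by
    refine h2.congr' ?_
    filter_upwards [Ioo_mem_nhdsGT (half_pos hR)] with ε hε
    have hεR : 2 * ε < R := by linarith [hε.2]
    have i1 := integrable_cutDens_mul_of_continuousAt hε.1 hεR hf
    have i2 := integrable_cutDens_mul_of_continuousAt hε.1 hεR hg
    have : ∀ y, (cutDens c ε y : ℂ) * ∑ j, (((y - c) j : ℝ) : ℂ) * V j y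
        = (cutDens c ε y : ℂ) * f y + (cutDens c ε y : ℂ) * g y := by
      intro y
      by_cases h1 : ‖y - c‖ < ε
      · simp [cutDens_eq_zero_of_lt hε.1 h1]
      by_cases h2 : ‖y - c‖ < R
      · rw [hfg y _ h2]
        · ring
        · rintro rfl; simp [hε.1] at h1
      · simp [cutDens_eq_zero_of_gt hε.1 (hεR.le.trans (not_lt.1 h2))]
    simp only [this]
    rw [integral_add i1 i2, integral_cutDens_mul_odd c ε hodd, zero_add]
  have := tendsto_nhds_unique h1 h3
  rw [← this, neg_neg]

/-! ### Integrability of powers of the distance -/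

/-- `‖y - c‖ ^ (-β)` on the ball of radius `R` about `c`. -/
def radPow (c : Plane) (R β : ℝ) : Plane → ℝ :=
  (Metric.ball c R).indicator fun y => ‖y - c‖ ^ (-β)

lemma radPow_nonneg (c : Plane) (R β : ℝ) (y : Plane) : 0 ≤ radPow c R β y :=
  indicator_nonneg (fun _ _ => by positivity) y

/-- In polar coordinates the integrand is r^(1-β), which is integrable at 0 because 1 - β > -1. -/
lemma integrable_radPow (c : Plane) (R : ℝ) {β : ℝ} (hβ : β < 2) :
    Integrable (radPow c R β) volume := by
  have h0 : IntegrableOn (fun v : Plane => ‖v‖ ^ (-β)) (Metric.ball 0 R) volume := by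
    refine (integrableOn_fun_norm_addHaar (volume : Measure Plane)
      (f := fun r : ℝ => r ^ (-β))).2 ?_
    simp only [finrank_euclideanSpace, Fintype.card_fin, smul_eq_mul, pow_one,
      Nat.add_one_sub_one]
    by_cases hR : 0 < R
    · have := (intervalIntegral.intervalIntegrable_rpow' (a := 0) (b := R) (r := 1 - β)
        (by linarith)).1
      refine (this.mono_set Ioo_subset_Ioc_self).congr_fun (fun r hr => ?_) measurableSet_Ioo
      simp only
      rw [sub_eq_add_neg, Real.rpow_add hr.1, Real.rpow_one]
    · simp [Ioo_eq_empty hR]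
  have h1 : Integrable ((Metric.ball (0 : Plane) R).indicator fun v => ‖v‖ ^ (-β)) volume :=
    (integrable_indicator_iff measurableSet_ball).2 h0
  have h2 := h1.comp_sub_right c
  refine h2.congr (.of_forall fun y => ?_)
  simp [radPow, indicator, dist_eq_norm]

lemma memLp_radPow (c : Plane) (R : ℝ) {β : ℝ} (hβ : β < 1) : MemLp (radPow c R β) 2 volume := by
  have h := integrable_radPow c R (β := 2 * β) (by linarith)
  have hm : AEStronglyMeasurable (radPow c R β) volume := by
    refine AEStronglyMeasurable.indicator ?_ measurableSet_ball
    exact (by fun_prop : Measurable fun y : Plane => ‖y - c‖ ^ (-β)).aestronglyMeasurable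
  refine (memLp_two_iff_integrable_sq hm).2 (h.congr (.of_forall fun y => ?_))
  by_cases hy : y ∈ Metric.ball c R
  · simp only [radPow, indicator_of_mem hy]
    rw [← Real.rpow_natCast, ← Real.rpow_mul (norm_nonneg _)]
    push_cast; ring_nf
  · simp [radPow, indicator_of_notMem hy]

/-! ### The defect functions -/

/-- The normalization `2^(ν-1) / √(2π)` of the defect functions. -/
def gConst (ν : ℝ) : ℝ := 2 ^ (ν - 1) / Real.sqrt (2 * Real.pi)

lemma gConst_pos (ν : ℝ) : 0 < gConst ν := by unfold gConst; positivity

lemma gConst_sq (ν : ℝ) : gConst ν ^ 2 = 2 ^ (2 * ν) / (8 * Real.pi) := by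
  have h : (2 : ℝ) ^ (2 * ν) = (2 ^ (ν - 1)) ^ 2 * 4 := by
    rw [← Real.rpow_natCast, ← Real.rpow_mul (by norm_num),
      show (4 : ℝ) = 2 ^ (2 : ℝ) by norm_num, ← Real.rpow_add (by norm_num)]
    push_cast; ring_nf
  rw [gConst, div_pow, Real.sq_sqrt (by positivity), h]
  field_simp; norm_num

/-- The degree of the harmonic polynomial attached to an angular momentum. -/
def angDeg (l : Fin 2) : ℝ := if l = 0 then 0 else 1

/-- The harmonic polynomial `r^|ℓ| e^{iℓθ}`. -/
def angPoly (l : Fin 2) (v : Plane) : ℂ :=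
  if l = 0 then 1 else ((v 0 : ℝ) : ℂ) - Complex.I * ((v 1 : ℝ) : ℂ)

/-- The partial derivatives of `angPoly`. -/
def angDer (l j : Fin 2) : ℂ := if l = 0 then 0 else if j = 0 then 1 else -Complex.I

lemma hasPd_angPoly (l : Fin 2) (c y : Plane) :
    HasPd (fun z => angPoly l (z - c)) (angDer l) y := by
  unfold angPoly
  have h : ∀ i : Fin 2, HasPd (fun z : Plane => (((z - c) i : ℝ) : ℂ))
      (fun j => if i = j then 1 else 0) y := fun i =>
    (((hasPd_coord i y).sub (hasPd_const ((c i : ℝ) : ℂ) y)).congr_of_eventuallyEq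
      (.of_forall fun z => by simp)).congr fun j => by simp
  fin_cases l
  · simpa [angDer] using (hasPd_const 1 y).congr (e := angDer 0) fun j => by simp [angDer]
  · refine ((h 0).sub ((h 1).const_mul Complex.I)).congr fun j => ?_
    fin_cases j <;> simp [angDer]

lemma norm_angPoly (l : Fin 2) (v : Plane) : ‖angPoly l v‖ = ‖v‖ ^ angDeg l := by
  fin_cases l
  · simp [angPoly, angDeg]
  · simp only [angPoly, angDeg, Fin.mk_one, Fin.isValue, one_ne_zero, if_false, Real.rpow_one]
    refine (sq_eq_sq₀ (norm_nonneg _) (norm_nonneg _)).1 ?_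
    rw [norm_sq_plane, ← Complex.normSq_eq_norm_sq, Complex.normSq_apply]
    simp; ring

lemma norm_angDer_le (l j : Fin 2) : ‖angDer l j‖ ≤ angDeg l := by
  fin_cases l <;> fin_cases j <;> simp [angDer, angDeg]

lemma contDiff_angPoly (l : Fin 2) (c : Plane) : ContDiff ℝ 2 (fun z => angPoly l (z - c)) := by
  have h : ∀ i : Fin 2, ContDiff ℝ 2 (fun z : Plane => (((z - c) i : ℝ) : ℂ)) := fun i =>
    Complex.ofRealCLM.contDiff.comp
      ((EuclideanSpace.proj i : Plane →L[ℝ] ℝ).contDiff.comp (contDiff_id.sub contDiff_const))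
  unfold angPoly
  fin_cases l
  · exact contDiff_const
  · exact (h 0).sub (contDiff_const.mul (h 1))

/-- The radial profile of the defect functions as a function of `ρ = r²`. -/
def radProf (lam ν : ℝ) (l : Fin 2) (ρ : ℝ) : ℝ :=
  gConst ν * (ρ ^ (-((ν + angDeg l) / 2)) * besselP ν (lam ^ 2 / 4 * ρ))

/-- The derivative of `radProf`. -/
def radDer (lam ν : ℝ) (l : Fin 2) (ρ : ℝ) : ℝ :=
  -(gConst ν * (ρ ^ (-((ν + angDeg l) / 2) - 1) * (besselP (ν + 1) (lam ^ 2 / 4 * ρ)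
    + ((angDeg l - ν) / 2) * besselP ν (lam ^ 2 / 4 * ρ))))

lemma hasDerivAt_besselP_mul (κ : ℝ) {lam ρ : ℝ} (hlam : 0 < lam) (hρ : 0 < ρ) :
    HasDerivAt (fun ρ => besselP κ (lam ^ 2 / 4 * ρ))
      (-besselP (κ - 1) (lam ^ 2 / 4 * ρ) * (lam ^ 2 / 4)) ρ := by
  have h := hasDerivAt_besselP κ (w := lam ^ 2 / 4 * ρ) (by positivity)
  have h2 : HasDerivAt (fun ρ : ℝ => lam ^ 2 / 4 * ρ) (lam ^ 2 / 4) ρ := by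
    simpa using (hasDerivAt_id ρ).const_mul (lam ^ 2 / 4)
  exact HasDerivAt.comp (h₂ := besselP κ) ρ h h2

/-- Differentiation produces P_{ν-1}, which is unbounded at 0 for ν < 1. The recurrence replaces it
by P_{ν+1} and P_ν, which for ν > 0 are bounded by Gamma values; hence the form of `radDer`. -/
lemma hasDerivAt_radProf (ν : ℝ) (l : Fin 2) {lam ρ : ℝ} (hlam : 0 < lam) (hρ : 0 < ρ) :
    HasDerivAt (radProf lam ν l) (radDer lam ν l ρ) ρ := by
  have h1 := hasDerivAt_besselP_mul ν hlam hρ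
  have h2 := Real.hasDerivAt_rpow_const (x := ρ) (p := -((ν + angDeg l) / 2)) (Or.inl hρ.ne')
  refine ((h2.mul h1).const_mul (gConst ν)).congr_deriv ?_
  have e := besselP_succ ν (w := lam ^ 2 / 4 * ρ) (by positivity)
  rw [radDer, e, Real.rpow_sub_one hρ.ne']
  field_simp; ring

/-- The Bessel equation in the variable ρ = r². The operator on the left is what the Laplacian does
to h(r²) p / p for p harmonic and homogeneous of degree |ℓ|: 4ρh'' + 4h' from the radial function
and 4|ℓ|h' from Euler's identity for p. -/
lemma radDer_ode (ν : ℝ) (l : Fin 2) {lam ρ : ℝ} (hlam : 0 < lam) (hρ : 0 < ρ) :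
    ∃ d, HasDerivAt (radDer lam ν l) d ρ ∧
      4 * ρ * d + 4 * (1 + angDeg l) * radDer lam ν l ρ
        = (lam ^ 2 + (ν ^ 2 - angDeg l ^ 2) / ρ) * radProf lam ν l ρ := by
  have h0 := hasDerivAt_besselP_mul ν hlam hρ
  have h1 := hasDerivAt_besselP_mul (ν + 1) hlam hρ
  have h2 := Real.hasDerivAt_rpow_const (x := ρ) (p := -((ν + angDeg l) / 2) - 1) (Or.inl hρ.ne')
  have h3 := ((h2.mul (h1.add (h0.const_mul ((angDeg l - ν) / 2)))).const_mul (gConst ν)).neg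
  refine ⟨_, h3, ?_⟩
  have e := besselP_succ ν (w := lam ^ 2 / 4 * ρ) (by positivity)
  rw [radDer, radProf, e, Real.rpow_sub_one hρ.ne', Real.rpow_sub_one hρ.ne', add_sub_cancel_right]
  simp only [Pi.add_apply]
  rw [e]
  field_simp
  ring

lemma contDiffAt_radProf (ν : ℝ) (l : Fin 2) {lam ρ : ℝ} (hlam : 0 < lam) (hρ : 0 < ρ) :
    ContDiffAt ℝ 2 (radProf lam ν l) ρ := by
  unfold radProf
  refine contDiffAt_const.mul ((Real.contDiffAt_rpow_const_of_ne hρ.ne').mul ?_)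
  exact (contDiffAt_besselP ν (w := lam ^ 2 / 4 * ρ) (by positivity)).comp ρ
    (contDiffAt_const.mul contDiffAt_id)

/-- With z = v₀ + i v₁ one has e^{-iθ} = conj(z)/|z|. The discontinuous polar angle thus disappears
in favour of a polynomial. -/
lemma angFactor_eq {v : Plane} (hv : v ≠ 0) (l : Fin 2) :
    Complex.exp (Complex.I * (ell l : ℂ) * (polarAngle v : ℂ))
      = ((‖v‖ ^ (-angDeg l) : ℝ) : ℂ) * angPoly l v := by
  fin_cases l
  · simp [ell, angPoly, angDeg]
  · have hn : 0 < ‖v‖ := norm_pos_iff.2 hv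
    set z : ℂ := ⟨v 0, v 1⟩ with hz
    have hzn : ‖z‖ = ‖v‖ := by
      refine (sq_eq_sq₀ (norm_nonneg _) (norm_nonneg _)).1 ?_
      rw [norm_sq_plane, ← Complex.normSq_eq_norm_sq, Complex.normSq_apply]; simp [hz]; ring
    have h1 := Complex.norm_mul_exp_arg_mul_I z
    have h2 : conj (Complex.exp (z.arg * Complex.I)) = Complex.exp (Complex.I * (-1) * z.arg) := by
      rw [← Complex.exp_conj]; simp [mul_comm]
    have h3 : conj z = angPoly 1 v := by
      simp only [angPoly, one_ne_zero, if_false, hz]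
      apply Complex.ext <;> simp
    have h4 := congrArg conj h1
    rw [map_mul, h2, h3, hzn, Complex.conj_ofReal] at h4
    simp only [ell, angDeg, Fin.mk_one, Fin.isValue, one_ne_zero, if_false, Real.rpow_neg_one]
    rw [← h4]
    have : (‖v‖ : ℂ) ≠ 0 := by exact_mod_cast hn.ne'
    simp only [polarAngle, ← hz]
    push_cast
    field_simp

/-- The normalization λ^ν cancels the λ in (λr)^(-ν). The parameter survives only in the argument of
P_ν, and this is why bounds can be uniform in λ. -/
lemma defectG_eq (x : Fin N → Plane) (α : Fin N → ℝ) {lam : ℝ} (hlam : 0 < lam) (n : Fin N)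
    (l : Fin 2) {y : Plane} (hy : y ≠ x n) :
    defectG x α lam n l y
      = (radProf lam (nu α n l) l (‖y - x n‖ ^ 2) : ℂ) * angPoly l (y - x n) := by
  have hn : 0 < ‖y - x n‖ := norm_pos_iff.2 (sub_ne_zero.2 hy)
  set r := ‖y - x n‖ with hr
  set ν := nu α n l with hν
  rw [defectG, angFactor_eq (sub_ne_zero.2 hy), macdonaldK_eq ν (by positivity), radProf]
  have e1 : lam ^ ν * ((1 / 2) * (lam * r / 2) ^ (-ν)) = 2 ^ (ν - 1) * r ^ (-ν) := by
    have h0 : (0 : ℝ) ≤ r := hn.le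
    rw [Real.div_rpow (mul_nonneg hlam.le h0) (by norm_num), Real.mul_rpow hlam.le h0,
      Real.rpow_sub_one (by norm_num), Real.rpow_neg hlam.le,
      Real.rpow_neg h0, Real.rpow_neg (show (0 : ℝ) ≤ 2 by norm_num)]
    have := (Real.rpow_pos_of_pos hlam ν).ne'
    field_simp
  have e2 : (r ^ 2) ^ (-((ν + angDeg l) / 2)) = r ^ (-ν) * r ^ (-angDeg l) := by
    rw [← Real.rpow_natCast, ← Real.rpow_mul hn.le, ← Real.rpow_add hn]
    push_cast; ring_nf
  have e3 : (lam * r) ^ 2 / 4 = lam ^ 2 / 4 * r ^ 2 := by ring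
  rw [e2, e3, gConst, ← mul_assoc, e1, ← hr]
  push_cast
  field_simp

lemma defectG_eventuallyEq (x : Fin N → Plane) (α : Fin N → ℝ) {lam : ℝ} (hlam : 0 < lam)
    (n : Fin N) (l : Fin 2) {y : Plane} (hy : y ≠ x n) :
    defectG x α lam n l =ᶠ[𝓝 y]
      fun z => (radProf lam (nu α n l) l (‖z - x n‖ ^ 2) : ℂ) * angPoly l (z - x n) := by
  filter_upwards [isOpen_ne.mem_nhds hy] with z hz using defectG_eq x α hlam n l hz

lemma contDiffAt_defectG (x : Fin N → Plane) (α : Fin N → ℝ) {lam : ℝ} (hlam : 0 < lam)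
    (n : Fin N) (l : Fin 2) {y : Plane} (hy : y ≠ x n) :
    ContDiffAt ℝ 2 (defectG x α lam n l) y := by
  have hn : 0 < ‖y - x n‖ := norm_pos_iff.2 (sub_ne_zero.2 hy)
  refine ContDiffAt.congr_of_eventuallyEq ?_ (defectG_eventuallyEq x α hlam n l hy)
  refine ContDiffAt.mul ?_ (contDiff_angPoly l (x n)).contDiffAt
  refine Complex.ofRealCLM.contDiff.contDiffAt.comp y ?_
  exact ContDiffAt.comp (g := radProf lam (nu α n l) l) y
    (contDiffAt_radProf (nu α n l) l hlam (ρ := ‖y - x n‖ ^ 2) (by positivity))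
    ((contDiffAt_id.sub contDiffAt_const).norm_sq ℝ)

/-- A radial function composed with the squared distance to `c`. -/
lemma hasPd_radial {h : ℝ → ℝ} {h' : ℝ} {c y : Plane} (hh : HasDerivAt h h' (‖y - c‖ ^ 2)) :
    HasPd (fun z => (h (‖z - c‖ ^ 2) : ℂ)) (fun j => 2 * h' * (((y - c) j : ℝ) : ℂ)) y := by
  have h1 : HasFDerivAt (fun z : Plane => ‖z - c‖ ^ 2)
      (2 • (innerSL ℝ (y - c)).comp (ContinuousLinearMap.id ℝ Plane)) y :=
    ((hasFDerivAt_id y).sub_const c).norm_sq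
  have h3 := hh.comp_hasFDerivAt y h1
  refine (hasPd_ofReal (f := fun z => h (‖z - c‖ ^ 2)) h3).congr fun j => ?_
  have h4 : inner ℝ (y - c) (EuclideanSpace.single j (1 : ℝ)) = (y - c) j := by
    rw [EuclideanSpace.inner_single_right]; simp
  simp only [smul_apply, ContinuousLinearMap.comp_id, innerSL_apply_apply, h4,
    smul_eq_mul, nsmul_eq_mul]
  push_cast; ring

lemma hasPd_defectG (x : Fin N → Plane) (α : Fin N → ℝ) {lam : ℝ} (hlam : 0 < lam)
    (n : Fin N) (l : Fin 2) {y : Plane} (hy : y ≠ x n) :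
    HasPd (defectG x α lam n l) (fun j =>
      2 * radDer lam (nu α n l) l (‖y - x n‖ ^ 2) * (((y - x n) j : ℝ) : ℂ) * angPoly l (y - x n)
        + radProf lam (nu α n l) l (‖y - x n‖ ^ 2) * angDer l j) y := by
  have hn : 0 < ‖y - x n‖ := norm_pos_iff.2 (sub_ne_zero.2 hy)
  refine HasPd.congr_of_eventuallyEq ?_ (defectG_eventuallyEq x α hlam n l hy)
  exact (hasPd_radial (hasDerivAt_radProf (nu α n l) l hlam (by positivity))).mul
    (hasPd_angPoly l (x n) y)

lemma hasPd_sub_coord (i : Fin 2) (c y : Plane) :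
    HasPd (fun z : Plane => (((z - c) i : ℝ) : ℂ)) (fun j => if i = j then 1 else 0) y :=
  (((hasPd_coord i y).sub (hasPd_const ((c i : ℝ) : ℂ) y)).congr_of_eventuallyEq
      (.of_forall fun z => by simp)).congr fun j => by simp

lemma norm_sq_plane_complex (v : Plane) :
    ((‖v‖ ^ 2 : ℝ) : ℂ) = ((v 0 : ℝ) : ℂ) ^ 2 + ((v 1 : ℝ) : ℂ) ^ 2 := by
  rw [norm_sq_plane]; push_cast; ring

/-- Here ℓ = -|ℓ|, so (ℓ + α)² - ℓ² = α² - 2α|ℓ|. The right side separates the contributions of |A|²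
and of A·∇. -/
lemma nu_sq_sub (α : Fin N → ℝ) (n : Fin N) (l : Fin 2) :
    nu α n l ^ 2 - angDeg l ^ 2 = α n ^ 2 - 2 * α n * angDeg l := by
  fin_cases l <;> simp [nu, ell, angDeg]; ring

lemma nu_mem (α : Fin N → ℝ) {n : Fin N} (l : Fin 2) (hα : α n ∈ Ioo (0 : ℝ) 1) :
    nu α n l ∈ Ioo (0 : ℝ) 1 := by
  fin_cases l
  · simp only [nu, ell]; simpa [abs_of_pos hα.1] using hα
  · simp only [nu, ell, Fin.mk_one, Matrix.cons_val_one, Matrix.cons_val_fin_one]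
    rw [abs_of_neg (by push_cast; linarith [hα.2])]
    exact ⟨by push_cast; linarith [hα.2], by push_cast; linarith [hα.1]⟩

lemma sin_nu (α : Fin N → ℝ) {n : Fin N} (l : Fin 2) (hα : α n ∈ Ioo (0 : ℝ) 1) :
    Real.sin (Real.pi * nu α n l) = Real.sin (Real.pi * α n) := by
  fin_cases l
  · simp [nu, ell, abs_of_pos hα.1]
  · simp only [nu, ell, Fin.mk_one, Matrix.cons_val_one, Matrix.cons_val_fin_one]
    rw [abs_of_neg (by push_cast; linarith [hα.2]), ← Real.sin_pi_sub]
    push_cast; ring_nf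

/-- The defect functions solve `(-i∇ + A_n)² G = -λ² G` away from `x_n`. -/
lemma defectG_ode (x : Fin N → Plane) (α : Fin N → ℝ) {lam : ℝ} (hlam : 0 < lam)
    (n : Fin N) (l : Fin 2) {y : Plane} (hy : y ≠ x n) :
    ∑ j, (-pd j (pd j (defectG x α lam n l)) y
      - 2 * Complex.I * ((potA x α n y j : ℝ) : ℂ) * pd j (defectG x α lam n l) y
      + ((potA x α n y j : ℝ) : ℂ) ^ 2 * defectG x α lam n l y)
      = -(lam : ℂ) ^ 2 * defectG x α lam n l y := by
  have hn : 0 < ‖y - x n‖ := norm_pos_iff.2 (sub_ne_zero.2 hy)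
  set ν := nu α n l with hν
  obtain ⟨d, hd, hode⟩ := radDer_ode ν l hlam (ρ := ‖y - x n‖ ^ 2) (by positivity)
  -- The formula for the first derivative holds on a neighbourhood of y and may be differentiated
  -- again; the right-hand side is filled in by unification with the product rules.
  have h2 : ∀ j, pd j (pd j (defectG x α lam n l)) y = _ := fun j =>
    (HasPd.congr_of_eventuallyEq (f := fun z =>
      2 * (radDer lam ν l (‖z - x n‖ ^ 2) : ℂ) * (((z - x n) j : ℝ) : ℂ) * angPoly l (z - x n)
        + radProf lam ν l (‖z - x n‖ ^ 2) * angDer l j)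
      (((((hasPd_radial hd).const_mul 2).mul (hasPd_sub_coord j (x n) y)).mul
        (hasPd_angPoly l (x n) y)).add
        ((hasPd_radial (hasDerivAt_radProf ν l hlam (by positivity))).mul
          (hasPd_const (angDer l j) y)))
      (by filter_upwards [isOpen_ne.mem_nhds hy] with z hz
          exact (hasPd_defectG x α hlam n l hz).2 j)).2 j
  simp only [h2, (hasPd_defectG x α hlam n l hy).2, defectG_eq x α hlam n l hy, ← hν]
  have hsq := norm_sq_plane_complex (y - x n)
  have hn0 : ‖y - x n‖ ^ 2 ≠ 0 := by positivity
  have hA : α n / ‖y - x n‖ ^ 2 * ‖y - x n‖ ^ 2 = α n := by field_simp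
  rw [nu_sq_sub] at hode
  simp only [Fin.sum_univ_two, potA, perp, PiLp.smul_apply, smul_eq_mul]
  generalize hA' : α n / ‖y - x n‖ ^ 2 = A at *
  -- With A = α/r² the centrifugal term splits into |A_n|² = A²r² and -2A|ℓ|, the latter being the
  -- action of -2i A_n·∇ on the angular polynomial.
  have hdiv : (α n ^ 2 - 2 * α n * angDeg l) / ‖y - x n‖ ^ 2
      = A ^ 2 * ‖y - x n‖ ^ 2 - 2 * A * angDeg l := by rw [← hA]; field_simp
  rw [hdiv] at hode
  set v := y - x n with hv
  generalize ‖v‖ ^ 2 = ρ at *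
  generalize radProf lam ν l ρ = h at *
  generalize radDer lam ν l ρ = h' at *
  have hode' := congrArg (fun t : ℝ => (t : ℂ)) hode
  push_cast at hode'
  simp only [Matrix.cons_val_zero, Matrix.cons_val_one, Matrix.cons_val_fin_one]
  fin_cases l
  · simp only [angPoly, angDer, angDeg, Fin.zero_eta, if_true] at hode' ⊢
    push_cast at hode' ⊢
    linear_combination -hode' + (4 * (d : ℂ) - (A : ℂ) ^ 2 * h) * hsq
  · simp only [angPoly, angDer, angDeg, Fin.mk_one, Fin.isValue, one_ne_zero, if_false,
      if_true] at hode' ⊢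
    push_cast at hode' ⊢
    linear_combination (-(((v 0 : ℝ) : ℂ) - Complex.I * ((v 1 : ℝ) : ℂ))) * hode'
      + (((v 0 : ℝ) : ℂ) - Complex.I * ((v 1 : ℝ) : ℂ)) * (4 * (d : ℂ) - (A : ℂ) ^ 2 * h) * hsq
      + 2 * (A : ℂ) * h * ((v 0 : ℝ) : ℂ) * Complex.I_sq

/-! ### Bounds and asymptotics of the defect functions -/

/-- The defect functions as linear functions of the values `P_ν` and `P_{ν+1}`. -/
lemma defectG_lin (x : Fin N → Plane) (α : Fin N → ℝ) {lam : ℝ} (hlam : 0 < lam)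
    (n : Fin N) (l : Fin 2) {y : Plane} (hy : y ≠ x n) :
    defectG x α lam n l y = ((gConst (nu α n l) * ‖y - x n‖ ^ (-nu α n l - angDeg l)
      * besselP (nu α n l) (lam ^ 2 / 4 * ‖y - x n‖ ^ 2) : ℝ) : ℂ) * angPoly l (y - x n) := by
  have e2 : (‖y - x n‖ ^ 2) ^ (-((nu α n l + angDeg l) / 2))
      = ‖y - x n‖ ^ (-nu α n l - angDeg l) := by
    rw [← Real.rpow_natCast, ← Real.rpow_mul (norm_nonneg _)]
    push_cast; ring_nf
  rw [defectG_eq x α hlam n l hy, radProf, e2, mul_assoc]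

lemma pd_defectG_lin (x : Fin N → Plane) (α : Fin N → ℝ) {lam : ℝ} (hlam : 0 < lam)
    (n : Fin N) (l : Fin 2) {y : Plane} (hy : y ≠ x n) (j : Fin 2) :
    pd j (defectG x α lam n l) y = -(((gConst (nu α n l) * ‖y - x n‖ ^ (-nu α n l - angDeg l - 2)
        * (y - x n) j * (2 * besselP (nu α n l + 1) (lam ^ 2 / 4 * ‖y - x n‖ ^ 2)
          + (angDeg l - nu α n l) * besselP (nu α n l) (lam ^ 2 / 4 * ‖y - x n‖ ^ 2)) : ℝ) : ℂ)
          * angPoly l (y - x n))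
      + ((gConst (nu α n l) * ‖y - x n‖ ^ (-nu α n l - angDeg l)
        * besselP (nu α n l) (lam ^ 2 / 4 * ‖y - x n‖ ^ 2) : ℝ) : ℂ) * angDer l j := by
  have e2 : (‖y - x n‖ ^ 2) ^ (-((nu α n l + angDeg l) / 2))
      = ‖y - x n‖ ^ (-nu α n l - angDeg l) := by
    rw [← Real.rpow_natCast, ← Real.rpow_mul (norm_nonneg _)]
    push_cast; ring_nf
  have e3 : (‖y - x n‖ ^ 2) ^ (-((nu α n l + angDeg l) / 2) - 1)
      = ‖y - x n‖ ^ (-nu α n l - angDeg l - 2) := by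
    rw [← Real.rpow_natCast, ← Real.rpow_mul (norm_nonneg _)]
    push_cast; ring_nf
  rw [(hasPd_defectG x α hlam n l hy).2 j, radProf, radDer, e2, e3]
  push_cast; ring

/-- Value and gradient of G are linear in the pair (P_ν, P_{ν+1}), here abstracted to (p0, p1). The
case s = 0 bounds G itself; s = 3ν/2 bounds the difference of two defect functions. -/
lemma norm_le_of_besselP_le {ν r p0 p1 A s : ℝ} (hν : ν ∈ Ioo (0 : ℝ) 1) (l j : Fin 2) {v : Plane}
    (hr : ‖v‖ = r) (hr0 : 0 < r) (h0 : |p0| ≤ A * r ^ s) (h1 : |p1| ≤ A * r ^ s) :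
    ‖((gConst ν * r ^ (-ν - angDeg l) * p0 : ℝ) : ℂ) * angPoly l v‖
        ≤ 4 * gConst ν * A * r ^ (s - ν) ∧
    ‖-(((gConst ν * r ^ (-ν - angDeg l - 2) * v j * (2 * p1 + (angDeg l - ν) * p0) : ℝ) : ℂ)
        * angPoly l v) + ((gConst ν * r ^ (-ν - angDeg l) * p0 : ℝ) : ℂ) * angDer l j‖
        ≤ 4 * gConst ν * A * r ^ (s - ν - 1) := by
  have hg := gConst_pos ν
  have hA : 0 ≤ A * r ^ s := (abs_nonneg _).trans h0
  have hA0 : 0 ≤ A := nonneg_of_mul_nonneg_left hA (by positivity)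
  have hk : |angDeg l - ν| ≤ 1 := by
    unfold angDeg; split_ifs <;> rw [abs_le] <;> constructor <;> linarith [hν.1, hν.2]
  constructor
  · rw [norm_mul, norm_angPoly, Complex.norm_real, Real.norm_eq_abs, abs_mul,
      abs_of_nonneg (show 0 ≤ gConst ν * r ^ (-ν - angDeg l) by positivity), hr]
    calc gConst ν * r ^ (-ν - angDeg l) * |p0| * r ^ angDeg l
        ≤ gConst ν * r ^ (-ν - angDeg l) * (A * r ^ s) * r ^ angDeg l := by gcongr
      _ = gConst ν * A * (r ^ s * r ^ (-ν - angDeg l) * r ^ angDeg l) := by ring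
      _ = gConst ν * A * r ^ (s - ν) := by
          rw [← Real.rpow_add hr0, ← Real.rpow_add hr0]; ring_nf
      _ ≤ 4 * gConst ν * A * r ^ (s - ν) := by
          have : 0 ≤ gConst ν * A * r ^ (s - ν) := by positivity
          linarith
  · refine (norm_add_le _ _).trans ?_
    have t1 : ‖-(((gConst ν * r ^ (-ν - angDeg l - 2) * v j * (2 * p1 + (angDeg l - ν) * p0) : ℝ)
        : ℂ) * angPoly l v)‖ ≤ 3 * gConst ν * A * r ^ (s - ν - 1) := by
      rw [norm_neg, norm_mul, norm_angPoly, Complex.norm_real, Real.norm_eq_abs, abs_mul, abs_mul,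
        abs_of_nonneg (show 0 ≤ gConst ν * r ^ (-ν - angDeg l - 2) by positivity), hr]
      have hv : |v j| ≤ r := hr ▸ abs_coord_le v j
      have hp : |2 * p1 + (angDeg l - ν) * p0| ≤ 3 * (A * r ^ s) := by
        refine (abs_add_le _ _).trans ?_
        rw [abs_mul, abs_mul, abs_two]
        have : |angDeg l - ν| * |p0| ≤ 1 * (A * r ^ s) := by gcongr
        linarith
      calc gConst ν * r ^ (-ν - angDeg l - 2) * |v j| * |2 * p1 + (angDeg l - ν) * p0|
            * r ^ angDeg l
          ≤ gConst ν * r ^ (-ν - angDeg l - 2) * r * (3 * (A * r ^ s)) * r ^ angDeg l := by gcongr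
        _ = 3 * gConst ν * A * (r ^ s * r ^ (-ν - angDeg l - 2) * r ^ (1 : ℝ) * r ^ angDeg l) := by
            rw [Real.rpow_one]; ring
        _ = 3 * gConst ν * A * r ^ (s - ν - 1) := by
            rw [← Real.rpow_add hr0, ← Real.rpow_add hr0, ← Real.rpow_add hr0]; ring_nf
    have t2 : ‖((gConst ν * r ^ (-ν - angDeg l) * p0 : ℝ) : ℂ) * angDer l j‖
        ≤ gConst ν * A * r ^ (s - ν - 1) := by
      rw [norm_mul, Complex.norm_real, Real.norm_eq_abs, abs_mul,
        abs_of_nonneg (show 0 ≤ gConst ν * r ^ (-ν - angDeg l) by positivity)]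
      have hd := norm_angDer_le l j
      -- For the s-wave the power r^(-ν) would not be controlled by r^(-ν-1) at large r, but the
      -- derivative of the constant polynomial vanishes.
      by_cases hl : l = 0
      · have : ‖angDer l j‖ = 0 := le_antisymm (by simpa [angDeg, hl] using hd) (norm_nonneg _)
        rw [this, mul_zero]; positivity
      · have hl1 : angDeg l = 1 := by simp [angDeg, hl]
        rw [hl1] at hd ⊢
        calc gConst ν * r ^ (-ν - 1) * |p0| * ‖angDer l j‖
            ≤ gConst ν * r ^ (-ν - 1) * (A * r ^ s) * 1 := by gcongr
          _ = gConst ν * A * (r ^ s * r ^ (-ν - 1)) := by ring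
          _ = gConst ν * A * r ^ (s - ν - 1) := by rw [← Real.rpow_add hr0]; ring_nf
    linarith

/-- Bounds for the defect functions, uniform in the spectral parameter. -/
lemma exists_defectG_bound (x : Fin N → Plane) (α : Fin N → ℝ) (n : Fin N) (l : Fin 2)
    (hα : α n ∈ Ioo (0 : ℝ) 1) :
    ∃ C, 0 < C ∧ ∀ lam : ℝ, 0 < lam → ∀ y, y ≠ x n →
      ‖defectG x α lam n l y‖ ≤ C * ‖y - x n‖ ^ (-nu α n l) ∧
      ∀ j, ‖pd j (defectG x α lam n l) y‖ ≤ C * ‖y - x n‖ ^ (-nu α n l - 1) := by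
  have hν := nu_mem α l hα
  set ν := nu α n l with hνd
  have hG0 := Real.Gamma_pos_of_pos hν.1
  have hG1 := Real.Gamma_pos_of_pos (show 0 < ν + 1 by linarith [hν.1])
  have hg := gConst_pos ν
  refine ⟨4 * gConst ν * (Real.Gamma ν + Real.Gamma (ν + 1)), by positivity,
    fun lam hlam y hy => ?_⟩
  have hr0 : 0 < ‖y - x n‖ := norm_pos_iff.2 (sub_ne_zero.2 hy)
  have hw : 0 ≤ lam ^ 2 / 4 * ‖y - x n‖ ^ 2 := by positivity
  have h0 := besselP_le_gamma hν.1 hw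
  have h1 := besselP_le_gamma (show 0 < ν + 1 by linarith [hν.1]) hw
  have key := fun j => norm_le_of_besselP_le (s := 0) (A := Real.Gamma ν + Real.Gamma (ν + 1))
    (p0 := besselP ν (lam ^ 2 / 4 * ‖y - x n‖ ^ 2))
    (p1 := besselP (ν + 1) (lam ^ 2 / 4 * ‖y - x n‖ ^ 2)) hν l
    j rfl hr0 (by rw [abs_of_nonneg (besselP_nonneg _ _), Real.rpow_zero]; linarith)
    (by rw [abs_of_nonneg (besselP_nonneg _ _), Real.rpow_zero]; linarith)
  rw [zero_sub] at key
  refine ⟨?_, fun j => ?_⟩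
  · rw [defectG_lin x α hlam n l hy]; exact (key 0).1
  · rw [pd_defectG_lin x α hlam n l hy j]; exact (key j).2

/-- The difference of two defect functions with different spectral parameters is less singular. -/
lemma exists_defectG_sub_bound (x : Fin N → Plane) (α : Fin N → ℝ) (n : Fin N) (l : Fin 2)
    (hα : α n ∈ Ioo (0 : ℝ) 1) {lam lam' : ℝ} (hlam : 0 < lam) (hlam' : 0 < lam') :
    ∃ C, 0 < C ∧ ∀ y, y ≠ x n →
      ‖defectG x α lam n l y - defectG x α lam' n l y‖ ≤ C * ‖y - x n‖ ^ (nu α n l / 2) ∧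
      ∀ j, ‖pd j (defectG x α lam n l) y - pd j (defectG x α lam' n l) y‖
        ≤ C * ‖y - x n‖ ^ (nu α n l / 2 - 1) := by
  have hν := nu_mem α l hα
  set ν := nu α n l with hνd
  -- Any t with ν/2 < t < ν would do: t < ν is required by the Hölder estimate, and 2t > ν makes the
  -- gain r^(2t) outweigh the singularity r^(-ν).
  set t := 3 * ν / 4 with ht
  have ht0 : 0 ≤ t := by have := hν.1; positivity
  have ht1 : t ≤ 1 := by linarith [hν.2]
  have htν : t < ν := by linarith [hν.1]
  have hg := gConst_pos ν
  have hG0 := Real.Gamma_pos_of_pos (show 0 < ν - t by linarith)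
  have hG1 := Real.Gamma_pos_of_pos (show 0 < ν + 1 - t by linarith)
  set K := ((lam ^ 2 / 4) ^ t + (lam' ^ 2 / 4) ^ t) * (Real.Gamma (ν - t) + Real.Gamma (ν + 1 - t))
    with hK
  have hK0 : 0 < K := by positivity
  refine ⟨4 * gConst ν * K, by positivity, fun y hy => ?_⟩
  have hr0 : 0 < ‖y - x n‖ := norm_pos_iff.2 (sub_ne_zero.2 hy)
  set r := ‖y - x n‖ with hr
  have hpow : ∀ c : ℝ, 0 < c → (c ^ 2 / 4 * r ^ 2) ^ t = (c ^ 2 / 4) ^ t * r ^ (3 * ν / 2) := by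
    intro c hc
    rw [Real.mul_rpow (by positivity) (by positivity), ← Real.rpow_natCast r 2,
      ← Real.rpow_mul hr0.le]
    congr 2; rw [ht]; push_cast; ring
  have hdiff : ∀ κ, t < κ → Real.Gamma (κ - t) ≤ Real.Gamma (ν - t) + Real.Gamma (ν + 1 - t) →
      |besselP κ (lam ^ 2 / 4 * r ^ 2) - besselP κ (lam' ^ 2 / 4 * r ^ 2)|
        ≤ K * r ^ (3 * ν / 2) := by
    intro κ hκ hκG
    have a1 := gamma_sub_besselP_le (w := lam ^ 2 / 4 * r ^ 2) (by positivity) ht0 ht1 hκ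
    have a2 := gamma_sub_besselP_le (w := lam' ^ 2 / 4 * r ^ 2) (by positivity) ht0 ht1 hκ
    rw [hpow lam hlam] at a1
    rw [hpow lam' hlam'] at a2
    have a3 := abs_sub_le (besselP κ (lam ^ 2 / 4 * r ^ 2)) (Real.Gamma κ)
      (besselP κ (lam' ^ 2 / 4 * r ^ 2))
    rw [abs_sub_comm] at a1
    refine a3.trans ((add_le_add a1 a2).trans ?_)
    have hr2 : 0 < r ^ (3 * ν / 2) := by positivity
    have e : (lam ^ 2 / 4) ^ t * r ^ (3 * ν / 2) * Real.Gamma (κ - t)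
        + (lam' ^ 2 / 4) ^ t * r ^ (3 * ν / 2) * Real.Gamma (κ - t)
        = ((lam ^ 2 / 4) ^ t + (lam' ^ 2 / 4) ^ t) * Real.Gamma (κ - t) * r ^ (3 * ν / 2) := by ring
    rw [e, hK]
    gcongr
  have key := fun j => norm_le_of_besselP_le (s := 3 * ν / 2) (A := K) hν l j hr.symm hr0
    (hdiff ν htν (by linarith)) (hdiff (ν + 1) (by linarith) (by linarith))
  have es : 3 * ν / 2 - ν = ν / 2 := by ring
  rw [es] at key
  refine ⟨?_, fun j => ?_⟩
  · rw [defectG_lin x α hlam n l hy, defectG_lin x α hlam' n l hy]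
    convert (key 0).1 using 2
    push_cast; ring
  · rw [pd_defectG_lin x α hlam n l hy j, pd_defectG_lin x α hlam' n l hy j]
    convert (key j).2 using 2
    push_cast; ring

/-- The radial component of the current of two defect functions. -/
def radialCurrent (x : Fin N → Plane) (α : Fin N → ℝ) (lam' lam : ℝ) (n : Fin N) (l l' : Fin 2)
    (y : Plane) : ℂ :=
  ∑ j, (((y - x n) j : ℝ) : ℂ) * (conj (defectG x α lam' n l y) * pd j (defectG x α lam n l') y
    - defectG x α lam n l' y * conj (pd j (defectG x α lam' n l) y))

/-- The radial factor of `radialCurrent`. -/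
def radialFactor (α : Fin N → ℝ) (lam' lam : ℝ) (n : Fin N) (l l' : Fin 2) (r : ℝ) : ℝ :=
  gConst (nu α n l) * gConst (nu α n l') * r ^ (-nu α n l - angDeg l)
    * r ^ (-nu α n l' - angDeg l') *
    (besselP (nu α n l') (lam ^ 2 / 4 * r ^ 2) * (2 * besselP (nu α n l + 1) (lam' ^ 2 / 4 * r ^ 2)
        - nu α n l * besselP (nu α n l) (lam' ^ 2 / 4 * r ^ 2))
      - besselP (nu α n l) (lam' ^ 2 / 4 * r ^ 2)
        * (2 * besselP (nu α n l' + 1) (lam ^ 2 / 4 * r ^ 2)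
        - nu α n l' * besselP (nu α n l') (lam ^ 2 / 4 * r ^ 2)))

/-- By Euler's identity the harmonic polynomial contributes |ℓ| to r∂_r, which cancels the |ℓ|
coming from the radial profile. -/
lemma euler_defectG (x : Fin N → Plane) (α : Fin N → ℝ) {lam : ℝ} (hlam : 0 < lam) (n : Fin N)
    (l : Fin 2) {y : Plane} (hy : y ≠ x n) :
    ∑ j, (((y - x n) j : ℝ) : ℂ) * pd j (defectG x α lam n l) y
      = -((gConst (nu α n l) * ‖y - x n‖ ^ (-nu α n l - angDeg l)
        * (2 * besselP (nu α n l + 1) (lam ^ 2 / 4 * ‖y - x n‖ ^ 2)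
          - nu α n l * besselP (nu α n l) (lam ^ 2 / 4 * ‖y - x n‖ ^ 2)) : ℝ) : ℂ)
        * angPoly l (y - x n) := by
  have hr0 : 0 < ‖y - x n‖ := norm_pos_iff.2 (sub_ne_zero.2 hy)
  have hsq := norm_sq_plane_complex (y - x n)
  have hdiv : ∑ j, (((y - x n) j : ℝ) : ℂ) * angDer l j = angDeg l * angPoly l (y - x n) := by
    fin_cases l
    · simp [angDer, angDeg]
    · simp [angDer, angDeg, angPoly, Fin.sum_univ_two]; ring
  have hpow : ‖y - x n‖ ^ (-nu α n l - angDeg l)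
      = ‖y - x n‖ ^ (-nu α n l - angDeg l - 2) * ‖y - x n‖ ^ 2 := by
    rw [← Real.rpow_natCast, ← Real.rpow_add hr0]; push_cast; ring_nf
  simp only [pd_defectG_lin x α hlam n l hy, Fin.sum_univ_two] at hdiv ⊢
  rw [hpow]
  push_cast at hsq ⊢
  rw [hsq]
  linear_combination ((gConst (nu α n l) : ℂ) * (‖y - x n‖ ^ (-nu α n l - angDeg l - 2) : ℝ)
    * ((((y - x n) 0 : ℝ) : ℂ) ^ 2 + (((y - x n) 1 : ℝ) : ℂ) ^ 2)
    * besselP (nu α n l) (lam ^ 2 / 4 * ‖y - x n‖ ^ 2)) * hdiv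

/-- A real radial factor times an angular polynomial, so parity can be read off. The centre is
included because oddness is later required for every displacement, the zero one as well. -/
lemma radialCurrent_eq (x : Fin N → Plane) (α : Fin N → ℝ) {lam' lam : ℝ} (hlam' : 0 < lam')
    (hlam : 0 < lam) (n : Fin N) (l l' : Fin 2) (y : Plane) :
    radialCurrent x α lam' lam n l l' y = if y = x n then 0 else
      (radialFactor α lam' lam n l l' ‖y - x n‖ : ℂ)
        * (conj (angPoly l (y - x n)) * angPoly l' (y - x n)) := by
  split_ifs with hy
  · simp [radialCurrent, hy]
  have h1 := euler_defectG x α hlam n l' hy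
  have h2 := congrArg conj (euler_defectG x α hlam' n l hy)
  have e : radialCurrent x α lam' lam n l l' y
      = conj (defectG x α lam' n l y)
          * (∑ j, (((y - x n) j : ℝ) : ℂ) * pd j (defectG x α lam n l') y)
        - defectG x α lam n l' y
          * conj (∑ j, (((y - x n) j : ℝ) : ℂ) * pd j (defectG x α lam' n l) y) := by
    simp only [radialCurrent, Fin.sum_univ_two, map_add, map_mul, Complex.conj_ofReal]; ring
  rw [e, h1, h2, defectG_lin x α hlam' n l hy, defectG_lin x α hlam n l' hy]
  simp only [map_mul, map_neg, Complex.conj_ofReal, radialFactor]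
  push_cast; ring

/-- For different angular momenta the angular factor is linear in v. The current then has no mean
over circles, and no limit at x_n is needed to discard its flux. -/
lemma radialCurrent_odd (x : Fin N → Plane) (α : Fin N → ℝ) {lam' lam : ℝ} (hlam' : 0 < lam')
    (hlam : 0 < lam) (n : Fin N) {l l' : Fin 2} (hll : l ≠ l') (v : Plane) :
    radialCurrent x α lam' lam n l l' (x n + v) = -radialCurrent x α lam' lam n l l' (x n - v) := by
  rw [radialCurrent_eq x α hlam' hlam, radialCurrent_eq x α hlam' hlam]
  by_cases hv : v = 0
  · simp [hv]
  rw [if_neg (by simpa using hv), if_neg (by simpa using hv)]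
  simp only [add_sub_cancel_left, sub_sub_cancel_left, norm_neg]
  fin_cases l <;> fin_cases l' <;> simp [angPoly] at hll ⊢ <;> ring

/-- The symmetry κ ↦ -κ exposes the exact power w^ν and leaves P_{1-ν}, which has a finite limit at
0 for ν < 1. -/
lemma mul_besselP_sub_one {ν w : ℝ} (hw : 0 < w) :
    w * besselP (ν - 1) w = w ^ ν * besselP (1 - ν) w := by
  have := besselP_neg (1 - ν) hw
  rw [neg_sub] at this
  rw [this, ← mul_assoc, Real.rpow_sub_one hw.ne']
  field_simp

/-- By the recurrence 2P_{ν+1} - νP_ν = νP_ν + 2wP_{ν-1}, and the products νP_νP_ν cancel between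
the two halves of the current. What remains are products P_ν P_{1-ν} with prefactors (λ²/4)^ν and
(λ'²/4)^ν, all powers of r having cancelled. Their limit is Γ(ν)Γ(1-ν) = π / sin πν. -/
lemma tendsto_radialCurrent (x : Fin N → Plane) (α : Fin N → ℝ) {lam' lam : ℝ} (hlam' : 0 < lam')
    (hlam : 0 < lam) (n : Fin N) (l : Fin 2) (hα : α n ∈ Ioo (0 : ℝ) 1) :
    Tendsto (radialCurrent x α lam' lam n l l) (𝓝[≠] (x n))
      (𝓝 (((lam' ^ (2 * nu α n l) - lam ^ (2 * nu α n l))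
        / (4 * Real.sin (Real.pi * α n)) : ℝ) : ℂ)) := by
  have hν := nu_mem α l hα
  set ν := nu α n l with hνd
  set F : ℝ → ℝ := fun r => 2 * gConst ν ^ 2 *
    ((lam' ^ 2 / 4) ^ ν * (besselP ν (lam ^ 2 / 4 * r ^ 2) * besselP (1 - ν) (lam' ^ 2 / 4 * r ^ 2))
      - (lam ^ 2 / 4) ^ ν
        * (besselP ν (lam' ^ 2 / 4 * r ^ 2) * besselP (1 - ν) (lam ^ 2 / 4 * r ^ 2))) with hF
  have hFlim : Tendsto F (𝓝[>] 0) (𝓝 ((lam' ^ (2 * ν) - lam ^ (2 * ν))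
      / (4 * Real.sin (Real.pi * α n)))) := by
    have hw : ∀ c : ℝ, 0 < c → Tendsto (fun r : ℝ => c ^ 2 / 4 * r ^ 2) (𝓝[>] 0) (𝓝[>] 0) := by
      intro c hc
      refine tendsto_nhdsWithin_iff.2 ⟨?_, ?_⟩
      · have : Tendsto (fun r : ℝ => c ^ 2 / 4 * r ^ 2) (𝓝 0) (𝓝 (c ^ 2 / 4 * 0 ^ 2)) :=
          (by fun_prop : Continuous fun r : ℝ => c ^ 2 / 4 * r ^ 2).tendsto 0
        simpa using this.mono_left nhdsWithin_le_nhds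
      · filter_upwards [self_mem_nhdsWithin] with r hr
        have : (0 : ℝ) < r := hr
        exact mem_Ioi.2 (by positivity)
    have t1 : ∀ κ c : ℝ, 0 < κ → 0 < c →
        Tendsto (fun r : ℝ => besselP κ (c ^ 2 / 4 * r ^ 2)) (𝓝[>] 0) (𝓝 (Real.Gamma κ)) :=
      fun κ c hκ hc => (tendsto_besselP_zero hκ).comp (hw c hc)
    have h1ν : 0 < 1 - ν := by linarith [hν.2]
    have key := ((((t1 ν lam hν.1 hlam).mul (t1 (1 - ν) lam' h1ν hlam')).const_mul
      ((lam' ^ 2 / 4) ^ ν)).sub (((t1 ν lam' hν.1 hlam').mul (t1 (1 - ν) lam h1ν hlam)).const_mul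
      ((lam ^ 2 / 4) ^ ν))).const_mul (2 * gConst ν ^ 2)
    convert key using 2
    have hpow : ∀ c : ℝ, 0 < c → (c ^ 2 / 4) ^ ν = c ^ (2 * ν) / 2 ^ (2 * ν) := by
      intro c hc
      rw [Real.div_rpow (by positivity) (by norm_num), ← Real.rpow_natCast c 2,
        ← Real.rpow_mul hc.le, show (4 : ℝ) = 2 ^ (2 : ℝ) by norm_num,
        ← Real.rpow_mul (by norm_num)]
      push_cast; rfl
    have hs : Real.sin (Real.pi * α n) ≠ 0 := by
      refine (Real.sin_pos_of_pos_of_lt_pi (mul_pos Real.pi_pos hα.1) ?_).ne'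
      nlinarith [Real.pi_pos, hα.2]
    have h2 : (0 : ℝ) < 2 ^ (2 * ν) := by positivity
    rw [Real.Gamma_mul_Gamma_one_sub, hνd, sin_nu α l hα, ← hνd, gConst_sq, hpow lam hlam,
      hpow lam' hlam']
    have hpi := Real.pi_ne_zero
    field_simp
    ring
  have hnorm : Tendsto (fun y : Plane => ‖y - x n‖) (𝓝[≠] (x n)) (𝓝[>] 0) := by
    refine tendsto_nhdsWithin_iff.2 ⟨?_, ?_⟩
    · have : Tendsto (fun y : Plane => ‖y - x n‖) (𝓝 (x n)) (𝓝 ‖x n - x n‖) :=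
        (by fun_prop : Continuous fun y : Plane => ‖y - x n‖).tendsto _
      simpa using this.mono_left nhdsWithin_le_nhds
    · filter_upwards [self_mem_nhdsWithin] with y hy
      exact norm_pos_iff.2 (sub_ne_zero.2 hy)
  refine ((Complex.continuous_ofReal.tendsto _).comp (hFlim.comp hnorm)).congr' ?_
  filter_upwards [self_mem_nhdsWithin] with y hy
  have hy : y ≠ x n := hy
  have hr0 : 0 < ‖y - x n‖ := norm_pos_iff.2 (sub_ne_zero.2 hy)
  rw [radialCurrent_eq x α hlam' hlam, if_neg hy]
  have hp : conj (angPoly l (y - x n)) * angPoly l (y - x n)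
      = ((‖y - x n‖ ^ (2 * angDeg l) : ℝ) : ℂ) := by
    rw [← Complex.normSq_eq_conj_mul_self, Complex.normSq_eq_norm_sq, norm_angPoly,
      ← Real.rpow_natCast, ← Real.rpow_mul (norm_nonneg _)]
    push_cast; ring_nf
  rw [hp]
  simp only [Function.comp_apply]
  rw [← Complex.ofReal_mul]
  congr 1
  set r := ‖y - x n‖ with hr
  rw [hF, radialFactor, ← hνd, besselP_succ ν (w := lam ^ 2 / 4 * r ^ 2) (by positivity),
    besselP_succ ν (w := lam' ^ 2 / 4 * r ^ 2) (by positivity),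
    mul_besselP_sub_one (w := lam ^ 2 / 4 * r ^ 2) (by positivity),
    mul_besselP_sub_one (w := lam' ^ 2 / 4 * r ^ 2) (by positivity)]
  have e1 : ∀ c : ℝ, (c ^ 2 / 4 * r ^ 2) ^ ν = (c ^ 2 / 4) ^ ν * r ^ (2 * ν) := by
    intro c
    rw [Real.mul_rpow (by positivity) (by positivity), ← Real.rpow_natCast r 2,
      ← Real.rpow_mul hr0.le]
    push_cast; rfl
  have e2 : r ^ (-ν - angDeg l) * r ^ (-ν - angDeg l) * r ^ (2 * angDeg l) * r ^ (2 * ν) = 1 := by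
    rw [← Real.rpow_add hr0, ← Real.rpow_add hr0, ← Real.rpow_add hr0]
    ring_nf; exact Real.rpow_zero r
  rw [e1, e1]
  linear_combination (-(2 * gConst ν ^ 2 *
    ((lam' ^ 2 / 4) ^ ν * (besselP ν (lam ^ 2 / 4 * r ^ 2) * besselP (1 - ν) (lam' ^ 2 / 4 * r ^ 2))
      - (lam ^ 2 / 4) ^ ν
        * (besselP ν (lam' ^ 2 / 4 * r ^ 2) * besselP (1 - ν) (lam ^ 2 / 4 * r ^ 2))))) * e2

lemma continuousAt_radialCurrent (x : Fin N → Plane) (α : Fin N → ℝ) {lam' lam : ℝ}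
    (hlam' : 0 < lam') (hlam : 0 < lam) (n : Fin N) (l l' : Fin 2) {y : Plane} (hy : y ≠ x n) :
    ContinuousAt (radialCurrent x α lam' lam n l l') y := by
  have hG : ∀ c : ℝ, 0 < c → ∀ l, ContinuousAt (defectG x α c n l) y := fun c hc l =>
    (contDiffAt_defectG x α hc n l hy).continuousAt
  have hD : ∀ c : ℝ, 0 < c → ∀ l j, ContinuousAt (pd j (defectG x α c n l)) y := fun c hc l j =>
    (contDiffAt_pd (m := 0) (contDiffAt_defectG x α hc n l hy) (by norm_num) j).continuousAt
  have hv : ∀ j : Fin 2, Continuous fun y : Plane => (((y - x n) j : ℝ) : ℂ) := fun j =>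
    Complex.continuous_ofReal.comp
      ((EuclideanSpace.proj j : Plane →L[ℝ] ℝ).continuous.comp
        (continuous_id.sub continuous_const))
  unfold radialCurrent
  refine tendsto_finsetSum _ fun j _ => (hv j).continuousAt.mul ?_
  exact (((Complex.continuous_conj.continuousAt.comp (hG lam' hlam' l)).mul (hD lam hlam l' j)).sub
    ((hG lam hlam l').mul (Complex.continuous_conj.continuousAt.comp (hD lam' hlam' l j))))

/-! ### Cut-off functions -/

lemma IsCutoff.contDiff {x : Fin N → Plane} {ξ : Fin N → Plane → ℝ} (h : IsCutoff x ξ)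
    (n : Fin N) : ContDiff ℝ 2 (ξ n) := (h.1 n).1

lemma IsCutoff.hasCompactSupport {x : Fin N → Plane} {ξ : Fin N → Plane → ℝ} (h : IsCutoff x ξ)
    (n : Fin N) : HasCompactSupport (ξ n) := by
  obtain ⟨r, _, _, hr⟩ := h.2.1
  exact HasCompactSupport.of_support_subset_isCompact (isCompact_closedBall (x n) r)
    ((subset_tsupport _).trans ((hr n).1.trans Metric.ball_subset_closedBall))

lemma IsCutoff.exists_radius {x : Fin N → Plane} {ξ : Fin N → Plane → ℝ} (h : IsCutoff x ξ)
    (n : Fin N) : ∃ R, 0 < R ∧ tsupport (ξ n) ⊆ Metric.ball (x n) R ∧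
      ∀ y, ‖y - x n‖ < R / 2 → ξ n y = 1 := by
  obtain ⟨r, hr0, _, hr⟩ := h.2.1
  exact ⟨r, hr0, (hr n).1, fun y hy => (hr n).2 y (by rwa [Metric.mem_ball, dist_eq_norm])⟩

/-- Both radii are less than half the distance of the two points, so supports at different points
are disjoint even across two families of cut-offs. -/
lemma IsCutoff.notMem_tsupport_of_ne {x : Fin N → Plane} {ξ ξ' : Fin N → Plane → ℝ}
    (h : IsCutoff x ξ) (h' : IsCutoff x ξ') {m n : Fin N} (hmn : m ≠ n) {y : Plane}
    (hy : y ∈ tsupport (ξ n)) : y ∉ tsupport (ξ' m) := by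
  obtain ⟨r, hr0, hr1, hr⟩ := h.2.1
  obtain ⟨r', hr0', hr1', hr'⟩ := h'.2.1
  intro hy'
  have a1 := Metric.mem_ball.1 ((hr n).1 hy)
  have a2 := Metric.mem_ball.1 ((hr' m).1 hy')
  have a3 := dist_triangle_left (x m) (x n) y
  linarith [hr1 m n hmn, hr1' m n hmn]

lemma IsCutoff.ne_of_mem_tsupport {x : Fin N → Plane} {ξ : Fin N → Plane → ℝ}
    (h : IsCutoff x ξ) {m n : Fin N} (hmn : m ≠ n) {y : Plane}
    (hy : y ∈ tsupport (ξ n)) : y ≠ x m := by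
  obtain ⟨r, hr0, hr1, hr⟩ := h.2.1
  rintro rfl
  have a1 := Metric.mem_ball.1 ((hr n).1 hy)
  linarith [hr1 m n hmn, dist_nonneg (x := x m) (y := x n)]

lemma IsCutoff.eventually_eq_zero {x : Fin N → Plane} {ξ : Fin N → Plane → ℝ}
    (_h : IsCutoff x ξ) {n : Fin N} {y : Plane} (hy : y ∉ tsupport (ξ n)) :
    ∀ᶠ z in 𝓝 y, z ∉ tsupport (ξ n) :=
  (isClosed_tsupport _).isOpen_compl.mem_nhds hy

/-- The complexified cut-off function. -/
def xiC (ξ : Fin N → Plane → ℝ) (n : Fin N) (y : Plane) : ℂ := (ξ n y : ℂ)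

lemma contDiff_xiC {x : Fin N → Plane} {ξ : Fin N → Plane → ℝ} (h : IsCutoff x ξ) (n : Fin N) :
    ContDiff ℝ 2 (xiC ξ n) := Complex.ofRealCLM.contDiff.comp (h.contDiff n)

lemma hasPd_xiC {x : Fin N → Plane} {ξ : Fin N → Plane → ℝ} (h : IsCutoff x ξ) (n : Fin N)
    (y : Plane) : HasPd (xiC ξ n) (fun j => pd j (xiC ξ n) y) y :=
  hasPd_pd ((contDiff_xiC h n).differentiable (by norm_num) y)

lemma hasPd_pd_xiC {x : Fin N → Plane} {ξ : Fin N → Plane → ℝ} (h : IsCutoff x ξ) (n : Fin N)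
    (j : Fin 2) (y : Plane) : HasPd (pd j (xiC ξ n)) (fun i => pd i (pd j (xiC ξ n)) y) y :=
  hasPd_pd ((contDiffAt_pd (m := 1) (contDiff_xiC h n).contDiffAt (by norm_num) j).differentiableAt
    (by norm_num))

lemma tsupport_xiC (ξ : Fin N → Plane → ℝ) (n : Fin N) : tsupport (xiC ξ n) = tsupport (ξ n) := by
  simp only [tsupport]
  congr 1
  ext y
  simp [xiC]

lemma pd_ofReal {f : Plane → ℝ} {y : Plane} (hf : DifferentiableAt ℝ f y) (j : Fin 2) :
    pd j (fun z => (f z : ℂ)) y = ((fderiv ℝ f y (EuclideanSpace.single j 1) : ℝ) : ℂ) :=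
  (hasPd_ofReal hf.hasFDerivAt).2 j

lemma pd_xiC {x : Fin N → Plane} {ξ : Fin N → Plane → ℝ} (h : IsCutoff x ξ) (n : Fin N)
    (j : Fin 2) (y : Plane) :
    pd j (xiC ξ n) y = ((fderiv ℝ (ξ n) y (EuclideanSpace.single j 1) : ℝ) : ℂ) :=
  pd_ofReal ((h.contDiff n).differentiable (by norm_num) y) j

lemma gradient_apply (f : Plane → ℝ) (y : Plane) (j : Fin 2) :
    gradient f y j = fderiv ℝ f y (EuclideanSpace.single j 1) := by
  have h : inner ℝ (gradient f y) (EuclideanSpace.single j (1 : ℝ)) = gradient f y j := by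
    rw [EuclideanSpace.inner_single_right]; simp
  rw [← h, gradient, InnerProductSpace.toDual_symm_apply]

lemma gradient_xi {x : Fin N → Plane} {ξ : Fin N → Plane → ℝ} (h : IsCutoff x ξ) (n : Fin N)
    (j : Fin 2) (y : Plane) : ((gradient (ξ n) y j : ℝ) : ℂ) = pd j (xiC ξ n) y := by
  rw [gradient_apply, pd_xiC h]

lemma norm_sq_gradient_xi {x : Fin N → Plane} {ξ : Fin N → Plane → ℝ} (h : IsCutoff x ξ)
    (n : Fin N) (y : Plane) :
    ((‖gradient (ξ n) y‖ ^ 2 : ℝ) : ℂ) = pd 0 (xiC ξ n) y ^ 2 + pd 1 (xiC ξ n) y ^ 2 := by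
  rw [norm_sq_plane_complex, gradient_xi h, gradient_xi h]

lemma laplacian_xi {x : Fin N → Plane} {ξ : Fin N → Plane → ℝ} (h : IsCutoff x ξ) (n : Fin N)
    (y : Plane) : ((Laplacian.laplacian (ξ n) y : ℝ) : ℂ)
      = pd 0 (pd 0 (xiC ξ n)) y + pd 1 (pd 1 (xiC ξ n)) y := by
  have hL := congrFun (InnerProductSpace.laplacian_eq_iteratedFDeriv_orthonormalBasis (ξ n)
    (EuclideanSpace.basisFun (Fin 2) ℝ)) y
  have h2 : ∀ j, pd j (pd j (xiC ξ n)) y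
      = ((iteratedFDeriv ℝ 2 (ξ n) y ![EuclideanSpace.single j 1, EuclideanSpace.single j 1] : ℝ)
        : ℂ) := by
    intro j
    have hd : DifferentiableAt ℝ (fderiv ℝ (ξ n)) y :=
      (((h.contDiff n).fderiv_right (m := 1) (by norm_num)).differentiable (by norm_num)) y
    have e1 : pd j (xiC ξ n) = fun z =>
        ((fderiv ℝ (ξ n) z (EuclideanSpace.single j 1) : ℝ) : ℂ) := funext fun z => pd_xiC h n j z
    have hd2 : HasFDerivAt (fun z => fderiv ℝ (ξ n) z (EuclideanSpace.single j (1 : ℝ)))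
        ((fderiv ℝ (fderiv ℝ (ξ n)) y).flip (EuclideanSpace.single j 1)) y := by
      simpa using hd.hasFDerivAt.clm_apply (hasFDerivAt_const (EuclideanSpace.single j (1 : ℝ)) y)
    rw [e1, (hasPd_ofReal hd2).2 j, iteratedFDeriv_two_apply]
    simp
  rw [hL, Fin.sum_univ_two, h2, h2]
  simp [EuclideanSpace.basisFun_apply]

/-! ### Potentials -/

/-- The complexified components of `A_n`. -/
def aC (x : Fin N → Plane) (α : Fin N → ℝ) (n : Fin N) (j : Fin 2) (y : Plane) : ℂ :=
  ((potA x α n y j : ℝ) : ℂ)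

/-- The complexified components of `Š_n`. -/
def sC (x : Fin N → Plane) (α : Fin N → ℝ) (n : Fin N) (j : Fin 2) (y : Plane) : ℂ :=
  ((potSCheck x α n y j : ℝ) : ℂ)

/-- The complexified components of `S_n(x_n)`. -/
def sC0 (x : Fin N → Plane) (α : Fin N → ℝ) (n : Fin N) (j : Fin 2) : ℂ :=
  ((potS x α n (x n) j : ℝ) : ℂ)

lemma aC_eq (x : Fin N → Plane) (α : Fin N → ℝ) (n : Fin N) (j : Fin 2) (y : Plane) :
    aC x α n j y = ((α n / ‖y - x n‖ ^ 2 : ℝ) : ℂ)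
      * (if j = 0 then -(((y - x n) 1 : ℝ) : ℂ) else (((y - x n) 0 : ℝ) : ℂ)) := by
  fin_cases j <;> simp [aC, potA, perp]

lemma contDiffAt_aC (x : Fin N → Plane) (α : Fin N → ℝ) (n : Fin N) (j : Fin 2) {y : Plane}
    (hy : y ≠ x n) : ContDiffAt ℝ 2 (aC x α n j) y := by
  have hn : ‖y - x n‖ ^ 2 ≠ 0 := by
    have := norm_pos_iff.2 (sub_ne_zero.2 hy); positivity
  have hv : ∀ i : Fin 2, ContDiff ℝ 2 fun z : Plane => (((z - x n) i : ℝ) : ℂ) := fun i =>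
    Complex.ofRealCLM.contDiff.comp
      ((EuclideanSpace.proj i : Plane →L[ℝ] ℝ).contDiff.comp (contDiff_id.sub contDiff_const))
  have h0 : ContDiffAt ℝ 2 (fun z : Plane => ((α n / ‖z - x n‖ ^ 2 : ℝ) : ℂ)) y :=
    Complex.ofRealCLM.contDiff.contDiffAt.comp y
      (contDiffAt_const.div ((contDiffAt_id.sub contDiffAt_const).norm_sq ℝ) hn)
  have e : aC x α n j = fun y => ((α n / ‖y - x n‖ ^ 2 : ℝ) : ℂ)
      * (if j = 0 then -(((y - x n) 1 : ℝ) : ℂ) else (((y - x n) 0 : ℝ) : ℂ)) :=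
    funext fun y => aC_eq x α n j y
  rw [e]
  refine h0.mul ?_
  fin_cases j
  · simpa using (hv 1).neg.contDiffAt
  · simpa using (hv 0).contDiffAt

/-- The field is tangential with a modulus depending only on r. In this gauge (-i∇ + A)² has no
zeroth-order divergence term. -/
lemma div_aC (x : Fin N → Plane) (α : Fin N → ℝ) (n : Fin N) {y : Plane} (hy : y ≠ x n) :
    pd 0 (aC x α n 0) y + pd 1 (aC x α n 1) y = 0 := by
  have hn : ‖y - x n‖ ^ 2 ≠ 0 := by
    have := norm_pos_iff.2 (sub_ne_zero.2 hy); positivity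
  have hd : HasDerivAt (fun ρ : ℝ => α n / ρ) (-α n / (‖y - x n‖ ^ 2) ^ 2) (‖y - x n‖ ^ 2) := by
    refine ((hasDerivAt_const (‖y - x n‖ ^ 2) (α n)).div (hasDerivAt_id _) hn).congr_deriv ?_
    simp
  have hr := hasPd_radial hd
  have e0 : aC x α n 0 = fun y => ((α n / ‖y - x n‖ ^ 2 : ℝ) : ℂ) * (-1 * (((y - x n) 1 : ℝ) : ℂ)) :=
    funext fun y => by simp [aC_eq]
  have e1 : aC x α n 1 = fun y => ((α n / ‖y - x n‖ ^ 2 : ℝ) : ℂ) * (((y - x n) 0 : ℝ) : ℂ) :=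
    funext fun y => by simp [aC_eq]
  rw [e0, e1, (hr.mul ((hasPd_sub_coord 1 (x n) y).const_mul (-1))).2 0,
    (hr.mul (hasPd_sub_coord 0 (x n) y)).2 1]
  simp; ring

lemma potS_apply (x : Fin N → Plane) (α : Fin N → ℝ) (n : Fin N) (j : Fin 2) (y : Plane) :
    ((potS x α n y j : ℝ) : ℂ) = ∑ m ∈ Finset.univ.erase n, aC x α m j y := by
  simp [potS, aC, WithLp.ofLp_sum]

lemma sC_eq (x : Fin N → Plane) (α : Fin N → ℝ) (n : Fin N) (j : Fin 2) (y : Plane) :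
    sC x α n j y = ∑ m ∈ Finset.univ.erase n, aC x α m j y - sC0 x α n j := by
  rw [← potS_apply, sC, sC0, potSCheck]; simp

lemma potTotal_apply (x : Fin N → Plane) (α : Fin N → ℝ) (n : Fin N) (j : Fin 2) (y : Plane) :
    ((potTotal x α y j : ℝ) : ℂ) = aC x α n j y + sC0 x α n j + sC x α n j y := by
  have h : ((potTotal x α y j : ℝ) : ℂ) = ∑ m, aC x α m j y := by
    simp [potTotal, aC, WithLp.ofLp_sum]
  rw [h, sC_eq, ← Finset.add_sum_erase _ _ (Finset.mem_univ n)]; ring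

lemma contDiffAt_sC (x : Fin N → Plane) (α : Fin N → ℝ) (n : Fin N) (j : Fin 2) {y : Plane}
    (hy : ∀ m, m ≠ n → y ≠ x m) : ContDiffAt ℝ 2 (sC x α n j) y := by
  have e : sC x α n j = fun y => ∑ m ∈ Finset.univ.erase n, aC x α m j y - sC0 x α n j :=
    funext fun y => sC_eq x α n j y
  rw [e]
  exact (ContDiffAt.sum fun m hm => contDiffAt_aC x α m j
    (hy m (Finset.ne_of_mem_erase hm))).sub contDiffAt_const

lemma div_sC (x : Fin N → Plane) (α : Fin N → ℝ) (n : Fin N) {y : Plane}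
    (hy : ∀ m, m ≠ n → y ≠ x m) : pd 0 (sC x α n 0) y + pd 1 (sC x α n 1) y = 0 := by
  have e : ∀ j, sC x α n j = fun y => ∑ m ∈ Finset.univ.erase n, aC x α m j y - sC0 x α n j :=
    fun j => funext fun y => sC_eq x α n j y
  have h : ∀ j, pd j (sC x α n j) y = ∑ m ∈ Finset.univ.erase n, pd j (aC x α m j) y := by
    intro j
    rw [e j, ((HasPd.sum (s := Finset.univ.erase n) fun m hm => hasPd_pd
      ((contDiffAt_aC x α m j (hy m (Finset.ne_of_mem_erase hm))).differentiableAt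
        (by norm_num))).sub (hasPd_const _ y)).2 j]
    simp
  rw [h, h, ← Finset.sum_add_distrib]
  exact Finset.sum_eq_zero fun m hm => div_aC x α m (hy m (Finset.ne_of_mem_erase hm))

lemma sC_self (x : Fin N → Plane) (α : Fin N → ℝ) (n : Fin N) (j : Fin 2) :
    sC x α n j (x n) = 0 := by simp [sC, potSCheck]

/-! ### The phase -/

lemma phase_eq (x : Fin N → Plane) (α : Fin N → ℝ) (n : Fin N) (y : Plane) :
    phase x α n y = Complex.exp (-Complex.I * (sC0 x α n 0 * (((y - x n) 0 : ℝ) : ℂ)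
      + sC0 x α n 1 * (((y - x n) 1 : ℝ) : ℂ))) := by
  rw [phase, sC0, sC0, PiLp.inner_apply, Fin.sum_univ_two]
  simp [mul_comm]

lemma contDiff_phase (x : Fin N → Plane) (α : Fin N → ℝ) (n : Fin N) :
    ContDiff ℝ ∞ (phase x α n) := by
  unfold phase
  have h : ContDiff ℝ ∞ fun y : Plane => inner ℝ (potS x α n (x n)) (y - x n) :=
    contDiff_const.inner ℝ (contDiff_id.sub contDiff_const)
  exact (contDiff_const.mul (Complex.ofRealCLM.contDiff.comp h)).cexp

/-- The phase gauges away the constant vector S_n(x_n): (-i∇ + S_n(x_n))(u f) = u(-i∇f). Only Š_n,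
which vanishes at x_n, is left to act on the singular function. -/
lemma hasPd_phase (x : Fin N → Plane) (α : Fin N → ℝ) (n : Fin N) (y : Plane) :
    HasPd (phase x α n) (fun j => -Complex.I * sC0 x α n j * phase x α n y) y := by
  have h1 := (((hasPd_sub_coord 0 (x n) y).const_mul (sC0 x α n 0)).add
    ((hasPd_sub_coord 1 (x n) y).const_mul (sC0 x α n 1))).const_mul (-Complex.I)
  have h2 := h1.1.hasFDerivAt.cexp
  refine ((HasFDerivAt.hasPd h2).congr_of_eventuallyEq
    (.of_forall fun z => phase_eq x α n z)).congr fun j => ?_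
  have h3 := h1.2 j
  rw [pd] at h3
  simp only [smul_apply, h3, smul_eq_mul, phase_eq]
  fin_cases j <;> simp <;> ring

lemma norm_phase (x : Fin N → Plane) (α : Fin N → ℝ) (n : Fin N) (y : Plane) :
    ‖phase x α n y‖ = 1 := by
  rw [phase, show -Complex.I * ((inner ℝ (potS x α n (x n)) (y - x n) : ℝ) : ℂ)
    = ((-inner ℝ (potS x α n (x n)) (y - x n) : ℝ) : ℂ) * Complex.I by push_cast; ring]
  exact Complex.norm_exp_ofReal_mul_I _

lemma conj_phase_mul (x : Fin N → Plane) (α : Fin N → ℝ) (n : Fin N) (y : Plane) :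
    conj (phase x α n y) * phase x α n y = 1 := by
  rw [← Complex.normSq_eq_conj_mul_self, Complex.normSq_eq_norm_sq, norm_phase]; simp

/-! ### Pointwise identities -/

/-- The components of `(-i∇ + A_n) G`. -/
def eC (x : Fin N → Plane) (α : Fin N → ℝ) (lam : ℝ) (n : Fin N) (l j : Fin 2) (y : Plane) : ℂ :=
  -Complex.I * pd j (defectG x α lam n l) y + aC x α n j y * defectG x α lam n l y

/-- The components of `Š_n ξ_n - i ∇ξ_n`. -/
def wC (x : Fin N → Plane) (α : Fin N → ℝ) (ξ : Fin N → Plane → ℝ) (n : Fin N) (j : Fin 2)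
    (y : Plane) : ℂ := xiC ξ n y * sC x α n j y - Complex.I * pd j (xiC ξ n) y

/-- One summand of the singular part with unit charge. -/
def sing (x : Fin N → Plane) (α : Fin N → ℝ) (ξ : Fin N → Plane → ℝ) (lam : ℝ) (n : Fin N)
    (l : Fin 2) (y : Plane) : ℂ := phase x α n y * (xiC ξ n y * defectG x α lam n l y)

lemma fieldW_apply {x : Fin N → Plane} (α : Fin N → ℝ) {ξ : Fin N → Plane → ℝ}
    (h : IsCutoff x ξ) (n : Fin N) (j : Fin 2) (y : Plane) :
    fieldW x α ξ n y j = wC x α ξ n j y := by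
  simp [fieldW, wC, toCVec, gradient_xi h, xiC, sC]

lemma zeta1_apply {x : Fin N → Plane} (α : Fin N → ℝ) {ξ : Fin N → Plane → ℝ}
    (h : IsCutoff x ξ) (n : Fin N) (j : Fin 2) (y : Plane) :
    zeta1 x α ξ n y j = phase x α n y * wC x α ξ n j y := by
  simp [zeta1, ← fieldW_apply α h]

lemma zeta2_eq {x : Fin N → Plane} (α : Fin N → ℝ) {ξ : Fin N → Plane → ℝ}
    (h : IsCutoff x ξ) (n : Fin N) (y : Plane) :
    zeta2 x α ξ n y = phase x α n y *
      ((sC x α n 0 y ^ 2 + sC x α n 1 y ^ 2) * xiC ξ n y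
        + 2 * (sC0 x α n 0 * wC x α ξ n 0 y + sC0 x α n 1 * wC x α ξ n 1 y)
        + (pd 0 (pd 0 (xiC ξ n)) y + pd 1 (pd 1 (xiC ξ n)) y)) := by
  simp only [zeta2, Fin.sum_univ_two, fieldW_apply α h, laplacian_xi h]
  rw [Complex.ofReal_mul, norm_sq_plane_complex]
  rfl

lemma magField_apply (a : Plane → Plane) (f : Plane → ℂ) (g : Plane → CVec) (y : Plane)
    (j : Fin 2) : magField a f g y j = -(Complex.I * g y j) + f y * ((a y j : ℝ) : ℂ) := by
  simp [magField, toCVec]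

/-- The density of `2⟨(-i∇ + A_n) f | ζ₁ G⟩ + ⟨f | ζ₂ G⟩` with classical derivatives. -/
def crossDens (x : Fin N → Plane) (α : Fin N → ℝ) (ξ : Fin N → Plane → ℝ) (lam : ℝ)
    (f : Plane → ℂ) (n : Fin N) (l : Fin 2) (y : Plane) : ℂ :=
  2 * ∑ j, conj (magField (potA x α n) f (cGrad f) y j)
      * (defectG x α lam n l y * zeta1 x α ξ n y j)
    + conj (f y) * (zeta2 x α ξ n y * defectG x α lam n l y)

/-- The field whose divergence compares the energy density with `crossDens`. -/
def crossField (x : Fin N → Plane) (α : Fin N → ℝ) (ξ : Fin N → Plane → ℝ) (lam : ℝ)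
    (f : Plane → ℂ) (n : Fin N) (l j : Fin 2) (y : Plane) : ℂ :=
  Complex.I * (conj (f y) * (phase x α n y * (xiC ξ n y * eC x α lam n l j y
    - wC x α ξ n j y * defectG x α lam n l y)))

section atoms

variable {x : Fin N → Plane} (α : Fin N → ℝ) {ξ : Fin N → Plane → ℝ} {lam : ℝ} (n : Fin N)
  (l : Fin 2) {y : Plane}

lemma hasPd_aC (hy : y ≠ x n) (j : Fin 2) :
    HasPd (aC x α n j) (fun i => pd i (aC x α n j) y) y :=
  hasPd_pd ((contDiffAt_aC x α n j hy).differentiableAt (by norm_num))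

lemma hasPd_sC (hy : ∀ m, m ≠ n → y ≠ x m) (j : Fin 2) :
    HasPd (sC x α n j) (fun i => pd i (sC x α n j) y) y :=
  hasPd_pd ((contDiffAt_sC x α n j hy).differentiableAt (by norm_num))

lemma hasPd_G (hlam : 0 < lam) (hy : y ≠ x n) :
    HasPd (defectG x α lam n l) (fun j => pd j (defectG x α lam n l) y) y :=
  hasPd_pd ((contDiffAt_defectG x α hlam n l hy).differentiableAt (by norm_num))

lemma contDiffAt_pd_G (hlam : 0 < lam) (hy : y ≠ x n) (j : Fin 2) :
    ContDiffAt ℝ 1 (pd j (defectG x α lam n l)) y :=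
  contDiffAt_pd (m := 1) (contDiffAt_defectG x α hlam n l hy) (by norm_num) j

lemma hasPd_pd_G (hlam : 0 < lam) (hy : y ≠ x n) (j : Fin 2) :
    HasPd (pd j (defectG x α lam n l)) (fun i => pd i (pd j (defectG x α lam n l)) y) y :=
  hasPd_pd ((contDiffAt_pd_G α n l hlam hy j).differentiableAt (by norm_num))

lemma hasPd_eC (hlam : 0 < lam) (hy : y ≠ x n) (j : Fin 2) :
    HasPd (eC x α lam n l j) (fun i => -Complex.I * pd i (pd j (defectG x α lam n l)) y
      + (pd i (aC x α n j) y * defectG x α lam n l y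
        + aC x α n j y * pd i (defectG x α lam n l) y)) y :=
  ((hasPd_pd_G α n l hlam hy j).const_mul _).add ((hasPd_aC α n hy j).mul (hasPd_G α n l hlam hy))

lemma hasPd_wC (h : IsCutoff x ξ) (hy : ∀ m, m ≠ n → y ≠ x m) (j : Fin 2) :
    HasPd (wC x α ξ n j) (fun i => (pd i (xiC ξ n) y * sC x α n j y
      + xiC ξ n y * pd i (sC x α n j) y) - Complex.I * pd i (pd j (xiC ξ n)) y) y :=
  ((hasPd_xiC h n y).mul (hasPd_sC α n hy j)).sub ((hasPd_pd_xiC h n j y).const_mul _)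

lemma hasPd_sing (h : IsCutoff x ξ) (hlam : 0 < lam) (hy : y ≠ x n) :
    HasPd (sing x α ξ lam n l) (fun j => -Complex.I * sC0 x α n j * phase x α n y
      * (xiC ξ n y * defectG x α lam n l y) + phase x α n y * (pd j (xiC ξ n) y
        * defectG x α lam n l y + xiC ξ n y * pd j (defectG x α lam n l) y)) y :=
  (hasPd_phase x α n y).mul ((hasPd_xiC h n y).mul (hasPd_G α n l hlam hy))

/-- With E = (-i∇ + A_n)G and W = Šξ - i∇ξ one has D(uξG) = u(ξE + WG). Integrating by parts against
conj f yields the flux of u(ξE + WG), while the factor 2 in the cross density yields twice the flux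
of uWG. The net field is u(ξE - WG), that of `crossField`, and the remaining terms match by the
equation for G. -/
lemma energy_sub_crossDens (h : IsCutoff x ξ) (hlam : 0 < lam) (hy : ∀ m, y ≠ x m)
    {f : Plane → ℂ} (hf : DifferentiableAt ℝ f y) :
    ∑ j, conj (magField (potTotal x α) f (cGrad f) y j)
        * magField (potTotal x α) (sing x α ξ lam n l) (cGrad (sing x α ξ lam n l)) y j
      + (lam : ℂ) ^ 2 * (conj (f y) * sing x α ξ lam n l y) - crossDens x α ξ lam f n l y
      = ∑ j, pd j (crossField x α ξ lam f n l j) y := by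
  -- The derivative is assembled by unification from the product rules, without writing it out.
  have hV : ∀ j, pd j (crossField x α ξ lam f n l j) y = _ := fun j =>
    (((hasPd_pd hf).conj.mul ((hasPd_phase x α n y).mul (((hasPd_xiC h n y).mul
      (hasPd_eC α n l hlam (hy n) j)).sub ((hasPd_wC α n h (fun m _ => hy m) j).mul
        (hasPd_G α n l hlam (hy n)))))).const_mul Complex.I).2 j
  have hode := defectG_ode x α hlam n l (hy n)
  have ha := div_aC x α n (hy n)
  have hs := div_sC x α n (fun m _ => hy m)
  simp only [hV, crossDens, magField_apply, cGrad_apply, potTotal_apply x α n,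
    (hasPd_sing α n l h hlam (hy n)).2, zeta1_apply α h, zeta2_eq α h, map_add, map_neg, map_mul,
    Complex.conj_I, Complex.conj_ofReal, Fin.sum_univ_two]
  have ea : ∀ j, ((potA x α n y j : ℝ) : ℂ) = aC x α n j y := fun _ => rfl
  have ca : ∀ j, conj (aC x α n j y) = aC x α n j y := fun _ => Complex.conj_ofReal _
  have cs : ∀ j, conj (sC x α n j y) = sC x α n j y := fun _ => Complex.conj_ofReal _
  have cs0 : ∀ j, conj (sC0 x α n j) = sC0 x α n j := fun _ => Complex.conj_ofReal _
  simp only [Fin.sum_univ_two, ea] at hode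
  simp only [ea, ca, cs, cs0, sing, eC, wC]
  have hI := Complex.I_sq
  -- What is left is a polynomial identity modulo i² = -1, the equation for G and the vanishing
  -- divergences of A_n and Š_n.
  grind

/-- The field whose divergence relates `crossDens` at a singular function to `Ξ`. -/
def xiField (x : Fin N → Plane) (α : Fin N → ℝ) (ξ : Fin N → Plane → ℝ) (lam : ℝ) (n : Fin N)
    (l l' j : Fin 2) (y : Plane) : ℂ :=
  xiC ξ n y * ((2 * Complex.I) * (sC x α n j y * (xiC ξ n y
      * (conj (defectG x α lam n l y) * defectG x α lam n l' y)))
    + pd j (xiC ξ n) y * (conj (defectG x α lam n l y) * defectG x α lam n l' y)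
    - (1 / 2 * Complex.I) * (xiC ξ n y * (conj (defectG x α lam n l y) * eC x α lam n l' j y
      + defectG x α lam n l' y * conj (eC x α lam n l j y))))

/-- The cross density contains Δξ and one-sided derivatives, whereas Ξ contains only |∇ξ|² and terms
with Š. Both equations, for G_ℓ' and for the conjugate of G_ℓ, enter; they share the same real
eigenvalue, so the λ² terms cancel and the discrepancy is a divergence. The phases drop out because
conj(u) u = 1. -/
lemma crossDens_sing_sub (h : IsCutoff x ξ) (hlam : 0 < lam) (hy : ∀ m, y ≠ x m) (l' : Fin 2) :
    crossDens x α ξ lam (sing x α ξ lam n l) n l' y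
      - (xi1 x α ξ lam n l l' y + 2 * xi2 x α ξ lam n l l' y)
      = ∑ j, pd j (xiField x α ξ lam n l l' j) y := by
  have hG := fun l => hasPd_G α n l hlam (hy n)
  have hV : ∀ j, pd j (xiField x α ξ lam n l l' j) y = _ := fun j =>
    ((hasPd_xiC h n y).mul (((((hasPd_sC α n (fun m _ => hy m) j).mul ((hasPd_xiC h n y).mul
      ((hG l).conj.mul (hG l')))).const_mul (2 * Complex.I)).add
      ((hasPd_pd_xiC h n j y).mul ((hG l).conj.mul (hG l')))).sub
      (((hasPd_xiC h n y).mul (((hG l).conj.mul (hasPd_eC α n l' hlam (hy n) j)).add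
        ((hG l').mul (hasPd_eC α n l hlam (hy n) j).conj))).const_mul (1 / 2 * Complex.I)))).2 j
  have hode := defectG_ode x α hlam n l' (hy n)
  have hode2 := congrArg conj (defectG_ode x α hlam n l (hy n))
  have ha := div_aC x α n (hy n)
  have ha2 := congrArg conj (div_aC x α n (hy n))
  have hs := div_sC x α n (fun m _ => hy m)
  have hu := conj_phase_mul x α n y
  have ea : ∀ j, ((potA x α n y j : ℝ) : ℂ) = aC x α n j y := fun _ => rfl
  have es : ∀ j, ((potSCheck x α n y j : ℝ) : ℂ) = sC x α n j y := fun _ => rfl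
  have ex : (fun w => (ξ n w : ℂ) * defectG x α lam n l' w)
      = fun w => xiC ξ n w * defectG x α lam n l' w := rfl
  have ex0 : (ξ n y : ℂ) = xiC ξ n y := rfl
  have ca : ∀ j, conj (aC x α n j y) = aC x α n j y := fun _ => Complex.conj_ofReal _
  have cs0 : ∀ j, conj (sC0 x α n j) = sC0 x α n j := fun _ => Complex.conj_ofReal _
  have cx : conj (xiC ξ n y) = xiC ξ n y := Complex.conj_ofReal _
  have cdx : ∀ j, conj (pd j (xiC ξ n) y) = pd j (xiC ξ n) y := fun j => by
    rw [pd_xiC h]; exact Complex.conj_ofReal _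
  have hin : ((inner ℝ (potSCheck x α n y) (potA x α n y) : ℝ) : ℂ)
      = sC x α n 0 y * aC x α n 0 y + sC x α n 1 y * aC x α n 1 y := by
    rw [PiLp.inner_apply, Fin.sum_univ_two]
    simp [sC, aC, mul_comm]
  have hns := norm_sq_plane_complex (potSCheck x α n y)
  have hng := norm_sq_gradient_xi h n y
  simp only [es] at hns
  push_cast at hns hng
  simp only [Fin.sum_univ_two, ea, map_add, map_neg, map_mul, map_sub, map_pow, Complex.conj_I,
    Complex.conj_ofReal, map_ofNat, ca, map_zero] at hode hode2 ha2
  simp only [hV, crossDens, xi1, xi2, magField_apply, cGrad_apply, ex, ex0, es,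
    ((hasPd_xiC h n y).mul (hG l')).2,
    (hasPd_sing α n l h hlam (hy n)).2, zeta1_apply α h, zeta2_eq α h, map_add, map_neg, map_mul,
    Complex.conj_I, Complex.conj_ofReal, Fin.sum_univ_two]
  push_cast
  simp only [ea, ca, cs0, cx, cdx, sing, eC, wC, hin, hns, hng, ex0, map_add, map_neg, map_mul,
    Complex.conj_I]
  have hI := Complex.I_sq
  clear hV hG ex ea es ca cs0 cx cdx hin hns hng
  -- From here on the only fact about the conjugate phase is that its product with the phase is 1.
  generalize conj (phase x α n y) = w at *
  grind

end atoms

/-! ### Uniform power bounds near a point -/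

/-- A family of functions bounded by a multiple of `‖y - c‖ ^ (-β)` on a punctured ball. -/
def UB {ι : Type*} (c : Plane) (R β : ℝ) (f : ι → Plane → ℂ) : Prop :=
  ∃ C, 0 ≤ C ∧ ∀ i, ∀ y ∈ Metric.ball c R, y ≠ c → ‖f i y‖ ≤ C * ‖y - c‖ ^ (-β)

namespace UB

variable {ι : Type*} {c : Plane} {R β γ : ℝ} {f g : ι → Plane → ℂ}

lemma mul (hf : UB c R β f) (hg : UB c R γ g) : UB c R (β + γ) (fun i y => f i y * g i y) := by
  obtain ⟨C, hC, h⟩ := hf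
  obtain ⟨D, hD, h'⟩ := hg
  refine ⟨C * D, mul_nonneg hC hD, fun i y hy hyc => ?_⟩
  have hr : 0 < ‖y - c‖ := norm_pos_iff.2 (sub_ne_zero.2 hyc)
  calc ‖f i y * g i y‖ = ‖f i y‖ * ‖g i y‖ := norm_mul _ _
    _ ≤ (C * ‖y - c‖ ^ (-β)) * (D * ‖y - c‖ ^ (-γ)) :=
        mul_le_mul (h i y hy hyc) (h' i y hy hyc) (norm_nonneg _) (by positivity)
    _ = C * D * ‖y - c‖ ^ (-(β + γ)) := by
        rw [neg_add, Real.rpow_add hr]; ring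

lemma add (hf : UB c R β f) (hg : UB c R β g) : UB c R β (fun i y => f i y + g i y) := by
  obtain ⟨C, hC, h⟩ := hf
  obtain ⟨D, hD, h'⟩ := hg
  refine ⟨C + D, add_nonneg hC hD, fun i y hy hyc => ?_⟩
  rw [add_mul]
  exact (norm_add_le _ _).trans (add_le_add (h i y hy hyc) (h' i y hy hyc))

lemma congr_norm (hf : UB c R β f)
    (h : ∀ i, ∀ y ∈ Metric.ball c R, y ≠ c → ‖g i y‖ ≤ ‖f i y‖) : UB c R β g := by
  obtain ⟨C, hC, h'⟩ := hf
  exact ⟨C, hC, fun i y hy hyc => (h i y hy hyc).trans (h' i y hy hyc)⟩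

lemma neg (hf : UB c R β f) : UB c R β (fun i y => -f i y) :=
  hf.congr_norm fun _ _ _ _ => by rw [norm_neg]

lemma star (hf : UB c R β f) : UB c R β (fun i y => (starRingEnd ℂ) (f i y)) :=
  hf.congr_norm fun _ _ _ _ => by rw [RCLike.norm_conj]

lemma sub (hf : UB c R β f) (hg : UB c R β g) : UB c R β (fun i y => f i y - g i y) := by
  simpa [sub_eq_add_neg] using hf.add hg.neg

lemma const (k : ℂ) : UB c R 0 (fun (_ : ι) _ => k) :=
  ⟨‖k‖, norm_nonneg _, fun _ _ _ _ => by simp⟩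

/-- On a bounded ball a stronger singularity dominates a weaker one up to R^(γ-β). This brings
summands of different orders to a common exponent. -/
lemma weaken (hf : UB c R β f) (h : β ≤ γ) : UB c R γ f := by
  obtain ⟨C, hC, h'⟩ := hf
  by_cases hR : 0 < R
  · refine ⟨C * R ^ (γ - β), by positivity, fun i y hy hyc => (h' i y hy hyc).trans ?_⟩
    have hr : 0 < ‖y - c‖ := norm_pos_iff.2 (sub_ne_zero.2 hyc)
    have hrR : ‖y - c‖ ≤ R := by
      rw [Metric.mem_ball, dist_eq_norm] at hy; exact hy.le
    rw [mul_assoc]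
    refine mul_le_mul_of_nonneg_left ?_ hC
    calc ‖y - c‖ ^ (-β) = ‖y - c‖ ^ (γ - β) * ‖y - c‖ ^ (-γ) := by
          rw [← Real.rpow_add hr]; ring_nf
      _ ≤ R ^ (γ - β) * ‖y - c‖ ^ (-γ) := by
          gcongr
  · refine ⟨C, hC, fun i y hy => ?_⟩
    rw [Metric.ball_eq_empty.2 (not_lt.1 hR)] at hy; exact hy.elim

lemma const_mul (k : ℂ) (hf : UB c R β f) : UB c R β (fun i y => k * f i y) := by
  simpa using (const (ι := ι) k).mul hf

lemma exists_le_radPow (hf : UB c R β f) (h0 : ∀ i y, y ∉ Metric.ball c R → f i y = 0) :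
    ∃ C, 0 ≤ C ∧ ∀ i y, y ≠ c → ‖f i y‖ ≤ C * radPow c R β y := by
  obtain ⟨C, hC, h'⟩ := hf
  refine ⟨C, hC, fun i y hyc => ?_⟩
  by_cases hy : y ∈ Metric.ball c R
  · simpa [radPow, indicator_of_mem hy] using h' i y hy hyc
  · simp [h0 i y hy, radPow, indicator_of_notMem hy]

end UB

lemma ae_forall_ne (x : Fin N → Plane) : ∀ᵐ y ∂(volume : Measure Plane), ∀ m, y ≠ x m :=
  ae_all_iff.2 fun m => compl_mem_ae_iff.2 (measure_singleton (x m))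

lemma aestronglyMeasurable_of_continuousAt {E : Type*} [TopologicalSpace E]
    [TopologicalSpace.PseudoMetrizableSpace E] (x : Fin N → Plane)
    {f : Plane → E} (hf : ∀ y, (∀ m, y ≠ x m) → ContinuousAt f y) :
    AEStronglyMeasurable f (volume : Measure Plane) := by
  have hm : MeasurableSet (range x)ᶜ := (finite_range x).measurableSet.compl
  have h1 : ContinuousOn f (range x)ᶜ := fun y hy =>
    (hf y fun m h => hy ⟨m, h.symm⟩).continuousWithinAt
  have h2 := h1.aestronglyMeasurable (μ := (volume : Measure Plane)) hm
  rwa [Measure.restrict_eq_self_of_ae_mem] at h2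
  filter_upwards [ae_forall_ne x] with y hy
  rintro ⟨m, rfl⟩
  exact hy m rfl

section atoms

variable {ι : Type*} (x : Fin N → Plane) (α : Fin N → ℝ) {ξ : Fin N → Plane → ℝ} (n : Fin N)

lemma IsCutoff.exists_radius' {x : Fin N → Plane} {ξ : Fin N → Plane → ℝ} (h : IsCutoff x ξ)
    (n : Fin N) : ∃ R, 0 < R ∧ tsupport (ξ n) ⊆ Metric.ball (x n) R ∧
      (∀ y, ‖y - x n‖ < R / 2 → ξ n y = 1) ∧ ∀ m, m ≠ n → x m ∉ Metric.closedBall (x n) R := by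
  obtain ⟨r, hr0, hr1, hr⟩ := h.2.1
  refine ⟨r, hr0, (hr n).1, fun y hy => (hr n).2 y (by rwa [Metric.mem_ball, dist_eq_norm]),
    fun m hm hmem => ?_⟩
  have := Metric.mem_closedBall.1 hmem
  linarith [hr1 m n hm, dist_nonneg (x := x m) (y := x n)]

variable {x} in
/-- A radius adapted to the `n`-th point and to a cut-off function. -/
structure IsRadius (x : Fin N → Plane) (n : Fin N) (R : ℝ) : Prop where
  pos : 0 < R
  avoid : ∀ m, m ≠ n → x m ∉ Metric.closedBall (x n) R

variable {x n} {R : ℝ}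

lemma IsRadius.ne (hR : IsRadius x n R) {m : Fin N} (hm : m ≠ n) {y : Plane}
    (hy : y ∈ Metric.closedBall (x n) R) : y ≠ x m := by
  rintro rfl; exact hR.avoid m hm hy

-- The family is indexed by the spectral parameter itself, so every estimate derived through `UB` is
-- automatically uniform in λ, as coercivity demands.
variable (n) in
lemma ub_G (l : Fin 2) (hα : α n ∈ Ioo (0 : ℝ) 1) (R : ℝ) :
    UB (x n) R (nu α n l) (fun lam : Ioi (0 : ℝ) => defectG x α lam n l) := by
  obtain ⟨C, hC, h⟩ := exists_defectG_bound x α n l hα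
  exact ⟨C, hC.le, fun lam y _ hyc => (h lam lam.2 y hyc).1⟩

variable (n) in
lemma ub_pd_G (l j : Fin 2) (hα : α n ∈ Ioo (0 : ℝ) 1) (R : ℝ) :
    UB (x n) R (nu α n l + 1) (fun lam : Ioi (0 : ℝ) => pd j (defectG x α lam n l)) := by
  obtain ⟨C, hC, h⟩ := exists_defectG_bound x α n l hα
  refine ⟨C, hC.le, fun lam y _ hyc => ?_⟩
  rw [neg_add]
  exact (h lam lam.2 y hyc).2 j

variable (x n) in
lemma ub_aC (j : Fin 2) (R : ℝ) : UB (x n) R 1 (fun _ : ι => aC x α n j) := by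
  refine ⟨|α n|, abs_nonneg _, fun _ y _ hyc => ?_⟩
  have hr : 0 < ‖y - x n‖ := norm_pos_iff.2 (sub_ne_zero.2 hyc)
  have h : ‖if j = 0 then -(((y - x n) 1 : ℝ) : ℂ) else (((y - x n) 0 : ℝ) : ℂ)‖ ≤ ‖y - x n‖ := by
    split_ifs
    · rw [norm_neg, Complex.norm_real]; exact abs_coord_le _ _
    · rw [Complex.norm_real]; exact abs_coord_le _ _
  change ‖aC x α n j y‖ ≤ _
  rw [aC_eq, norm_mul, Complex.norm_real, Real.norm_eq_abs, abs_div,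
    abs_of_nonneg (sq_nonneg ‖y - x n‖), Real.rpow_neg_one]
  calc |α n| / ‖y - x n‖ ^ 2 * _ ≤ |α n| / ‖y - x n‖ ^ 2 * ‖y - x n‖ := by gcongr
    _ = |α n| * ‖y - x n‖⁻¹ := by field_simp

/-- A C¹ function vanishing at the centre is O(r) by the mean value inequality; the exponent -1
records this gain. -/
lemma ub_of_contDiffAt (hR : 0 < R) {f : Plane → ℂ}
    (hf : ∀ y ∈ Metric.closedBall (x n) R, ContDiffAt ℝ 1 f y) (h0 : f (x n) = 0) :
    UB (x n) R (-1) (fun _ : ι => f) := by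
  obtain ⟨C, hC⟩ := (isCompact_closedBall (x n) R).exists_bound_of_continuousOn
    (f := fderiv ℝ f) fun y hy =>
      ((hf y hy).fderiv_right (m := 0) (by norm_num)).continuousAt.continuousWithinAt
  have hC0 : 0 ≤ C := (norm_nonneg _).trans (hC (x n) (Metric.mem_closedBall_self hR.le))
  refine ⟨C, hC0, fun _ y hy _ => ?_⟩
  have := (convex_closedBall (x n) R).norm_image_sub_le_of_norm_fderiv_le (𝕜 := ℝ) (C := C)
    (fun z hz => (hf z hz).differentiableAt (by norm_num)) hC
    (Metric.mem_closedBall_self hR.le) (Metric.ball_subset_closedBall hy)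
  simpa [h0] using this

lemma ub_of_continuousOn {f : Plane → ℂ}
    (hf : ∀ y ∈ Metric.closedBall (x n) R, ContinuousAt f y) :
    UB (x n) R 0 (fun _ : ι => f) := by
  obtain ⟨C, hC⟩ := (isCompact_closedBall (x n) R).exists_bound_of_continuousOn
    (f := f) fun y hy => (hf y hy).continuousWithinAt
  refine ⟨max C 0, le_max_right _ _, fun _ y hy _ => ?_⟩
  simpa using Or.inl (hC y (Metric.ball_subset_closedBall hy))

lemma ub_sC (hR : IsRadius x n R) (j : Fin 2) : UB (x n) R (-1) (fun _ : ι => sC x α n j) :=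
  ub_of_contDiffAt hR.pos (fun _ hy => (contDiffAt_sC x α n j fun _ hm => hR.ne hm hy).of_le
    (by norm_num)) (sC_self x α n j)

lemma ub_phase : UB (x n) R 0 (fun _ : ι => phase x α n) :=
  ⟨1, zero_le_one, fun _ y _ _ => by rw [norm_phase]; simp⟩

lemma ub_xiC (h : IsCutoff x ξ) : UB (x n) R 0 (fun _ : ι => xiC ξ n) :=
  ub_of_continuousOn fun _ _ => (contDiff_xiC h n).continuous.continuousAt

lemma pd_xiC_self (h : IsCutoff x ξ) (n : Fin N) (j : Fin 2) : pd j (xiC ξ n) (x n) = 0 := by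
  obtain ⟨r, hr0, _, hr⟩ := h.exists_radius n
  have : xiC ξ n =ᶠ[𝓝 (x n)] fun _ => 1 := by
    filter_upwards [Metric.ball_mem_nhds (x n) (half_pos hr0)] with y hy
    rw [Metric.mem_ball, dist_eq_norm] at hy
    simp [xiC, hr y hy]
  rw [pd, this.fderiv_eq]; simp

lemma contDiff_pd_xiC (h : IsCutoff x ξ) (n : Fin N) (j : Fin 2) :
    ContDiff ℝ 1 (pd j (xiC ξ n)) :=
  contDiff_iff_contDiffAt.2 fun _ =>
    contDiffAt_pd (m := 1) (contDiff_xiC h n).contDiffAt (by norm_num) j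

lemma continuous_pd_pd_xiC (h : IsCutoff x ξ) (n : Fin N) (i j : Fin 2) :
    Continuous (pd i (pd j (xiC ξ n))) :=
  continuous_iff_continuousAt.2 fun _ =>
    (contDiffAt_pd (m := 0) (contDiff_pd_xiC h n j).contDiffAt (by norm_num) i).continuousAt

lemma ub_pd_xiC (hR : 0 < R) (h : IsCutoff x ξ) (j : Fin 2) :
    UB (x n) R (-1) (fun _ : ι => pd j (xiC ξ n)) :=
  ub_of_contDiffAt hR (fun _ _ => (contDiff_pd_xiC h n j).contDiffAt) (pd_xiC_self h n j)

lemma ub_pd_pd_xiC (h : IsCutoff x ξ) (i j : Fin 2) :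
    UB (x n) R 0 (fun _ : ι => pd i (pd j (xiC ξ n))) :=
  ub_of_continuousOn fun _ _ => (continuous_pd_pd_xiC h n i j).continuousAt

/-- Both Š_n and ∇ξ_n vanish at x_n. The resulting power of r compensates one derivative of G in all
later estimates. -/
lemma ub_wC (hR : IsRadius x n R) (h : IsCutoff x ξ) (j : Fin 2) :
    UB (x n) R (-1) (fun _ : ι => wC x α ξ n j) := by
  unfold wC
  refine UB.sub ?_ ((ub_pd_xiC hR.pos h j).const_mul _)
  simpa using (ub_xiC h).mul (ub_sC α hR j)

end atoms

/-! ### Supports -/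

lemma xiC_eq_zero {ξ : Fin N → Plane → ℝ} {n : Fin N} {y : Plane} (hy : y ∉ tsupport (ξ n)) :
    xiC ξ n y = 0 := by simp [xiC, image_eq_zero_of_notMem_tsupport hy]

lemma pd_xiC_eq_zero {ξ : Fin N → Plane → ℝ} {n : Fin N} {y : Plane} (hy : y ∉ tsupport (ξ n))
    (j : Fin 2) : pd j (xiC ξ n) y = 0 :=
  pd_eq_zero_of_notMem (by rwa [tsupport_xiC]) j

lemma pd_pd_xiC_eq_zero {ξ : Fin N → Plane → ℝ} {n : Fin N} {y : Plane}
    (hy : y ∉ tsupport (ξ n)) (i j : Fin 2) : pd i (pd j (xiC ξ n)) y = 0 := by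
  refine pd_eq_zero_of_notMem (fun h => hy ?_) i
  rw [← tsupport_xiC]
  exact closure_minimal (fun z hz => by
    by_contra h'; exact hz (pd_eq_zero_of_notMem h' j)) (isClosed_tsupport _) h

lemma wC_eq_zero {x : Fin N → Plane} (α : Fin N → ℝ) {ξ : Fin N → Plane → ℝ} {n : Fin N}
    {y : Plane} (hy : y ∉ tsupport (ξ n)) (j : Fin 2) : wC x α ξ n j y = 0 := by
  simp [wC, xiC_eq_zero hy, pd_xiC_eq_zero hy]

lemma sing_eq_zero {x : Fin N → Plane} (α : Fin N → ℝ) {ξ : Fin N → Plane → ℝ} (lam : ℝ)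
    {n : Fin N} (l : Fin 2) {y : Plane} (hy : y ∉ tsupport (ξ n)) :
    sing x α ξ lam n l y = 0 := by simp [sing, xiC_eq_zero hy]

/-! ### The representing functions of the cross terms -/

/-- The vector field representing `φ ↦ 2⟨(-i∇ + A_n) φ | ζ₁ G⟩ + ⟨φ | ζ₂ G⟩` against the
magnetic gradient. -/
def aVec (x : Fin N → Plane) (α : Fin N → ℝ) (ξ : Fin N → Plane → ℝ) (lam : ℝ) (n : Fin N)
    (l : Fin 2) (y : Plane) : CVec := (2 * defectG x α lam n l y) • zeta1 x α ξ n y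

/-- The function representing `φ ↦ 2⟨(-i∇ + A_n) φ | ζ₁ G⟩ + ⟨φ | ζ₂ G⟩` against `φ`. -/
def bFun (x : Fin N → Plane) (α : Fin N → ℝ) (ξ : Fin N → Plane → ℝ) (lam : ℝ) (n : Fin N)
    (l : Fin 2) (y : Plane) : ℂ :=
  zeta2 x α ξ n y * defectG x α lam n l y
    - 2 * ∑ j, (sC0 x α n j + sC x α n j y) * (defectG x α lam n l y * zeta1 x α ξ n y j)

lemma inner_cvec (u v : CVec) : inner ℂ u v = ∑ j, conj (u j) * v j := by
  simp [PiLp.inner_apply, mul_comm]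

/-- Since (-i∇ + A_n)f = Df - (S_n(x_n) + Š_n)f, the cross term becomes a pairing with Df and f, the
two components carried by the closed graph. It is thereby a bounded functional on L² × L². -/
lemma cross_pairing (x : Fin N → Plane) (α : Fin N → ℝ) (ξ : Fin N → Plane → ℝ) (lam : ℝ)
    (n : Fin N) (l : Fin 2) (f : Plane → ℂ) (g : Plane → CVec) (y : Plane) :
    2 * inner ℂ (magField (potA x α n) f g y) (defectG x α lam n l y • zeta1 x α ξ n y)
      + conj (f y) * (zeta2 x α ξ n y * defectG x α lam n l y)
      = inner ℂ (magField (potTotal x α) f g y) (aVec x α ξ lam n l y)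
        + conj (f y) * bFun x α ξ lam n l y := by
  have ea : ∀ j, ((potA x α n y j : ℝ) : ℂ) = aC x α n j y := fun _ => rfl
  have cs : ∀ j, conj (sC x α n j y) = sC x α n j y := fun _ => Complex.conj_ofReal _
  have cs0 : ∀ j, conj (sC0 x α n j) = sC0 x α n j := fun _ => Complex.conj_ofReal _
  simp only [inner_cvec, magField_apply, potTotal_apply x α n, aVec, bFun, Fin.sum_univ_two, ea,
    map_add, map_mul, map_neg, cs, cs0, PiLp.smul_apply, smul_eq_mul]
  ring

lemma crossDens_eq (x : Fin N → Plane) (α : Fin N → ℝ) (ξ : Fin N → Plane → ℝ) (lam : ℝ)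
    (n : Fin N) (l : Fin 2) (f : Plane → ℂ) (y : Plane) :
    crossDens x α ξ lam f n l y
      = inner ℂ (magField (potTotal x α) f (cGrad f) y) (aVec x α ξ lam n l y)
        + conj (f y) * bFun x α ξ lam n l y := by
  rw [← cross_pairing, crossDens, inner_cvec]
  simp

lemma cross1_add_cross2 (x : Fin N → Plane) (α : Fin N → ℝ) (ξ : Fin N → Plane → ℝ) (lam : ℝ)
    (n : Fin N) (l : Fin 2) (φ : L2) (y : Plane) :
    2 * cross1 x α ξ lam φ n l y + cross2 x α ξ lam φ n l y
      = inner ℂ (magGrad x (potTotal x α) φ y) (aVec x α ξ lam n l y)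
        + conj (φ y) * bFun x α ξ lam n l y :=
  cross_pairing x α ξ lam n l φ (weakGrad x φ) y

section bounds

variable {x : Fin N → Plane} (α : Fin N → ℝ) {ξ : Fin N → Plane → ℝ} {n : Fin N} {R : ℝ}

lemma ub_sing (h : IsCutoff x ξ) (l : Fin 2) (hα : α n ∈ Ioo (0 : ℝ) 1) :
    UB (x n) R (nu α n l) (fun lam : Ioi (0 : ℝ) => sing x α ξ lam n l) := by
  unfold sing
  simpa using (ub_phase α).mul ((ub_xiC h).mul (ub_G α n l hα R))

lemma ub_zeta1 (hR : IsRadius x n R) (h : IsCutoff x ξ) (l j : Fin 2)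
    (hα : α n ∈ Ioo (0 : ℝ) 1) :
    UB (x n) R (nu α n l - 1)
      (fun (lam : Ioi (0 : ℝ)) y => defectG x α lam n l y * zeta1 x α ξ n y j) := by
  simp only [zeta1_apply α h]
  simpa [sub_eq_add_neg] using (ub_G α n l hα R).mul ((ub_phase α).mul (ub_wC α hR h j))

lemma ub_zeta2 (hR : IsRadius x n R) (h : IsCutoff x ξ) :
    UB (x n) R 0 (fun _ : Ioi (0 : ℝ) => zeta2 x α ξ n) := by
  have e : zeta2 x α ξ n = fun y => phase x α n y *
      ((sC x α n 0 y * sC x α n 0 y + sC x α n 1 y * sC x α n 1 y) * xiC ξ n y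
        + (2 * (sC0 x α n 0 * wC x α ξ n 0 y + sC0 x α n 1 * wC x α ξ n 1 y)
        + (pd 0 (pd 0 (xiC ξ n)) y + pd 1 (pd 1 (xiC ξ n)) y))) := by
    funext y; rw [zeta2_eq α h]; ring
  rw [e]
  have hs := fun j => ub_sC (ι := Ioi (0 : ℝ)) α hR j
  have hw := fun j => ub_wC (ι := Ioi (0 : ℝ)) α hR h j
  have hd := fun j => ub_pd_pd_xiC (ι := Ioi (0 : ℝ)) (R := R) (n := n) h j j
  have t1 := (((((hs 0).mul (hs 0)).add ((hs 1).mul (hs 1))).mul (ub_xiC h)).weaken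
    (γ := 0) (by norm_num))
  have t2 := ((((hw 0).const_mul (sC0 x α n 0)).add ((hw 1).const_mul (sC0 x α n 1))).const_mul
    2).weaken (γ := 0) (by norm_num)
  simpa using (ub_phase α).mul (t1.add (t2.add ((hd 0).add (hd 1))))

lemma ub_bFun (hR : IsRadius x n R) (h : IsCutoff x ξ) (l : Fin 2) (hα : α n ∈ Ioo (0 : ℝ) 1) :
    UB (x n) R (nu α n l) (fun lam : Ioi (0 : ℝ) => bFun x α ξ lam n l) := by
  unfold bFun
  simp only [Fin.sum_univ_two]
  have t1 : UB (x n) R (nu α n l)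
      (fun (lam : Ioi (0 : ℝ)) y => zeta2 x α ξ n y * defectG x α lam n l y) := by
    simpa using (ub_zeta2 α hR h).mul (ub_G α n l hα R)
  have hs : ∀ j, UB (x n) R 0 (fun (_ : Ioi (0 : ℝ)) y => sC0 x α n j + sC x α n j y) :=
    fun j => (UB.const _).add ((ub_sC α hR j).weaken (by norm_num))
  have t2 := fun j => (((hs j).mul (ub_zeta1 α hR h l j hα)).weaken (γ := nu α n l)
    (by linarith))
  exact t1.sub (((t2 0).add (t2 1)).const_mul 2)

lemma ub_aVec (hR : IsRadius x n R) (h : IsCutoff x ξ) (l j : Fin 2) (hα : α n ∈ Ioo (0 : ℝ) 1) :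
    UB (x n) R (nu α n l - 1) (fun (lam : Ioi (0 : ℝ)) y => aVec x α ξ lam n l y j) := by
  refine ((ub_zeta1 α hR h l j hα).const_mul 2).congr_norm fun i y _ _ => le_of_eq ?_
  simp [aVec, mul_assoc]

end bounds

/-! ### Square integrable representatives -/

open Classical in
/-- The class in `L²` of a function; zero if the function is not square integrable. -/
def toL2 {E : Type*} [NormedAddCommGroup E] (f : Plane → E) : Lp E 2 (volume : Measure Plane) :=
  if h : MemLp f 2 volume then h.toLp f else 0

lemma coeFn_toL2 {E : Type*} [NormedAddCommGroup E] {f : Plane → E} (h : MemLp f 2 volume) :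
    toL2 f =ᵐ[volume] f := by
  rw [toL2, dif_pos h]; exact h.coeFn_toLp

lemma inner_eq_integral {E : Type*} [NormedAddCommGroup E] [InnerProductSpace ℂ E]
    {u v : Lp E 2 (volume : Measure Plane)} {f g : Plane → E} (hf : u =ᵐ[volume] f)
    (hg : v =ᵐ[volume] g) : inner ℂ u v = ∫ y, inner ℂ (f y) (g y) := by
  rw [L2.inner_def]
  exact integral_congr_ae (by filter_upwards [hf, hg] with y h1 h2; rw [h1, h2])

lemma UB.comp {ι κ : Type*} {c : Plane} {R β : ℝ} {f : ι → Plane → ℂ} (hf : UB c R β f)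
    (e : κ → ι) : UB c R β (fun k => f (e k)) := by
  obtain ⟨C, hC, h⟩ := hf
  exact ⟨C, hC, fun k => h (e k)⟩

/-- In the plane r^(-β) is locally square integrable when β < 1, and a single multiple of it
dominates the whole family. -/
lemma UB.exists_memLp_bound {ι E : Type*} [NormedAddCommGroup E] {c : Plane} {R β : ℝ}
    {f : ι → Plane → E} (hf : UB c R β (fun i y => ((‖f i y‖ : ℝ) : ℂ)))
    (h0 : ∀ i y, y ∉ Metric.ball c R → f i y = 0)
    (hm : ∀ i, AEStronglyMeasurable (f i) (volume : Measure Plane)) (hβ : β < 1) :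
    ∃ C, ∀ i, MemLp (f i) 2 volume ∧ ‖toL2 (f i)‖ ≤ C := by
  obtain ⟨C, hC, h⟩ := hf.exists_le_radPow fun i y hy => by simp [h0 i y hy]
  have hr : MemLp (fun y => C * radPow c R β y) 2 volume := (memLp_radPow c R hβ).const_mul C
  have hle : ∀ i, ∀ᵐ y ∂(volume : Measure Plane), ‖f i y‖ ≤ C * radPow c R β y := fun i => by
    filter_upwards [(compl_mem_ae_iff.2 (measure_singleton c) : ∀ᵐ y ∂volume, y ≠ c)] with y hy
    simpa using h i y hy
  refine ⟨‖toL2 (fun y => C * radPow c R β y)‖, fun i => ?_⟩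
  have hi : MemLp (f i) 2 volume := hr.mono' (hm i) (hle i)
  refine ⟨hi, Lp.norm_le_norm_of_ae_le ?_⟩
  filter_upwards [coeFn_toL2 hi, coeFn_toL2 hr, hle i] with y h1 h2 h3
  rw [h1, h2]
  exact h3.trans (le_abs_self _)

lemma UB.exists_integrable_bound {ι : Type*} {c : Plane} {R β : ℝ} {f : ι → Plane → ℂ}
    (hf : UB c R β f) (h0 : ∀ i y, y ∉ Metric.ball c R → f i y = 0)
    (hm : ∀ i, AEStronglyMeasurable (f i) (volume : Measure Plane)) (hβ : β < 2) :
    ∃ C, ∀ i, Integrable (f i) volume ∧ ‖∫ y, f i y‖ ≤ C := by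
  obtain ⟨C, hC, h⟩ := hf.exists_le_radPow h0
  have hr : Integrable (fun y => C * radPow c R β y) volume := (integrable_radPow c R hβ).const_mul C
  have hle : ∀ i, ∀ᵐ y ∂(volume : Measure Plane), ‖f i y‖ ≤ C * radPow c R β y := fun i => by
    filter_upwards [(compl_mem_ae_iff.2 (measure_singleton c) : ∀ᵐ y ∂volume, y ≠ c)] with y hy
    exact h i y hy
  exact ⟨∫ y, C * radPow c R β y, fun i =>
    ⟨hr.mono' (hm i) (hle i), norm_integral_le_of_norm_le hr (hle i)⟩⟩

/-! ### Continuity away from the points -/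

section continuity

variable {x : Fin N → Plane} (α : Fin N → ℝ) {ξ : Fin N → Plane → ℝ} {lam : ℝ} {n : Fin N}
  {y : Plane}

lemma continuousAt_G (hlam : 0 < lam) (l : Fin 2) (hy : y ≠ x n) :
    ContinuousAt (defectG x α lam n l) y := (hasPd_G α n l hlam hy).1.continuousAt

lemma continuousAt_pd_G (hlam : 0 < lam) (l j : Fin 2) (hy : y ≠ x n) :
    ContinuousAt (pd j (defectG x α lam n l)) y := (hasPd_pd_G α n l hlam hy j).1.continuousAt

lemma continuousAt_phase : ContinuousAt (phase x α n) y := (hasPd_phase x α n y).1.continuousAt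

lemma continuousAt_wC (h : IsCutoff x ξ) (j : Fin 2) (hy : ∀ m, y ≠ x m) :
    ContinuousAt (wC x α ξ n j) y := (hasPd_wC α n h (fun m _ => hy m) j).1.continuousAt

lemma continuousAt_zeta1 (h : IsCutoff x ξ) (j : Fin 2) (hy : ∀ m, y ≠ x m) :
    ContinuousAt (fun z => zeta1 x α ξ n z j) y := by
  simp only [zeta1_apply α h]
  exact (continuousAt_phase α).mul (continuousAt_wC α h j hy)

lemma continuousAt_sC (j : Fin 2) (hy : ∀ m, y ≠ x m) : ContinuousAt (sC x α n j) y :=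
  (hasPd_sC α n (fun m _ => hy m) j).1.continuousAt

lemma continuousAt_aC (j : Fin 2) (hy : y ≠ x n) : ContinuousAt (aC x α n j) y :=
  (hasPd_aC α n hy j).1.continuousAt

lemma continuousAt_zeta2 (h : IsCutoff x ξ) (hy : ∀ m, y ≠ x m) :
    ContinuousAt (zeta2 x α ξ n) y := by
  have e : zeta2 x α ξ n = fun y => phase x α n y *
      ((sC x α n 0 y ^ 2 + sC x α n 1 y ^ 2) * xiC ξ n y
        + 2 * (sC0 x α n 0 * wC x α ξ n 0 y + sC0 x α n 1 * wC x α ξ n 1 y)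
        + (pd 0 (pd 0 (xiC ξ n)) y + pd 1 (pd 1 (xiC ξ n)) y)) := funext fun y => zeta2_eq α h n y
  rw [e]
  have h1 := fun j => continuousAt_sC (n := n) α j hy
  have h2 := fun j => continuousAt_wC (n := n) α h j hy
  have h3 := fun j => (continuous_pd_pd_xiC h n j j).continuousAt (x := y)
  exact (continuousAt_phase α).mul (((((h1 0).pow 2).add ((h1 1).pow 2)).mul
    (contDiff_xiC h n).continuous.continuousAt).add (continuousAt_const.mul
      ((continuousAt_const.mul (h2 0)).add (continuousAt_const.mul (h2 1)))) |>.add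
        ((h3 0).add (h3 1)))

lemma continuousAt_sing (h : IsCutoff x ξ) (hlam : 0 < lam) (l : Fin 2) (hy : y ≠ x n) :
    ContinuousAt (sing x α ξ lam n l) y := (hasPd_sing α n l h hlam hy).1.continuousAt

lemma continuousAt_bFun (h : IsCutoff x ξ) (hlam : 0 < lam) (l : Fin 2) (hy : ∀ m, y ≠ x m) :
    ContinuousAt (bFun x α ξ lam n l) y := by
  unfold bFun
  have hG := continuousAt_G (x := x) α hlam l (hy n)
  refine ((continuousAt_zeta2 α h hy).mul hG).sub (continuousAt_const.mul ?_)
  exact tendsto_finsetSum _ fun j _ => (continuousAt_const.add (continuousAt_sC α j hy)).mul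
    (hG.mul (continuousAt_zeta1 α h j hy))

lemma continuousAt_aVec (h : IsCutoff x ξ) (hlam : 0 < lam) (l : Fin 2) (hy : ∀ m, y ≠ x m) :
    ContinuousAt (aVec x α ξ lam n l) y := by
  unfold aVec
  refine (continuousAt_const.mul (continuousAt_G (x := x) α hlam l (hy n))).smul ?_
  have h1 : ContinuousAt (fun z => WithLp.toLp 2 fun j => zeta1 x α ξ n z j) y :=
    (PiLp.continuous_toLp 2 fun _ : Fin 2 => ℂ).continuousAt.comp
      (continuousAt_pi.2 fun j => continuousAt_zeta1 α h j hy)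
  exact h1

end continuity

/-! ### Vanishing away from the supports of the cut-off functions -/

lemma zeta1_eq_zero {x : Fin N → Plane} (α : Fin N → ℝ) {ξ : Fin N → Plane → ℝ}
    (h : IsCutoff x ξ) {n : Fin N} {y : Plane} (hy : y ∉ tsupport (ξ n)) :
    zeta1 x α ξ n y = 0 := by
  ext j
  simp [zeta1_apply α h, wC_eq_zero α hy]

lemma zeta2_eq_zero {x : Fin N → Plane} (α : Fin N → ℝ) {ξ : Fin N → Plane → ℝ}
    (h : IsCutoff x ξ) {n : Fin N} {y : Plane} (hy : y ∉ tsupport (ξ n)) :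
    zeta2 x α ξ n y = 0 := by
  simp [zeta2_eq α h, wC_eq_zero α hy, xiC_eq_zero hy, pd_pd_xiC_eq_zero hy]

lemma aVec_eq_zero {x : Fin N → Plane} (α : Fin N → ℝ) {ξ : Fin N → Plane → ℝ}
    (h : IsCutoff x ξ) (lam : ℝ) {n : Fin N} (l : Fin 2) {y : Plane} (hy : y ∉ tsupport (ξ n)) :
    aVec x α ξ lam n l y = 0 := by simp [aVec, zeta1_eq_zero α h hy]

lemma bFun_eq_zero {x : Fin N → Plane} (α : Fin N → ℝ) {ξ : Fin N → Plane → ℝ}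
    (h : IsCutoff x ξ) (lam : ℝ) {n : Fin N} (l : Fin 2) {y : Plane} (hy : y ∉ tsupport (ξ n)) :
    bFun x α ξ lam n l y = 0 := by simp [bFun, zeta1_eq_zero α h hy, zeta2_eq_zero α h hy]

lemma crossDens_eq_zero {x : Fin N → Plane} (α : Fin N → ℝ) {ξ : Fin N → Plane → ℝ}
    (h : IsCutoff x ξ) (lam : ℝ) (f : Plane → ℂ) {n : Fin N} (l : Fin 2) {y : Plane}
    (hy : y ∉ tsupport (ξ n)) : crossDens x α ξ lam f n l y = 0 := by
  simp [crossDens, zeta1_eq_zero α h hy, zeta2_eq_zero α h hy]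

/-! ### Square integrability and uniform bounds -/

/-- One ball holding both supports, free of the other points, together with a smaller ball on which
both cut-offs equal 1; there the fields reduce to those of the bare defect functions. -/
lemma IsCutoff.exists_common_radius {x : Fin N → Plane} {ξ ξ' : Fin N → Plane → ℝ}
    (h : IsCutoff x ξ) (h' : IsCutoff x ξ') (n : Fin N) :
    ∃ R, IsRadius x n R ∧ tsupport (ξ n) ⊆ Metric.ball (x n) R ∧
      tsupport (ξ' n) ⊆ Metric.ball (x n) R ∧
      ∃ δ, 0 < δ ∧ δ ≤ R ∧ ∀ y, ‖y - x n‖ < δ → ξ n y = 1 ∧ ξ' n y = 1 := by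
  obtain ⟨R, hR, h1, h2, h3⟩ := h.exists_radius' n
  obtain ⟨R', hR', h1', h2', h3'⟩ := h'.exists_radius' n
  refine ⟨max R R', ⟨lt_max_of_lt_left hR, fun m hm => ?_⟩,
    h1.trans (Metric.ball_subset_ball (le_max_left _ _)),
    h1'.trans (Metric.ball_subset_ball (le_max_right _ _)),
    min (R / 2) (R' / 2), by positivity,
    (min_le_left _ _).trans ((half_le_self hR.le).trans (le_max_left _ _)),
    fun y hy => ⟨h2 y (hy.trans_le (min_le_left _ _)), h2' y (hy.trans_le (min_le_right _ _))⟩⟩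
  rcases max_choice R R' with e | e <;> rw [e]
  exacts [h3 m hm, h3' m hm]

section bounds

variable {x : Fin N → Plane} (α : Fin N → ℝ) {ξ : Fin N → Plane → ℝ} (n : Fin N)

lemma exists_sing_bound (h : IsCutoff x ξ) (l : Fin 2) (hα : α n ∈ Ioo (0 : ℝ) 1) :
    ∃ C, ∀ lam : Ioi (0 : ℝ), MemLp (sing x α ξ lam n l) 2 volume ∧
      ‖toL2 (sing x α ξ lam n l)‖ ≤ C := by
  obtain ⟨R, hR, h1, -⟩ := h.exists_common_radius h n
  refine UB.exists_memLp_bound (c := x n) (R := R) (f := fun lam : Ioi (0 : ℝ) =>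
    sing x α ξ lam n l) ((ub_sing α h l hα).congr_norm fun _ _ _ _ => by simp)
    (fun i y hy => sing_eq_zero α _ l fun hy' => hy (h1 hy')) (fun i => ?_) (nu_mem α l hα).2
  exact aestronglyMeasurable_of_continuousAt x fun y hy => continuousAt_sing α h i.2 l (hy n)

lemma memLp_sing (h : IsCutoff x ξ) (l : Fin 2) (hα : α n ∈ Ioo (0 : ℝ) 1) {lam : ℝ}
    (hlam : 0 < lam) : MemLp (sing x α ξ lam n l) 2 volume :=
  ((exists_sing_bound α n h l hα).choose_spec ⟨lam, hlam⟩).1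

lemma exists_bFun_bound (h : IsCutoff x ξ) (l : Fin 2) (hα : α n ∈ Ioo (0 : ℝ) 1) :
    ∃ C, ∀ lam : Ioi (0 : ℝ), MemLp (bFun x α ξ lam n l) 2 volume ∧
      ‖toL2 (bFun x α ξ lam n l)‖ ≤ C := by
  obtain ⟨R, hR, h1, -⟩ := h.exists_common_radius h n
  refine UB.exists_memLp_bound (c := x n) (R := R) (f := fun lam : Ioi (0 : ℝ) =>
    bFun x α ξ lam n l) ((ub_bFun α hR h l hα).congr_norm fun _ _ _ _ => by simp)
    (fun i y hy => bFun_eq_zero α h _ l fun hy' => hy (h1 hy')) (fun i => ?_) (nu_mem α l hα).2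
  exact aestronglyMeasurable_of_continuousAt x fun y hy => continuousAt_bFun α h i.2 l hy

lemma memLp_bFun (h : IsCutoff x ξ) (l : Fin 2) (hα : α n ∈ Ioo (0 : ℝ) 1) {lam : ℝ}
    (hlam : 0 < lam) : MemLp (bFun x α ξ lam n l) 2 volume :=
  ((exists_bFun_bound α n h l hα).choose_spec ⟨lam, hlam⟩).1

lemma UB.norm_cvec {ι : Type*} {c : Plane} {R β : ℝ} {f : ι → Plane → CVec}
    (hf : ∀ j, UB c R β (fun i y => f i y j)) : UB c R β (fun i y => ((‖f i y‖ : ℝ) : ℂ)) := by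
  obtain ⟨C, hC, h⟩ := hf 0
  obtain ⟨D, hD, h'⟩ := hf 1
  refine ⟨2 * (C + D), by positivity, fun i y hy hyc => ?_⟩
  have hp : 0 ≤ ‖y - c‖ ^ (-β) := by positivity
  rw [Complex.norm_real, norm_norm, mul_assoc]
  refine norm_cvec_le _ fun j => ?_
  rw [add_mul]
  fin_cases j
  · exact (h i y hy hyc).trans (le_add_of_nonneg_right (mul_nonneg hD hp))
  · exact (h' i y hy hyc).trans (le_add_of_nonneg_left (mul_nonneg hC hp))

lemma exists_aVec_bound (h : IsCutoff x ξ) (l : Fin 2) (hα : α n ∈ Ioo (0 : ℝ) 1) :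
    ∃ C, ∀ lam : Ioi (0 : ℝ), MemLp (aVec x α ξ lam n l) 2 volume ∧
      ‖toL2 (aVec x α ξ lam n l)‖ ≤ C := by
  obtain ⟨R, hR, h1, -⟩ := h.exists_common_radius h n
  refine UB.exists_memLp_bound (c := x n) (R := R) (f := fun lam : Ioi (0 : ℝ) =>
    aVec x α ξ lam n l) (UB.norm_cvec fun j => ub_aVec α hR h l j hα)
    (fun i y hy => aVec_eq_zero α h _ l fun hy' => hy (h1 hy')) (fun i => ?_)
    (by linarith [(nu_mem α l hα).2])
  exact aestronglyMeasurable_of_continuousAt x fun y hy => continuousAt_aVec α h i.2 l hy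

lemma memLp_aVec (h : IsCutoff x ξ) (l : Fin 2) (hα : α n ∈ Ioo (0 : ℝ) 1) {lam : ℝ}
    (hlam : 0 < lam) : MemLp (aVec x α ξ lam n l) 2 volume :=
  ((exists_aVec_bound α n h l hα).choose_spec ⟨lam, hlam⟩).1

lemma xi1_eq (h : IsCutoff x ξ) (lam : ℝ) (l l' : Fin 2) (y : Plane) :
    xi1 x α ξ lam n l l' y = conj (defectG x α lam n l y) *
      ((((sC x α n 0 y * sC x α n 0 y + sC x α n 1 y * sC x α n 1 y)
        + 2 * (sC x α n 0 y * aC x α n 0 y + sC x α n 1 y * aC x α n 1 y))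
        * (xiC ξ n y * xiC ξ n y)
        + (pd 0 (xiC ξ n) y * pd 0 (xiC ξ n) y + pd 1 (xiC ξ n) y * pd 1 (xiC ξ n) y))
        * defectG x α lam n l' y) := by
  have hin : ((inner ℝ (potSCheck x α n y) (potA x α n y) : ℝ) : ℂ)
      = sC x α n 0 y * aC x α n 0 y + sC x α n 1 y * aC x α n 1 y := by
    rw [PiLp.inner_apply, Fin.sum_univ_two]
    simp [sC, aC, mul_comm]
  have hns := norm_sq_plane_complex (potSCheck x α n y)
  have hng := norm_sq_gradient_xi h n y
  have es : ∀ j, ((potSCheck x α n y j : ℝ) : ℂ) = sC x α n j y := fun _ => rfl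
  push_cast at hns hng
  simp only [es] at hns
  rw [xi1]
  push_cast
  rw [hin, hns, hng, show (ξ n y : ℂ) = xiC ξ n y from rfl]
  ring

lemma xi2_eq (h : IsCutoff x ξ) {lam : ℝ} (hlam : 0 < lam) (l l' : Fin 2) {y : Plane}
    (hy : y ≠ x n) :
    xi2 x α ξ lam n l l' y = conj (xiC ξ n y * defectG x α lam n l y) *
      (sC x α n 0 y * (-Complex.I * (pd 0 (xiC ξ n) y * defectG x α lam n l' y
          + xiC ξ n y * pd 0 (defectG x α lam n l') y))
        + sC x α n 1 y * (-Complex.I * (pd 1 (xiC ξ n) y * defectG x α lam n l' y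
          + xiC ξ n y * pd 1 (defectG x α lam n l') y))) := by
  have e := ((hasPd_xiC h n y).mul (hasPd_G α n l' hlam hy)).2
  simp only [xi2, cGrad_apply, Fin.sum_univ_two, show (fun w => (ξ n w : ℂ) * defectG x α lam n l' w)
      = fun w => xiC ξ n w * defectG x α lam n l' w from rfl, e]
  rfl

/-- Š = O(r) against A = O(1/r) makes the bracket bounded. The integrand is O(r^(-ν-ν')) and ν + ν'
< 2. -/
lemma exists_xi1_bound (h : IsCutoff x ξ) (l l' : Fin 2) (hα : α n ∈ Ioo (0 : ℝ) 1) :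
    ∃ C, ∀ lam : Ioi (0 : ℝ), Integrable (xi1 x α ξ lam n l l') volume ∧
      ‖∫ y, xi1 x α ξ lam n l l' y‖ ≤ C := by
  obtain ⟨R, hR, h1, -⟩ := h.exists_common_radius h n
  have hs := fun j => ub_sC (ι := Ioi (0 : ℝ)) α hR j
  have ha := fun j => ub_aC (ι := Ioi (0 : ℝ)) x α n j R
  have hd := fun j => ub_pd_xiC (ι := Ioi (0 : ℝ)) (n := n) hR.pos h j
  have hx := ub_xiC (ι := Ioi (0 : ℝ)) (n := n) (R := R) h
  have t1 := ((((hs 0).mul (hs 0)).add ((hs 1).mul (hs 1))).weaken (γ := 0) (by norm_num)).add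
    (((((hs 0).mul (ha 0)).add ((hs 1).mul (ha 1))).weaken (γ := 0) (by norm_num)).const_mul 2)
  have t2 := ((t1.mul (hx.mul hx)).weaken (γ := 0) (by norm_num)).add
    ((((hd 0).mul (hd 0)).add ((hd 1).mul (hd 1))).weaken (γ := 0) (by norm_num))
  have t3 := (ub_G α n l hα R).star.mul (t2.mul (ub_G α n l' hα R))
  refine UB.exists_integrable_bound (c := x n) (R := R)
    (f := fun lam : Ioi (0 : ℝ) => xi1 x α ξ lam n l l')
    (t3.congr_norm fun _ _ _ _ => by rw [xi1_eq α n h]) (fun i y hy => ?_) (fun i => ?_)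
    (by linarith [(nu_mem α l hα).2, (nu_mem α l' hα).2])
  · have hy' : y ∉ tsupport (ξ n) := fun hy' => hy (h1 hy')
    simp [xi1_eq α n h, xiC_eq_zero hy', pd_xiC_eq_zero hy']
  · refine aestronglyMeasurable_of_continuousAt x fun y hy => ?_
    rw [show xi1 x α ξ i n l l' = _ from funext fun y => xi1_eq α n h i l l' y]
    have c1 := fun j => continuousAt_sC (n := n) α j hy
    have c2 := fun j => continuousAt_aC α j (hy n)
    have c3 := (contDiff_xiC h n).continuous.continuousAt (x := y)
    have c4 := fun j => (contDiff_pd_xiC h n j).continuous.continuousAt (x := y)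
    have c5 := fun l => continuousAt_G (lam := i) α i.2 l (hy n)
    have c6 := Complex.continuous_conj.continuousAt.comp (c5 l)
    exact c6.mul (((((((c1 0).mul (c1 0)).add ((c1 1).mul (c1 1))).add (continuousAt_const.mul
      (((c1 0).mul (c2 0)).add ((c1 1).mul (c2 1))))).mul (c3.mul c3)).add
      (((c4 0).mul (c4 0)).add ((c4 1).mul (c4 1)))).mul (c5 l'))

/-- The factor Š = O(r) offsets the derivative of G, so the order is again r^(-ν-ν'). -/
lemma exists_xi2_bound (h : IsCutoff x ξ) (l l' : Fin 2) (hα : α n ∈ Ioo (0 : ℝ) 1) :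
    ∃ C, ∀ lam : Ioi (0 : ℝ), Integrable (xi2 x α ξ lam n l l') volume ∧
      ‖∫ y, xi2 x α ξ lam n l l' y‖ ≤ C := by
  obtain ⟨R, hR, h1, -⟩ := h.exists_common_radius h n
  have hν := nu_mem α l hα
  have hν' := nu_mem α l' hα
  have hs := fun j => ub_sC (ι := Ioi (0 : ℝ)) α hR j
  have hd := fun j => ub_pd_xiC (ι := Ioi (0 : ℝ)) (n := n) hR.pos h j
  have hx := ub_xiC (ι := Ioi (0 : ℝ)) (n := n) (R := R) h
  have hG := fun l => ub_G (x := x) α n l hα R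
  have hD := fun j => ub_pd_G (x := x) α n l' j hα R
  have t1 := fun j => ((((hd j).mul (hG l')).weaken (γ := 0 + (nu α n l' + 1))
    (by linarith)).add (hx.mul (hD j))).const_mul (-Complex.I)
  have t2 := (hx.mul (hG l)).star.mul (((hs 0).mul (t1 0)).add ((hs 1).mul (t1 1)))
  -- The product rule is available only away from x_n. F is the representative given by it
  -- everywhere, and it agrees with the integrand almost everywhere.
  set F : ℝ → Plane → ℂ := fun lam y => conj (xiC ξ n y * defectG x α lam n l y) *
      (sC x α n 0 y * (-Complex.I * (pd 0 (xiC ξ n) y * defectG x α lam n l' y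
          + xiC ξ n y * pd 0 (defectG x α lam n l') y))
        + sC x α n 1 y * (-Complex.I * (pd 1 (xiC ξ n) y * defectG x α lam n l' y
          + xiC ξ n y * pd 1 (defectG x α lam n l') y))) with hF
  have hae : ∀ lam : Ioi (0 : ℝ), F lam =ᵐ[volume] xi2 x α ξ lam n l l' := fun lam => by
    filter_upwards [ae_forall_ne x] with y hy
    rw [xi2_eq α n h lam.2 l l' (hy n)]
  have h0 : ∀ (i : Ioi (0 : ℝ)) (y : Plane), y ∉ Metric.ball (x n) R → F i y = 0 := fun i y hy => by
    have hy' : y ∉ tsupport (ξ n) := fun hy' => hy (h1 hy')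
    simp [hF, xiC_eq_zero hy']
  have hm : ∀ i : Ioi (0 : ℝ), AEStronglyMeasurable (F i) volume := fun i => by
    refine aestronglyMeasurable_of_continuousAt x fun y hy => ?_
    have c1 := fun j => continuousAt_sC (n := n) α j hy
    have c3 := (contDiff_xiC h n).continuous.continuousAt (x := y)
    have c4 := fun j => (contDiff_pd_xiC h n j).continuous.continuousAt (x := y)
    have c5 := fun l => continuousAt_G (lam := i) α i.2 l (hy n)
    have c7 := fun j => continuousAt_pd_G (lam := i) α i.2 l' j (hy n)
    have c6 := Complex.continuous_conj.continuousAt.comp (c3.mul (c5 l))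
    have c8 := fun j => (c1 j).mul (continuousAt_const (y := -Complex.I) |>.mul
      (((c4 j).mul (c5 l')).add (c3.mul (c7 j))))
    exact c6.mul ((c8 0).add (c8 1))
  obtain ⟨C, hC⟩ := UB.exists_integrable_bound (c := x n) (R := R)
    (f := fun lam : Ioi (0 : ℝ) => F lam) t2 h0 hm (by linarith [hν.2, hν'.2])
  refine ⟨C, fun lam => ⟨(hC lam).1.congr (hae lam), ?_⟩⟩
  rw [← integral_congr_ae (hae lam)]; exact (hC lam).2

lemma exists_Xi_bound (h : IsCutoff x ξ) (l l' : Fin 2) (hα : α n ∈ Ioo (0 : ℝ) 1) :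
    ∃ C, ∀ lam : ℝ, 0 < lam → ‖Xi x α ξ lam n l l'‖ ≤ C := by
  obtain ⟨C, hC⟩ := exists_xi1_bound α n h l l' hα
  obtain ⟨D, hD⟩ := exists_xi2_bound α n h l l' hα
  refine ⟨C + 2 * D, fun lam hlam => (norm_add_le _ _).trans
    (add_le_add (hC ⟨lam, hlam⟩).2 ?_)⟩
  rw [norm_mul]
  simpa using (hD ⟨lam, hlam⟩).2

end bounds

/-! ### Fields supported near one point -/

section fields

variable {x : Fin N → Plane} (α : Fin N → ℝ) {ξ ξ' : Fin N → Plane → ℝ} {lam lam' : ℝ} (n : Fin N)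

lemma contDiffAt_conj {f : Plane → ℂ} {y : Plane} {k : WithTop ℕ∞} (hf : ContDiffAt ℝ k f y) :
    ContDiffAt ℝ k (fun z => conj (f z)) y :=
  (Complex.conjCLE : ℂ ≃L[ℝ] ℂ).contDiff.contDiffAt.comp y hf

lemma contDiffAt_sing (h : IsCutoff x ξ) (hlam : 0 < lam) (l : Fin 2) {y : Plane} (hy : y ≠ x n) :
    ContDiffAt ℝ 2 (sing x α ξ lam n l) y :=
  ((contDiff_phase x α n).of_le (by norm_cast)).contDiffAt.mul
    ((contDiff_xiC h n).contDiffAt.mul (contDiffAt_defectG x α hlam n l hy))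

lemma contDiffAt_eC (hlam : 0 < lam) (l j : Fin 2) {y : Plane} (hy : y ≠ x n) :
    ContDiffAt ℝ 1 (eC x α lam n l j) y :=
  (contDiffAt_const.mul (contDiffAt_pd_G α n l hlam hy j)).add
    (((contDiffAt_aC x α n j hy).of_le (by norm_num)).mul
      ((contDiffAt_defectG x α hlam n l hy).of_le (by norm_num)))

lemma contDiffAt_wC (h : IsCutoff x ξ) (j : Fin 2) {y : Plane} (hy : ∀ m, y ≠ x m) :
    ContDiffAt ℝ 1 (wC x α ξ n j) y :=
  (((contDiff_xiC h n).contDiffAt.of_le (by norm_num)).mul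
    ((contDiffAt_sC x α n j fun m _ => hy m).of_le (by norm_num))).sub
    (contDiffAt_const.mul (contDiff_pd_xiC h n j).contDiffAt)

/-- The other points lie outside the support of ξ_n, so a field localized by ξ_n has x_n as its only
possible singularity. -/
lemma contDiffAt_of_support {V : Plane → ℂ} (h : IsCutoff x ξ)
    (h0 : ∀ y, y ∉ tsupport (ξ n) → V y = 0)
    (h1 : ∀ y, (∀ m, y ≠ x m) → ContDiffAt ℝ 1 V y) {y : Plane} (hy : y ≠ x n) :
    ContDiffAt ℝ 1 V y := by
  by_cases hs : y ∈ tsupport (ξ n)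
  · refine h1 y fun m => ?_
    rcases eq_or_ne m n with rfl | hm
    exacts [hy, h.ne_of_mem_tsupport hm hs]
  · refine (contDiffAt_const (c := (0 : ℂ))).congr_of_eventuallyEq ?_
    filter_upwards [h.eventually_eq_zero hs] with z hz using h0 z hz

lemma crossField_eq_zero (f : Plane → ℂ) (l j : Fin 2) {y : Plane} (hy : y ∉ tsupport (ξ n)) :
    crossField x α ξ lam f n l j y = 0 := by
  simp [crossField, xiC_eq_zero hy, wC_eq_zero α hy]

lemma xiField_eq_zero (l l' j : Fin 2) {y : Plane} (hy : y ∉ tsupport (ξ n)) :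
    xiField x α ξ lam n l l' j y = 0 := by
  simp [xiField, xiC_eq_zero hy]

lemma contDiffAt_crossField (h : IsCutoff x ξ) (hlam : 0 < lam) {f : Plane → ℂ}
    (hf : ∀ y, (∀ m, y ≠ x m) → ContDiffAt ℝ 1 f y) (l j : Fin 2) {y : Plane} (hy : y ≠ x n) :
    ContDiffAt ℝ 1 (crossField x α ξ lam f n l j) y := by
  refine contDiffAt_of_support n h (fun z hz => crossField_eq_zero α n f l j hz)
    (fun z hz => ?_) hy
  exact contDiffAt_const.mul ((contDiffAt_conj (hf z hz)).mul
    ((((contDiff_phase x α n).of_le (by norm_cast)).contDiffAt).mul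
      ((((contDiff_xiC h n).contDiffAt.of_le (by norm_num)).mul
        (contDiffAt_eC α n hlam l j (hz n))).sub ((contDiffAt_wC α n h j hz).mul
          ((contDiffAt_defectG x α hlam n l (hz n)).of_le (by norm_num))))))

lemma contDiffAt_xiField (h : IsCutoff x ξ) (hlam : 0 < lam) (l l' j : Fin 2) {y : Plane}
    (hy : y ≠ x n) : ContDiffAt ℝ 1 (xiField x α ξ lam n l l' j) y := by
  refine contDiffAt_of_support n h (fun z hz => xiField_eq_zero α n l l' j hz)
    (fun z hz => ?_) hy
  have hx : ContDiffAt ℝ 1 (xiC ξ n) z := (contDiff_xiC h n).contDiffAt.of_le (by norm_num)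
  have hG := fun l => (contDiffAt_defectG x α hlam n l (hz n)).of_le
    (show (1 : WithTop ℕ∞) ≤ 2 by norm_num)
  have hE := fun l => contDiffAt_eC α n hlam l j (hz n)
  have hs : ContDiffAt ℝ 1 (sC x α n j) z :=
    (contDiffAt_sC x α n j fun m _ => hz m).of_le (by norm_num)
  have hGG := (contDiffAt_conj (hG l)).mul (hG l')
  exact hx.mul (((contDiffAt_const.mul (hs.mul (hx.mul hGG))).add
    ((contDiff_pd_xiC h n j).contDiffAt.mul hGG)).sub (contDiffAt_const.mul (hx.mul
      (((contDiffAt_conj (hG l)).mul (hE l')).add ((hG l').mul (contDiffAt_conj (hE l)))))))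

end fields

/-! ### Test functions -/

/-- `(-i∇ + ∑ₙ A_n) f` with classical derivatives. -/
def magD (x : Fin N → Plane) (α : Fin N → ℝ) (f : Plane → ℂ) : Plane → CVec :=
  magField (potTotal x α) f (cGrad f)

lemma magD_apply (x : Fin N → Plane) (α : Fin N → ℝ) (f : Plane → ℂ) (y : Plane) (j : Fin 2) :
    magD x α f y j = -(Complex.I * pd j f y) + f y * ((potTotal x α y j : ℝ) : ℂ) :=
  magField_apply _ _ _ _ _

lemma continuousAt_potTotal (x : Fin N → Plane) (α : Fin N → ℝ) (j : Fin 2) {y : Plane}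
    (hy : ∀ m, y ≠ x m) : ContinuousAt (fun z => ((potTotal x α z j : ℝ) : ℂ)) y := by
  have h : ∀ z, ((potTotal x α z j : ℝ) : ℂ) = ∑ m, aC x α m j z := fun z => by
    simp [potTotal, aC, WithLp.ofLp_sum]
  simp only [h]
  exact tendsto_finsetSum _ fun m _ => continuousAt_aC α j (hy m)

lemma continuousAt_magD {x : Fin N → Plane} (α : Fin N → ℝ) {f : Plane → ℂ} {y : Plane}
    (hf : ContDiffAt ℝ 1 f y) (hy : ∀ m, y ≠ x m) : ContinuousAt (magD x α f) y := by
  have h1 : ContinuousAt (fun z => WithLp.toLp 2 fun j => magD x α f z j) y := by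
    refine (PiLp.continuous_toLp 2 fun _ : Fin 2 => ℂ).continuousAt.comp
      (continuousAt_pi.2 fun j => ?_)
    simp only [magD_apply]
    exact ((continuousAt_const.mul (contDiffAt_pd (m := 0) hf (by norm_num) j).continuousAt).neg).add
      (hf.continuousAt.mul (continuousAt_potTotal x α j hy))
  exact h1

lemma magD_eq_zero (x : Fin N → Plane) (α : Fin N → ℝ) {f : Plane → ℂ} {y : Plane}
    (hy : y ∉ tsupport f) : magD x α f y = 0 := by
  ext j
  simp [magD_apply, pd_eq_zero_of_notMem hy, image_eq_zero_of_notMem_tsupport hy]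

lemma continuous_magD {x : Fin N → Plane} (α : Fin N → ℝ) {f : Plane → ℂ} (hf : ContDiff ℝ 1 f)
    (hs : tsupport f ⊆ (range x)ᶜ) : Continuous (magD x α f) := by
  refine continuous_iff_continuousAt.2 fun y => ?_
  by_cases hy : y ∈ tsupport f
  · exact continuousAt_magD α hf.contDiffAt fun m hm => hs hy ⟨m, hm.symm⟩
  · refine (continuousAt_const (y := (0 : CVec))).congr ?_
    filter_upwards [(isClosed_tsupport f).isOpen_compl.mem_nhds hy] with z hz
    exact (magD_eq_zero x α hz).symm

lemma hasCompactSupport_magD (x : Fin N → Plane) (α : Fin N → ℝ) {f : Plane → ℂ}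
    (hc : HasCompactSupport f) : HasCompactSupport (magD x α f) :=
  HasCompactSupport.intro hc fun _ hy => magD_eq_zero x α hy

lemma memLp_magD {x : Fin N → Plane} (α : Fin N → ℝ) {f : Plane → ℂ} (hf : ContDiff ℝ 1 f)
    (hc : HasCompactSupport f) (hs : tsupport f ⊆ (range x)ᶜ) : MemLp (magD x α f) 2 volume :=
  (continuous_magD α hf hs).memLp_of_hasCompactSupport (hasCompactSupport_magD x α hc)

lemma IsTest.contDiff_one {x : Fin N → Plane} {f : Plane → ℂ} (hf : IsTest x f) : ContDiff ℝ 1 f :=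
  hf.1.of_le (by norm_cast)

lemma IsTest.memLp {x : Fin N → Plane} {f : Plane → ℂ} (hf : IsTest x f) : MemLp f 2 volume :=
  hf.1.continuous.memLp_of_hasCompactSupport hf.2.1

lemma IsTest.memLp_magD {x : Fin N → Plane} (α : Fin N → ℝ) {f : Plane → ℂ} (hf : IsTest x f) :
    MemLp (magD x α f) 2 volume := AharonovBohm.memLp_magD α hf.contDiff_one hf.2.1 hf.2.2

lemma integrable_inner {E : Type*} [NormedAddCommGroup E] [InnerProductSpace ℂ E]
    {f g : Plane → E} (hf : MemLp f 2 volume) (hg : MemLp g 2 volume) :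
    Integrable (fun y => inner ℂ (f y) (g y)) volume := by
  refine (L2.integrable_inner (𝕜 := ℂ) (hf.toLp f) (hg.toLp g)).congr ?_
  filter_upwards [hf.coeFn_toLp, hg.coeFn_toLp] with y h1 h2
  rw [h1, h2]

lemma inner_complex (a b : ℂ) : inner ℂ a b = conj a * b := by simp [mul_comm]

section pairing

variable {x : Fin N → Plane} (α : Fin N → ℝ) {ξ ξ' : Fin N → Plane → ℝ} {lam lam' : ℝ} (n : Fin N)

/-- A test function vanishes near every point, so `crossField` is C¹ with compact support in the
whole plane and its divergence integrates to zero. The singular function need not have a square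
integrable magnetic gradient, so integrability of the left side is part of the claim. -/
lemma test_pairing (h : IsCutoff x ξ) (hlam : 0 < lam) (l : Fin 2) (hα : α n ∈ Ioo (0 : ℝ) 1)
    {f : Plane → ℂ} (hf : IsTest x f) :
    Integrable (fun y => inner ℂ (magD x α f y) (magD x α (sing x α ξ lam n l) y)) volume ∧
    ∫ y, inner ℂ (magD x α f y) (magD x α (sing x α ξ lam n l) y)
      = inner ℂ (toL2 (magD x α f)) (toL2 (aVec x α ξ lam n l))
        + inner ℂ (toL2 f) (toL2 (bFun x α ξ lam n l))
        - (lam : ℂ) ^ 2 * inner ℂ (toL2 f) (toL2 (sing x α ξ lam n l)) := by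
  have hD := hf.memLp_magD α
  have ha := memLp_aVec α n h l hα hlam
  have hb := memLp_bFun α n h l hα hlam
  have hs := memLp_sing α n h l hα hlam
  rw [inner_eq_integral (coeFn_toL2 hD) (coeFn_toL2 ha),
    inner_eq_integral (coeFn_toL2 hf.memLp) (coeFn_toL2 hb),
    inner_eq_integral (coeFn_toL2 hf.memLp) (coeFn_toL2 hs)]
  have i1 := integrable_inner hD ha
  have i2 := integrable_inner hf.memLp hb
  have i3 := (integrable_inner hf.memLp hs).const_mul ((lam : ℂ) ^ 2)
  have hV : ∀ j, ContDiff ℝ 1 (crossField x α ξ lam f n l j) := fun j =>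
    contDiff_iff_contDiffAt.2 fun y => by
      by_cases hy : y = x n
      · refine (contDiffAt_const (c := (0 : ℂ))).congr_of_eventuallyEq ?_
        have hyf : y ∉ tsupport f := fun hm => hf.2.2 hm ⟨n, hy.symm⟩
        filter_upwards [(isClosed_tsupport f).isOpen_compl.mem_nhds hyf] with z hz
        simp [crossField, image_eq_zero_of_notMem_tsupport hz]
      · exact contDiffAt_crossField α n h hlam (fun z _ => hf.contDiff_one.contDiffAt) l j hy
  have hVc : ∀ j, HasCompactSupport (crossField x α ξ lam f n l j) := fun j =>
    HasCompactSupport.intro (h.hasCompactSupport n) fun y hy => crossField_eq_zero α n f l j hy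
  have i12 : Integrable (fun y => inner ℂ (magD x α f y) (aVec x α ξ lam n l y)
      + inner ℂ (f y) (bFun x α ξ lam n l y)) volume := i1.add i2
  have i123 : Integrable (fun y => inner ℂ (magD x α f y) (aVec x α ξ lam n l y)
      + inner ℂ (f y) (bFun x α ξ lam n l y)
      - (lam : ℂ) ^ 2 * inner ℂ (f y) (sing x α ξ lam n l y)) volume := i12.sub i3
  have i4 : Integrable (fun y => ∑ j, pd j (crossField x α ξ lam f n l j) y) volume :=
    integrable_finsetSum _ fun j _ => integrable_pd (hV j) (hVc j) j
  have hae : (fun y => inner ℂ (magD x α f y) (magD x α (sing x α ξ lam n l) y))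
      =ᵐ[volume] fun y => (inner ℂ (magD x α f y) (aVec x α ξ lam n l y)
        + inner ℂ (f y) (bFun x α ξ lam n l y)
        - (lam : ℂ) ^ 2 * inner ℂ (f y) (sing x α ξ lam n l y))
        + ∑ j, pd j (crossField x α ξ lam f n l j) y := by
    filter_upwards [ae_forall_ne x] with y hy
    rw [← energy_sub_crossDens α n l h hlam hy (hf.contDiff_one.differentiable (by norm_num) y),
      crossDens_eq, inner_complex, inner_complex, inner_cvec (magD x α f y) (magD x α _ y)]
    simp only [magD]
    ring
  refine ⟨(i123.add i4).congr hae.symm, ?_⟩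
  rw [integral_congr_ae hae, integral_add i123 i4, integral_sub i12 i3,
    integral_add i1 i2, integral_const_mul,
    integral_finsetSum _ fun j _ => integrable_pd (hV j) (hVc j) j,
    Finset.sum_eq_zero fun j _ => integral_pd_eq_zero (hV j) (hVc j) j, add_zero]

/-! ### Cross terms between singular functions -/

lemma ub_pd_sing (h : IsCutoff x ξ) (hR : 0 < lam) (l j : Fin 2) (hα : α n ∈ Ioo (0 : ℝ) 1)
    {R : ℝ} (hRad : IsRadius x n R) :
    UB (x n) R (nu α n l + 1) (fun _ : Unit => pd j (sing x α ξ lam n l)) := by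
  have hν := nu_mem α l hα
  have hp := ub_phase (ι := Unit) (x := x) (n := n) (R := R) α
  have hx := ub_xiC (ι := Unit) (n := n) (R := R) h
  have hd := ub_pd_xiC (ι := Unit) (n := n) hRad.pos h j
  have hG := (ub_G (x := x) α n l hα R).comp (fun _ : Unit => (⟨lam, hR⟩ : Ioi (0 : ℝ)))
  have hD := (ub_pd_G (x := x) α n l j hα R).comp (fun _ : Unit => (⟨lam, hR⟩ : Ioi (0 : ℝ)))
  have t1 := ((hp.const_mul (-Complex.I * sC0 x α n j)).mul (hx.mul hG)).weaken
    (γ := nu α n l + 1) (by linarith)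
  have t2 := (hp.mul ((((hd.mul hG).weaken (γ := nu α n l + 1) (by linarith)).add
    ((hx.mul hD).weaken (γ := nu α n l + 1) (by linarith))))).weaken (γ := nu α n l + 1)
    (by linarith)
  exact (t1.add t2).congr_norm fun _ y _ hy => by rw [(hasPd_sing α n l h hR hy).2 j]

/-- The magnetic gradient of order r^(-ν-1) meets ζ₁G of order r^(1-ν'). All terms are O(r^(-ν-ν'))
with ν + ν' < 2. -/
lemma integrable_crossDens_sing (h : IsCutoff x ξ) (h' : IsCutoff x ξ') (hlam : 0 < lam)
    (hlam' : 0 < lam') (l l' : Fin 2) (hα : α n ∈ Ioo (0 : ℝ) 1) :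
    Integrable (crossDens x α ξ lam (sing x α ξ' lam' n l) n l') volume := by
  obtain ⟨R, hR, h1, h2, -⟩ := h.exists_common_radius h' n
  have hν := nu_mem α l hα
  have hν' := nu_mem α l' hα
  have e : crossDens x α ξ lam (sing x α ξ' lam' n l) n l'
      = fun y => 2 * (conj (-(Complex.I * pd 0 (sing x α ξ' lam' n l) y)
          + sing x α ξ' lam' n l y * aC x α n 0 y) * (defectG x α lam n l' y * zeta1 x α ξ n y 0)
        + conj (-(Complex.I * pd 1 (sing x α ξ' lam' n l) y)
          + sing x α ξ' lam' n l y * aC x α n 1 y) * (defectG x α lam n l' y * zeta1 x α ξ n y 1))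
        + conj (sing x α ξ' lam' n l y) * (zeta2 x α ξ n y * defectG x α lam n l' y) := by
    funext y
    simp only [crossDens, magField_apply, Fin.sum_univ_two, cGrad_apply]
    rfl
  have hS := (ub_sing (R := R) α h' l hα).comp (fun _ : Unit => (⟨lam', hlam'⟩ : Ioi (0 : ℝ)))
  have hdS := fun j => ub_pd_sing α n h' hlam' l j hα hR
  have hG := (ub_G (x := x) α n l' hα R).comp (fun _ : Unit => (⟨lam, hlam⟩ : Ioi (0 : ℝ)))
  have hz1 := fun j => (ub_zeta1 α hR h l' j hα).comp
    (fun _ : Unit => (⟨lam, hlam⟩ : Ioi (0 : ℝ)))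
  have hz2 := (ub_zeta2 α hR h).comp (fun _ : Unit => (⟨lam, hlam⟩ : Ioi (0 : ℝ)))
  have ha := fun j => ub_aC (ι := Unit) x α n j R
  have t1 := fun j => ((((hdS j).const_mul Complex.I).neg).add
    ((hS.mul (ha j)))).star.mul (hz1 j)
  have t2 := (((t1 0).add (t1 1)).const_mul 2).weaken (γ := nu α n l + nu α n l') (by linarith)
  have t3 := (hS.star.mul (hz2.mul hG)).weaken (γ := nu α n l + nu α n l') (by linarith)
  have hm : AEStronglyMeasurable (crossDens x α ξ lam (sing x α ξ' lam' n l) n l')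
      (volume : Measure Plane) := by
    refine aestronglyMeasurable_of_continuousAt x fun y hy => ?_
    rw [e]
    have c1 := continuousAt_sing (n := n) α h' hlam' l (hy n)
    have c2 := fun j => (contDiffAt_pd (m := 1) (contDiffAt_sing α n h' hlam' l (hy n))
      (by norm_num) j).continuousAt
    have c3 := fun j => continuousAt_aC α j (hy n)
    have c4 := fun j => (continuousAt_G (x := x) α hlam l' (hy n)).mul (continuousAt_zeta1 (n := n) α h j hy)
    have c5 := (continuousAt_zeta2 (n := n) α h hy).mul (continuousAt_G (x := x) α hlam l' (hy n))
    have c6 := fun j => (Complex.continuous_conj.continuousAt.comp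
      (((continuousAt_const (y := Complex.I)).mul (c2 j)).neg.add (c1.mul (c3 j)))).mul (c4 j)
    exact (continuousAt_const.mul ((c6 0).add (c6 1))).add
      ((Complex.continuous_conj.continuousAt.comp c1).mul c5)
  obtain ⟨C, hC⟩ := UB.exists_integrable_bound (c := x n) (R := R)
    (f := fun _ : Unit => crossDens x α ξ lam (sing x α ξ' lam' n l) n l')
    ((t2.add t3).congr_norm fun _ _ _ _ => by rw [e])
    (fun _ y hy => crossDens_eq_zero α h lam _ l' fun hy' => hy (h1 hy')) (fun _ => hm)
    (by linarith [hν.2, hν'.2])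
  exact (hC ()).1

lemma crossDens_sing_eq_zero (h : IsCutoff x ξ) (h' : IsCutoff x ξ') (lam lam' : ℝ) {m n : Fin N}
    (hmn : m ≠ n) (l l' : Fin 2) (y : Plane) :
    crossDens x α ξ lam (sing x α ξ' lam' m l) n l' y = 0 := by
  by_cases hy : y ∈ tsupport (ξ n)
  · have hm := h.notMem_tsupport_of_ne h' hmn hy
    have h0 : sing x α ξ' lam' m l =ᶠ[𝓝 y] fun _ => 0 := by
      filter_upwards [h'.eventually_eq_zero hm] with z hz using sing_eq_zero α _ l hz
    have hp : ∀ j, pd j (sing x α ξ' lam' m l) y = 0 := fun j => by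
      rw [pd, h0.fderiv_eq]; simp
    simp [crossDens, magField_apply, cGrad_apply, hp, sing_eq_zero α _ l hm]
  · exact crossDens_eq_zero α h lam _ l' hy

lemma UB.tendsto_zero {c : Plane} {R β : ℝ} {f : Plane → ℂ} (hR : 0 < R) (hβ : β < 0)
    (hf : UB c R β (fun _ : Unit => f)) : Tendsto f (𝓝[≠] c) (𝓝 0) := by
  obtain ⟨C, hC, h⟩ := hf
  have h1 : Tendsto (fun y : Plane => C * ‖y - c‖ ^ (-β)) (𝓝[≠] c) (𝓝 0) := by
    have : ContinuousAt (fun y : Plane => C * ‖y - c‖ ^ (-β)) c :=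
      continuousAt_const.mul ((continuousAt_id.sub continuousAt_const).norm.rpow_const
        (Or.inr (by linarith)))
    have h2 := this.tendsto
    simp only [sub_self, norm_zero, Real.zero_rpow (show -β ≠ 0 by linarith), mul_zero] at h2
    exact h2.mono_left nhdsWithin_le_nhds
  refine squeeze_zero_norm' ?_ h1
  filter_upwards [self_mem_nhdsWithin, nhdsWithin_le_nhds (Metric.ball_mem_nhds c hR)] with y hy hy'
  exact h () y hy' hy

/-- The error of the radial component of the current. -/
def radialRest (x : Fin N → Plane) (α : Fin N → ℝ) (lam' lam : ℝ) (n : Fin N) (l l' : Fin 2)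
    (y : Plane) : ℂ :=
  ((((y - x n) 0 : ℝ) : ℂ) * sC x α n 0 y + (((y - x n) 1 : ℝ) : ℂ) * sC x α n 1 y)
    * (conj (defectG x α lam' n l y) * defectG x α lam n l' y)

/-- The radial component of Š contributes r² against r^(-ν-ν'), and ν + ν' < 2. -/
lemma tendsto_radialRest (hlam : 0 < lam) (hlam' : 0 < lam') (l l' : Fin 2)
    (hα : α n ∈ Ioo (0 : ℝ) 1) {R : ℝ} (hR : IsRadius x n R) :
    Tendsto (radialRest x α lam' lam n l l') (𝓝[≠] (x n)) (𝓝 0) := by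
  have hν := nu_mem α l hα
  have hν' := nu_mem α l' hα
  have hv : ∀ j : Fin 2, UB (x n) R (-1) (fun (_ : Unit) y => (((y - x n) j : ℝ) : ℂ)) := fun j =>
    ⟨1, zero_le_one, fun _ y _ _ => by
      rw [Complex.norm_real, neg_neg, Real.rpow_one, one_mul]; exact abs_coord_le _ _⟩
  have hs := fun j => ub_sC (ι := Unit) α hR j
  have hG := fun l => (ub_G (x := x) α n l hα R)
  have t := (((hv 0).mul (hs 0)).add ((hv 1).mul (hs 1))).mul
    (((hG l).comp (fun _ : Unit => (⟨lam', hlam'⟩ : Ioi (0 : ℝ)))).star.mul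
      ((hG l').comp (fun _ : Unit => (⟨lam, hlam⟩ : Ioi (0 : ℝ)))))
  exact UB.tendsto_zero (f := radialRest x α lam' lam n l l') hR.pos
    (by linarith [hν.2, hν'.2]) t

lemma continuousAt_radialRest (hlam : 0 < lam) (hlam' : 0 < lam') (l l' : Fin 2) {y : Plane}
    (hy : ∀ m, y ≠ x m) : ContinuousAt (radialRest x α lam' lam n l l') y := by
  have hv : ∀ j : Fin 2, Continuous fun y : Plane => (((y - x n) j : ℝ) : ℂ) := fun j =>
    Complex.continuous_ofReal.comp
      ((EuclideanSpace.proj j : Plane →L[ℝ] ℝ).continuous.comp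
        (continuous_id.sub continuous_const))
  have hs := fun j => continuousAt_sC (n := n) α j hy
  exact (((hv 0).continuousAt.mul (hs 0)).add ((hv 1).continuousAt.mul (hs 1))).mul
    ((Complex.continuous_conj.continuousAt.comp (continuousAt_G α hlam' l (hy n))).mul
      (continuousAt_G α hlam l' (hy n)))

/-- Near x_n the radial component consists of the current and a remainder tending to 0. For ℓ = ℓ'
the current has a limit; for ℓ ≠ ℓ' it plays the role of the odd part in the divergence theorem. -/
lemma integral_div_eq_radial {V : Fin 2 → Plane → ℂ}
    (hV : ∀ j y, y ≠ x n → ContDiffAt ℝ 1 (V j) y) (hc : ∀ j, HasCompactSupport (V j))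
    (hint : Integrable (fun y => ∑ j, pd j (V j) y) volume) {R δ : ℝ} (hR : IsRadius x n R)
    (hδ : 0 < δ) (hδR : δ ≤ R) (k k' : ℂ) (hlam : 0 < lam) (hlam' : 0 < lam') (l l' : Fin 2)
    (hα : α n ∈ Ioo (0 : ℝ) 1)
    (hfg : ∀ y, y ≠ x n → ‖y - x n‖ < δ → ∑ j, (((y - x n) j : ℝ) : ℂ) * V j y
      = k * radialCurrent x α lam' lam n l l' y + k' * radialRest x α lam' lam n l l' y) :
    ∫ y, ∑ j, pd j (V j) y = if l = l' then -(2 * Real.pi * (k * (((lam' ^ (2 * nu α n l)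
        - lam ^ (2 * nu α n l)) / (4 * Real.sin (Real.pi * α n)) : ℝ) : ℂ))) else 0 := by
  have hne : ∀ y, y ≠ x n → ‖y - x n‖ < δ → ∀ m, y ≠ x m := fun y hy hyδ m => by
    rcases eq_or_ne m n with rfl | hm
    · exact hy
    · exact hR.ne hm (by rw [Metric.mem_closedBall, dist_eq_norm]; linarith)
  have c1 : ∀ y, y ≠ x n → ‖y - x n‖ < δ →
      ContinuousAt (fun y => k * radialCurrent x α lam' lam n l l' y) y := fun y hy _ =>
    continuousAt_const.mul (continuousAt_radialCurrent x α hlam' hlam n l l' hy)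
  have c2 : ∀ y, y ≠ x n → ‖y - x n‖ < δ →
      ContinuousAt (fun y => k' * radialRest x α lam' lam n l l' y) y := fun y hy hyδ =>
    continuousAt_const.mul (continuousAt_radialRest α n hlam hlam' l l' (hne y hy hyδ))
  have r0 := (tendsto_radialRest α n hlam hlam' l l' hα hR).const_mul k'
  rw [mul_zero] at r0
  split_ifs with hl
  · subst hl
    refine integral_div_eq_flux (f := fun _ => 0)
      (g := fun y => k * radialCurrent x α lam' lam n l l y + k' * radialRest x α lam' lam n l l y)
      hV hc hint hδ (fun y hy hyδ => by rw [hfg y hy hyδ, zero_add])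
      (fun _ _ _ => continuousAt_const) (fun y hy hyδ => (c1 y hy hyδ).add (c2 y hy hyδ))
      (by simp) ?_
    simpa using ((tendsto_radialCurrent x α hlam' hlam n l hα).const_mul k).add r0
  · have := integral_div_eq_flux hV hc hint hδ hfg c1 c2
      (fun v => by rw [radialCurrent_odd x α hlam' hlam n hl v, mul_neg]) r0
    simpa using this

/-- A_n is tangential and does not contribute to any flux through a circle about x_n. -/
lemma radial_aC (y : Plane) :
    (((y - x n) 0 : ℝ) : ℂ) * aC x α n 0 y + (((y - x n) 1 : ℝ) : ℂ) * aC x α n 1 y = 0 := by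
  rw [aC_eq, aC_eq]
  simp; ring

lemma pd_xiC_eq_zero_of_eq_one {δ : ℝ} (hδ : ∀ y, ‖y - x n‖ < δ → ξ n y = 1) {y : Plane}
    (hy : ‖y - x n‖ < δ) (j : Fin 2) : pd j (xiC ξ n) y = 0 := by
  have h0 : xiC ξ n =ᶠ[𝓝 y] fun _ => 1 := by
    filter_upwards [Metric.isOpen_ball.mem_nhds (show y ∈ Metric.ball (x n) δ by
      rwa [Metric.mem_ball, dist_eq_norm])] with z hz
    rw [Metric.mem_ball, dist_eq_norm] at hz
    simp [xiC, hδ z hz]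
  rw [pd, h0.fderiv_eq]; simp

/-- The pairing of a singular function with itself reproduces `Ξ`. -/
lemma integral_crossDens_self (h : IsCutoff x ξ) (hlam : 0 < lam) (l l' : Fin 2)
    (hα : α n ∈ Ioo (0 : ℝ) 1) :
    ∫ y, crossDens x α ξ lam (sing x α ξ lam n l) n l' y = Xi x α ξ lam n l l' := by
  obtain ⟨R, hR, h1, -, δ, hδ, hδR, hδ1⟩ := h.exists_common_radius h n
  have i1 := ((exists_xi1_bound α n h l l' hα).choose_spec ⟨lam, hlam⟩).1
  have i2 := (((exists_xi2_bound α n h l l' hα).choose_spec ⟨lam, hlam⟩).1).const_mul 2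
  have i3 := integrable_crossDens_sing α n h h hlam hlam l l' hα
  have i12 : Integrable (fun y => xi1 x α ξ lam n l l' y + 2 * xi2 x α ξ lam n l l' y) volume :=
    i1.add i2
  have hae : (fun y => crossDens x α ξ lam (sing x α ξ lam n l) n l' y
      - (xi1 x α ξ lam n l l' y + 2 * xi2 x α ξ lam n l l' y)) =ᵐ[volume]
      fun y => ∑ j, pd j (xiField x α ξ lam n l l' j) y := by
    filter_upwards [ae_forall_ne x] with y hy using crossDens_sing_sub α n l h hlam hy l'
  -- Where ξ = 1 the radial component is -1/2 times the current plus 2i times the remainder. Both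
  -- defect functions have the same λ, so the limiting flux is zero.
  have key := integral_div_eq_radial α n
    (fun j y hy => contDiffAt_xiField α n h hlam l l' j hy)
    (fun j => HasCompactSupport.intro (h.hasCompactSupport n) fun y hy =>
      xiField_eq_zero α n l l' j hy) ((i3.sub i12).congr hae) hR hδ hδR (-(1 / 2))
    (2 * Complex.I) hlam hlam l l' hα fun y hy hyδ => by
      have hx1 : xiC ξ n y = 1 := by simp [xiC, (hδ1 y hyδ).1]
      have hp := pd_xiC_eq_zero_of_eq_one n (fun y hy => (hδ1 y hy).1) hyδ
      have ha := radial_aC (x := x) α n y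
      have ca : ∀ j, conj (aC x α n j y) = aC x α n j y := fun _ => Complex.conj_ofReal _
      simp only [xiField, hx1, hp, radialCurrent, radialRest, Fin.sum_univ_two, eC, map_add,
        map_mul, map_neg, Complex.conj_I, ca]
      linear_combination (-Complex.I * (conj (defectG x α lam n l y) * defectG x α lam n l' y)) * ha
        + (1 / 2 * (conj (defectG x α lam n l y)
            * ((((y - x n) 0 : ℝ) : ℂ) * pd 0 (defectG x α lam n l') y
              + (((y - x n) 1 : ℝ) : ℂ) * pd 1 (defectG x α lam n l') y)
          - defectG x α lam n l' y
            * ((((y - x n) 0 : ℝ) : ℂ) * conj (pd 0 (defectG x α lam n l) y)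
              + (((y - x n) 1 : ℝ) : ℂ) * conj (pd 1 (defectG x α lam n l) y)))) * Complex.I_sq
  rw [← integral_congr_ae hae, integral_sub i3 i12, integral_add i1 i2, integral_const_mul] at key
  rw [Xi]
  refine sub_eq_zero.1 (key.trans ?_)
  simp

/-- Green's identity for two singular functions at the same point. -/
lemma green_sing (h : IsCutoff x ξ) (h' : IsCutoff x ξ') (hlam : 0 < lam) (hlam' : 0 < lam')
    (l l' : Fin 2) (hα : α n ∈ Ioo (0 : ℝ) 1) :
    ((lam : ℂ) ^ 2 - (lam' : ℂ) ^ 2)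
        * inner ℂ (toL2 (sing x α ξ' lam' n l)) (toL2 (sing x α ξ lam n l'))
      - (∫ y, crossDens x α ξ lam (sing x α ξ' lam' n l) n l' y)
      + conj (∫ y, crossDens x α ξ' lam' (sing x α ξ lam n l') n l y)
      = if l = l' then -(((Real.pi * lam' ^ (2 * nu α n l) / (2 * Real.sin (Real.pi * α n)) : ℝ) : ℂ)
        - ((Real.pi * lam ^ (2 * nu α n l) / (2 * Real.sin (Real.pi * α n)) : ℝ) : ℂ)) else 0 := by
  obtain ⟨R, hR, h1, h2, δ, hδ, hδR, hδ1⟩ := h.exists_common_radius h' n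
  have hs := memLp_sing α n h l' hα hlam
  have hs' := memLp_sing α n h' l hα hlam'
  rw [inner_eq_integral (coeFn_toL2 hs') (coeFn_toL2 hs)]
  have i1 := (integrable_inner hs' hs).const_mul ((lam : ℂ) ^ 2 - (lam' : ℂ) ^ 2)
  have i2 := integrable_crossDens_sing α n h h' hlam hlam' l l' hα
  have i3 : Integrable (fun y => conj (crossDens x α ξ' lam' (sing x α ξ lam n l') n l y)) volume :=
    Complex.conjCLE.integrable_comp_iff.2 (integrable_crossDens_sing α n h' h hlam' hlam l' l hα)
  have i12 : Integrable (fun y => ((lam : ℂ) ^ 2 - (lam' : ℂ) ^ 2)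
      * inner ℂ (sing x α ξ' lam' n l y) (sing x α ξ lam n l' y)
      - crossDens x α ξ lam (sing x α ξ' lam' n l) n l' y) volume := i1.sub i2
  -- Subtracting the conjugate of the identity with the roles exchanged cancels the energy densities
  -- conj(Dχ')·Dχ, which need not be integrable one by one.
  set V : Fin 2 → Plane → ℂ := fun j y => crossField x α ξ lam (sing x α ξ' lam' n l) n l' j y
    - conj (crossField x α ξ' lam' (sing x α ξ lam n l') n l j y) with hV
  have c1 : ∀ j y, y ≠ x n →
      ContDiffAt ℝ 1 (crossField x α ξ lam (sing x α ξ' lam' n l) n l' j) y := fun j y hy =>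
    contDiffAt_crossField α n h hlam
      (fun z hz => (contDiffAt_sing α n h' hlam' l (hz n)).of_le (by norm_num)) l' j hy
  have c2 : ∀ j y, y ≠ x n →
      ContDiffAt ℝ 1 (crossField x α ξ' lam' (sing x α ξ lam n l') n l j) y := fun j y hy =>
    contDiffAt_crossField α n h' hlam'
      (fun z hz => (contDiffAt_sing α n h hlam l' (hz n)).of_le (by norm_num)) l j hy
  have hVs : ∀ j, HasCompactSupport (V j) := fun j => by
    refine HasCompactSupport.intro ((h.hasCompactSupport n).isCompact.union
      (h'.hasCompactSupport n).isCompact) fun y hy => ?_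
    rw [mem_union, not_or] at hy
    simp [hV, crossField_eq_zero α n _ _ _ hy.1, crossField_eq_zero α n _ _ _ hy.2]
  have hae : (fun y => ((lam : ℂ) ^ 2 - (lam' : ℂ) ^ 2)
      * inner ℂ (sing x α ξ' lam' n l y) (sing x α ξ lam n l' y)
      - crossDens x α ξ lam (sing x α ξ' lam' n l) n l' y
      + conj (crossDens x α ξ' lam' (sing x α ξ lam n l') n l y)) =ᵐ[volume]
      fun y => ∑ j, pd j (V j) y := by
    filter_upwards [ae_forall_ne x] with y hy
    have e1 := energy_sub_crossDens α n l' h hlam hy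
      ((contDiffAt_sing α n h' hlam' l (hy n)).differentiableAt (by norm_num))
    have e2 := congrArg conj (energy_sub_crossDens α n l h' hlam' hy
      ((contDiffAt_sing α n h hlam l' (hy n)).differentiableAt (by norm_num)))
    have e3 : ∀ j, pd j (V j) y = pd j (crossField x α ξ lam (sing x α ξ' lam' n l) n l' j) y
        - conj (pd j (crossField x α ξ' lam' (sing x α ξ lam n l') n l j) y) := fun j =>
      ((hasPd_pd ((c1 j y (hy n)).differentiableAt (by norm_num))).sub
        (hasPd_pd ((c2 j y (hy n)).differentiableAt (by norm_num))).conj).2 j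
    simp only [e3, Finset.sum_sub_distrib, ← e1]
    rw [← map_sum, ← e2, inner_complex]
    simp only [map_add, map_sub, map_mul, map_pow, Complex.conj_ofReal, Complex.conj_conj, map_sum]
    simp only [Fin.sum_univ_two]
    ring
  -- Where both cut-offs are 1, the two halves of V combine to the current with coefficient 1 and
  -- the remainder with coefficient -2i.
  have key := integral_div_eq_radial α n
    (fun j y hy => (c1 j y hy).sub (contDiffAt_conj (c2 j y hy))) hVs
    ((i12.add i3).congr hae) hR hδ hδR 1 (-2 * Complex.I) hlam hlam' l l' hα fun y hy hyδ => by
      have hx1 : xiC ξ n y = 1 := by simp [xiC, (hδ1 y hyδ).1]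
      have hx1' : xiC ξ' n y = 1 := by simp [xiC, (hδ1 y hyδ).2]
      have hp := pd_xiC_eq_zero_of_eq_one n (fun y hy => (hδ1 y hy).1) hyδ
      have hp' := pd_xiC_eq_zero_of_eq_one n (fun y hy => (hδ1 y hy).2) hyδ
      have ha := radial_aC (x := x) α n y
      have hu := conj_phase_mul x α n y
      have ca : ∀ j, conj (aC x α n j y) = aC x α n j y := fun _ => Complex.conj_ofReal _
      have cs : ∀ j, conj (sC x α n j y) = sC x α n j y := fun _ => Complex.conj_ofReal _
      simp only [crossField, hx1, hx1', hp, hp', radialCurrent, radialRest, Fin.sum_univ_two,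
        eC, wC, sing, map_add, map_mul, map_neg, map_sub, Complex.conj_I, Complex.conj_conj, ca, cs,
        map_one, map_zero]
      generalize (((y - x n) 0 : ℝ) : ℂ) = v0 at *
      generalize (((y - x n) 1 : ℝ) : ℂ) = v1 at *
      have hI := Complex.I_sq
      generalize conj (phase x α n y) = w at *
      clear i1 i2 i3 i12 c1 c2 hVs hae hs hs' hp hp' ca cs
      grind
  rw [← integral_congr_ae hae, integral_add i12 i3, integral_sub i1 i2, integral_const_mul,
    integral_conj] at key
  rw [key]
  split_ifs
  · push_cast
    have : (Real.sin (Real.pi * α n) : ℂ) ≠ 0 := by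
      rw [Complex.ofReal_ne_zero]
      exact (Real.sin_pos_of_pos_of_lt_pi (by have := hα.1; positivity)
        (by nlinarith [hα.2, Real.pi_pos])).ne'
    push_cast at this
    field_simp
    ring
  · rfl

/-- Not visible from the definition, whose second integral differentiates only one of the two
functions. It is Green's identity with coinciding parameters and cut-offs: the L² term and the flux
both vanish. -/
lemma Xi_conj (h : IsCutoff x ξ) (hlam : 0 < lam) (l l' : Fin 2) (hα : α n ∈ Ioo (0 : ℝ) 1) :
    conj (Xi x α ξ lam n l' l) = Xi x α ξ lam n l l' := by
  have := green_sing α n h h hlam hlam l l' hα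
  rw [integral_crossDens_self α n h hlam l l' hα, integral_crossDens_self α n h hlam l' l hα] at this
  simp only [sub_self, zero_mul, zero_sub, neg_zero, ite_self] at this
  linear_combination this

end pairing

/-! ### Mollification -/

-- Convolution with bumps of radius δ/(k+1) keeps all supports in the closed δ-thickening of the
-- support of f, and derivatives pass to f. The common compact set and the bounds independent of k
-- prepare a dominated convergence argument.
open ContinuousLinearMap in
lemma exists_mollification {f : Plane → ℂ} (hf : ContDiff ℝ 1 f) (hc : HasCompactSupport f)
    {U : Set Plane} (hU : IsOpen U) (hfU : tsupport f ⊆ U) :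
    ∃ (K : Set Plane) (C : ℝ) (F : ℕ → Plane → ℂ), IsCompact K ∧ K ⊆ U ∧
      (∀ k, ContDiff ℝ ∞ (F k) ∧ tsupport (F k) ⊆ K) ∧
      (∀ k y, ‖F k y‖ ≤ C ∧ ∀ j, ‖pd j (F k) y‖ ≤ C) ∧
      ∀ y, Tendsto (fun k => F k y) atTop (𝓝 (f y)) ∧
        ∀ j, Tendsto (fun k => pd j (F k) y) atTop (𝓝 (pd j f y)) := by
  obtain ⟨δ, hδ, hδU⟩ := hc.isCompact.exists_cthickening_subset_open hU hfU
  set r : ℕ → ℝ := fun k => δ / (k + 1) with hr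
  have hr0 : ∀ k, 0 < r k := fun k => by positivity
  have hrδ : ∀ k, r k ≤ δ := fun k => div_le_self hδ.le (by simp)
  have hrt : Tendsto r atTop (𝓝 0) := by
    simpa [hr, div_eq_mul_inv] using (tendsto_one_div_add_atTop_nhds_zero_nat (𝕜 := ℝ)).const_mul δ
  set φ : ℕ → ContDiffBump (0 : Plane) := fun k => ⟨r k / 2, r k, half_pos (hr0 k),
    half_lt_self (hr0 k)⟩ with hφ
  set M : ℕ → (Plane → ℂ) → Plane → ℂ := fun k g =>
    convolution ((φ k).normed volume) g (lsmul ℝ ℝ) volume with hM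
  have hcont : ∀ j, Continuous (pd j f) := fun j => continuous_iff_continuousAt.2 fun y =>
    (contDiffAt_pd (m := 0) hf.contDiffAt (by norm_num) j).continuousAt
  have hdM : ∀ g : Plane → ℂ, Continuous g → ∀ k y ε, (∀ z ∈ Metric.ball y (r k),
      dist (g z) (g y) ≤ ε) → dist (M k g y) (g y) ≤ ε := fun g hg k y ε h =>
    (φ k).dist_normed_convolution_le hg.aestronglyMeasurable h
  have hφi : ∀ k, LocallyIntegrable ((φ k).normed (volume : Measure Plane)) volume := fun k =>
    ((φ k).continuous_normed).locallyIntegrable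
  have hpd : ∀ k j y, pd j (M k f) y = M k (pd j f) y := fun k j y => by
    have h1 := hc.hasFDerivAt_convolution_right (lsmul ℝ ℝ : ℝ →L[ℝ] ℂ →L[ℝ] ℂ) (hφi k) hf y
    rw [pd, h1.fderiv, convolution_precompR_apply _ (hφi k) (hc.fderiv (𝕜 := ℝ))
      (hf.continuous_fderiv (by norm_num))]
    rfl
  have hbd : ∀ g : Plane → ℂ, Continuous g → HasCompactSupport g → ∃ C, ∀ k y, ‖M k g y‖ ≤ C := by
    intro g hg hgc
    obtain ⟨C, hC⟩ := hgc.exists_bound_of_continuous hg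
    refine ⟨C + C + C, fun k y => ?_⟩
    have := hdM g hg k y (C + C) fun z _ => (dist_le_norm_add_norm _ _).trans
      (add_le_add (hC z) (hC y))
    calc ‖M k g y‖ ≤ dist (M k g y) (g y) + ‖g y‖ := by
          rw [dist_eq_norm]; simpa using norm_add_le (M k g y - g y) (g y)
      _ ≤ _ := add_le_add this (hC y)
  have hlim : ∀ g : Plane → ℂ, Continuous g → ∀ y, Tendsto (fun k => M k g y) atTop (𝓝 (g y)) := by
    intro g hg y
    rw [Metric.tendsto_nhds]
    intro ε hε
    obtain ⟨ρ, hρ, hρ'⟩ := Metric.continuousAt_iff.1 hg.continuousAt (ε / 2) (half_pos hε)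
    filter_upwards [hrt.eventually (gt_mem_nhds hρ)] with k hk
    refine (hdM g hg k y (ε / 2) fun z hz => (hρ' ?_).le).trans_lt (half_lt_self hε)
    exact (Metric.mem_ball.1 hz).trans hk
  obtain ⟨C, hC⟩ := hbd f hf.continuous hc
  obtain ⟨D, hD⟩ := hbd _ (hcont 0) (hasCompactSupport_pd hc 0)
  obtain ⟨E, hE⟩ := hbd _ (hcont 1) (hasCompactSupport_pd hc 1)
  refine ⟨Metric.cthickening δ (tsupport f), max C (max D E), fun k => M k f,
    hc.isCompact.cthickening, hδU, fun k => ⟨?_, ?_⟩, fun k y => ⟨?_, ?_⟩, fun y => ⟨?_, ?_⟩⟩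
  · exact (φ k).hasCompactSupport_normed.contDiff_convolution_left _ (φ k).contDiff_normed
      hf.continuous.locallyIntegrable
  · refine closure_minimal (fun y hy => ?_) Metric.isClosed_cthickening
    by_contra hy'
    refine hy ?_
    have h0 : ∀ z ∈ Metric.ball y (r k), f z = 0 := fun z hz => by
      by_contra hz'
      refine hy' (Metric.mem_cthickening_of_dist_le y z δ _ (subset_tsupport _ hz') ?_)
      rw [dist_comm]
      exact (Metric.mem_ball.1 hz).le.trans (hrδ k)
    have hy0 := h0 y (Metric.mem_ball_self (hr0 k))
    have := (φ k).normed_convolution_eq_right (μ := (volume : Measure Plane)) (g := f) (x₀ := y)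
      fun z hz => by rw [h0 z hz, hy0]
    exact this.trans hy0
  · exact (hC k y).trans (le_max_left _ _)
  · intro j
    rw [hpd]
    fin_cases j
    · exact (hD k y).trans ((le_max_left _ _).trans (le_max_right _ _))
    · exact (hE k y).trans ((le_max_right _ _).trans (le_max_right _ _))
  · exact hlim f hf.continuous y
  · intro j
    simp only [hpd]
    exact hlim _ (hcont j) y

/-! ### Dominated convergence in `L²` -/

lemma toL2_congr {E : Type*} [NormedAddCommGroup E] {f g : Plane → E} (hf : MemLp f 2 volume)
    (h : f =ᵐ[volume] g) : toL2 f = toL2 g :=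
  Lp.ext ((coeFn_toL2 hf).trans (h.trans (coeFn_toL2 ((memLp_congr_ae h).1 hf)).symm))

lemma toL2_coeFn {E : Type*} [NormedAddCommGroup E] (u : Lp E 2 (volume : Measure Plane)) :
    toL2 (u : Plane → E) = u := Lp.ext (coeFn_toL2 (Lp.memLp u))

lemma toL2_eq {E : Type*} [NormedAddCommGroup E] {u : Lp E 2 (volume : Measure Plane)}
    {f : Plane → E} (h : u =ᵐ[volume] f) : toL2 f = u := by
  rw [← toL2_congr (Lp.memLp u) h, toL2_coeFn]

lemma tendsto_toL2 {E : Type*} [NormedAddCommGroup E] [InnerProductSpace ℂ E]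
    {F : ℕ → Plane → E} {f : Plane → E} {g : Plane → ℝ} (hF : ∀ k, MemLp (F k) 2 volume)
    (hf : MemLp f 2 volume) (hg : MemLp g 2 volume)
    (hle : ∀ k, ∀ᵐ y ∂(volume : Measure Plane), ‖F k y‖ ≤ g y)
    (hlim : ∀ᵐ y ∂(volume : Measure Plane), Tendsto (fun k => F k y) atTop (𝓝 (f y))) :
    Tendsto (fun k => toL2 (F k)) atTop (𝓝 (toL2 f)) := by
  rw [tendsto_iff_norm_sub_tendsto_zero]
  have hsq : ∀ k, ‖toL2 (F k) - toL2 f‖ ^ 2 = ∫ y, ‖F k y - f y‖ ^ 2 := fun k => by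
    have h1 : (toL2 (F k) - toL2 f : Lp E 2 (volume : Measure Plane))
        =ᵐ[volume] fun y => F k y - f y := by
      filter_upwards [Lp.coeFn_sub (toL2 (F k)) (toL2 f), coeFn_toL2 (hF k), coeFn_toL2 hf]
        with y h1 h2 h3
      rw [h1, Pi.sub_apply, h2, h3]
    have h2 := inner_eq_integral h1 h1
    simp only [inner_self_eq_norm_sq_to_K, ← RCLike.ofReal_pow] at h2
    exact Complex.ofReal_injective (h2.trans integral_complex_ofReal)
  have hlim2 : Tendsto (fun k => ∫ y, ‖F k y - f y‖ ^ 2) atTop (𝓝 (∫ _ : Plane, (0 : ℝ))) := by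
    refine tendsto_integral_of_dominated_convergence (fun y => (g y + g y) ^ 2)
      (fun k => (((hF k).sub hf).1.norm.pow 2)) ((hg.add hg).integrable_sq) (fun k => ?_) ?_
    · filter_upwards [hle k, ae_all_iff.2 hle, hlim] with y h1 h2 h3
      have h4 : ‖f y‖ ≤ g y := le_of_tendsto h3.norm (.of_forall h2)
      rw [norm_pow, norm_norm]
      exact pow_le_pow_left₀ (norm_nonneg _) ((norm_sub_le _ _).trans (add_le_add h1 h4)) _
    · filter_upwards [hlim] with y hy
      have := ((hy.sub (tendsto_const_nhds (x := f y))).norm.pow 2)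
      simpa using this
  rw [integral_zero] at hlim2
  have := hlim2.sqrt
  simp only [← hsq, Real.sqrt_zero] at this
  simpa using this

/-! ### The graph of the magnetic gradient -/

lemma IsTest.add {x : Fin N → Plane} {f g : Plane → ℂ} (hf : IsTest x f) (hg : IsTest x g) :
    IsTest x (fun y => f y + g y) :=
  ⟨hf.1.add hg.1, hf.2.1.add hg.2.1, (tsupport_add f g).trans (union_subset hf.2.2 hg.2.2)⟩

lemma IsTest.const_mul {x : Fin N → Plane} {f : Plane → ℂ} (c : ℂ) (hf : IsTest x f) :
    IsTest x (fun y => c * f y) :=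
  ⟨contDiff_const.mul hf.1, hf.2.1.mul_left, (tsupport_mul_subset_right (f := fun _ => c)
    (g := f)).trans hf.2.2⟩

lemma magD_add {x : Fin N → Plane} (α : Fin N → ℝ) {f g : Plane → ℂ} {y : Plane}
    (hf : DifferentiableAt ℝ f y) (hg : DifferentiableAt ℝ g y) :
    magD x α (fun z => f z + g z) y = magD x α f y + magD x α g y := by
  ext j
  simp only [magD_apply, PiLp.add_apply, ((hasPd_pd hf).add (hasPd_pd hg)).2 j]
  ring

lemma magD_const_mul {x : Fin N → Plane} (α : Fin N → ℝ) {f : Plane → ℂ} {y : Plane} (c : ℂ)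
    (hf : DifferentiableAt ℝ f y) :
    magD x α (fun z => c * f z) y = c • magD x α f y := by
  ext j
  simp only [magD_apply, PiLp.smul_apply, ((hasPd_pd hf).const_mul c).2 j, smul_eq_mul]
  ring

lemma IsTest.differentiable {x : Fin N → Plane} {f : Plane → ℂ} (hf : IsTest x f) (y : Plane) :
    DifferentiableAt ℝ f y := hf.contDiff_one.differentiable (by norm_num) y

/-- The graph of `-i∇ + ∑ₙ A_n` on test functions. -/
def testGraph (x : Fin N → Plane) (α : Fin N → ℝ) :
    Submodule ℂ (L2 × Lp CVec 2 (volume : Measure Plane)) where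
  carrier := {p | ∃ f, IsTest x f ∧ p.1 =ᵐ[volume] f ∧ p.2 =ᵐ[volume] magD x α f}
  zero_mem' := by
    refine ⟨fun _ => 0, ⟨contDiff_const, HasCompactSupport.zero, by simp [tsupport]⟩,
      Lp.coeFn_zero _ _ _, (Lp.coeFn_zero _ _ _).trans (.of_forall fun y => ?_)⟩
    ext j
    simp [magD_apply, (hasPd_const 0 y).2]
  add_mem' := by
    rintro p q ⟨f, hf, h1, h2⟩ ⟨g, hg, h3, h4⟩
    refine ⟨_, hf.add hg, ?_, ?_⟩
    · filter_upwards [Lp.coeFn_add p.1 q.1, h1, h3] with y e1 e2 e3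
      rw [Prod.fst_add, e1, Pi.add_apply, e2, e3]
    · filter_upwards [Lp.coeFn_add p.2 q.2, h2, h4] with y e1 e2 e3
      rw [Prod.snd_add, e1, Pi.add_apply, e2, e3, magD_add α (hf.differentiable y)
        (hg.differentiable y)]
  smul_mem' := by
    rintro c p ⟨f, hf, h1, h2⟩
    refine ⟨_, hf.const_mul c, ?_, ?_⟩
    · filter_upwards [Lp.coeFn_smul c p.1, h1] with y e1 e2
      rw [Prod.smul_fst, e1, Pi.smul_apply, e2, smul_eq_mul]
    · filter_upwards [Lp.coeFn_smul c p.2, h2] with y e1 e2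
      rw [Prod.smul_snd, e1, Pi.smul_apply, e2, magD_const_mul α c (hf.differentiable y)]

/-- The closure of the graph of `-i∇ + ∑ₙ A_n` on test functions. -/
def formGraph (x : Fin N → Plane) (α : Fin N → ℝ) :
    Submodule ℂ (L2 × Lp CVec 2 (volume : Measure Plane)) := (testGraph x α).topologicalClosure

lemma isClosed_formGraph (x : Fin N → Plane) (α : Fin N → ℝ) :
    IsClosed (formGraph x α : Set (L2 × Lp CVec 2 (volume : Measure Plane))) :=
  Submodule.isClosed_topologicalClosure _

lemma IsTest.mem_testGraph {x : Fin N → Plane} (α : Fin N → ℝ) {f : Plane → ℂ} (hf : IsTest x f) :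
    (toL2 f, toL2 (magD x α f)) ∈ testGraph x α :=
  ⟨f, hf, coeFn_toL2 hf.memLp, coeFn_toL2 (hf.memLp_magD α)⟩

lemma mem_formGraph_of_tendsto {x : Fin N → Plane} {α : Fin N → ℝ}
    {p : ℕ → L2 × Lp CVec 2 (volume : Measure Plane)}
    {q : L2 × Lp CVec 2 (volume : Measure Plane)} (hp : ∀ k, p k ∈ formGraph x α)
    (h1 : Tendsto (fun k => (p k).1) atTop (𝓝 q.1)) (h2 : Tendsto (fun k => (p k).2) atTop (𝓝 q.2)) :
    q ∈ formGraph x α :=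
  (isClosed_formGraph x α).mem_of_tendsto (h1.prodMk_nhds h2) (.of_forall hp)

/-- A property closed under limits holds on the graph if it holds for test functions. -/
lemma formGraph_induction {x : Fin N → Plane} {α : Fin N → ℝ}
    {P : Set (L2 × Lp CVec 2 (volume : Measure Plane))} (hP : IsClosed P)
    (h : ∀ f, IsTest x f → (toL2 f, toL2 (magD x α f)) ∈ P) : (formGraph x α : Set _) ⊆ P := by
  refine closure_minimal ?_ hP
  rintro ⟨u, v⟩ ⟨f, hf, h1, h2⟩
  have := h f hf
  rwa [toL2_eq h1, toL2_eq h2] at this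

/-- Mollification away from the points: the approximants share a compact set on which the potential
is bounded. -/
lemma mem_formGraph_of_contDiff {x : Fin N → Plane} (α : Fin N → ℝ) {f : Plane → ℂ}
    (hf : ContDiff ℝ 1 f) (hc : HasCompactSupport f) (hs : tsupport f ⊆ (range x)ᶜ) :
    (toL2 f, toL2 (magD x α f)) ∈ formGraph x α := by
  have hU : IsOpen (range x)ᶜ := (finite_range x).isClosed.isOpen_compl
  obtain ⟨K, C, F, hK, hKU, hF, hb, hlim⟩ := exists_mollification hf hc hU hs
  have hT : ∀ k, IsTest x (F k) := fun k => ⟨(hF k).1,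
    hK.of_isClosed_subset (isClosed_tsupport _) (hF k).2, (hF k).2.trans hKU⟩
  obtain ⟨A, hA⟩ : ∃ A : ℝ, ∀ y ∈ K, ∀ j, ‖((potTotal x α y j : ℝ) : ℂ)‖ ≤ A := by
    have h1 : ∀ j : Fin 2, ∃ A, ∀ y ∈ K, ‖((potTotal x α y j : ℝ) : ℂ)‖ ≤ A := fun j =>
      hK.exists_bound_of_continuousOn fun y hy =>
        (continuousAt_potTotal x α j fun m hm => hKU hy ⟨m, hm.symm⟩).continuousWithinAt
    choose A hA using h1
    refine ⟨max (A 0) (A 1), fun y hy j => (hA j y hy).trans ?_⟩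
    fin_cases j
    exacts [le_max_left _ _, le_max_right _ _]
  have hind : ∀ c : ℝ, MemLp (K.indicator fun _ => c) 2 (volume : Measure Plane) := fun c =>
    memLp_indicator_const 2 hK.measurableSet c (Or.inr hK.measure_lt_top.ne)
  refine mem_formGraph_of_tendsto (fun k => Submodule.le_topologicalClosure _
    ((hT k).mem_testGraph α)) ?_ ?_
  · refine tendsto_toL2 (fun k => (hT k).memLp)
      (hf.continuous.memLp_of_hasCompactSupport hc) (hind C) (fun k => .of_forall fun y => ?_)
      (.of_forall fun y => (hlim y).1)
    by_cases hy : y ∈ K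
    · rw [indicator_of_mem hy]; exact (hb k y).1
    · rw [indicator_of_notMem hy, image_eq_zero_of_notMem_tsupport fun h => hy ((hF k).2 h),
        norm_zero]
  · refine tendsto_toL2 (fun k => (hT k).memLp_magD α) (memLp_magD α hf hc hs)
      (hind (2 * (C + C * A))) (fun k => .of_forall fun y => ?_) (.of_forall fun y => ?_)
    · by_cases hy : y ∈ K
      · rw [indicator_of_mem hy]
        refine norm_cvec_le _ fun j => ?_
        rw [magD_apply]
        refine (norm_add_le _ _).trans (add_le_add ?_ ?_)
        · simpa using (hb k y).2 j
        · rw [norm_mul]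
          exact mul_le_mul (hb k y).1 (hA y hy j) (norm_nonneg _)
            ((norm_nonneg _).trans (hb k y).1)
      · rw [indicator_of_notMem hy, magD_eq_zero x α fun h => hy ((hF k).2 h), norm_zero]
    · have : Tendsto (fun k => WithLp.toLp 2 fun j => magD x α (F k) y j) atTop
          (𝓝 (WithLp.toLp 2 fun j => magD x α f y j)) := by
        refine ((PiLp.continuous_toLp 2 fun _ : Fin 2 => ℂ).tendsto _).comp
          (tendsto_pi_nhds.2 fun j => ?_)
        simp only [magD_apply]
        exact (((hlim y).2 j).const_mul _).neg.add ((hlim y).1.mul_const _)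
      exact this

/-! ### Approximation of functions vanishing at one point -/

lemma magD_cutAway_mul {x : Fin N → Plane} (α : Fin N → ℝ) (c : Plane) (ε : ℝ) {f : Plane → ℂ}
    {y : Plane} (hf : DifferentiableAt ℝ f y) :
    magD x α (fun z => (cutAway c ε z : ℂ) * f z) y = (cutAway c ε y : ℂ) • magD x α f y
      + (-(Complex.I * f y) * (cutDens c ε y : ℂ)) • toCVec (y - c) := by
  ext j
  simp only [magD_apply, PiLp.add_apply, PiLp.smul_apply, smul_eq_mul, toCVec,
    ((hasPd_cutAway c ε y).mul (hasPd_pd hf)).2 j]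
  push_cast
  ring

lemma norm_toCVec (v : Plane) : ‖toCVec v‖ = ‖v‖ := by
  simp [EuclideanSpace.norm_eq, toCVec]

/-- A function of size r^(-β) with β < 0 can be cut away near x_n. The commutator term f ∇cut is
O(r^(-β-1)) uniformly in the cut-off radius, which is square integrable because β + 1 < 1, and at
each point it vanishes eventually. -/
lemma mem_formGraph_of_singular {x : Fin N → Plane} (α : Fin N → ℝ) (n : Fin N) {f : Plane → ℂ}
    (hf : ∀ y, y ≠ x n → ContDiffAt ℝ 1 f y) {T : Set Plane} (hT : IsCompact T)
    (hfT : ∀ y, y ∉ T → f y = 0) (hxT : ∀ m, m ≠ n → x m ∉ T) {R β : ℝ} (hβ : β < 0)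
    (hTR : T ⊆ Metric.ball (x n) R) (hb : UB (x n) R β (fun _ : Unit => f))
    (hf2 : MemLp f 2 volume) (hD2 : MemLp (magD x α f) 2 volume) :
    (toL2 f, toL2 (magD x α f)) ∈ formGraph x α := by
  set e : ℕ → ℝ := fun k => 1 / ((k : ℝ) + 1) with he
  have he0 : ∀ k, 0 < e k := fun k => by positivity
  have het : Tendsto e atTop (𝓝 0) := tendsto_one_div_add_atTop_nhds_zero_nat
  set F : ℕ → Plane → ℂ := fun k y => (cutAway (x n) (e k) y : ℂ) * f y with hF
  have hF1 : ∀ k, ContDiff ℝ 1 (F k) := fun k => contDiff_cutAway_mul (he0 k) hf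
  have hFs : ∀ k, tsupport (F k) ⊆ T ∩ (Metric.ball (x n) (e k))ᶜ := fun k => by
    refine closure_minimal (fun y hy => ⟨?_, fun hy' => hy ?_⟩)
      (hT.isClosed.inter Metric.isOpen_ball.isClosed_compl)
    · by_contra h; exact hy (by simp [hF, hfT y h])
    · rw [Metric.mem_ball, dist_eq_norm] at hy'
      simp [hF, cutAway_eq_zero (he0 k) hy'.le]
  have hFc : ∀ k, HasCompactSupport (F k) := fun k =>
    hT.of_isClosed_subset (isClosed_tsupport _) ((hFs k).trans inter_subset_left)
  have hFx : ∀ k, tsupport (F k) ⊆ (range x)ᶜ := fun k y hy => by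
    rintro ⟨m, rfl⟩
    rcases eq_or_ne m n with rfl | hm
    · exact (hFs k hy).2 (Metric.mem_ball_self (he0 k))
    · exact hxT m hm (hFs k hy).1
  obtain ⟨K, hK, hKd⟩ := exists_cutDens_le
  obtain ⟨C, hC, hCb⟩ := hb.exists_le_radPow fun _ y hy => hfT y fun h => hy (hTR h)
  have hcut1 : ∀ k y, ‖(cutAway (x n) (e k) y : ℂ)‖ ≤ 1 := fun k y => by
    rw [Complex.norm_real, Real.norm_eq_abs, abs_le]
    exact ⟨by linarith [(cutAway_mem (x n) (e k) y).1], (cutAway_mem (x n) (e k) y).2⟩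
  have hev : ∀ y, y ≠ x n → ∀ᶠ k in atTop, 2 * e k < ‖y - x n‖ := fun y hy => by
    have h0 : 0 < ‖y - x n‖ := norm_pos_iff.2 (sub_ne_zero.2 hy)
    have := (het.const_mul 2)
    rw [mul_zero] at this
    exact this.eventually (gt_mem_nhds h0)
  have hne : ∀ᵐ y ∂(volume : Measure Plane), y ≠ x n := by
    filter_upwards [ae_forall_ne x] with y hy using hy n
  refine mem_formGraph_of_tendsto (fun k => mem_formGraph_of_contDiff α (hF1 k) (hFc k) (hFx k))
    ?_ ?_
  · refine tendsto_toL2 (fun k => (hF1 k).continuous.memLp_of_hasCompactSupport (hFc k)) hf2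
      hf2.norm (fun k => .of_forall fun y => ?_) ?_
    · rw [hF, norm_mul]
      exact mul_le_of_le_one_left (norm_nonneg _) (hcut1 k y)
    · filter_upwards [hne] with y hy
      refine tendsto_const_nhds.congr' ?_
      filter_upwards [hev y hy] with k hk
      simp [hF, cutAway_eq_one (he0 k) hk.le]
  · refine tendsto_toL2 (fun k => memLp_magD α (hF1 k) (hFc k) (hFx k)) hD2
      (hD2.norm.add ((memLp_radPow (x n) R (β := β + 1) (by linarith)).const_mul (C * K)))
      (fun k => ?_) ?_
    · filter_upwards [hne] with y hy
      have h0 : 0 < ‖y - x n‖ := norm_pos_iff.2 (sub_ne_zero.2 hy)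
      rw [hF, magD_cutAway_mul α _ _ ((hf y hy).differentiableAt (by norm_num))]
      refine (norm_add_le _ _).trans (add_le_add ?_ ?_)
      · rw [norm_smul]
        exact mul_le_of_le_one_left (norm_nonneg _) (hcut1 k y)
      · rw [norm_smul, norm_toCVec, norm_mul, norm_neg, norm_mul, Complex.norm_I, one_mul,
          Complex.norm_real, Real.norm_eq_abs, abs_of_nonneg (cutDens_nonneg _ _ _)]
        have h1 := hCb () y hy
        have h2 := hKd (x n) (e k) y (he0 k) hy
        by_cases hyR : y ∈ Metric.ball (x n) R
        · have e1 : radPow (x n) R (β + 1) y = radPow (x n) R β y * ‖y - x n‖⁻¹ := by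
            simp only [radPow, indicator_of_mem hyR]
            rw [neg_add, Real.rpow_add h0, Real.rpow_neg_one]
          simp only [e1]
          calc ‖f y‖ * cutDens (x n) (e k) y * ‖y - x n‖
              ≤ (C * radPow (x n) R β y) * (K / ‖y - x n‖ ^ 2) * ‖y - x n‖ := by
                have := cutDens_nonneg (x n) (e k) y
                have := mul_nonneg hC (radPow_nonneg (x n) R β y)
                gcongr
            _ = C * K * (radPow (x n) R β y * ‖y - x n‖⁻¹) := by field_simp
        · rw [hfT y fun h => hyR (hTR h)]
          simp only [norm_zero, zero_mul]
          exact mul_nonneg (mul_nonneg hC hK.le) (radPow_nonneg _ _ _ _)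
    · filter_upwards [hne] with y hy
      refine tendsto_const_nhds.congr' ?_
      filter_upwards [hev y hy] with k hk
      rw [hF, magD_cutAway_mul α _ _ ((hf y hy).differentiableAt (by norm_num)),
        cutAway_eq_one (he0 k) hk.le, cutDens_eq_zero_of_gt (he0 k) hk.le]
      simp

/-! ### Weak gradients -/

lemma isOpen_compl_range (x : Fin N → Plane) : IsOpen (range x)ᶜ :=
  (finite_range x).isClosed.isOpen_compl

lemma ae_mem_compl_range (x : Fin N → Plane) :
    ∀ᵐ y ∂(volume : Measure Plane), y ∈ (range x)ᶜ := by
  filter_upwards [ae_forall_ne x] with y hy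
  rintro ⟨m, rfl⟩
  exact hy m rfl

lemma ne_of_mem_compl_range {x : Fin N → Plane} {y : Plane} (hy : y ∈ (range x)ᶜ) (m : Fin N) :
    y ≠ x m := fun h => hy ⟨m, h.symm⟩

lemma continuous_mul_of_tsupport {x : Fin N → Plane} {h f : Plane → ℂ}
    (hh : ∀ y, (∀ m, y ≠ x m) → ContinuousAt h y) (hf : Continuous f)
    (hs : tsupport f ⊆ (range x)ᶜ) : Continuous (fun y => h y * f y) := by
  refine continuous_iff_continuousAt.2 fun y => ?_
  by_cases hy : y ∈ tsupport f
  · exact (hh y (ne_of_mem_compl_range (hs hy))).mul hf.continuousAt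
  · refine (continuousAt_const (y := (0 : ℂ))).congr ?_
    filter_upwards [(isClosed_tsupport f).isOpen_compl.mem_nhds hy] with z hz
    rw [image_eq_zero_of_notMem_tsupport hz, mul_zero]

lemma tsupport_pd_subset (f : Plane → ℂ) (j : Fin 2) : tsupport (pd j f) ⊆ tsupport f :=
  closure_minimal (fun y hy => by
    by_contra h; exact hy (pd_eq_zero_of_notMem h j)) (isClosed_tsupport _)

lemma continuous_pd {f : Plane → ℂ} (hf : ContDiff ℝ 1 f) (j : Fin 2) : Continuous (pd j f) :=
  continuous_iff_continuousAt.2 fun _ =>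
    (contDiffAt_pd (m := 0) hf.contDiffAt (by norm_num) j).continuousAt

/-- The fundamental lemma of the calculus of variations on the open complement of the points, which
has full measure; real test functions already separate. -/
lemma IsWeakGrad.ae_eq {x : Fin N → Plane} {φ : Plane → ℂ} {g g' : Plane → CVec}
    (h : IsWeakGrad x φ g) (h' : IsWeakGrad x φ g') : g =ᵐ[volume] g' := by
  have hj : ∀ j : Fin 2, ∀ᵐ y ∂(volume : Measure Plane), y ∈ (range x)ᶜ → g y j - g' y j = 0 := by
    intro j
    have hl : ∀ g : Plane → CVec, LocallyIntegrableOn g (range x)ᶜ volume →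
        LocallyIntegrableOn (fun y => g y j) (range x)ᶜ volume := fun g hg y hy => by
      obtain ⟨U, hU, hi⟩ := hg y hy
      exact ⟨U, hU, (EuclideanSpace.proj j : CVec →L[ℂ] ℂ).integrable_comp hi⟩
    have hm : ∀ g : Plane → CVec, LocallyIntegrableOn g (range x)ᶜ volume → ∀ f : Plane → ℂ,
        Continuous f → HasCompactSupport f → tsupport f ⊆ (range x)ᶜ →
        Integrable (fun y => g y j * f y) volume := fun g hg f hf hc hs => by
      have h1 : IntegrableOn (fun y => g y j) (tsupport f) volume :=
        (hl g hg).integrableOn_compact_subset hs hc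
      have h2 : IntegrableOn (fun y => g y j * f y) (tsupport f) volume :=
        h1.mul_continuousOn hf.continuousOn hc
      exact (integrableOn_iff_integrable_of_support_subset fun y hy => by
        by_contra h0; exact hy (by simp [image_eq_zero_of_notMem_tsupport h0])).1 h2
    refine (isOpen_compl_range x).ae_eq_zero_of_integral_contDiff_smul_eq_zero
      ((hl g h.1).sub (hl g' h'.1)) fun f hf hc hs => ?_
    have hs' : tsupport (fun y => (f y : ℂ)) ⊆ tsupport f :=
      closure_mono fun y hy => by simpa using hy
    have hc' : HasCompactSupport fun y => (f y : ℂ) :=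
      hc.comp_left (g := fun t : ℝ => (t : ℂ)) Complex.ofReal_zero
    have hT : IsTest x (fun y => (f y : ℂ)) :=
      ⟨Complex.ofRealCLM.contDiff.comp hf, hc', hs'.trans hs⟩
    have e : (fun y => f y • (g y j - g' y j)) = fun y => g y j * (f y : ℂ) - g' y j * (f y : ℂ) := by
      funext y; rw [Complex.real_smul]; ring
    change ∫ y, f y • (g y j - g' y j) = 0
    rw [e, integral_sub (hm g h.1 _ hT.1.continuous hT.2.1 hT.2.2)
      (hm g' h'.1 _ hT.1.continuous hT.2.1 hT.2.2), h.2 _ hT j, h'.2 _ hT j, sub_self]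
  filter_upwards [hj 0, hj 1, ae_mem_compl_range x] with y h0 h1 hy
  ext j
  fin_cases j
  exacts [sub_eq_zero.1 (h0 hy), sub_eq_zero.1 (h1 hy)]

lemma IsWeakGrad.congr {x : Fin N → Plane} {φ φ' : Plane → ℂ} {g : Plane → CVec}
    (h : IsWeakGrad x φ g) (hφ : φ =ᵐ[volume] φ') : IsWeakGrad x φ' g := by
  refine ⟨h.1, fun f hf j => ?_⟩
  rw [h.2 f hf j]
  congr 1
  exact integral_congr_ae (by filter_upwards [hφ] with y hy; rw [hy])

lemma IsWeakGrad.weakGrad_ae_eq {x : Fin N → Plane} {φ : Plane → ℂ} {g : Plane → CVec}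
    (h : IsWeakGrad x φ g) : weakGrad x φ =ᵐ[volume] g := by
  have h1 : ∃ g, IsWeakGrad x φ g := ⟨g, h⟩
  rw [weakGrad, dif_pos h1]
  exact h1.choose_spec.ae_eq h

lemma continuousAt_toCVec_potTotal (x : Fin N → Plane) (α : Fin N → ℝ) {y : Plane}
    (hy : ∀ m, y ≠ x m) : ContinuousAt (fun z => toCVec (potTotal x α z)) y :=
  (PiLp.continuous_toLp 2 fun _ : Fin 2 => ℂ).continuousAt.comp
    (continuousAt_pi.2 fun j => continuousAt_potTotal x α j hy)

/-- A classical gradient is a weak gradient. -/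
lemma isWeakGrad_cGrad {x : Fin N → Plane} {F : Plane → ℂ}
    (hF : ∀ y, (∀ m, y ≠ x m) → ContDiffAt ℝ 1 F y) : IsWeakGrad x F (cGrad F) := by
  have hpd : ∀ j y, (∀ m, y ≠ x m) → ContinuousAt (pd j F) y := fun j y hy =>
    (contDiffAt_pd (m := 0) (hF y hy) (by norm_num) j).continuousAt
  refine ⟨ContinuousOn.locallyIntegrableOn (fun y hy => ContinuousAt.continuousWithinAt ?_)
    (isOpen_compl_range x).measurableSet, fun f hf j => ?_⟩
  · exact (PiLp.continuous_toLp 2 fun _ : Fin 2 => ℂ).continuousAt.comp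
      (continuousAt_pi.2 fun j => hpd j y (ne_of_mem_compl_range hy))
  · have hC : ContDiff ℝ 1 (fun y => F y * f y) := contDiff_iff_contDiffAt.2 fun y => by
      by_cases hy : y ∈ tsupport f
      · exact (hF y (ne_of_mem_compl_range (hf.2.2 hy))).mul hf.contDiff_one.contDiffAt
      · refine (contDiffAt_const (c := (0 : ℂ))).congr_of_eventuallyEq ?_
        filter_upwards [(isClosed_tsupport f).isOpen_compl.mem_nhds hy] with z hz
        rw [image_eq_zero_of_notMem_tsupport hz, mul_zero]
    have h0 := integral_pd_eq_zero hC hf.2.1.mul_left j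
    have e : (fun y => pd j (fun y => F y * f y) y)
        =ᵐ[volume] fun y => pd j F y * f y + F y * pd j f y := by
      filter_upwards [ae_forall_ne x] with y hy
      exact ((hasPd_pd ((hF y hy).differentiableAt (by norm_num))).mul
        (hasPd_pd (hf.differentiable y))).2 j
    have i1 : Integrable (fun y => pd j F y * f y) volume :=
      (continuous_mul_of_tsupport (hpd j) hf.1.continuous
        hf.2.2).integrable_of_hasCompactSupport hf.2.1.mul_left
    have i2 : Integrable (fun y => F y * pd j f y) volume :=
      (continuous_mul_of_tsupport (fun y hy => (hF y hy).continuousAt)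
        (continuous_pd hf.contDiff_one j)
        ((tsupport_pd_subset f j).trans hf.2.2)).integrable_of_hasCompactSupport
        (hasCompactSupport_pd hf.2.1 j).mul_left
    rw [integral_congr_ae e, integral_add i1 i2] at h0
    exact eq_neg_of_add_eq_zero_left h0

/-- The gradient recovered from the magnetic gradient. -/
def gradOf (x : Fin N → Plane) (α : Fin N → ℝ) (φ : Plane → ℂ) (v : Plane → CVec) (y : Plane) :
    CVec := Complex.I • (v y - φ y • toCVec (potTotal x α y))

lemma magField_gradOf (x : Fin N → Plane) (α : Fin N → ℝ) (φ : Plane → ℂ) (v : Plane → CVec)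
    (y : Plane) : magField (potTotal x α) φ (gradOf x α φ v) y = v y := by
  rw [magField, gradOf, smul_smul, Complex.I_mul_I]
  module

/-- For a fixed test function the integration by parts formula is the vanishing of a continuous
functional on L² × L². It holds on the test graph and hence on its closure. -/
lemma isWeakGrad_of_mem {x : Fin N → Plane} {α : Fin N → ℝ} {φ : L2}
    {v : Lp CVec 2 (volume : Measure Plane)} (h : (φ, v) ∈ formGraph x α) :
    IsWeakGrad x φ (gradOf x α φ v) := by
  refine ⟨?_, fun f hf j => ?_⟩
  · have h1 : LocallyIntegrableOn v (range x)ᶜ volume :=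
      ((Lp.memLp v).locallyIntegrable (by norm_num)).locallyIntegrableOn _
    have h2 : LocallyIntegrableOn φ (range x)ᶜ volume :=
      ((Lp.memLp φ).locallyIntegrable (by norm_num)).locallyIntegrableOn _
    have h3 : LocallyIntegrableOn (fun y => φ y • toCVec (potTotal x α y)) (range x)ᶜ volume :=
      h2.smul_continuousOn (isOpen_compl_range x).isLocallyClosed fun y hy =>
        (continuousAt_toCVec_potTotal x α (ne_of_mem_compl_range hy)).continuousWithinAt
    exact (h1.sub h3).smul Complex.I
  -- The coefficient of φ is ∂_j f - i A_j f, written as 2∂_j f - i(Df)_j so that continuity is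
  -- inherited from Df although A is singular.
  · set h1 : Plane → ℂ := fun y => conj (2 * pd j f y - Complex.I * magD x α f y j) with hh1
    set h2 : Plane → CVec := fun y => EuclideanSpace.single j (conj (Complex.I * f y)) with hh2
    have c1 : Continuous h1 := Complex.continuous_conj.comp
      ((continuous_const.mul (continuous_pd hf.contDiff_one j)).sub (continuous_const.mul
        ((EuclideanSpace.proj j : CVec →L[ℂ] ℂ).continuous.comp
          (continuous_magD α hf.contDiff_one hf.2.2))))
    have c2 : Continuous h2 := by
      refine (PiLp.continuous_toLp 2 fun _ : Fin 2 => ℂ).comp (continuous_pi fun i => ?_)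
      rcases eq_or_ne i j with rfl | hij
      · have c0 : Continuous fun y => -(Complex.I * conj (f y)) :=
          (continuous_const.mul (Complex.continuous_conj.comp hf.1.continuous)).neg
        simpa using c0
      · simpa [hij] using continuous_const
    have m1 : MemLp h1 2 volume := c1.memLp_of_hasCompactSupport
      (HasCompactSupport.intro hf.2.1 fun y hy => by
        simp [hh1, pd_eq_zero_of_notMem hy, magD_eq_zero x α hy])
    have m2 : MemLp h2 2 volume := c2.memLp_of_hasCompactSupport
      (HasCompactSupport.intro hf.2.1 fun y hy => by
        simp [hh2, image_eq_zero_of_notMem_tsupport hy])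
    have hi : ∀ (a : Plane → ℂ) (w : Plane → CVec) y, inner ℂ (h1 y) (a y) + inner ℂ (h2 y) (w y)
        = gradOf x α a w y j * f y + a y * pd j f y := fun a w y => by
      simp only [inner_complex, hh1, hh2, EuclideanSpace.inner_single_left, Complex.conj_conj,
        gradOf, PiLp.smul_apply, PiLp.sub_apply, smul_eq_mul, magD_apply, toCVec]
      linear_combination (a y * pd j f y) * Complex.I_sq
    have key : (formGraph x α : Set (L2 × Lp CVec 2 (volume : Measure Plane))) ⊆
        {p | inner ℂ (toL2 h1) p.1 + inner ℂ (toL2 h2) p.2 = 0} := by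
      refine formGraph_induction (isClosed_eq (by fun_prop) continuous_const) fun g hg => ?_
      rw [mem_ofPred_eq, inner_eq_integral (coeFn_toL2 m1) (coeFn_toL2 hg.memLp),
        inner_eq_integral (coeFn_toL2 m2) (coeFn_toL2 (hg.memLp_magD α)),
        ← integral_add (integrable_inner m1 hg.memLp) (integrable_inner m2 (hg.memLp_magD α))]
      refine (integral_congr_ae (.of_forall fun y => ?_)).trans
        (integral_pd_eq_zero (hg.contDiff_one.mul hf.contDiff_one) hf.2.1.mul_left j)
      simp only [hi]
      rw [((hasPd_pd (hg.differentiable y)).mul (hasPd_pd (hf.differentiable y))).2 j, gradOf]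
      simp only [PiLp.smul_apply, PiLp.sub_apply, smul_eq_mul, magD_apply, toCVec]
      linear_combination (-(pd j g y * f y)) * Complex.I_sq
    have h0 := key h
    rw [mem_ofPred_eq, inner_eq_integral (coeFn_toL2 m1) (EventuallyEq.refl _ _),
      inner_eq_integral (coeFn_toL2 m2) (EventuallyEq.refl _ _),
      ← integral_add (integrable_inner m1 (Lp.memLp φ)) (integrable_inner m2 (Lp.memLp v))] at h0
    simp only [hi] at h0
    have i2 : Integrable (fun y => φ y * pd j f y) volume := by
      have := integrable_inner (f := fun y => conj (pd j f y)) (g := φ)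
        ((Complex.continuous_conj.comp (continuous_pd hf.contDiff_one j)).memLp_of_hasCompactSupport
          (HasCompactSupport.intro hf.2.1 fun y hy => by simp [pd_eq_zero_of_notMem hy])) (Lp.memLp φ)
      simpa [mul_comm] using this
    have i1 : Integrable (fun y => gradOf x α φ v y j * f y) volume := by
      refine (((integrable_inner m1 (Lp.memLp φ)).add
        (integrable_inner m2 (Lp.memLp v))).sub i2).congr (.of_forall fun y => ?_)
      simp only [Pi.sub_apply, Pi.add_apply, hi]
      ring
    rw [integral_add i1 i2] at h0
    exact eq_neg_of_add_eq_zero_left h0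

/-! ### The Friedrichs form and the closed graph -/

lemma magField_congr {a : Plane → Plane} {φ : Plane → ℂ} {g g' : Plane → CVec}
    (h : g =ᵐ[volume] g') : magField a φ g =ᵐ[volume] magField a φ g' := by
  filter_upwards [h] with y hy
  rw [magField, magField, hy]

lemma magGrad_ae_eq {x : Fin N → Plane} {α : Fin N → ℝ} {φ : L2}
    {v : Lp CVec 2 (volume : Measure Plane)} (h : (φ, v) ∈ formGraph x α) :
    magGrad x (potTotal x α) φ =ᵐ[volume] v :=
  (magField_congr (isWeakGrad_of_mem h).weakGrad_ae_eq).trans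
    (.of_forall fun y => magField_gradOf x α φ v y)

/-- Closability of D: the second component of a graph element is determined by the weak gradient of
the first. -/
lemma snd_unique {x : Fin N → Plane} {α : Fin N → ℝ} {φ : L2}
    {v w : Lp CVec 2 (volume : Measure Plane)} (h : (φ, v) ∈ formGraph x α)
    (h' : (φ, w) ∈ formGraph x α) : v = w :=
  Lp.ext ((magGrad_ae_eq h).symm.trans (magGrad_ae_eq h'))

/-- The magnetic gradient of a classically differentiable element of the graph is classical. -/
lemma snd_ae_eq_magD {x : Fin N → Plane} {α : Fin N → ℝ} {φ : L2}
    {v : Lp CVec 2 (volume : Measure Plane)} (h : (φ, v) ∈ formGraph x α) {F : Plane → ℂ}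
    (hφ : φ =ᵐ[volume] F) (hF : ∀ y, (∀ m, y ≠ x m) → ContDiffAt ℝ 1 F y) :
    v =ᵐ[volume] magD x α F := by
  have h1 := (((isWeakGrad_of_mem h).congr hφ)).ae_eq (isWeakGrad_cGrad hF)
  filter_upwards [h1, hφ] with y e1 e2
  rw [← magField_gradOf x α φ v y, magD, magField, magField, e1, e2]

/-- Completion in the form norm and closure of the graph in L² × L² are the same limit process; the
weak gradient in the definition is supplied by `gradOf`. -/
lemma mem_friedrichsDomain_iff {x : Fin N → Plane} {α : Fin N → ℝ} {φ : L2} :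
    φ ∈ friedrichsDomain x α ↔ ∃ v, (φ, v) ∈ formGraph x α := by
  constructor
  · rintro ⟨g, hg, f, hf, h1, h2⟩
    set w := magField (potTotal x α) φ g with hw
    have hwm : AEStronglyMeasurable w (volume : Measure Plane) := by
      have hgm : AEStronglyMeasurable g (volume : Measure Plane) := by
        have := hg.1.aestronglyMeasurable
        rwa [Measure.restrict_eq_self_of_ae_mem (ae_mem_compl_range x)] at this
      have hA : AEStronglyMeasurable (fun y => toCVec (potTotal x α y)) (volume : Measure Plane) :=
        aestronglyMeasurable_of_continuousAt x fun y hy => continuousAt_toCVec_potTotal x α hy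
      exact ((hgm.const_smul Complex.I).neg).add ((Lp.aestronglyMeasurable φ).smul hA)
    have hD : ∀ k, MemLp (magField (potTotal x α) (f k) (cGrad (f k))) 2 volume := fun k =>
      (hf k).memLp_magD α
    have hwL : MemLp w 2 volume := by
      -- A single approximant at finite distance shows that the limit is square integrable.
      obtain ⟨k, hk⟩ := (h2.eventually (gt_mem_nhds ENNReal.zero_lt_top)).exists
      have : MemLp (fun y => w y - magField (potTotal x α) (f k) (cGrad (f k)) y) 2 volume :=
        ⟨hwm.sub (hD k).1, hk⟩
      refine (memLp_congr_ae (.of_forall fun y => ?_)).1 (this.add (hD k))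
      simp
    refine ⟨toL2 w, mem_formGraph_of_tendsto (p := fun k => (toL2 (f k), toL2 (magD x α (f k))))
      (fun k => Submodule.le_topologicalClosure _ ((hf k).mem_testGraph α)) ?_ ?_⟩
    · rw [Lp.tendsto_Lp_iff_tendsto_eLpNorm']
      refine h1.congr fun k => ?_
      rw [eLpNorm_sub_comm]
      refine eLpNorm_congr_ae ?_
      filter_upwards [coeFn_toL2 (hf k).memLp] with y hy
      rw [Pi.sub_apply, hy]
    · rw [Lp.tendsto_Lp_iff_tendsto_eLpNorm']
      refine h2.congr fun k => ?_
      rw [eLpNorm_sub_comm]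
      refine eLpNorm_congr_ae ?_
      filter_upwards [coeFn_toL2 ((hf k).memLp_magD α), coeFn_toL2 hwL] with y hy hy'
      rw [Pi.sub_apply, hy, hy']
      rfl
  · rintro ⟨v, hv⟩
    obtain ⟨p, hp, hlim⟩ := mem_closure_iff_seq_limit.1 (show (φ, v) ∈ closure (testGraph x α : Set _)
      from hv)
    choose f hf e1 e2 using hp
    refine ⟨_, isWeakGrad_of_mem hv, f, hf, ?_, ?_⟩
    · have := (Lp.tendsto_Lp_iff_tendsto_eLpNorm' _ _).1 ((continuous_fst.tendsto _).comp hlim)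
      refine this.congr fun k => ?_
      rw [eLpNorm_sub_comm]
      refine eLpNorm_congr_ae ?_
      filter_upwards [e1 k] with y hy
      rw [Pi.sub_apply, Function.comp_apply, hy]
    · have := (Lp.tendsto_Lp_iff_tendsto_eLpNorm' _ _).1 ((continuous_snd.tendsto _).comp hlim)
      refine this.congr fun k => ?_
      rw [eLpNorm_sub_comm]
      refine eLpNorm_congr_ae ?_
      filter_upwards [e2 k] with y hy
      rw [Pi.sub_apply, Function.comp_apply, hy, magField_gradOf]
      rfl

lemma friedrichsForm_eq {x : Fin N → Plane} {α : Fin N → ℝ} {φ : L2}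
    {v : Lp CVec 2 (volume : Measure Plane)} (h : (φ, v) ∈ formGraph x α) :
    friedrichsForm x α φ = ‖v‖ ^ 2 := by
  have h1 : (((‖v‖ ^ 2 : ℝ)) : ℂ) = ((friedrichsForm x α φ : ℝ) : ℂ) := by
    have h2 := inner_eq_integral (EventuallyEq.refl (ae volume) v) (magGrad_ae_eq h).symm
    rw [friedrichsForm, ← integral_complex_ofReal]
    have h3 := inner_eq_integral (magGrad_ae_eq h).symm (magGrad_ae_eq h).symm
    simp only [inner_self_eq_norm_sq_to_K, ← RCLike.ofReal_pow] at h3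
    exact h3
  exact_mod_cast h1.symm

lemma memLp_magGrad {x : Fin N → Plane} {α : Fin N → ℝ} {φ : L2}
    {v : Lp CVec 2 (volume : Measure Plane)} (h : (φ, v) ∈ formGraph x α) :
    MemLp (magGrad x (potTotal x α) φ) 2 volume :=
  (memLp_congr_ae (magGrad_ae_eq h)).2 (Lp.memLp v)

/-! ### The cross terms on the graph -/

section cross

variable {x : Fin N → Plane} {α : Fin N → ℝ} {ξ : Fin N → Plane → ℝ} {lam : ℝ} {n : Fin N}

lemma memLp_zeta2_mul (h : IsCutoff x ξ) (l : Fin 2) (hα : α n ∈ Ioo (0 : ℝ) 1)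
    (hlam : 0 < lam) : MemLp (fun y => zeta2 x α ξ n y * defectG x α lam n l y) 2 volume := by
  obtain ⟨R, hR, h1, -⟩ := h.exists_common_radius h n
  obtain ⟨C, hC⟩ := UB.exists_memLp_bound (c := x n) (R := R)
    (f := fun (lam : Ioi (0 : ℝ)) y => zeta2 x α ξ n y * defectG x α lam n l y)
    (((ub_zeta2 α hR h).mul (ub_G α n l hα R)).congr_norm fun _ _ _ _ => by
      rw [Complex.norm_real, norm_norm])
    (fun i y hy => by rw [zeta2_eq_zero α h fun hy' => hy (h1 hy'), zero_mul])
    (fun i => aestronglyMeasurable_of_continuousAt x fun y hy =>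
      (continuousAt_zeta2 α h hy).mul (continuousAt_G α i.2 l (hy n)))
    (by linarith [(nu_mem α l hα).2])
  exact (hC ⟨lam, hlam⟩).1

lemma cross_of_mem (h : IsCutoff x ξ) (l : Fin 2) (hα : α n ∈ Ioo (0 : ℝ) 1) (hlam : 0 < lam)
    {φ : L2} {v : Lp CVec 2 (volume : Measure Plane)} (hφ : (φ, v) ∈ formGraph x α) :
    Integrable (cross1 x α ξ lam φ n l) volume ∧ Integrable (cross2 x α ξ lam φ n l) volume ∧
    2 * (∫ y, cross1 x α ξ lam φ n l y) + ∫ y, cross2 x α ξ lam φ n l y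
      = inner ℂ v (toL2 (aVec x α ξ lam n l)) + inner ℂ φ (toL2 (bFun x α ξ lam n l)) := by
  have ha := memLp_aVec α n h l hα hlam
  have hb := memLp_bFun α n h l hα hlam
  have i1 := integrable_inner (memLp_magGrad hφ) ha
  have i2 := integrable_inner (Lp.memLp φ) hb
  have e : ∀ y, 2 * cross1 x α ξ lam φ n l y + cross2 x α ξ lam φ n l y
      = inner ℂ (magGrad x (potTotal x α) φ y) (aVec x α ξ lam n l y)
        + inner ℂ (φ y) (bFun x α ξ lam n l y) := fun y => by
    rw [cross1_add_cross2, inner_complex]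
  have j2 : Integrable (cross2 x α ξ lam φ n l) volume := by
    refine (integrable_inner (Lp.memLp φ) (memLp_zeta2_mul h l hα hlam)).congr
      (.of_forall fun y => ?_)
    simp only [inner_complex, cross2]
  -- Only the full magnetic gradient is known to be square integrable, so the term with A_n alone is
  -- obtained by subtracting the second cross term from the combined pairing.
  have j1 : Integrable (cross1 x α ξ lam φ n l) volume := by
    refine (((i1.add i2).sub j2).const_mul (1 / 2)).congr (.of_forall fun y => ?_)
    simp only [Pi.sub_apply, Pi.add_apply, ← e]
    ring
  refine ⟨j1, j2, ?_⟩
  rw [inner_eq_integral (magGrad_ae_eq hφ).symm (coeFn_toL2 ha),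
    inner_eq_integral (EventuallyEq.refl _ _) (coeFn_toL2 hb), ← integral_add i1 i2,
    ← integral_const_mul, ← integral_add (j1.const_mul 2) j2]
  simp only [e]

end cross

/-! ### Differences of singular functions -/

section eta

variable {x : Fin N → Plane} (α : Fin N → ℝ) {ξ ξ' : Fin N → Plane → ℝ} {lam lam' : ℝ}
  (n : Fin N) (l : Fin 2)

/-- The difference of the singular functions for two choices of the parameters. -/
def eta (x : Fin N → Plane) (α : Fin N → ℝ) (ξ ξ' : Fin N → Plane → ℝ) (lam lam' : ℝ) (n : Fin N)
    (l : Fin 2) (y : Plane) : ℂ := sing x α ξ lam n l y - sing x α ξ' lam' n l y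

lemma magD_sub {f g : Plane → ℂ} {y : Plane} (hf : DifferentiableAt ℝ f y)
    (hg : DifferentiableAt ℝ g y) :
    magD x α (fun z => f z - g z) y = magD x α f y - magD x α g y := by
  ext j
  simp only [magD_apply, PiLp.sub_apply, ((hasPd_pd hf).sub (hasPd_pd hg)).2 j]
  ring

lemma magD_eta (h : IsCutoff x ξ) (h' : IsCutoff x ξ') (hlam : 0 < lam) (hlam' : 0 < lam')
    {y : Plane} (hy : y ≠ x n) : magD x α (eta x α ξ ξ' lam lam' n l) y
      = magD x α (sing x α ξ lam n l) y - magD x α (sing x α ξ' lam' n l) y :=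
  magD_sub α (hasPd_sing α n l h hlam hy).1 (hasPd_sing α n l h' hlam' hy).1

lemma ub_sub_xiC {R : ℝ} (hR : 0 < R) (h : IsCutoff x ξ) (h' : IsCutoff x ξ') :
    UB (x n) R (-1) (fun (_ : Unit) y => xiC ξ n y - xiC ξ' n y) := by
  refine ub_of_contDiffAt hR (fun y _ => (((contDiff_xiC h n).sub
    (contDiff_xiC h' n)).contDiffAt).of_le (by norm_num)) ?_
  obtain ⟨R, hR, -, -, δ, hδ, -, h1⟩ := h.exists_common_radius h' n
  have := h1 (x n) (by simpa using hδ)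
  simp [xiC, this.1, this.2]

/-- The change is split into one of the parameter with the cut-off fixed and one of the cut-off with
the parameter fixed; each part tends to 0 at x_n. -/
lemma eta_eq (y : Plane) : eta x α ξ ξ' lam lam' n l y = phase x α n y
    * (xiC ξ n y * (defectG x α lam n l y - defectG x α lam' n l y)
      + (xiC ξ n y - xiC ξ' n y) * defectG x α lam' n l y) := by
  simp only [eta, sing]; ring

lemma exists_ub_eta (h : IsCutoff x ξ) (h' : IsCutoff x ξ') (hlam : 0 < lam) (hlam' : 0 < lam')
    (hα : α n ∈ Ioo (0 : ℝ) 1) {R : ℝ} (hR : IsRadius x n R) :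
    ∃ β, β < 0 ∧ UB (x n) R β (fun _ : Unit => eta x α ξ ξ' lam lam' n l) ∧
      ∀ j, UB (x n) R (β + 1) (fun (_ : Unit) y => magD x α (eta x α ξ ξ' lam lam' n l) y j) := by
  have hν := nu_mem α l hα
  obtain ⟨C, hC, hb⟩ := exists_defectG_sub_bound x α n l hα hlam hlam'
  -- The parameter change is O(r^(ν/2)) and the cut-off change is O(r · r^(-ν)); both exponents are
  -- positive because 0 < ν < 1.
  set β := max (-(nu α n l / 2)) (nu α n l - 1) with hβ
  have hβ1 : -(nu α n l / 2) ≤ β := le_max_left _ _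
  have hβ2 : nu α n l - 1 ≤ β := le_max_right _ _
  have hβ0 : β < 0 := max_lt (by linarith [hν.1]) (by linarith [hν.2])
  have hp := ub_phase (ι := Unit) (x := x) (n := n) (R := R) α
  have hx := ub_xiC (ι := Unit) (n := n) (R := R) h
  have hx' := ub_xiC (ι := Unit) (n := n) (R := R) h'
  have hd := fun j => ub_pd_xiC (ι := Unit) (n := n) hR.pos h j
  have hd' := fun j => ub_pd_xiC (ι := Unit) (n := n) hR.pos h' j
  have hG := (ub_G (x := x) α n l hα R).comp (fun _ : Unit => (⟨lam', hlam'⟩ : Ioi (0 : ℝ)))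
  have hD := fun j => (ub_pd_G (x := x) α n l j hα R).comp
    (fun _ : Unit => (⟨lam', hlam'⟩ : Ioi (0 : ℝ)))
  have hs := ub_sub_xiC n hR.pos h h'
  have hg : UB (x n) R (-(nu α n l / 2))
      (fun (_ : Unit) y => defectG x α lam n l y - defectG x α lam' n l y) :=
    ⟨C, hC.le, fun _ y _ hy => by rw [neg_neg]; exact (hb y hy).1⟩
  have hgd : ∀ j, UB (x n) R (1 - nu α n l / 2)
      (fun (_ : Unit) y => pd j (defectG x α lam n l) y - pd j (defectG x α lam' n l) y) := fun j =>
    ⟨C, hC.le, fun _ y _ hy => by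
      rw [neg_sub]; exact (hb y hy).2 j⟩
  have t0 : UB (x n) R β (fun (_ : Unit) y => xiC ξ n y
      * (defectG x α lam n l y - defectG x α lam' n l y)
      + (xiC ξ n y - xiC ξ' n y) * defectG x α lam' n l y) :=
    ((hx.mul hg).weaken (by linarith)).add ((hs.mul hG).weaken (by linarith))
  have t1 : UB (x n) R β (fun _ : Unit => eta x α ξ ξ' lam lam' n l) :=
    ((hp.mul t0).weaken (γ := β) (by linarith)).congr_norm fun _ y _ _ => by rw [eta_eq]
  refine ⟨β, hβ0, t1, fun j => ?_⟩
  have t2 : UB (x n) R (β + 1) (fun (_ : Unit) y =>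
      (pd j (xiC ξ n) y * (defectG x α lam n l y - defectG x α lam' n l y)
        + xiC ξ n y * (pd j (defectG x α lam n l) y - pd j (defectG x α lam' n l) y))
      + ((pd j (xiC ξ n) y - pd j (xiC ξ' n) y) * defectG x α lam' n l y
        + (xiC ξ n y - xiC ξ' n y) * pd j (defectG x α lam' n l) y)) :=
    (((hd j).mul hg).weaken (by linarith)).add ((hx.mul (hgd j)).weaken (by linarith)) |>.add
      (((((hd j).sub (hd' j)).mul hG).weaken (by linarith)).add
        ((hs.mul (hD j)).weaken (by linarith)))
  have hA : UB (x n) R 1 (fun (_ : Unit) y => aC x α n j y + sC0 x α n j + sC x α n j y) :=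
    ((ub_aC x α n j R).add ((UB.const (sC0 x α n j)).weaken (by norm_num))).add
      ((ub_sC α hR j).weaken (by norm_num))
  have t3 := (((((t1.const_mul (-Complex.I * sC0 x α n j)).weaken (γ := β + 1) (by linarith)).add
    ((hp.mul t2).weaken (γ := β + 1) (by linarith))).const_mul Complex.I).neg).add (t1.mul hA)
  refine t3.congr_norm fun _ y _ hy => le_of_eq ?_
  rw [magD_apply, potTotal_apply x α n, show pd j (eta x α ξ ξ' lam lam' n l) y = _ from
    ((hasPd_sing α n l h hlam hy).sub (hasPd_sing α n l h' hlam' hy)).2 j]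
  congr 1
  simp only [eta_eq]
  ring

/-- The difference of two singular functions belongs to the closed graph. -/
lemma eta_mem (h : IsCutoff x ξ) (h' : IsCutoff x ξ') (hlam : 0 < lam) (hlam' : 0 < lam')
    (hα : α n ∈ Ioo (0 : ℝ) 1) :
    MemLp (eta x α ξ ξ' lam lam' n l) 2 volume ∧
    MemLp (magD x α (eta x α ξ ξ' lam lam' n l)) 2 volume ∧
    (toL2 (eta x α ξ ξ' lam lam' n l), toL2 (magD x α (eta x α ξ ξ' lam lam' n l)))
      ∈ formGraph x α := by
  obtain ⟨R, hR, h1, h2, -⟩ := h.exists_common_radius h' n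
  obtain ⟨β, hβ, hb, hbd⟩ := exists_ub_eta α n l h h' hlam hlam' hα hR
  have hc : ∀ y, y ≠ x n → ContDiffAt ℝ 1 (eta x α ξ ξ' lam lam' n l) y := fun y hy =>
    ((contDiffAt_sing α n h hlam l hy).sub (contDiffAt_sing α n h' hlam' l hy)).of_le (by norm_num)
  have hT0 : ∀ y, y ∉ tsupport (ξ n) ∪ tsupport (ξ' n) → eta x α ξ ξ' lam lam' n l y = 0 :=
    fun y hy => by
      rw [mem_union, not_or] at hy
      simp [eta, sing_eq_zero α _ l hy.1, sing_eq_zero α _ l hy.2]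
  have hTR : tsupport (ξ n) ∪ tsupport (ξ' n) ⊆ Metric.ball (x n) R := union_subset h1 h2
  have hf2 : MemLp (eta x α ξ ξ' lam lam' n l) 2 volume :=
    (memLp_sing α n h l hα hlam).sub (memLp_sing α n h' l hα hlam')
  have hD2 : MemLp (magD x α (eta x α ξ ξ' lam lam' n l)) 2 volume := by
    have hts : tsupport (eta x α ξ ξ' lam lam' n l) ⊆ tsupport (ξ n) ∪ tsupport (ξ' n) :=
      closure_minimal (fun z hz => by by_contra h0; exact hz (hT0 z h0))
        ((isClosed_tsupport _).union (isClosed_tsupport _))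
    obtain ⟨C, hC⟩ := UB.exists_memLp_bound (c := x n) (R := R)
      (f := fun _ : Unit => magD x α (eta x α ξ ξ' lam lam' n l)) (UB.norm_cvec hbd)
      (fun _ y hy => magD_eq_zero x α fun hy' => hy (hTR (hts hy'))) (fun _ =>
        aestronglyMeasurable_of_continuousAt x fun y hy => continuousAt_magD α (hc y (hy n)) hy)
      (by linarith)
    exact (hC ()).1
  refine ⟨hf2, hD2, mem_formGraph_of_singular α n hc
    ((h.hasCompactSupport n).isCompact.union (h'.hasCompactSupport n).isCompact) hT0
    (fun m hm hx => ?_) hβ hTR hb hf2 hD2⟩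
  exact hR.avoid m hm (Metric.ball_subset_closedBall (hTR hx))

end eta

/-! ### The data of the abstract form -/

/-- The functional representing the cross terms. -/
def crossL (x : Fin N → Plane) (α : Fin N → ℝ) (ξ : Fin N → Plane → ℝ) (lam : ℝ)
    (p : Fin N × Fin 2) (g : L2 × Lp CVec 2 (volume : Measure Plane)) : ℂ :=
  inner ℂ g.2 (toL2 (aVec x α ξ lam p.1 p.2)) + inner ℂ g.1 (toL2 (bFun x α ξ lam p.1 p.2))

/-- The pairing of the cross terms with a singular function. -/
def crossPair (x : Fin N → Plane) (α : Fin N → ℝ) (ξ ξ' : Fin N → Plane → ℝ) (lam lam' : ℝ)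
    (p' p : Fin N × Fin 2) : ℂ :=
  ∫ y, crossDens x α ξ lam (sing x α ξ' lam' p'.1 p'.2) p.1 p.2 y

/-- The class of a singular function. -/
def chi (x : Fin N → Plane) (α : Fin N → ℝ) (ξ : Fin N → Plane → ℝ) (lam : ℝ)
    (p : Fin N × Fin 2) : L2 := toL2 (sing x α ξ lam p.1 p.2)

/-- The diagonal coefficient `π λ^(2ν) / (2 sin πα)`. -/
def diagC (α : Fin N → ℝ) (lam : ℝ) (p : Fin N × Fin 2) : ℝ :=
  Real.pi * lam ^ (2 * nu α p.1 p.2) / (2 * Real.sin (Real.pi * α p.1))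

/-- The block diagonal matrix of the `Ξ`. -/
def xiM (x : Fin N → Plane) (α : Fin N → ℝ) (ξ : Fin N → Plane → ℝ) (lam : ℝ)
    (p p' : Fin N × Fin 2) : ℂ := if p.1 = p'.1 then Xi x α ξ lam p.1 p.2 p'.2 else 0

section pairings

variable {x : Fin N → Plane} {α : Fin N → ℝ} {ξ ξ' : Fin N → Plane → ℝ} {lam lam' : ℝ}

lemma xiM_conj (h : IsCutoff x ξ) (hlam : 0 < lam) (hα : ∀ n, α n ∈ Ioo (0 : ℝ) 1)
    (p p' : Fin N × Fin 2) : conj (xiM x α ξ lam p' p) = xiM x α ξ lam p p' := by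
  obtain ⟨n, l⟩ := p
  obtain ⟨m, k⟩ := p'
  simp only [xiM]
  by_cases hmn : n = m
  · subst hmn
    simpa using Xi_conj α n h hlam l k (hα n)
  · simp [hmn, Ne.symm hmn]

lemma crossPair_self (h : IsCutoff x ξ) (hlam : 0 < lam) (hα : ∀ n, α n ∈ Ioo (0 : ℝ) 1)
    (p p' : Fin N × Fin 2) : crossPair x α ξ ξ lam lam p p' = xiM x α ξ lam p p' := by
  obtain ⟨n, l⟩ := p
  obtain ⟨m, k⟩ := p'
  simp only [xiM, crossPair]
  by_cases hmn : n = m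
  · subst hmn
    simpa using integral_crossDens_self α n h hlam l k (hα n)
  · simp [hmn, crossDens_sing_eq_zero α h h lam lam hmn]

lemma inner_chi_eq_zero (h : IsCutoff x ξ) (h' : IsCutoff x ξ') (hlam : 0 < lam)
    (hlam' : 0 < lam') (hα : ∀ n, α n ∈ Ioo (0 : ℝ) 1) {p p' : Fin N × Fin 2} (hp : p.1 ≠ p'.1) :
    inner ℂ (chi x α ξ' lam' p) (chi x α ξ lam p') = 0 := by
  rw [chi, chi, inner_eq_integral (coeFn_toL2 (memLp_sing α p.1 h' p.2 (hα _) hlam'))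
    (coeFn_toL2 (memLp_sing α p'.1 h p'.2 (hα _) hlam))]
  refine (integral_congr_ae (.of_forall fun y => ?_)).trans (integral_zero _ _)
  by_cases hy : y ∈ tsupport (ξ p'.1)
  · simp [sing_eq_zero α lam' p.2 (h.notMem_tsupport_of_ne h' hp hy)]
  · simp [sing_eq_zero α lam p'.2 hy]

lemma green_chi (h : IsCutoff x ξ) (h' : IsCutoff x ξ') (hlam : 0 < lam) (hlam' : 0 < lam')
    (hα : ∀ n, α n ∈ Ioo (0 : ℝ) 1) (p p' : Fin N × Fin 2) :
    ((lam : ℂ) ^ 2 - (lam' : ℂ) ^ 2) * inner ℂ (chi x α ξ' lam' p) (chi x α ξ lam p')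
      - crossPair x α ξ ξ' lam lam' p p' + conj (crossPair x α ξ' ξ lam' lam p' p)
      = if p = p' then -((diagC α lam' p : ℂ) - (diagC α lam p : ℂ)) else 0 := by
  by_cases hp : p.1 = p'.1
  · obtain ⟨n, l⟩ := p
    obtain ⟨m, k⟩ := p'
    subst hp
    simpa [Prod.ext_iff, diagC, crossPair, chi] using green_sing α n h h' hlam hlam' l k (hα n)
  · have hp2 : p ≠ p' := fun h => hp (congrArg _ h)
    rw [inner_chi_eq_zero h h' hlam hlam' hα hp, if_neg hp2]
    simp [crossPair, crossDens_sing_eq_zero α h h' lam lam' hp,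
      crossDens_sing_eq_zero α h' h lam' lam (Ne.symm hp)]

lemma continuous_crossL (x : Fin N → Plane) (α : Fin N → ℝ) (ξ : Fin N → Plane → ℝ) (lam : ℝ)
    (p : Fin N × Fin 2) : Continuous (crossL x α ξ lam p) := by
  unfold crossL; fun_prop

/-- The cross terms at a classical function. -/
lemma crossL_classical (h : IsCutoff x ξ) (hlam : 0 < lam) (hα : ∀ n, α n ∈ Ioo (0 : ℝ) 1)
    (p : Fin N × Fin 2) {f : Plane → ℂ} {g : L2 × Lp CVec 2 (volume : Measure Plane)}
    (hf : g.1 =ᵐ[volume] f) (hD : g.2 =ᵐ[volume] magD x α f) :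
    crossL x α ξ lam p g = ∫ y, crossDens x α ξ lam f p.1 p.2 y := by
  have ha := memLp_aVec α p.1 h p.2 (hα _) hlam
  have hb := memLp_bFun α p.1 h p.2 (hα _) hlam
  have m1 : MemLp f 2 volume := (memLp_congr_ae hf).1 (Lp.memLp g.1)
  have m2 : MemLp (magD x α f) 2 volume := (memLp_congr_ae hD).1 (Lp.memLp g.2)
  rw [crossL, inner_eq_integral hD (coeFn_toL2 ha), inner_eq_integral hf (coeFn_toL2 hb),
    ← integral_add (integrable_inner m2 ha) (integrable_inner m1 hb)]
  refine integral_congr_ae (.of_forall fun y => ?_)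
  simp only [crossDens_eq, inner_complex]
  rfl

lemma crossDens_sum {ι : Type*} (s : Finset ι) (c : ι → ℂ) (f : ι → Plane → ℂ) (n : Fin N)
    (l : Fin 2) {y : Plane} (hf : ∀ i ∈ s, DifferentiableAt ℝ (f i) y) :
    crossDens x α ξ lam (fun z => ∑ i ∈ s, c i * f i z) n l y
      = ∑ i ∈ s, conj (c i) * crossDens x α ξ lam (f i) n l y := by
  have hpd : ∀ j, pd j (fun z => ∑ i ∈ s, c i * f i z) y = ∑ i ∈ s, c i * pd j (f i) y := fun j =>
    (HasPd.sum fun i hi => (hasPd_pd (hf i hi)).const_mul (c i)).2 j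
  simp only [crossDens, magField_apply, cGrad_apply, hpd, Fin.sum_univ_two, map_add, map_neg,
    map_mul, map_sum, mul_add, Finset.sum_add_distrib, Finset.mul_sum, Finset.sum_mul,
    Complex.conj_ofReal, ← Finset.sum_neg_distrib]
  simp only [← Finset.sum_add_distrib]
  simp only [Finset.sum_mul, Finset.mul_sum, ← Finset.sum_add_distrib]
  refine Finset.sum_congr rfl fun i _ => ?_
  ring

lemma magD_sum {ι : Type*} (s : Finset ι) (c : ι → ℂ) (f : ι → Plane → ℂ) {y : Plane}
    (hf : ∀ i ∈ s, DifferentiableAt ℝ (f i) y) :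
    magD x α (fun z => ∑ i ∈ s, c i * f i z) y = ∑ i ∈ s, c i • magD x α (f i) y := by
  have hpd : ∀ j, pd j (fun z => ∑ i ∈ s, c i * f i z) y = ∑ i ∈ s, c i * pd j (f i) y := fun j =>
    (HasPd.sum fun i hi => (hasPd_pd (hf i hi)).const_mul (c i)).2 j
  ext j
  rw [WithLp.ofLp_sum, Finset.sum_apply]
  simp only [magD_apply, hpd, PiLp.smul_apply, smul_eq_mul, Finset.mul_sum, Finset.sum_mul,
    ← Finset.sum_neg_distrib, ← Finset.sum_add_distrib]
  refine Finset.sum_congr rfl fun i _ => ?_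
  ring

/-- The class of `η`. -/
def etaL (x : Fin N → Plane) (α : Fin N → ℝ) (ξ ξ' : Fin N → Plane → ℝ) (lam lam' : ℝ)
    (p : Fin N × Fin 2) : L2 × Lp CVec 2 (volume : Measure Plane) :=
  (toL2 (eta x α ξ ξ' lam lam' p.1 p.2), toL2 (magD x α (eta x α ξ ξ' lam lam' p.1 p.2)))

lemma etaL_mem (h : IsCutoff x ξ) (h' : IsCutoff x ξ') (hlam : 0 < lam) (hlam' : 0 < lam')
    (hα : ∀ n, α n ∈ Ioo (0 : ℝ) 1) (p : Fin N × Fin 2) :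
    etaL x α ξ ξ' lam lam' p ∈ formGraph x α := (eta_mem α p.1 p.2 h h' hlam hlam' (hα _)).2.2

lemma etaL_fst (h : IsCutoff x ξ) (h' : IsCutoff x ξ') (hlam : 0 < lam) (hlam' : 0 < lam')
    (hα : ∀ n, α n ∈ Ioo (0 : ℝ) 1) (p : Fin N × Fin 2) :
    (etaL x α ξ ξ' lam lam' p).1 = chi x α ξ lam p - chi x α ξ' lam' p := by
  refine toL2_eq ?_
  filter_upwards [Lp.coeFn_sub (chi x α ξ lam p) (chi x α ξ' lam' p),
    coeFn_toL2 (memLp_sing α p.1 h p.2 (hα _) hlam),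
    coeFn_toL2 (memLp_sing α p.1 h' p.2 (hα _) hlam')] with y h1 h2 h3
  rw [h1, Pi.sub_apply, chi, chi, h2, h3, eta]

/-- Both sides are continuous in the graph element, so test functions suffice. There it is the
difference of two instances of `test_pairing`, and Dη is square integrable although the two magnetic
gradients separately need not be. -/
lemma inner_etaL (h : IsCutoff x ξ) (h' : IsCutoff x ξ') (hlam : 0 < lam) (hlam' : 0 < lam')
    (hα : ∀ n, α n ∈ Ioo (0 : ℝ) 1) (p : Fin N × Fin 2)
    {g : L2 × Lp CVec 2 (volume : Measure Plane)} (hg : g ∈ formGraph x α) :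
    inner ℂ g.2 (etaL x α ξ ξ' lam lam' p).2
      = crossL x α ξ lam p g - (lam : ℂ) ^ 2 * inner ℂ g.1 (chi x α ξ lam p)
        - (crossL x α ξ' lam' p g - (lam' : ℂ) ^ 2 * inner ℂ g.1 (chi x α ξ' lam' p)) := by
  have c1 := continuous_crossL x α ξ lam p
  have c2 := continuous_crossL x α ξ' lam' p
  refine formGraph_induction (P := {g | inner ℂ g.2 (etaL x α ξ ξ' lam lam' p).2
      = crossL x α ξ lam p g - (lam : ℂ) ^ 2 * inner ℂ g.1 (chi x α ξ lam p)
        - (crossL x α ξ' lam' p g - (lam' : ℂ) ^ 2 * inner ℂ g.1 (chi x α ξ' lam' p))})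
    (isClosed_eq (by fun_prop) (by fun_prop)) (fun f hf => ?_) hg
  have t1 := test_pairing α p.1 h hlam p.2 (hα _) hf
  have t2 := test_pairing α p.1 h' hlam' p.2 (hα _) hf
  have hD := (eta_mem α p.1 p.2 h h' hlam hlam' (hα _)).2.1
  simp only [mem_ofPred_eq, crossL, chi]
  rw [← t1.2, ← t2.2, ← integral_sub t1.1 t2.1, etaL,
    inner_eq_integral (coeFn_toL2 (hf.memLp_magD α)) (coeFn_toL2 hD)]
  refine integral_congr_ae ?_
  filter_upwards [ae_forall_ne x] with y hy
  rw [magD_eta α p.1 p.2 h h' hlam hlam' (hy _), inner_sub_right]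

lemma crossL_etaL (h : IsCutoff x ξ) (h' : IsCutoff x ξ') {ζ : Fin N → Plane → ℝ}
    (hζ : IsCutoff x ζ) (hlam : 0 < lam) (hlam' : 0 < lam') {μ : ℝ} (hμ : 0 < μ)
    (hα : ∀ n, α n ∈ Ioo (0 : ℝ) 1) (p p' : Fin N × Fin 2) :
    crossL x α ζ μ p' (etaL x α ξ ξ' lam lam' p)
      = crossPair x α ζ ξ μ lam p p' - crossPair x α ζ ξ' μ lam' p p' := by
  have hm := eta_mem α p.1 p.2 h h' hlam hlam' (hα _)
  rw [crossL_classical hζ hμ hα p' (coeFn_toL2 hm.1) (coeFn_toL2 hm.2.1), crossPair, crossPair]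
  have hint : ∀ {ξ lam}, IsCutoff x ξ → 0 < lam →
      Integrable (crossDens x α ζ μ (sing x α ξ lam p.1 p.2) p'.1 p'.2) volume := by
    intro ξ lam h hlam
    by_cases hp : p.1 = p'.1
    · rw [hp]
      exact integrable_crossDens_sing α p'.1 hζ h hμ hlam p.2 p'.2 (hα _)
    · refine (integrable_zero Plane ℂ volume).congr (.of_forall fun y => ?_)
      exact (crossDens_sing_eq_zero α hζ h μ lam hp p.2 p'.2 y).symm
  rw [← integral_sub (hint h hlam) (hint h' hlam')]
  refine integral_congr_ae ?_
  filter_upwards [ae_forall_ne x] with y hy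
  have hs := (hasPd_sing α p.1 p.2 h hlam (hy _)).1
  have hs' := (hasPd_sing α p.1 p.2 h' hlam' (hy _)).1
  -- The difference is treated as a combination with coefficients 1 and -1.
  have := crossDens_sum (x := x) (α := α) (ξ := ζ) (lam := μ) Finset.univ ![1, -1]
    ![sing x α ξ lam p.1 p.2, sing x α ξ' lam' p.1 p.2] p'.1 p'.2 (y := y)
    (fun i _ => by fin_cases i <;> assumption)
  simp only [Fin.sum_univ_two, Matrix.cons_val_zero, Matrix.cons_val_one, one_mul, neg_mul,
    map_one, map_neg] at this
  simp only [← sub_eq_add_neg] at this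
  exact this

/-- A combination of singular functions in the Friedrichs domain. -/
lemma sum_chi_ae (h : IsCutoff x ξ) (hlam : 0 < lam) (hα : ∀ n, α n ∈ Ioo (0 : ℝ) 1)
    (q : Fin N × Fin 2 → ℂ) :
    ((∑ p, q p • chi x α ξ lam p : L2) : Plane → ℂ)
      =ᵐ[volume] fun y => ∑ p, q p * sing x α ξ lam p.1 p.2 y := by
  have h1 : ∀ p, (chi x α ξ lam p : Plane → ℂ) =ᵐ[volume] sing x α ξ lam p.1 p.2 := fun p =>
    coeFn_toL2 (memLp_sing α p.1 h p.2 (hα _) hlam)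
  have h2 := Lp.coeFn_finsetSum (p := 2) (μ := (volume : Measure Plane)) Finset.univ
    fun p => q p • chi x α ξ lam p
  filter_upwards [h2, ae_all_iff.2 h1, ae_all_iff.2 fun p => Lp.coeFn_smul (q p) (chi x α ξ lam p)]
    with y e1 e2 e3
  rw [e1, Finset.sum_apply]
  exact Finset.sum_congr rfl fun p _ => by rw [e3, Pi.smul_apply, e2, smul_eq_mul]

lemma contDiffAt_sum_sing (h : IsCutoff x ξ) (hlam : 0 < lam) (q : Fin N × Fin 2 → ℂ) {y : Plane}
    (hy : ∀ m, y ≠ x m) :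
    ContDiffAt ℝ 1 (fun y => ∑ p : Fin N × Fin 2, q p * sing x α ξ lam p.1 p.2 y) y :=
  ContDiffAt.sum fun p _ => contDiffAt_const.mul
    ((contDiffAt_sing α p.1 h hlam p.2 (hy _)).of_le (by norm_num))

/-- Green's identity for a combination of singular functions in the Friedrichs domain. -/
lemma inner_sum_chi (h : IsCutoff x ξ) (hlam : 0 < lam) (hα : ∀ n, α n ∈ Ioo (0 : ℝ) 1)
    {q : Fin N × Fin 2 → ℂ} {v : Lp CVec 2 (volume : Measure Plane)}
    (hv : (∑ p, q p • chi x α ξ lam p, v) ∈ formGraph x α)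
    {g : L2 × Lp CVec 2 (volume : Measure Plane)} (hg : g ∈ formGraph x α) :
    inner ℂ g.2 v = ∑ p, q p * (crossL x α ξ lam p g
      - (lam : ℂ) ^ 2 * inner ℂ g.1 (chi x α ξ lam p)) := by
  -- By uniqueness of weak gradients, v is the classical magnetic gradient of the combination, so
  -- that the pairing with a test function can be computed termwise.
  have hvD := snd_ae_eq_magD hv (sum_chi_ae h hlam hα q)
    fun y hy => contDiffAt_sum_sing h hlam q hy
  have c1 := continuous_crossL x α ξ lam
  refine formGraph_induction (P := {g | inner ℂ g.2 v = ∑ p, q p * (crossL x α ξ lam p g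
      - (lam : ℂ) ^ 2 * inner ℂ g.1 (chi x α ξ lam p))})
    (isClosed_eq (by fun_prop) (by fun_prop)) (fun f hf => ?_) hg
  have t := fun p : Fin N × Fin 2 => test_pairing α p.1 h hlam p.2 (hα _) hf
  simp only [mem_ofPred_eq, crossL, chi]
  simp only [← (t _).2, ← integral_const_mul]
  rw [← integral_finsetSum _ fun p _ => (t p).1.const_mul _,
    inner_eq_integral (coeFn_toL2 (hf.memLp_magD α)) hvD]
  refine integral_congr_ae ?_
  filter_upwards [ae_forall_ne x] with y hy
  rw [magD_sum Finset.univ q (fun p => sing x α ξ lam p.1 p.2)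
    fun p _ => (hasPd_sing α p.1 p.2 h hlam (hy _)).1, inner_sum]
  exact Finset.sum_congr rfl fun p _ => by rw [inner_smul_right]

lemma crossL_sum_chi (h : IsCutoff x ξ) (h' : IsCutoff x ξ') (hlam : 0 < lam) (hlam' : 0 < lam')
    (hα : ∀ n, α n ∈ Ioo (0 : ℝ) 1) {q : Fin N × Fin 2 → ℂ}
    {v : Lp CVec 2 (volume : Measure Plane)}
    (hv : (∑ p, q p • chi x α ξ' lam' p, v) ∈ formGraph x α) (p' : Fin N × Fin 2) :
    crossL x α ξ lam p' (∑ p, q p • chi x α ξ' lam' p, v)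
      = ∑ p, conj (q p) * crossPair x α ξ ξ' lam lam' p p' := by
  have hae := sum_chi_ae h' hlam' hα q
  rw [crossL_classical h hlam hα p' (g := (∑ p, q p • chi x α ξ' lam' p, v)) hae
    (snd_ae_eq_magD hv hae fun y hy => contDiffAt_sum_sing h' hlam' q hy)]
  have hint : ∀ p : Fin N × Fin 2,
      Integrable (crossDens x α ξ lam (sing x α ξ' lam' p.1 p.2) p'.1 p'.2) volume := by
    intro p
    by_cases hp : p.1 = p'.1
    · rw [hp]
      exact integrable_crossDens_sing α p'.1 h h' hlam hlam' p.2 p'.2 (hα _)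
    · refine (integrable_zero Plane ℂ volume).congr (.of_forall fun y => ?_)
      exact (crossDens_sing_eq_zero α h h' lam lam' hp p.2 p'.2 y).symm
  simp only [crossPair, ← integral_const_mul]
  rw [← integral_finsetSum _ fun p _ => (hint p).const_mul _]
  refine integral_congr_ae ?_
  filter_upwards [ae_forall_ne x] with y hy
  exact crossDens_sum Finset.univ q (fun p => sing x α ξ' lam' p.1 p.2) p'.1 p'.2
    fun p _ => (hasPd_sing α p.1 p.2 h' hlam' (hy _)).1

end pairings

/-! ### Charges -/

/-- The ambient space of the graph of the closed magnetic gradient. -/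
abbrev GraphSpace : Type := L2 × Lp CVec 2 (volume : Measure Plane)

/-- The sesquilinear form of a matrix. -/
def hermSum {P : Type*} [Fintype P] (M : P → P → ℂ) (q q' : P → ℂ) : ℂ :=
  ∑ p, ∑ p', conj (q p) * q' p' * M p p'

section hermSum

variable {P : Type*} [Fintype P]

lemma hermSum_add_left (M : P → P → ℂ) (q r s : P → ℂ) :
    hermSum M (q + r) s = hermSum M q s + hermSum M r s := by
  simp only [hermSum, Pi.add_apply, map_add, ← Finset.sum_add_distrib]
  exact Finset.sum_congr rfl fun _ _ => Finset.sum_congr rfl fun _ _ => by ring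

lemma hermSum_add_right (M : P → P → ℂ) (q r s : P → ℂ) :
    hermSum M q (r + s) = hermSum M q r + hermSum M q s := by
  simp only [hermSum, Pi.add_apply, ← Finset.sum_add_distrib]
  exact Finset.sum_congr rfl fun _ _ => Finset.sum_congr rfl fun _ _ => by ring

lemma hermSum_smul_left (M : P → P → ℂ) (c : ℂ) (q r : P → ℂ) :
    hermSum M (c • q) r = conj c * hermSum M q r := by
  simp only [hermSum, Pi.smul_apply, smul_eq_mul, map_mul, Finset.mul_sum]
  exact Finset.sum_congr rfl fun _ _ => Finset.sum_congr rfl fun _ _ => by ring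

lemma hermSum_smul_right (M : P → P → ℂ) (c : ℂ) (q r : P → ℂ) :
    hermSum M q (c • r) = c * hermSum M q r := by
  simp only [hermSum, Pi.smul_apply, smul_eq_mul, Finset.mul_sum]
  exact Finset.sum_congr rfl fun _ _ => Finset.sum_congr rfl fun _ _ => by ring

lemma conj_hermSum (M : P → P → ℂ) (q r : P → ℂ) :
    conj (hermSum M q r) = hermSum (fun p p' => conj (M p' p)) r q := by
  simp only [hermSum, map_sum, map_mul, Complex.conj_conj]
  rw [Finset.sum_comm]
  exact Finset.sum_congr rfl fun _ _ => Finset.sum_congr rfl fun _ _ => by ring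

lemma hermSum_add (M M' : P → P → ℂ) (q r : P → ℂ) :
    hermSum (fun p p' => M p p' + M' p p') q r = hermSum M q r + hermSum M' q r := by
  simp only [hermSum, mul_add, Finset.sum_add_distrib]

lemma hermSum_sub (M M' : P → P → ℂ) (q r : P → ℂ) :
    hermSum (fun p p' => M p p' - M' p p') q r = hermSum M q r - hermSum M' q r := by
  simp only [hermSum, mul_sub, Finset.sum_sub_distrib]

lemma hermSum_diag [DecidableEq P] (D : P → ℂ) (q r : P → ℂ) :
    hermSum (fun p p' => if p = p' then D p else 0) q r = ∑ p, conj (q p) * r p * D p := by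
  simp [hermSum]

lemma inner_linearCombination {H : Type*} [NormedAddCommGroup H] [InnerProductSpace ℂ H]
    (v w : P → H) (q r : P → ℂ) :
    inner ℂ (Fintype.linearCombination ℂ v q) (Fintype.linearCombination ℂ w r)
      = hermSum (fun p p' => inner ℂ (v p) (w p')) q r := by
  simp only [Fintype.linearCombination_apply, sum_inner, inner_sum, inner_smul_left,
    inner_smul_right, hermSum, Finset.mul_sum]
  rw [Finset.sum_comm]
  exact Finset.sum_congr rfl fun _ _ => Finset.sum_congr rfl fun _ _ => by ring

lemma norm_hermSum_le {M : P → P → ℂ} {C : ℝ} (hM : ∀ p p', ‖M p p'‖ ≤ C) (q : P → ℂ) :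
    ‖hermSum M q q‖ ≤ C * (∑ p, ‖q p‖) ^ 2 := by
  rw [hermSum, pow_two, Finset.sum_mul_sum, Finset.mul_sum]
  refine (norm_sum_le _ _).trans (Finset.sum_le_sum fun p _ => ?_)
  rw [Finset.mul_sum]
  refine (norm_sum_le _ _).trans (Finset.sum_le_sum fun p' _ => ?_)
  rw [norm_mul, norm_mul, RCLike.norm_conj, mul_comm]
  gcongr
  exact hM p p'

lemma continuous_hermSum (M : P → P → ℂ) : Continuous fun q : P → ℂ => hermSum M q q := by
  unfold hermSum; fun_prop

end hermSum

/-- The singular part as a linear function of the charges. -/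
def chiS (x : Fin N → Plane) (α : Fin N → ℝ) (ξ : Fin N → Plane → ℝ) (lam : ℝ) :
    (Fin N × Fin 2 → ℂ) →ₗ[ℂ] L2 := Fintype.linearCombination ℂ (chi x α ξ lam)

/-- The total cross term. -/
def crossS (x : Fin N → Plane) (α : Fin N → ℝ) (ξ : Fin N → Plane → ℝ) (lam : ℝ)
    (q : Fin N × Fin 2 → ℂ) (g : GraphSpace) : ℂ := ∑ p, q p * crossL x α ξ lam p g

/-- The change of the regular part when the parameter and the cut-offs are changed. -/
def etaS (x : Fin N → Plane) (α : Fin N → ℝ) (ξ ξ' : Fin N → Plane → ℝ) (lam lam' : ℝ) :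
    (Fin N × Fin 2 → ℂ) →ₗ[ℂ] GraphSpace :=
  Fintype.linearCombination ℂ (etaL x α ξ ξ' lam lam')

section charges

variable {x : Fin N → Plane} {α : Fin N → ℝ} {ξ ξ' : Fin N → Plane → ℝ} {lam lam' : ℝ}

lemma crossL_add (p : Fin N × Fin 2) (g g' : GraphSpace) :
    crossL x α ξ lam p (g + g') = crossL x α ξ lam p g + crossL x α ξ lam p g' := by
  simp only [crossL, Prod.fst_add, Prod.snd_add, inner_add_left]; ring

lemma crossL_smul (p : Fin N × Fin 2) (c : ℂ) (g : GraphSpace) :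
    crossL x α ξ lam p (c • g) = conj c * crossL x α ξ lam p g := by
  simp only [crossL, Prod.smul_fst, Prod.smul_snd, inner_smul_left]; ring

lemma crossL_sum_smul {ι : Type*} (s : Finset ι) (p : Fin N × Fin 2) (c : ι → ℂ)
    (g : ι → GraphSpace) :
    crossL x α ξ lam p (∑ i ∈ s, c i • g i) = ∑ i ∈ s, conj (c i) * crossL x α ξ lam p (g i) := by
  classical
  induction s using Finset.induction_on with
  | empty => simp [crossL]
  | insert i s hi ih => rw [Finset.sum_insert hi, Finset.sum_insert hi, crossL_add, crossL_smul, ih]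

lemma crossS_add_left (q r : Fin N × Fin 2 → ℂ) (g : GraphSpace) :
    crossS x α ξ lam (q + r) g = crossS x α ξ lam q g + crossS x α ξ lam r g := by
  simp only [crossS, Pi.add_apply, add_mul, Finset.sum_add_distrib]

lemma crossS_smul_left (c : ℂ) (q : Fin N × Fin 2 → ℂ) (g : GraphSpace) :
    crossS x α ξ lam (c • q) g = c * crossS x α ξ lam q g := by
  simp only [crossS, Pi.smul_apply, smul_eq_mul, Finset.mul_sum, mul_assoc]

lemma crossS_add_right (q : Fin N × Fin 2 → ℂ) (g g' : GraphSpace) :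
    crossS x α ξ lam q (g + g') = crossS x α ξ lam q g + crossS x α ξ lam q g' := by
  simp only [crossS, crossL_add, mul_add, Finset.sum_add_distrib]

lemma crossS_smul_right (c : ℂ) (q : Fin N × Fin 2 → ℂ) (g : GraphSpace) :
    crossS x α ξ lam q (c • g) = conj c * crossS x α ξ lam q g := by
  simp only [crossS, crossL_smul, Finset.mul_sum]
  exact Finset.sum_congr rfl fun _ _ => by ring

lemma continuous_crossS (x : Fin N → Plane) (α : Fin N → ℝ) (ξ : Fin N → Plane → ℝ) (lam : ℝ) :
    Continuous fun d : GraphSpace × (Fin N × Fin 2 → ℂ) => crossS x α ξ lam d.2 d.1 := by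
  have := continuous_crossL x α ξ lam
  unfold crossS; fun_prop

lemma continuous_chiS (x : Fin N → Plane) (α : Fin N → ℝ) (ξ : Fin N → Plane → ℝ) (lam : ℝ) :
    Continuous (chiS x α ξ lam) := LinearMap.continuous_of_finiteDimensional _

lemma etaS_mem (h : IsCutoff x ξ) (h' : IsCutoff x ξ') (hlam : 0 < lam) (hlam' : 0 < lam')
    (hα : ∀ n, α n ∈ Ioo (0 : ℝ) 1) (q : Fin N × Fin 2 → ℂ) :
    etaS x α ξ ξ' lam lam' q ∈ formGraph x α :=
  Submodule.sum_mem _ fun p _ => Submodule.smul_mem _ _ (etaL_mem h h' hlam hlam' hα p)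

lemma etaS_fst (h : IsCutoff x ξ) (h' : IsCutoff x ξ') (hlam : 0 < lam) (hlam' : 0 < lam')
    (hα : ∀ n, α n ∈ Ioo (0 : ℝ) 1) (q : Fin N × Fin 2 → ℂ) :
    (etaS x α ξ ξ' lam lam' q).1 = chiS x α ξ lam q - chiS x α ξ' lam' q := by
  simp only [etaS, chiS, Fintype.linearCombination_apply, Prod.fst_sum, Prod.smul_fst,
    etaL_fst h h' hlam hlam' hα, smul_sub, Finset.sum_sub_distrib]

lemma inner_etaS (h : IsCutoff x ξ) (h' : IsCutoff x ξ') (hlam : 0 < lam) (hlam' : 0 < lam')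
    (hα : ∀ n, α n ∈ Ioo (0 : ℝ) 1) (q : Fin N × Fin 2 → ℂ) {g : GraphSpace}
    (hg : g ∈ formGraph x α) :
    inner ℂ g.2 (etaS x α ξ ξ' lam lam' q).2
      = crossS x α ξ lam q g - (lam : ℂ) ^ 2 * inner ℂ g.1 (chiS x α ξ lam q)
        - (crossS x α ξ' lam' q g - (lam' : ℂ) ^ 2 * inner ℂ g.1 (chiS x α ξ' lam' q)) := by
  simp only [etaS, chiS, crossS, Fintype.linearCombination_apply, Prod.snd_sum, Prod.smul_snd,
    inner_sum, inner_smul_right, inner_etaL h h' hlam hlam' hα _ hg, Finset.mul_sum,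
    ← Finset.sum_sub_distrib]
  exact Finset.sum_congr rfl fun _ _ => by ring

lemma crossS_etaS (h : IsCutoff x ξ) (h' : IsCutoff x ξ') {ζ : Fin N → Plane → ℝ}
    (hζ : IsCutoff x ζ) (hlam : 0 < lam) (hlam' : 0 < lam') {μ : ℝ} (hμ : 0 < μ)
    (hα : ∀ n, α n ∈ Ioo (0 : ℝ) 1) (q : Fin N × Fin 2 → ℂ) :
    crossS x α ζ μ q (etaS x α ξ ξ' lam lam' q)
      = hermSum (crossPair x α ζ ξ μ lam) q q - hermSum (crossPair x α ζ ξ' μ lam') q q := by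
  rw [← hermSum_sub]
  simp only [← crossL_etaL h h' hζ hlam hlam' hμ hα, crossS, etaS, hermSum,
    Fintype.linearCombination_apply, crossL_sum_smul, Finset.mul_sum]
  rw [Finset.sum_comm]
  exact Finset.sum_congr rfl fun _ _ => Finset.sum_congr rfl fun _ _ => by ring

/-- Green's identity for singular parts. -/
lemma green_chiS (h : IsCutoff x ξ) (h' : IsCutoff x ξ') (hlam : 0 < lam) (hlam' : 0 < lam')
    (hα : ∀ n, α n ∈ Ioo (0 : ℝ) 1) (q : Fin N × Fin 2 → ℂ) :
    ((lam : ℂ) ^ 2 - (lam' : ℂ) ^ 2) * inner ℂ (chiS x α ξ' lam' q) (chiS x α ξ lam q)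
      - hermSum (crossPair x α ξ ξ' lam lam') q q + conj (hermSum (crossPair x α ξ' ξ lam' lam) q q)
      = -∑ p, conj (q p) * q p * ((diagC α lam' p : ℂ) - (diagC α lam p : ℂ)) := by
  rw [← Finset.sum_neg_distrib]
  simp only [← mul_neg]
  rw [← hermSum_diag, chiS, chiS, inner_linearCombination, conj_hermSum]
  simp only [← green_chi h h' hlam hlam' hα]
  simp only [hermSum, Finset.mul_sum, ← Finset.sum_sub_distrib, ← Finset.sum_add_distrib]
  exact Finset.sum_congr rfl fun _ _ => Finset.sum_congr rfl fun _ _ => by ring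

/-- Strict monotonicity in λ, due to ν > 0 and sin πα > 0, is what forces the charges to vanish in
the uniqueness argument. -/
lemma diagC_lt {p : Fin N × Fin 2} (hα : α p.1 ∈ Ioo (0 : ℝ) 1) (hlam : 0 < lam)
    (hlt : lam < lam') : diagC α lam p < diagC α lam' p := by
  have hs : 0 < Real.sin (Real.pi * α p.1) :=
    Real.sin_pos_of_pos_of_lt_pi (mul_pos Real.pi_pos hα.1)
      (by nlinarith [Real.pi_pos, hα.2])
  have hν := (nu_mem α p.2 hα).1
  have := Real.rpow_lt_rpow hlam.le hlt (by positivity : 0 < 2 * nu α p.1 p.2)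
  unfold diagC
  have := Real.pi_pos
  gcongr

/-- This growth absorbs all λ-uniformly bounded coefficients in the coercivity estimate. -/
lemma tendsto_diagC {p : Fin N × Fin 2} (hα : α p.1 ∈ Ioo (0 : ℝ) 1) :
    Tendsto (fun lam => diagC α lam p) atTop atTop := by
  have hs : 0 < Real.sin (Real.pi * α p.1) :=
    Real.sin_pos_of_pos_of_lt_pi (mul_pos Real.pi_pos hα.1)
      (by nlinarith [Real.pi_pos, hα.2])
  have hν := (nu_mem α p.2 hα).1
  unfold diagC
  exact ((tendsto_rpow_atTop (by positivity)).const_mul_atTop Real.pi_pos).atTop_div_const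
    (by positivity)

/-- No nontrivial singular part belongs to the Friedrichs domain. -/
lemma eq_zero_of_chiS_mem (h : IsCutoff x ξ) (hlam : 0 < lam)
    (hα : ∀ n, α n ∈ Ioo (0 : ℝ) 1) {q : Fin N × Fin 2 → ℂ}
    {v : Lp CVec 2 (volume : Measure Plane)} (hv : (chiS x α ξ lam q, v) ∈ formGraph x α) :
    q = 0 := by
  have hlam' : 0 < lam + 1 := by linarith
  -- Since η is in the Friedrichs domain, the singular part with λ + 1 and the same charges lies
  -- there too; any larger parameter would serve.
  set w := v - (etaS x α ξ ξ lam (lam + 1) q).2 with hw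
  have hv' : (chiS x α ξ (lam + 1) q, w) ∈ formGraph x α := by
    have := Submodule.sub_mem _ hv (etaS_mem h h hlam hlam' hα q)
    convert this using 1
    refine Prod.ext ?_ rfl
    rw [Prod.fst_sub, etaS_fst h h hlam hlam' hα]
    simp
  -- The product ⟨w, v⟩ is evaluated with either singular part as the one to which Green's identity
  -- is applied.
  have e1 := inner_sum_chi h hlam hα hv hv'
  have e2 := inner_sum_chi h hlam' hα hv' hv
  have f1 := fun p' => crossL_sum_chi (ξ := ξ) h h hlam hlam' hα hv' p'
  have f2 := fun p' => crossL_sum_chi (ξ := ξ) h h hlam' hlam hα hv p'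
  have key : ∀ {lam lam' : ℝ} {v w : Lp CVec 2 (volume : Measure Plane)},
      inner ℂ w v = ∑ p, q p * (crossL x α ξ lam p (chiS x α ξ lam' q, w)
        - (lam : ℂ) ^ 2 * inner ℂ (chiS x α ξ lam' q) (chi x α ξ lam p)) →
      (∀ p', crossL x α ξ lam p' (chiS x α ξ lam' q, w)
        = ∑ p, conj (q p) * crossPair x α ξ ξ lam lam' p p') →
      inner ℂ w v = hermSum (crossPair x α ξ ξ lam lam') q q
        - (lam : ℂ) ^ 2 * inner ℂ (chiS x α ξ lam' q) (chiS x α ξ lam q) := by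
    intro lam lam' v w e f
    rw [e, hermSum, Finset.sum_comm]
    conv_rhs => rw [chiS, chiS, Fintype.linearCombination_apply ℂ (chi x α ξ lam), inner_sum]
    rw [Finset.mul_sum, ← Finset.sum_sub_distrib]
    refine Finset.sum_congr rfl fun p _ => ?_
    rw [f, inner_smul_right, mul_sub, Finset.mul_sum, chiS]
    congr 1
    · exact Finset.sum_congr rfl fun _ _ => by ring
    · ring
  have k1 : inner ℂ w v = _ := key e1 f1
  have k2 := congrArg conj (key e2 f2)
  simp only [map_sub, map_mul, inner_conj_symm, map_pow, Complex.conj_ofReal] at k2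
  have g := green_chiS h h hlam hlam' hα q
  -- The two evaluations agree up to conjugation, so the left side of Green's identity vanishes and
  -- only the diagonal coefficients remain.
  have hsum : (∑ p, conj (q p) * q p
      * ((diagC α (lam + 1) p : ℂ) - (diagC α lam p : ℂ))) = 0 := by
    linear_combination g - k1 + k2
  have hsum' : ∑ p, ‖q p‖ ^ 2 * (diagC α (lam + 1) p - diagC α lam p) = 0 := by
    have : ((∑ p, ‖q p‖ ^ 2 * (diagC α (lam + 1) p - diagC α lam p) : ℝ) : ℂ) = 0 := by
      rw [← hsum]
      push_cast
      exact Finset.sum_congr rfl fun p _ => by rw [RCLike.conj_mul]; rfl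
    exact_mod_cast this
  have hpos : ∀ p, 0 < diagC α (lam + 1) p - diagC α lam p := fun p =>
    sub_pos.2 (diagC_lt (hα p.1) hlam (by linarith))
  rw [Finset.sum_eq_zero_iff_of_nonneg fun p _ => mul_nonneg (sq_nonneg _) (hpos p).le] at hsum'
  funext p
  simpa [(hpos p).ne'] using hsum' p (Finset.mem_univ p)

end charges

/-! ### The sesquilinear form -/

/-- The function with regular part `d.1` and charges `d.2`. -/
def total (x : Fin N → Plane) (α : Fin N → ℝ) (ξ : Fin N → Plane → ℝ) (lam : ℝ) :
    GraphSpace × (Fin N × Fin 2 → ℂ) →ₗ[ℂ] L2 :=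
  (LinearMap.fst ℂ _ _).comp (LinearMap.fst ℂ _ _) + (chiS x α ξ lam).comp (LinearMap.snd ℂ _ _)

/-- The matrix of the quadratic form in the charges. -/
def chargeM (x : Fin N → Plane) (α : Fin N → ℝ) (ξ : Fin N → Plane → ℝ) (lam : ℝ)
    (B : Matrix (Fin N × Fin 2) (Fin N × Fin 2) ℂ) (p p' : Fin N × Fin 2) : ℂ :=
  B p p' + (if p = p' then (diagC α lam p : ℂ) else 0) + xiM x α ξ lam p p'

/-- The polarization of the perturbed form. -/
def sesqVal (x : Fin N → Plane) (α : Fin N → ℝ) (ξ : Fin N → Plane → ℝ) (lam : ℝ)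
    (B : Matrix (Fin N × Fin 2) (Fin N × Fin 2) ℂ) (d e : GraphSpace × (Fin N × Fin 2 → ℂ)) : ℂ :=
  inner ℂ d.1.2 e.1.2 - (lam : ℂ) ^ 2 * inner ℂ (total x α ξ lam d) (total x α ξ lam e)
    + (lam : ℂ) ^ 2 * inner ℂ d.1.1 e.1.1
    + crossS x α ξ lam e.2 d.1 + conj (crossS x α ξ lam d.2 e.1)
    + hermSum (chargeM x α ξ lam B) d.2 e.2

section sesq

variable {x : Fin N → Plane} {α : Fin N → ℝ} {ξ ξ' : Fin N → Plane → ℝ} {lam lam' : ℝ}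
  {B : Matrix (Fin N × Fin 2) (Fin N × Fin 2) ℂ}

lemma total_apply (d : GraphSpace × (Fin N × Fin 2 → ℂ)) :
    total x α ξ lam d = d.1.1 + chiS x α ξ lam d.2 := rfl

lemma conj_hermSum_xiM (h : IsCutoff x ξ) (hlam : 0 < lam) (hα : ∀ n, α n ∈ Ioo (0 : ℝ) 1)
    (q r : Fin N × Fin 2 → ℂ) :
    conj (hermSum (xiM x α ξ lam) q r) = hermSum (xiM x α ξ lam) r q := by
  rw [conj_hermSum]
  simp only [xiM_conj h hlam hα]

lemma hermSum_chargeM (q r : Fin N × Fin 2 → ℂ) :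
    hermSum (chargeM x α ξ lam B) q r = hermSum (fun p p' => B p p') q r
      + ∑ p, conj (q p) * r p * (diagC α lam p : ℂ) + hermSum (xiM x α ξ lam) q r := by
  rw [← hermSum_diag, ← hermSum_add, ← hermSum_add]
  rfl

lemma conj_sesqVal (h : IsCutoff x ξ) (hlam : 0 < lam) (hα : ∀ n, α n ∈ Ioo (0 : ℝ) 1)
    (hB : B.IsHermitian) (d e : GraphSpace × (Fin N × Fin 2 → ℂ)) :
    conj (sesqVal x α ξ lam B d e) = sesqVal x α ξ lam B e d := by
  have hb : conj (hermSum (chargeM x α ξ lam B) d.2 e.2)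
      = hermSum (chargeM x α ξ lam B) e.2 d.2 := by
    rw [conj_hermSum]
    refine congrArg (fun M => hermSum M e.2 d.2) (funext fun p => funext fun p' => ?_)
    have hBp : conj (B p' p) = B p p' := by simpa using hB.apply p p'
    simp only [chargeM, map_add, xiM_conj h hlam hα, hBp]
    by_cases hp : p = p'
    · subst hp; simp
    · simp [hp, Ne.symm hp]
  simp only [sesqVal, map_add, map_sub, map_mul, inner_conj_symm, map_pow, Complex.conj_ofReal,
    Complex.conj_conj, hb]
  ring

/-- The polarization as a sesquilinear map. -/
def sesq (x : Fin N → Plane) (α : Fin N → ℝ) (ξ : Fin N → Plane → ℝ) (lam : ℝ)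
    (B : Matrix (Fin N × Fin 2) (Fin N × Fin 2) ℂ) :
    GraphSpace × (Fin N × Fin 2 → ℂ) →ₗ⋆[ℂ] GraphSpace × (Fin N × Fin 2 → ℂ) →ₗ[ℂ] ℂ :=
  LinearMap.mk₂'ₛₗ (starRingEnd ℂ) (RingHom.id ℂ) (sesqVal x α ξ lam B)
    (fun d d' e => by
      simp only [sesqVal, Prod.fst_add, Prod.snd_add, map_add, inner_add_left, crossS_add_left,
        crossS_add_right, hermSum_add_left]
      ring)
    (fun c d e => by
      simp only [sesqVal, Prod.smul_fst, Prod.smul_snd, map_smul, inner_smul_left,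
        crossS_smul_left, crossS_smul_right, hermSum_smul_left, map_mul, smul_eq_mul]
      ring)
    (fun d e e' => by
      simp only [sesqVal, Prod.fst_add, Prod.snd_add, map_add, inner_add_right, crossS_add_left,
        crossS_add_right, hermSum_add_right]
      ring)
    (fun c d e => by
      simp only [sesqVal, Prod.smul_fst, Prod.smul_snd, map_smul, inner_smul_right,
        crossS_smul_left, crossS_smul_right, hermSum_smul_right, map_mul, smul_eq_mul,
        Complex.conj_conj, RingHom.id_apply]
      ring)

lemma sesq_apply (d e : GraphSpace × (Fin N × Fin 2 → ℂ)) :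
    sesq x α ξ lam B d e = sesqVal x α ξ lam B d e := rfl

/-- The form does not depend on the parameter and on the cut-offs. -/
lemma sesqVal_change (h : IsCutoff x ξ) (h' : IsCutoff x ξ') (hlam : 0 < lam) (hlam' : 0 < lam')
    (hα : ∀ n, α n ∈ Ioo (0 : ℝ) 1) {g : GraphSpace} (hg : g ∈ formGraph x α)
    (q : Fin N × Fin 2 → ℂ) :
    sesqVal x α ξ' lam' B (g + etaS x α ξ ξ' lam lam' q, q) (g + etaS x α ξ ξ' lam lam' q, q)
      = sesqVal x α ξ lam B (g, q) (g, q) := by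
  have e1 := inner_etaS h h' hlam hlam' hα q hg
  have e1' := congrArg conj e1
  have e2 := inner_etaS h h' hlam hlam' hα q (etaS_mem h h' hlam hlam' hα q)
  have l1 := crossS_etaS h h' h hlam hlam' hlam hα q
  have l2 := crossS_etaS h h' h' hlam hlam' hlam' hα q
  have l2' := congrArg conj l2
  have gr := green_chiS h h' hlam hlam' hα q
  have m1 : hermSum (crossPair x α ξ ξ lam lam) q q = hermSum (xiM x α ξ lam) q q := by
    simp only [hermSum, crossPair_self h hlam hα]
  have m2 : hermSum (crossPair x α ξ' ξ' lam' lam') q q = hermSum (xiM x α ξ' lam') q q := by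
    simp only [hermSum, crossPair_self h' hlam' hα]
  rw [m1] at l1
  rw [m2] at l2 l2'
  rw [l1, l2, etaS_fst h h' hlam hlam' hα] at e2
  simp only [map_sub, map_mul, inner_conj_symm, map_pow, Complex.conj_ofReal,
    conj_hermSum_xiM h' hlam' hα] at e1' l2'
  have t : total x α ξ' lam' (g + etaS x α ξ ξ' lam lam' q, q) = total x α ξ lam (g, q) := by
    simp only [total_apply, Prod.fst_add, etaS_fst h h' hlam hlam' hα]
    abel
  simp only [sesqVal, t]
  simp only [total_apply, Prod.fst_add, Prod.snd_add, etaS_fst h h' hlam hlam' hα,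
    crossS_add_right, map_add, inner_add_left, inner_add_right, inner_sub_left, inner_sub_right,
    hermSum_chargeM] at e2 ⊢
  simp only [mul_sub, Finset.sum_sub_distrib] at gr
  -- With g the old regular part: `e1` and its conjugate are ⟨Dg, Dη⟩ and ⟨Dη, Dg⟩, `e2` is ‖Dη‖²,
  -- and `l2` with its conjugate gives the new cross terms at η. What remains are the mixed pairings
  -- of the two singular parts, which `gr` converts into the change of the diagonal coefficients.
  linear_combination e1 + e1' + e2 + l2 + l2' + gr

end sesq

/-! ### Decompositions -/

section decomp

variable {x : Fin N → Plane} {α : Fin N → ℝ} {ξ ξ' : Fin N → Plane → ℝ} {lam lam' : ℝ}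
  {B : Matrix (Fin N × Fin 2) (Fin N × Fin 2) ℂ} {ψ φ φ' : L2} {q q' : Fin N × Fin 2 → ℂ}

lemma singularPart_eq (q : Fin N × Fin 2 → ℂ) (y : Plane) :
    singularPart x α ξ lam q y = ∑ p, q p * sing x α ξ lam p.1 p.2 y := by
  rw [Fintype.sum_prod_type]
  simp only [singularPart, Finset.mul_sum, sing, xiC]
  exact Finset.sum_congr rfl fun _ _ => Finset.sum_congr rfl fun _ _ => by ring

lemma chiS_ae (h : IsCutoff x ξ) (hlam : 0 < lam) (hα : ∀ n, α n ∈ Ioo (0 : ℝ) 1)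
    (q : Fin N × Fin 2 → ℂ) :
    (chiS x α ξ lam q : Plane → ℂ) =ᵐ[volume] singularPart x α ξ lam q := by
  filter_upwards [sum_chi_ae h hlam hα q] with y hy
  rw [singularPart_eq, ← hy]
  rfl

lemma memLp_singularPart (h : IsCutoff x ξ) (hlam : 0 < lam) (hα : ∀ n, α n ∈ Ioo (0 : ℝ) 1)
    (q : Fin N × Fin 2 → ℂ) : MemLp (singularPart x α ξ lam q) 2 volume :=
  (memLp_congr_ae (chiS_ae h hlam hα q)).1 (Lp.memLp _)

lemma isDecomp_iff (h : IsCutoff x ξ) (hlam : 0 < lam) (hα : ∀ n, α n ∈ Ioo (0 : ℝ) 1) :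
    IsDecomp x α ξ lam ψ φ q
      ↔ ∃ v, (φ, v) ∈ formGraph x α ∧ ψ = total x α ξ lam ((φ, v), q) := by
  have key : (∀ᵐ y ∂(volume : Measure Plane), ψ y = φ y + singularPart x α ξ lam q y)
      ↔ ψ = φ + chiS x α ξ lam q := by
    constructor
    · intro hψ
      refine Lp.ext ?_
      filter_upwards [hψ, Lp.coeFn_add φ (chiS x α ξ lam q), chiS_ae h hlam hα q] with y h1 h2 h3
      rw [h1, h2, Pi.add_apply, h3]
    · rintro rfl
      filter_upwards [Lp.coeFn_add φ (chiS x α ξ lam q), chiS_ae h hlam hα q] with y h2 h3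
      rw [h2, Pi.add_apply, h3]
  rw [IsDecomp, key, mem_friedrichsDomain_iff]
  exact exists_and_right.symm

lemma formExpr_eq (h : IsCutoff x ξ) (hlam : 0 < lam) (hα : ∀ n, α n ∈ Ioo (0 : ℝ) 1)
    {v : Lp CVec 2 (volume : Measure Plane)} (hv : (φ, v) ∈ formGraph x α) :
    formExpr x α ξ lam B (total x α ξ lam ((φ, v), q)) φ q
      = sesqVal x α ξ lam B ((φ, v), q) ((φ, v), q) := by
  have hc : (2 : ℂ) * ∑ n, ∑ l, (((q (n, l) * (2 * (∫ y, cross1 x α ξ lam φ n l y)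
      + ∫ y, cross2 x α ξ lam φ n l y)).re : ℝ) : ℂ)
      = crossS x α ξ lam q (φ, v) + conj (crossS x α ξ lam q (φ, v)) := by
    simp only [(cross_of_mem h _ (hα _) hlam hv).2.2]
    rw [Complex.add_conj, crossS, Fintype.sum_prod_type]
    simp only [Complex.re_sum, crossL]
    push_cast
    rfl
  have hm : (∑ m, ∑ n, ∑ l, ∑ l', conj (q (m, l)) * q (n, l') *
      (B (m, l) (n, l') + if m = n then
            (if l = l' then
              ((Real.pi * lam ^ (2 * nu α n l) / (2 * Real.sin (Real.pi * α n)) : ℝ) : ℂ)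
            else 0) + Xi x α ξ lam n l l' else 0))
      = hermSum (chargeM x α ξ lam B) q q := by
    simp only [hermSum, Fintype.sum_prod_type]
    refine Finset.sum_congr rfl fun m _ => ?_
    rw [Finset.sum_comm]
    refine Finset.sum_congr rfl fun l _ => Finset.sum_congr rfl fun n _ =>
      Finset.sum_congr rfl fun l' _ => ?_
    congr 1
    simp only [chargeM, xiM, diagC, Prod.mk.injEq, add_assoc]
    congr 1
    by_cases hmn : m = n
    · subst hmn; simp
    · simp [hmn]
  rw [formExpr, hc, hm, sesqVal, friedrichsForm_eq hv]
  simp only [inner_self_eq_norm_sq_to_K]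
  push_cast
  simp only [Complex.coe_algebraMap]
  ring

/-- If φ plus a singular part is zero, that singular part equals -φ and lies in the Friedrichs
domain, so the charges vanish; then φ = 0, and the second component vanishes by uniqueness. -/
lemma total_injOn (h : IsCutoff x ξ) (hlam : 0 < lam) (hα : ∀ n, α n ∈ Ioo (0 : ℝ) 1)
    {d : GraphSpace × (Fin N × Fin 2 → ℂ)} (hd : d.1 ∈ formGraph x α)
    (h0 : total x α ξ lam d = 0) : d = 0 := by
  obtain ⟨⟨φ, v⟩, q⟩ := d
  have e : chiS x α ξ lam q = -φ := by
    rw [total_apply] at h0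
    exact (neg_eq_of_add_eq_zero_right h0).symm
  have hq : q = 0 := eq_zero_of_chiS_mem h hlam hα (v := -v) (by
    rw [e]; exact Submodule.neg_mem _ hd)
  subst hq
  have hφ : φ = 0 := by simpa using e
  subst hφ
  have hv : v = 0 := snd_unique hd (Submodule.zero_mem _)
  subst hv
  rfl

lemma total_inj (h : IsCutoff x ξ) (hlam : 0 < lam) (hα : ∀ n, α n ∈ Ioo (0 : ℝ) 1)
    {d e : GraphSpace × (Fin N × Fin 2 → ℂ)} (hd : d.1 ∈ formGraph x α)
    (he : e.1 ∈ formGraph x α) (h0 : total x α ξ lam d = total x α ξ lam e) : d = e :=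
  sub_eq_zero.1 (total_injOn h hlam hα (Submodule.sub_mem _ hd he) (by rw [map_sub, h0, sub_self]))

lemma IsDecomp.unique (h : IsCutoff x ξ) (hlam : 0 < lam) (hα : ∀ n, α n ∈ Ioo (0 : ℝ) 1)
    (h1 : IsDecomp x α ξ lam ψ φ q) (h2 : IsDecomp x α ξ lam ψ φ' q') : φ = φ' ∧ q = q' := by
  obtain ⟨v, hv, e⟩ := (isDecomp_iff h hlam hα).1 h1
  obtain ⟨v', hv', e'⟩ := (isDecomp_iff h hlam hα).1 h2
  have := total_inj h hlam hα (d := ((φ, v), q)) (e := ((φ', v'), q')) hv hv' (e.symm.trans e')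
  exact ⟨congrArg (fun d => d.1.1) this, congrArg Prod.snd this⟩

lemma sesqVal_self_re (h : IsCutoff x ξ) (hlam : 0 < lam) (hα : ∀ n, α n ∈ Ioo (0 : ℝ) 1)
    (hB : B.IsHermitian) (d : GraphSpace × (Fin N × Fin 2 → ℂ)) :
    (((sesqVal x α ξ lam B d d).re : ℝ) : ℂ) = sesqVal x α ξ lam B d d :=
  Complex.conj_eq_iff_re.1 (conj_sesqVal h hlam hα hB d d)

/-- The decomposition chosen inside `form` is irrelevant by uniqueness. -/
lemma form_total (h : IsCutoff x ξ) (hlam : 0 < lam) (hα : ∀ n, α n ∈ Ioo (0 : ℝ) 1)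
    {d : GraphSpace × (Fin N × Fin 2 → ℂ)} (hd : d.1 ∈ formGraph x α) :
    form x α ξ lam B (total x α ξ lam d) = (sesqVal x α ξ lam B d d).re := by
  have hdec : IsDecomp x α ξ lam (total x α ξ lam d) d.1.1 d.2 :=
    (isDecomp_iff h hlam hα).2 ⟨d.1.2, hd, rfl⟩
  have hex : ∃ p : L2 × (Fin N × Fin 2 → ℂ),
      IsDecomp x α ξ lam (total x α ξ lam d) p.1 p.2 := ⟨(d.1.1, d.2), hdec⟩
  obtain ⟨e1, e2⟩ := IsDecomp.unique h hlam hα hex.choose_spec hdec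
  rw [form, dif_pos hex, e1, e2]
  exact congrArg Complex.re (formExpr_eq (q := d.2) h hlam hα hd)

lemma form_eq_formExpr (h : IsCutoff x ξ) (hlam : 0 < lam) (hα : ∀ n, α n ∈ Ioo (0 : ℝ) 1)
    (hB : B.IsHermitian) (hd : IsDecomp x α ξ lam ψ φ q) :
    (form x α ξ lam B ψ : ℂ) = formExpr x α ξ lam B ψ φ q := by
  obtain ⟨v, hv, rfl⟩ := (isDecomp_iff h hlam hα).1 hd
  rw [form_total h hlam hα (d := ((φ, v), q)) hv, sesqVal_self_re h hlam hα hB,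
    formExpr_eq h hlam hα hv]

lemma mem_formDomain_iff (h : IsCutoff x ξ) (hlam : 0 < lam) (hα : ∀ n, α n ∈ Ioo (0 : ℝ) 1) :
    ψ ∈ formDomain x α ξ lam ↔ ∃ d, d.1 ∈ formGraph x α ∧ total x α ξ lam d = ψ := by
  constructor
  · rintro ⟨φ, q, hd⟩
    obtain ⟨v, hv, rfl⟩ := (isDecomp_iff h hlam hα).1 hd
    exact ⟨((φ, v), q), hv, rfl⟩
  · rintro ⟨d, hd, rfl⟩
    exact ⟨d.1.1, d.2, (isDecomp_iff h hlam hα).2 ⟨d.1.2, hd, rfl⟩⟩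

/-- The domain is the image of graph × charges under an injective linear map; the explicit
sesquilinear expression is transported along its inverse. -/
lemma isHermitianForm_form (h : IsCutoff x ξ) (hlam : 0 < lam)
    (hα : ∀ n, α n ∈ Ioo (0 : ℝ) 1) (hB : B.IsHermitian) :
    IsHermitianForm (formDomain x α ξ lam) (form x α ξ lam B) := by
  set K : Submodule ℂ (GraphSpace × (Fin N × Fin 2 → ℂ)) := (formGraph x α).prod ⊤ with hK
  set T : K →ₗ[ℂ] L2 := (total x α ξ lam).domRestrict K with hT
  have hinj : Function.Injective T := by
    rw [← LinearMap.ker_eq_bot, LinearMap.ker_eq_bot']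
    intro d hd
    exact Subtype.ext (total_injOn h hlam hα d.2.1 hd)
  obtain ⟨f, hf, hTf⟩ : ∃ f : LinearMap.range T →ₗ[ℂ] GraphSpace × (Fin N × Fin 2 → ℂ),
      (∀ u, (f u).1 ∈ formGraph x α) ∧ ∀ u, total x α ξ lam (f u) = u :=
    ⟨K.subtype.comp (LinearEquiv.ofInjective T hinj).symm.toLinearMap,
      fun u => ((LinearEquiv.ofInjective T hinj).symm u).2.1,
      fun u => congrArg Subtype.val ((LinearEquiv.ofInjective T hinj).apply_symm_apply u)⟩
  refine ⟨LinearMap.range T, LinearMap.mk₂'ₛₗ (starRingEnd ℂ) (RingHom.id ℂ)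
      (fun u v => sesq x α ξ lam B (f u) (f v)) (by simp) (by simp) (by simp) (by simp),
    ?_, fun u v => ?_, fun u => ?_⟩
  · ext ψ
    rw [mem_formDomain_iff h hlam hα]
    constructor
    · rintro ⟨d, rfl⟩
      exact ⟨d, d.2.1, rfl⟩
    · rintro ⟨d, hd, rfl⟩
      exact ⟨⟨d, hd, trivial⟩, rfl⟩
  · exact (conj_sesqVal h hlam hα hB (f v) (f u)).symm
  · have hu := form_total (B := B) h hlam hα (hf u)
    rw [hTf] at hu
    exact (sesqVal_self_re h hlam hα hB (f u)).symm.trans (congrArg Complex.ofReal hu.symm)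

/-- Independence of the parameter and of the cut-offs, one inclusion. -/
lemma form_change (h : IsCutoff x ξ) (h' : IsCutoff x ξ') (hlam : 0 < lam) (hlam' : 0 < lam')
    (hα : ∀ n, α n ∈ Ioo (0 : ℝ) 1) (hψ : ψ ∈ formDomain x α ξ lam) :
    ψ ∈ formDomain x α ξ' lam' ∧ form x α ξ lam B ψ = form x α ξ' lam' B ψ := by
  obtain ⟨⟨g, q⟩, hg, rfl⟩ := (mem_formDomain_iff h hlam hα).1 hψ
  have hg' := Submodule.add_mem _ hg (etaS_mem h h' hlam hlam' hα q)
  have e : total x α ξ' lam' (g + etaS x α ξ ξ' lam lam' q, q) = total x α ξ lam (g, q) := by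
    simp only [total_apply, Prod.fst_add, etaS_fst h h' hlam hlam' hα]
    abel
  refine ⟨(mem_formDomain_iff h' hlam' hα).2 ⟨_, hg', e⟩, ?_⟩
  rw [← e, form_total h' hlam' hα (d := (g + etaS x α ξ ξ' lam lam' q, q)) hg', e,
    form_total h hlam hα hg, sesqVal_change h h' hlam hlam' hα hg q]

lemma formDomain_eq (h : IsCutoff x ξ) (h' : IsCutoff x ξ') (hlam : 0 < lam) (hlam' : 0 < lam')
    (hα : ∀ n, α n ∈ Ioo (0 : ℝ) 1) : formDomain x α ξ lam = formDomain x α ξ' lam' :=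
  Subset.antisymm (fun _ hψ => (form_change (B := 0) h h' hlam hlam' hα hψ).1)
    fun _ hψ => (form_change (B := 0) h' h hlam' hlam hα hψ).1

/-! ### Coercivity and closedness -/

/-- The added λ²‖ψ‖² cancels the only term in which φ and the singular part meet through the L²
product. What is left is explicit in (Dφ, φ, q). -/
lemma re_sesqVal_add (d : GraphSpace × (Fin N × Fin 2 → ℂ)) :
    (sesqVal x α ξ lam B d d).re + lam ^ 2 * ‖total x α ξ lam d‖ ^ 2
      = ‖d.1.2‖ ^ 2 + lam ^ 2 * ‖d.1.1‖ ^ 2 + 2 * (crossS x α ξ lam d.2 d.1).re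
        + (∑ p, diagC α lam p * ‖d.2 p‖ ^ 2
        + (hermSum (fun p p' => B p p' + xiM x α ξ lam p p') d.2 d.2).re) := by
  have e : (∑ p, conj (d.2 p) * d.2 p * (diagC α lam p : ℂ))
      = ((∑ p, diagC α lam p * ‖d.2 p‖ ^ 2 : ℝ) : ℂ) := by
    push_cast
    exact Finset.sum_congr rfl fun p _ => by rw [RCLike.conj_mul, mul_comm]; rfl
  rw [sesqVal, hermSum_chargeM, e, hermSum_add (fun p p' => B p p')]
  simp only [inner_self_eq_norm_sq_to_K, Complex.coe_algebraMap, ← Complex.ofReal_pow,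
    ← Complex.ofReal_mul, Complex.add_re, Complex.sub_re, Complex.ofReal_re, Complex.conj_re]
  ring

/-- Bounds of the coefficients, uniform in the parameter. -/
lemma exists_coefficient_bound (h : IsCutoff x ξ) (hα : ∀ n, α n ∈ Ioo (0 : ℝ) 1)
    (B : Matrix (Fin N × Fin 2) (Fin N × Fin 2) ℂ) :
    ∃ C, 0 ≤ C ∧ ∀ lam, 0 < lam →
      (∀ (g : GraphSpace) (p), ‖crossL x α ξ lam p g‖ ≤ C * (‖g.2‖ + ‖g.1‖)) ∧
      ∀ p p', ‖B p p' + xiM x α ξ lam p p'‖ ≤ C := by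
  choose Ca hCa using fun p : Fin N × Fin 2 => exists_aVec_bound α p.1 h p.2 (hα _)
  choose Cb hCb using fun p : Fin N × Fin 2 => exists_bFun_bound α p.1 h p.2 (hα _)
  choose Cx hCx using fun (p : Fin N × Fin 2) (l : Fin 2) => exists_Xi_bound α p.1 h p.2 l (hα _)
  obtain ⟨C1, h1⟩ := Finite.exists_le fun p => |Ca p| + |Cb p|
  obtain ⟨C2, h2⟩ := Finite.exists_le fun r : (Fin N × Fin 2) × (Fin N × Fin 2) =>
    ‖B r.1 r.2‖ + |Cx r.1 r.2.2|
  refine ⟨|C1| + |C2|, by positivity, fun lam hlam => ⟨fun g p => ?_, fun p p' => ?_⟩⟩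
  · have k1 := (hCa p ⟨lam, hlam⟩).2
    have k2 := (hCb p ⟨lam, hlam⟩).2
    have k3 := h1 p
    have a1 := le_abs_self (Ca p)
    have a2 := le_abs_self (Cb p)
    have a3 := le_abs_self C1
    have a4 := abs_nonneg C2
    have a5 := abs_nonneg (Ca p)
    have a6 := abs_nonneg (Cb p)
    rw [mul_add]
    refine (norm_add_le _ _).trans (add_le_add ?_ ?_)
    · refine (norm_inner_le_norm _ _).trans ?_
      rw [mul_comm]
      gcongr
      linarith
    · refine (norm_inner_le_norm _ _).trans ?_
      rw [mul_comm]
      gcongr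
      linarith
  · have k3 := h2 (p, p')
    have a1 := le_abs_self (Cx p p'.2)
    have a2 := le_abs_self C2
    have a3 := abs_nonneg C1
    have : ‖xiM x α ξ lam p p'‖ ≤ |Cx p p'.2| := by
      rw [xiM]
      split_ifs
      · exact (hCx p p'.2 lam hlam).trans a1
      · simp
    refine (norm_add_le _ _).trans ?_
    simp only at k3
    linarith

/-- Coercivity for large parameters. -/
lemma exists_coercive (h : IsCutoff x ξ) (hα : ∀ n, α n ∈ Ioo (0 : ℝ) 1)
    (B : Matrix (Fin N × Fin 2) (Fin N × Fin 2) ℂ) :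
    ∃ lam₀ : ℝ, 0 < lam₀ ∧ ∀ lam, lam₀ ≤ lam → ∀ d : GraphSpace × (Fin N × Fin 2 → ℂ),
      1 / 2 * (‖d.1.2‖ ^ 2 + ‖d.1.1‖ ^ 2 + ∑ p, ‖d.2 p‖ ^ 2)
        ≤ (sesqVal x α ξ lam B d d).re + lam ^ 2 * ‖total x α ξ lam d‖ ^ 2 := by
  obtain ⟨C, hC0, hC⟩ := exists_coefficient_bound h hα B
  set k : ℝ := (Fintype.card (Fin N × Fin 2) : ℝ) with hk
  -- Completing squares in ‖Dφ‖ and ‖φ‖ costs 2C² (∑|q_p|)² each, the matrix costs C (∑|q_p|)², and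
  -- Cauchy–Schwarz turns (∑|q_p|)² into k ∑|q_p|². The remaining 1/2 is the coercivity constant.
  have ev : ∀ᶠ lam in atTop, ∀ p, 1 / 2 + (4 * C ^ 2 + C) * k ≤ diagC α lam p :=
    eventually_all.2 fun p => (tendsto_diagC (hα p.1)).eventually_ge_atTop _
  obtain ⟨L, hL⟩ := eventually_atTop.1 ev
  -- λ ≥ 1 ensures λ²‖φ‖² ≥ ‖φ‖², enough to absorb the cross term in φ.
  refine ⟨max L 1, by positivity, fun lam hl d => ?_⟩
  have hl1 : 1 ≤ lam := (le_max_right _ _).trans hl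
  obtain ⟨c1, c2⟩ := hC lam (by linarith)
  rw [re_sesqVal_add]
  set s := ∑ p, ‖d.2 p‖ with hs
  set t := ∑ p, ‖d.2 p‖ ^ 2 with ht
  have hs0 : 0 ≤ s := Finset.sum_nonneg fun _ _ => norm_nonneg _
  have hst : s ^ 2 ≤ k * t := by
    have := sq_sum_le_card_mul_sum_sq (s := Finset.univ) (f := fun p => ‖d.2 p‖)
    rwa [Finset.card_univ] at this
  have hD : (1 / 2 + (4 * C ^ 2 + C) * k) * t ≤ ∑ p, diagC α lam p * ‖d.2 p‖ ^ 2 := by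
    rw [ht, Finset.mul_sum]
    exact Finset.sum_le_sum fun p _ => mul_le_mul_of_nonneg_right
      (hL lam ((le_max_left _ _).trans hl) p) (sq_nonneg _)
  have hX : ‖crossS x α ξ lam d.2 d.1‖ ≤ C * s * (‖d.1.2‖ + ‖d.1.1‖) := by
    rw [crossS, hs, Finset.mul_sum, Finset.sum_mul]
    refine (norm_sum_le _ _).trans (Finset.sum_le_sum fun p _ => ?_)
    rw [norm_mul]
    nlinarith [c1 d.1 p, norm_nonneg (d.2 p)]
  have hX' := (abs_le.1 (Complex.abs_re_le_norm (crossS x α ξ lam d.2 d.1))).1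
  have hM := (abs_le.1 (Complex.abs_re_le_norm
    (hermSum (fun p p' => B p p' + xiM x α ξ lam p p') d.2 d.2))).1
  have hM' := norm_hermSum_le c2 d.2
  have y1 := sq_nonneg (‖d.1.2‖ - 2 * (C * s))
  have y2 := sq_nonneg (‖d.1.1‖ - 2 * (C * s))
  have y3 : ‖d.1.1‖ ^ 2 ≤ lam ^ 2 * ‖d.1.1‖ ^ 2 :=
    le_mul_of_one_le_left (sq_nonneg _) (one_le_pow₀ hl1)
  have y4 : (4 * C ^ 2 + C) * s ^ 2 ≤ (4 * C ^ 2 + C) * (k * t) :=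
    mul_le_mul_of_nonneg_left hst (by positivity)
  rw [← hs] at hM'
  nlinarith

lemma continuous_total : Continuous (total x α ξ lam) := by
  have := continuous_chiS x α ξ lam
  change Continuous fun d : GraphSpace × (Fin N × Fin 2 → ℂ) => d.1.1 + chiS x α ξ lam d.2
  fun_prop

lemma continuous_sesqVal_self : Continuous fun d => sesqVal x α ξ lam B d d := by
  have h1 := continuous_total (x := x) (α := α) (ξ := ξ) (lam := lam)
  have h2 := continuous_crossS x α ξ lam
  have h3 := (continuous_hermSum (chargeM x α ξ lam B)).comp
    (continuous_snd (X := GraphSpace) (Y := Fin N × Fin 2 → ℂ))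
  simp only [Function.comp_def] at h3
  unfold sesqVal
  fun_prop

/-- A form which is coercive in terms of the decomposition is closed. -/
lemma isClosedOn_of_coercive (h : IsCutoff x ξ) (hlam : 0 < lam)
    (hα : ∀ n, α n ∈ Ioo (0 : ℝ) 1)
    (hc : ∀ d : GraphSpace × (Fin N × Fin 2 → ℂ),
      1 / 2 * (‖d.1.2‖ ^ 2 + ‖d.1.1‖ ^ 2 + ∑ p, ‖d.2 p‖ ^ 2)
        ≤ (sesqVal x α ξ lam B d d).re + lam ^ 2 * ‖total x α ξ lam d‖ ^ 2) :
    IsClosedOn (formDomain x α ξ lam) (form x α ξ lam B) := by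
  intro u ψ hu hψ hQ
  choose d hd hdu using fun k => (mem_formDomain_iff h hlam hα).1 (hu k)
  -- The norms on products and on the charges are maximum norms, hence dominated by the Euclidean
  -- sum in the coercivity estimate.
  have hn : ∀ e : GraphSpace × (Fin N × Fin 2 → ℂ),
      ‖e‖ ^ 2 ≤ ‖e.1.2‖ ^ 2 + ‖e.1.1‖ ^ 2 + ∑ p, ‖e.2 p‖ ^ 2 := by
    intro e
    have hs : 0 ≤ ∑ p, ‖e.2 p‖ ^ 2 := Finset.sum_nonneg fun _ _ => sq_nonneg _
    have h2 : ‖e.2‖ ^ 2 ≤ ∑ p, ‖e.2 p‖ ^ 2 := by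
      refine (Real.le_sqrt (norm_nonneg _) hs).1
        ((pi_norm_le_iff_of_nonneg (Real.sqrt_nonneg _)).2 fun p => Real.le_sqrt_of_sq_le ?_)
      exact Finset.single_le_sum (f := fun p => ‖e.2 p‖ ^ 2) (fun _ _ => sq_nonneg _)
        (Finset.mem_univ p)
    have h1 := sq_nonneg ‖e.1.2‖
    have h3 := sq_nonneg ‖e.1.1‖
    rw [Prod.norm_def, Prod.norm_def]
    rcases max_choice (max ‖e.1.1‖ ‖e.1.2‖) ‖e.2‖ with hm | hm <;> rw [hm]
    · rcases max_choice ‖e.1.1‖ ‖e.1.2‖ with hm | hm <;> rw [hm] <;> linarith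
    · linarith
  have hdiff : ∀ k l, u k - u l = total x α ξ lam (d k - d l) := fun k l => by
    rw [map_sub, hdu, hdu]
  have hbound : ∀ k l, ‖d k - d l‖ ^ 2
      ≤ 2 * (form x α ξ lam B (u k - u l) + lam ^ 2 * ‖u k - u l‖ ^ 2) := fun k l => by
    have h1 := hc (d k - d l)
    have h2 := hn (d k - d l)
    rw [hdiff, form_total h hlam hα (Submodule.sub_mem _ (hd k) (hd l))]
    linarith
  -- Coercivity bounds the distance of two decompositions by the form and the L² norm of the
  -- difference, both of which tend to zero.
  have hcau : CauchySeq d := by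
    have hu0 : Tendsto (fun p : ℕ × ℕ => u p.1 - u p.2) atTop (𝓝 0) := by
      rw [← prod_atTop_atTop_eq, ← sub_self ψ]
      exact (hψ.comp tendsto_fst).sub (hψ.comp tendsto_snd)
    have hlim : Tendsto (fun p : ℕ × ℕ => 2 * (form x α ξ lam B (u p.1 - u p.2)
        + lam ^ 2 * ‖u p.1 - u p.2‖ ^ 2)) atTop (𝓝 0) := by
      simpa using (hQ.add ((hu0.norm.pow 2).const_mul (lam ^ 2))).const_mul 2
    have hsq : Tendsto (fun p : ℕ × ℕ => ‖d p.1 - d p.2‖ ^ 2) atTop (𝓝 0) :=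
      squeeze_zero (fun _ => sq_nonneg _) (fun p => hbound p.1 p.2) hlim
    rw [cauchySeq_iff_tendsto_dist_atTop_0]
    simpa [Real.sqrt_sq, dist_eq_norm] using hsq.sqrt
  obtain ⟨e, he⟩ := cauchySeq_tendsto_of_complete hcau
  have heG : e.1 ∈ formGraph x α := (isClosed_formGraph x α).mem_of_tendsto
    ((continuous_fst.tendsto e).comp he) (.of_forall hd)
  have heψ : total x α ξ lam e = ψ := by
    refine tendsto_nhds_unique ((continuous_total.tendsto e).comp he) ?_
    simpa [Function.comp_def, hdu] using hψ
  refine ⟨(mem_formDomain_iff h hlam hα).2 ⟨e, heG, heψ⟩, ?_⟩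
  have hval : ∀ k, form x α ξ lam B (u k - ψ)
      = (sesqVal x α ξ lam B (d k - e) (d k - e)).re := fun k => by
    rw [← hdu, ← heψ, ← map_sub, form_total h hlam hα (Submodule.sub_mem _ (hd k) heG)]
  simp only [hval]
  -- The form is a continuous function of the decomposition and vanishes at zero, so convergence of
  -- decompositions gives convergence in the form.
  have h0 : Tendsto (fun k => d k - e) atTop (𝓝 0) := by
    simpa using he.sub_const e
  have := ((Complex.continuous_re.comp
    (continuous_sesqVal_self (x := x) (α := α) (ξ := ξ) (lam := lam) (B := B))).tendsto 0).comp h0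
  have hz : (sesqVal x α ξ lam B 0 0).re = 0 := by
    rw [← sesq_apply, map_zero]; rfl
  simpa only [Function.comp_def, hz] using this

lemma isClosedOn_congr {D : Set L2} {Q Q' : L2 → ℝ} (hQ : IsClosedOn D Q)
    (hsub : ∀ u ∈ D, ∀ v ∈ D, u - v ∈ D) (heq : ∀ u ∈ D, Q u = Q' u) : IsClosedOn D Q' := by
  intro u ψ hu hψ hlim
  obtain ⟨h1, h2⟩ := hQ u ψ hu hψ (hlim.congr fun p => (heq _ (hsub _ (hu _) _ (hu _))).symm)
  exact ⟨h1, h2.congr fun k => heq _ (hsub _ (hu _) _ h1)⟩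

lemma sub_mem_formDomain (h : IsCutoff x ξ) (hlam : 0 < lam) (hα : ∀ n, α n ∈ Ioo (0 : ℝ) 1)
    {u v : L2} (hu : u ∈ formDomain x α ξ lam) (hv : v ∈ formDomain x α ξ lam) :
    u - v ∈ formDomain x α ξ lam := by
  obtain ⟨d, hd, rfl⟩ := (mem_formDomain_iff h hlam hα).1 hu
  obtain ⟨e, he, rfl⟩ := (mem_formDomain_iff h hlam hα).1 hv
  exact (mem_formDomain_iff h hlam hα).2 ⟨d - e, Submodule.sub_mem _ hd he, map_sub _ _ _⟩

/-- Neither the domain nor the form depends on the parameter, so it is enough to treat one large μ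
at which coercivity holds. -/
lemma isClosedOn_form (h : IsCutoff x ξ) (hlam : 0 < lam) (hα : ∀ n, α n ∈ Ioo (0 : ℝ) 1)
    (B : Matrix (Fin N × Fin 2) (Fin N × Fin 2) ℂ) :
    IsClosedOn (formDomain x α ξ lam) (form x α ξ lam B) := by
  obtain ⟨μ, hμ, hc⟩ := exists_coercive h hα B
  have := isClosedOn_of_coercive h hμ hα (hc μ le_rfl)
  rw [formDomain_eq h h hlam hμ hα]
  exact isClosedOn_congr this (fun u hu v hv => sub_mem_formDomain h hμ hα hu hv)
    fun u hu => (form_change h h hμ hlam hα hu).2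

/-- A coercive parameter μ yields the lower bound -μ², and independence transfers it to every λ. -/
lemma isBoundedBelow_form (h : IsCutoff x ξ) (hlam : 0 < lam) (hα : ∀ n, α n ∈ Ioo (0 : ℝ) 1)
    (B : Matrix (Fin N × Fin 2) (Fin N × Fin 2) ℂ) :
    IsBoundedBelow (formDomain x α ξ lam) (form x α ξ lam B) := by
  obtain ⟨μ, hμ, hc⟩ := exists_coercive h hα B
  refine ⟨-μ ^ 2, fun ψ hψ => ?_⟩
  obtain ⟨h1, h2⟩ := form_change (B := B) h h hlam hμ hα hψ
  obtain ⟨d, hd, rfl⟩ := (mem_formDomain_iff h hμ hα).1 h1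
  rw [h2, form_total h hμ hα hd]
  have h3 := hc μ le_rfl d
  have h4 : 0 ≤ ∑ p, ‖d.2 p‖ ^ 2 := Finset.sum_nonneg fun _ _ => sq_nonneg _
  nlinarith [sq_nonneg ‖d.1.1‖, sq_nonneg ‖d.1.2‖]

end decomp

end

end AharonovBohm

/-! ### Assembly of the theorem -/

theorem mainTheorem2 {N : ℕ} (x : Fin N → Plane) (hx : Function.Injective x)
    (α : Fin N → ℝ) (hα : ∀ n, α n ∈ Ioo (0 : ℝ) 1)
    (B : Matrix (Fin N × Fin 2) (Fin N × Fin 2) ℂ) (hB : B.IsHermitian) :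
    -- well-posedness: every term of the expression converges, the decomposition is unique,
    -- and the form is a real quadratic form given by the expression on the whole domain
    (∀ (ξ : Fin N → Plane → ℝ) (lam : ℝ), IsCutoff x ξ → 0 < lam →
      (∀ q, MemLp (singularPart x α ξ lam q) 2 volume) ∧
      (∀ φ ∈ friedrichsDomain x α,
        MemLp (magGrad x (potTotal x α) φ) 2 volume ∧
        ∀ n l, Integrable (cross1 x α ξ lam φ n l) volume ∧
          Integrable (cross2 x α ξ lam φ n l) volume) ∧
      (∀ n l l', Integrable (xi1 x α ξ lam n l l') volume ∧
        Integrable (xi2 x α ξ lam n l l') volume) ∧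
      (∀ ψ φ φ' q q', IsDecomp x α ξ lam ψ φ q → IsDecomp x α ξ lam ψ φ' q' →
        φ = φ' ∧ q = q') ∧
      (∀ ψ φ q, IsDecomp x α ξ lam ψ φ q →
        (form x α ξ lam B ψ : ℂ) = formExpr x α ξ lam B ψ φ q) ∧
      IsHermitianForm (formDomain x α ξ lam) (form x α ξ lam B)) ∧
    -- independence of the parameter and of the cut-off functions
    (∀ (ξ ξ' : Fin N → Plane → ℝ) (lam lam' : ℝ), IsCutoff x ξ → IsCutoff x ξ' →
      0 < lam → 0 < lam' →
      formDomain x α ξ lam = formDomain x α ξ' lam' ∧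
      ∀ ψ ∈ formDomain x α ξ lam, form x α ξ lam B ψ = form x α ξ' lam' B ψ) ∧
    -- closedness and boundedness from below
    (∀ (ξ : Fin N → Plane → ℝ) (lam : ℝ), IsCutoff x ξ → 0 < lam →
      IsClosedOn (formDomain x α ξ lam) (form x α ξ lam B) ∧
      IsBoundedBelow (formDomain x α ξ lam) (form x α ξ lam B)) ∧
    -- coercivity
    (∀ ξ : Fin N → Plane → ℝ, IsCutoff x ξ → ∃ lam₀ : ℝ, 0 < lam₀ ∧ ∀ lam : ℝ, lam₀ ≤ lam →
      ∃ c : ℝ, 0 < c ∧ ∀ ψ φ q, IsDecomp x α ξ lam ψ φ q →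
        c * (friedrichsForm x α φ + ‖φ‖ ^ 2 + ∑ p, ‖q p‖ ^ 2)
          ≤ form x α ξ lam B ψ + lam ^ 2 * ‖ψ‖ ^ 2) := by
  refine ⟨fun ξ lam h hlam => ⟨memLp_singularPart h hlam hα, fun φ hφ => ?_, fun n l l' => ?_,
    fun ψ φ φ' q q' h1 h2 => h1.unique h hlam hα h2,
    fun ψ φ q hd => form_eq_formExpr h hlam hα hB hd, isHermitianForm_form h hlam hα hB⟩,
    fun ξ ξ' lam lam' h h' hlam hlam' => ⟨formDomain_eq h h' hlam hlam' hα,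
      fun ψ hψ => (form_change h h' hlam hlam' hα hψ).2⟩,
    fun ξ lam h hlam => ⟨isClosedOn_form h hlam hα B, isBoundedBelow_form h hlam hα B⟩,
    fun ξ h => ?_⟩
  · obtain ⟨v, hv⟩ := mem_friedrichsDomain_iff.1 hφ
    exact ⟨memLp_magGrad hv, fun n l => ⟨(cross_of_mem h l (hα n) hlam hv).1,
      (cross_of_mem h l (hα n) hlam hv).2.1⟩⟩
  · exact ⟨((exists_xi1_bound α n h l l' (hα n)).choose_spec ⟨lam, hlam⟩).1,
      ((exists_xi2_bound α n h l l' (hα n)).choose_spec ⟨lam, hlam⟩).1⟩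
  · obtain ⟨μ, hμ, hc⟩ := exists_coercive h hα B
    -- The constant 1/2 works for every λ above the threshold.
    refine ⟨μ, hμ, fun lam hl => ⟨1 / 2, by norm_num, fun ψ φ q hd => ?_⟩⟩
    have hlam := hμ.trans_le hl
    obtain ⟨v, hv, rfl⟩ := (isDecomp_iff h hlam hα).1 hd
    rw [form_total h hlam hα (d := ((φ, v), q)) hv, friedrichsForm_eq hv]
    exact hc lam hl ((φ, v), q)
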